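/- Model of computation. Programs run on a random access machine in the comparison-addition model: integer words of $O(\log n)$ bits with the arithmetic operations $+$, truncated $-$, $\cdot$, integer quotient and remainder, comparisons and indirect addressing, and exact real numbers, which can only be moved, added and compared; every elementary operation and every test costs one step, and a program is one fixed finite text for all inputs. Let $\omega$ be any real number such that the integer product of two $n\times n$ matrices with entries in $\{0,1\}$ can be computed in this model in $O(n^\omega)$ time. Input. $G=(V,E)$ is a directed acyclic graph without parallel edges, with $n$ vertices, $m$ edges and arbitrary (positive, negative or zero) real edge weights, given by the list of its edges, in any order, with their weights. The length of a directed path is the sum of the weights of its edges; a path is shortest if no directed path with the same end vertices has smaller length. The numbers of edges entering and leaving $v$ are $\text{indeg}(v)$ and $\text{outdeg}(v)$. Trees. Fix a numbering of $V$ that extends the topological partial order of $G$. A shortest path $P$ from $u$ to $v\neq u$ is lexicographically first if its next to last vertex $x$ has the lowest number among the next to last vertices of all shortest paths from $u$ to $v$, and the part of $P$ from $u$ to $x$ is the lexicographically first shortest path from $u$ to $x$; the one-vertex path from $u$ to $u$ is lexicographically first. $T_v$ is the union of the lexicographically first shortest paths to $v$ from $v$ and all its ancestors (the vertices from which $v$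 can be reached), a tree with root $v$ and edges directed towards $v$, and $\text{leaf}(T_v)$ is the set of its leaves. Let $\tilde G$ be the weighted DAG obtained from $G$ by reversing all edges. $U_v$ is the tree obtained by reversing the edges of the tree $T_v$ of $\tilde G$, where $\tilde G$ has its own numbering extending its topological partial order; $\text{leaf}(U_v)$ is the set of leaves of $U_v$, with $v$ as its root. Theorem. The all-pairs shortest paths problem for $G$, that is, to compute for all vertices $u,v$ whether $v$ can be reached from $u$ and, if so, the distance from $u$ to $v$ and (for $v\ne u$) the second vertex of some shortest path from $u$ to $v$, can be solved in time $$O\Bigl(\min\{n^{\omega},\,nm+n^2\log n\}+\min\Bigl\{\sum_{v\in V}\text{indeg}(v)\,|\text{leaf}(T_v)|,\ \sum_{v\in V}\text{outdeg}(v)\,|\text{leaf}(U_v)|\Bigr\}\Bigr)\qquad(n\ge 2),$$ with a constant that depends only on $\omega$ (and on the algorithm). This holds in two versions: with numberings of $G$ and $\tilde G$ that the algorithm chooses from the edge list alone, independently of the weights; and with arbitrary numberings of $G$ and $\tilde G$ that extend their topological orders and are supplied with the input. -/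

import Mathlib

namespace APSP

/-! ### Machine model

A random access machine in the comparison-addition model.  Its memory consists of word registers and
word arrays, which hold natural numbers below a word bound `W`, and of real registers and real
arrays, which hold exact real numbers.  Real numbers can only be moved, added and compared.
A program is a fixed finite text, which does not depend on the input; every elementary command and
every test costs one step. -/

/-- Contents of the memory.  `mem a i` is cell `i` of the word array `a`, and `rmem a i` is cell `i`
of the real array `a`. -/
structure State where
  reg : ℕ → ℕ
  rreg : ℕ → ℝ
  mem : ℕ → ℕ → ℕ
  rmem : ℕ → ℕ → ℝ

/-- Arithmetic operations on words. -/
inductive WordOp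
  | add
  | sub
  | mul
  | div
  | mod

/-- The value of a word operation: `sub` is truncated subtraction, `div` and `mod` are quotient and
remainder of the division of natural numbers. -/
def WordOp.eval : WordOp → ℕ → ℕ → ℕ
  | .add, a, b => a + b
  | .sub, a, b => a - b
  | .mul, a, b => a * b
  | .div, a, b => a / b
  | .mod, a, b => a % b

/-- Programs.  The letters `x y z i` stand for word registers, `r s t` for real registers, `a` for
an array. -/
inductive Cmd
  | skip
  /-- `x := k` -/
  | const (x k : ℕ)
  /-- `x := y o z` -/
  | op (o : WordOp) (x y z : ℕ)
  /-- `x := a[i]` -/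
  | load (x a i : ℕ)
  /-- `a[i] := x` -/
  | store (a i x : ℕ)
  /-- `r := s` -/
  | rcopy (r s : ℕ)
  /-- `r := s + t` -/
  | radd (r s t : ℕ)
  /-- `r := a[i]`, for a real array `a` -/
  | rload (r a i : ℕ)
  /-- `a[i] := r`, for a real array `a` -/
  | rstore (a i r : ℕ)
  | seq (c d : Cmd)
  /-- if `x < y` then `c` else `d` -/
  | ifLt (x y : ℕ) (c d : Cmd)
  /-- if `r < s` then `c` else `d`, for real registers `r`, `s` -/
  | ifRLt (r s : ℕ) (c d : Cmd)
  /-- while `x < y` do `c` -/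
  | whileLt (x y : ℕ) (c : Cmd)

namespace State

def setReg (s : State) (x k : ℕ) : State :=
  { s with reg := Function.update s.reg x k }

def setRReg (s : State) (r : ℕ) (v : ℝ) : State :=
  { s with rreg := Function.update s.rreg r v }

def setMem (s : State) (a i k : ℕ) : State :=
  { s with mem := Function.update s.mem a (Function.update (s.mem a) i k) }

def setRMem (s : State) (a i : ℕ) (v : ℝ) : State :=
  { s with rmem := Function.update s.rmem a (Function.update (s.rmem a) i v) }

end State

/-- `Exec W c s s' t`: with words bounded by `W`, the program `c` started in the state `s` halts in
the state `s'` after exactly `t` steps.  An execution that would produce a word `≥ W` is stuck. -/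
inductive Exec (W : ℕ) : Cmd → State → State → ℕ → Prop
  | skip (s : State) : Exec W .skip s s 1
  | const (s : State) (x k : ℕ) (h : k < W) : Exec W (.const x k) s (s.setReg x k) 1
  | op (s : State) (o : WordOp) (x y z : ℕ) (h : o.eval (s.reg y) (s.reg z) < W) :
      Exec W (.op o x y z) s (s.setReg x (o.eval (s.reg y) (s.reg z))) 1
  | load (s : State) (x a i : ℕ) :
      Exec W (.load x a i) s (s.setReg x (s.mem a (s.reg i))) 1
  | store (s : State) (a i x : ℕ) :
      Exec W (.store a i x) s (s.setMem a (s.reg i) (s.reg x)) 1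
  | rcopy (s : State) (r q : ℕ) : Exec W (.rcopy r q) s (s.setRReg r (s.rreg q)) 1
  | radd (s : State) (r p q : ℕ) :
      Exec W (.radd r p q) s (s.setRReg r (s.rreg p + s.rreg q)) 1
  | rload (s : State) (r a i : ℕ) :
      Exec W (.rload r a i) s (s.setRReg r (s.rmem a (s.reg i))) 1
  | rstore (s : State) (a i r : ℕ) :
      Exec W (.rstore a i r) s (s.setRMem a (s.reg i) (s.rreg r)) 1
  | seq {c d : Cmd} {s s' s'' : State} {t t' : ℕ} (h : Exec W c s s' t)
      (h' : Exec W d s' s'' t') : Exec W (.seq c d) s s'' (t + t')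
  | ifLt_true {x y : ℕ} {c d : Cmd} {s s' : State} {t : ℕ} (hxy : s.reg x < s.reg y)
      (h : Exec W c s s' t) : Exec W (.ifLt x y c d) s s' (t + 1)
  | ifLt_false {x y : ℕ} {c d : Cmd} {s s' : State} {t : ℕ} (hxy : ¬ s.reg x < s.reg y)
      (h : Exec W d s s' t) : Exec W (.ifLt x y c d) s s' (t + 1)
  | ifRLt_true {r q : ℕ} {c d : Cmd} {s s' : State} {t : ℕ} (hrq : s.rreg r < s.rreg q)
      (h : Exec W c s s' t) : Exec W (.ifRLt r q c d) s s' (t + 1)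
  | ifRLt_false {r q : ℕ} {c d : Cmd} {s s' : State} {t : ℕ} (hrq : ¬ s.rreg r < s.rreg q)
      (h : Exec W d s s' t) : Exec W (.ifRLt r q c d) s s' (t + 1)
  | while_true {x y : ℕ} {c : Cmd} {s s' s'' : State} {t t' : ℕ} (hxy : s.reg x < s.reg y)
      (h : Exec W c s s' t) (h' : Exec W (.whileLt x y c) s' s'' t') :
      Exec W (.whileLt x y c) s s'' (t + t' + 1)
  | while_false {x y : ℕ} {c : Cmd} {s : State} (hxy : ¬ s.reg x < s.reg y) :
      Exec W (.whileLt x y c) s s 1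

/-! ### Matrix multiplication -/

/-- The initial state for multiplying `A` and `B`: `n` is in word register `0`, the matrices are in
the word arrays `0` and `1`, row by row, and everything else is zero. -/
def matMulInput {n : ℕ} (A B : Matrix (Fin n) (Fin n) ℕ) : State where
  reg x := if x = 0 then n else 0
  rreg _ := 0
  mem a i :=
    if h : i / n < n ∧ i % n < n then
      if a = 0 then A ⟨i / n, h.1⟩ ⟨i % n, h.2⟩
      else if a = 1 then B ⟨i / n, h.1⟩ ⟨i % n, h.2⟩ else 0
    else 0
  rmem _ _ := 0

/-- Two `n × n` matrices can be multiplied in time `O(n ^ ω)`: some program computes the integer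
product of any two `0/1` matrices in that many steps on words of `O(log n)` bits, and writes it
row by row to the word array `2`. -/
def MatMulInTime (ω : ℝ) : Prop :=
  ∃ (P : Cmd) (k : ℕ) (C : ℝ), ∀ n : ℕ, 1 ≤ n →
    ∀ A B : Matrix (Fin n) (Fin n) ℕ, (∀ i j, A i j ≤ 1) → (∀ i j, B i j ≤ 1) →
      ∃ (s : State) (t : ℕ), Exec ((n + 2) ^ k) P (matMulInput A B) s t ∧
        (t : ℝ) ≤ C * (n : ℝ) ^ ω ∧
        ∀ i j : Fin n, s.mem 2 (i * n + j) = (A * B) i j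

/-! ### Directed acyclic graphs -/

/-- A directed acyclic graph with vertex set `Fin n` and `m` edges, listed in an arbitrary order
without repetition; `edge e = (u, v)` is an edge with tail `u` and head `v`. -/
structure Dag (n m : ℕ) where
  edge : Fin m → Fin n × Fin n
  edge_injective : Function.Injective edge
  acyclic : ∀ v : Fin n, ¬ Relation.TransGen (fun a b => ∃ e, edge e = (a, b)) v v

namespace Dag

variable {n m : ℕ}

/-- There is an edge from `u` to `v`. -/
def Adj (G : Dag n m) (u v : Fin n) : Prop := ∃ e, G.edge e = (u, v)

/-- The graph obtained by reversing the direction of the edges. -/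
def reverse (G : Dag n m) : Dag n m where
  edge e := (G.edge e).swap
  edge_injective := Prod.swap_injective.comp G.edge_injective
  acyclic v hv := by
    refine G.acyclic v (Relation.transGen_swap.mp (Relation.TransGen.mono ?_ v v hv))
    rintro a b ⟨e, he⟩
    exact ⟨e, by rw [← Prod.swap_swap (G.edge e), he]; rfl⟩

def indeg (G : Dag n m) (v : Fin n) : ℕ := (Finset.univ.filter fun e => (G.edge e).2 = v).card

def outdeg (G : Dag n m) (v : Fin n) : ℕ := (Finset.univ.filter fun e => (G.edge e).1 = v).card

/-- The weight of the edge from `u` to `v`, when edge number `e` has the weight `w e`; for an edge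
`(u, v)` the sum has exactly one nontrivial term. -/
def wt (G : Dag n m) (w : Fin m → ℝ) (u v : Fin n) : ℝ :=
  ∑ e, if G.edge e = (u, v) then w e else 0

/-- The list of vertices `p` is a directed path from `u` to `v`; `[u]` is a path from `u` to `u`. -/
def IsPath (G : Dag n m) (u v : Fin n) (p : List (Fin n)) : Prop :=
  p.head? = some u ∧ p.getLast? = some v ∧ p.IsChain G.Adj

/-- The length of a path: the sum of the weights of its edges. -/
def length (G : Dag n m) (w : Fin m → ℝ) : List (Fin n) → ℝ
  | [] => 0
  | [_] => 0
  | a :: b :: p => G.wt w a b + length G w (b :: p)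

/-- `p` is a shortest path from `u` to `v`. -/
def IsShortest (G : Dag n m) (w : Fin m → ℝ) (u v : Fin n) (p : List (Fin n)) : Prop :=
  G.IsPath u v p ∧ ∀ q, G.IsPath u v q → G.length w p ≤ G.length w q

/-- The numbering `σ` of the vertices extends the topological partial order. -/
def IsTopological (G : Dag n m) (σ : Equiv.Perm (Fin n)) : Prop :=
  ∀ u v, G.Adj u v → σ u < σ v

/-- `p` is the lexicographically first shortest path from `u` to `v`: its next to last vertex `x`
has the lowest number among the next to last vertices of the shortest paths from `u` to `v`, and its
part up to `x` is the lexicographically first shortest path from `u` to `x`. -/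
inductive LexFirst (G : Dag n m) (w : Fin m → ℝ) (σ : Equiv.Perm (Fin n)) (u : Fin n) :
    Fin n → List (Fin n) → Prop
  | refl : LexFirst G w σ u u [u]
  | snoc {x v : Fin n} {p : List (Fin n)} (hp : LexFirst G w σ u x p)
      (hs : G.IsShortest w u v (p ++ [v]))
      (hx : ∀ y q, G.IsShortest w u v (q ++ [y, v]) → σ x ≤ σ y) :
      LexFirst G w σ u v (p ++ [v])

/-- Vertices of the tree `T_v`, the union of the lexicographically first shortest paths to `v` from
`v` and its ancestors. -/
def treeVertices (G : Dag n m) (w : Fin m → ℝ) (σ : Equiv.Perm (Fin n)) (v : Fin n) :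
    Set (Fin n) :=
  {a | ∃ u p, G.LexFirst w σ u v p ∧ a ∈ p}

/-- Edges of the tree `T_v`; they are directed towards the root `v`. -/
def treeEdges (G : Dag n m) (w : Fin m → ℝ) (σ : Equiv.Perm (Fin n)) (v : Fin n) :
    Set (Fin n × Fin n) :=
  {e | ∃ u p, G.LexFirst w σ u v p ∧ [e.1, e.2] <:+: p}

/-- The leaves of the tree `T_v`: its vertices without children. -/
def leaf (G : Dag n m) (w : Fin m → ℝ) (σ : Equiv.Perm (Fin n)) (v : Fin n) : Set (Fin n) :=
  {a | a ∈ G.treeVertices w σ v ∧ ∀ b, (b, a) ∉ G.treeEdges w σ v}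

/-- The leaves of the tree `U_v` of shortest paths from `v` to its descendants: reversing the edges
of `U_v` gives the tree `T_v` of the reversed graph, for a numbering `τ` of the latter. -/
def leafU (G : Dag n m) (w : Fin m → ℝ) (τ : Equiv.Perm (Fin n)) (v : Fin n) : Set (Fin n) :=
  G.reverse.leaf w τ v

/-! ### The all-pairs shortest paths problem -/

/-- The initial state for a weighted DAG: `n` and `m` are in the word registers `0` and `1`, the
tails, heads and weights of the edges are in the word arrays `0` and `1` and in the real array `0`,
and everything else is zero. -/
def input (G : Dag n m) (w : Fin m → ℝ) : State where
  reg x := if x = 0 then n else if x = 1 then m else 0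
  rreg _ := 0
  mem a i :=
    if h : i < m then
      if a = 0 then (G.edge ⟨i, h⟩).1 else if a = 1 then (G.edge ⟨i, h⟩).2 else 0
    else 0
  rmem a i := if h : i < m then if a = 0 then w ⟨i, h⟩ else 0 else 0

/-- The same, with two numberings of the vertices supplied in the word arrays `2` and `3`. -/
def numberedInput (G : Dag n m) (w : Fin m → ℝ) (σ τ : Equiv.Perm (Fin n)) : State :=
  { G.input w with
    mem := fun a i =>
      if a = 2 then (if h : i < n then σ ⟨i, h⟩ else 0)
      else if a = 3 then (if h : i < n then τ ⟨i, h⟩ else 0)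
      else (G.input w).mem a i }

/-- The state `s` represents shortest paths between all pairs of vertices.  If there is a path from
`u` to `v ≠ u`, then cell `u * n + v` of the real array `1` is the distance from `u` to `v`, and
this cell of the word array `4` is `x + 1`, where `x` is the vertex after `u` on some shortest path
from `u` to `v`.  The word is `0` if there is no path or `u = v`; the distance from `u` to `u`
is `0`. -/
def IsOutput (G : Dag n m) (w : Fin m → ℝ) (s : State) : Prop :=
  ∀ u v : Fin n,
    (u = v → s.rmem 1 (u * n + v) = 0 ∧ s.mem 4 (u * n + v) = 0) ∧
    ((∀ p, ¬ G.IsPath u v p) → s.mem 4 (u * n + v) = 0) ∧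
    (u ≠ v → (∃ p, G.IsPath u v p) →
      ∃ (x : Fin n) (q : List (Fin n)), G.IsShortest w u v (u :: x :: q) ∧
        s.rmem 1 (u * n + v) = G.length w (u :: x :: q) ∧
        s.mem 4 (u * n + v) = x + 1)

/-- `min {n ^ ω, n m + n² log n} + min {∑ indeg(v) |leaf(T_v)|, ∑ outdeg(v) |leaf(U_v)|}`. -/
noncomputable def timeBound (G : Dag n m) (w : Fin m → ℝ) (ω : ℝ)
    (σ τ : Equiv.Perm (Fin n)) : ℝ :=
  min ((n : ℝ) ^ ω) ((n : ℝ) * m + (n : ℝ) ^ 2 * Real.log n) +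
    min (∑ v, (G.indeg v : ℝ) * (G.leaf w σ v).ncard)
      (∑ v, (G.outdeg v : ℝ) * (G.leafU w τ v).ncard)

/-- Started in the state `s`, on words below `(n + 2) ^ k`, hence of `O(log n)` bits, the program
`P` halts with shortest paths between all pairs, for `n ≥ 2` within `C * timeBound` steps. -/
def SolvedInTime (G : Dag n m) (w : Fin m → ℝ) (ω : ℝ) (σ τ : Equiv.Perm (Fin n))
    (P : Cmd) (k : ℕ) (C : ℝ) (s : State) : Prop :=
  ∃ (s' : State) (t : ℕ), Exec ((n + 2) ^ k) P s s' t ∧ G.IsOutput w s' ∧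
    (2 ≤ n → (t : ℝ) ≤ C * G.timeBound w ω σ τ)

end Dag

end APSP

/-! Fix a vertex v and suppose that everything is known about the tails of the edges that enter v.
The lexicographically first shortest path from u to v is such a path from u to some tail x, followed
by the edge (x, v), so x can be found by inspecting the indeg(v) entering edges. Every suffix of a
lexicographically first path is again lexicographically first (`Dag.LexFirst.right`). One inspection
therefore settles all vertices of the path at once: following it makes an entry for each of them at
constant cost, with the same x. Now let u run through the ancestors of v in topological order,
passing over the vertices that are already settled. A child b of u in T_v has a lower number, so it
is settled earlier, and its path runs through u; hence an inspection takes place only if u has no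
child, that is, at a leaf of T_v (`Dag.mem_leaf_of_forall_not_lexFirst`). The column of v costs O(n
+ indeg(v) |leaf(T_v)|) steps (`wp_column`).

The second sum is the same quantity for the reversed graph. Which sum is smaller is not known
beforehand. So G and its reversal are put into one graph with two separate halves, `Dag.union`,
numbered in topological order, and the next column is always computed in the half in which fewer
edges have been inspected, until one half is complete. The two counts never differ by more than
O(n²), so the work is at most twice the minimum plus O(n²) (`wp_columns`). The tables hold both the
second and the next to last vertex of each path: the former answers the query in G, the latter in
the reversal.

The first minimum pays for finding out who is an ancestor of whom. Scanning the edges in topological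
order takes O(nm + n²) steps (`wp_scanClosure`). With matrix multiplication, order the reachability
matrix topologically and let two adjacent diagonal blocks be closed already. A path from the first
block to the second passes from one to the other by exactly one edge, so the block between them is a
product of three matrices (`Dag.Ordered.stage_step`). Doubling the size of the blocks costs a sum of
terms 2^(L-i) T(2^i), where T(z) is the time for multiplying matrices of size z. This sum is
geometric because ω ≥ 2 (`levelSum_le`), and ω ≥ 2 because n² positive entries have to be written
(`Multiplies.sq_le`). The smaller of the two costs is reached without any knowledge of ω: the
multiplications get a budget of about the cost of a scan, and when it is used up the edges are
scanned instead (`wp_closure`). For this the given multiplication program is simulated step by step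
with a fuel counter, and time stamps on its memory cells make a fresh memory available at no cost
(`Simulates.clockedRun`, `wp_multiply`).

The algorithm is written in a small structured language whose programs compile to the machine with a
constant factor in time and in word length (`Prog.Run.exec_compile`); correctness and running time
are proved together with weakest preconditions. When the numberings are not supplied, a quadratic
topological sort computes them. It never compares real numbers, so its result cannot depend on the
weights (`Dag.exists_numbering`). Finally `Dag.le_timeBound` turns the step counts into the stated
bound. -/

namespace APSP

/-! ### A structured language with expressions -/

/-- Word expressions. -/
inductive Expr
  | lit (k : ℕ)
  | var (x : ℕ)
  | bin (o : WordOp) (e f : Expr)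
  | ld (a : ℕ) (e : Expr)

namespace Expr

@[simp] def eval : Expr → State → ℕ
  | lit k, _ => k
  | var x, s => s.reg x
  | bin o e f, s => o.eval (e.eval s) (f.eval s)
  | ld a e, s => s.mem a (e.eval s)

/-- One number serves two purposes: it bounds the steps of the compiled expression, and a value
computed from words below B is below B to this power. The latter is why a literal k counts k + 1; a
variable counts 2 because fetching it takes two commands. -/
def size : Expr → ℕ
  | lit k => k + 1
  | var _ => 2
  | bin _ e f => e.size + f.size + 1
  | ld _ e => e.size + 1

end Expr

@[simp] theorem WordOp.eval_add (a b : ℕ) : WordOp.add.eval a b = a + b := rfl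
@[simp] theorem WordOp.eval_sub (a b : ℕ) : WordOp.sub.eval a b = a - b := rfl
@[simp] theorem WordOp.eval_mul (a b : ℕ) : WordOp.mul.eval a b = a * b := rfl
@[simp] theorem WordOp.eval_div (a b : ℕ) : WordOp.div.eval a b = a / b := rfl
@[simp] theorem WordOp.eval_mod (a b : ℕ) : WordOp.mod.eval a b = a % b := rfl

/-- Structured programs over expressions. -/
inductive Prog
  | skip
  /-- `x := e` -/
  | set (x : ℕ) (e : Expr)
  /-- `a[e] := f` -/
  | put (a : ℕ) (e f : Expr)
  | rcopy (r q : ℕ)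
  | radd (r p q : ℕ)
  /-- `r := a[e]`, for a real array `a` -/
  | rget (r a : ℕ) (e : Expr)
  /-- `a[e] := r`, for a real array `a` -/
  | rput (a : ℕ) (e : Expr) (r : ℕ)
  | seq (p q : Prog)
  /-- if `e < f` then `p` else `q` -/
  | ite (e f : Expr) (p q : Prog)
  /-- if `r < r'` then `p` else `q`, for real registers -/
  | rite (r r' : ℕ) (p q : Prog)
  /-- while `e < f` do `p` -/
  | loop (e f : Expr) (p : Prog)

infixr:67 " ;; " => Prog.seq

namespace Prog

/-- Big-step semantics, in which every word that is produced has to be less than `B`. -/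
inductive Run (B : ℕ) : Prog → State → State → ℕ → Prop
  | skip (s : State) : Run B .skip s s 1
  | set (s : State) (x : ℕ) (e : Expr) (h : e.eval s < B) :
      Run B (.set x e) s (s.setReg x (e.eval s)) 1
  | put (s : State) (a : ℕ) (e f : Expr) (h : f.eval s < B) :
      Run B (.put a e f) s (s.setMem a (e.eval s) (f.eval s)) 1
  | rcopy (s : State) (r q : ℕ) : Run B (.rcopy r q) s (s.setRReg r (s.rreg q)) 1
  | radd (s : State) (r p q : ℕ) :
      Run B (.radd r p q) s (s.setRReg r (s.rreg p + s.rreg q)) 1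
  | rget (s : State) (r a : ℕ) (e : Expr) :
      Run B (.rget r a e) s (s.setRReg r (s.rmem a (e.eval s))) 1
  | rput (s : State) (a : ℕ) (e : Expr) (r : ℕ) :
      Run B (.rput a e r) s (s.setRMem a (e.eval s) (s.rreg r)) 1
  | seq {p q : Prog} {s s' s'' : State} {t t' : ℕ} (h : Run B p s s' t)
      (h' : Run B q s' s'' t') : Run B (.seq p q) s s'' (t + t')
  | ite_true {e f : Expr} {p q : Prog} {s s' : State} {t : ℕ} (hc : e.eval s < f.eval s)
      (h : Run B p s s' t) : Run B (.ite e f p q) s s' (t + 1)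
  | ite_false {e f : Expr} {p q : Prog} {s s' : State} {t : ℕ} (hc : ¬ e.eval s < f.eval s)
      (h : Run B q s s' t) : Run B (.ite e f p q) s s' (t + 1)
  | rite_true {r r' : ℕ} {p q : Prog} {s s' : State} {t : ℕ} (hc : s.rreg r < s.rreg r')
      (h : Run B p s s' t) : Run B (.rite r r' p q) s s' (t + 1)
  | rite_false {r r' : ℕ} {p q : Prog} {s s' : State} {t : ℕ} (hc : ¬ s.rreg r < s.rreg r')
      (h : Run B q s s' t) : Run B (.rite r r' p q) s s' (t + 1)
  | loop_true {e f : Expr} {p : Prog} {s s' s'' : State} {t t' : ℕ} (hc : e.eval s < f.eval s)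
      (h : Run B p s s' t) (h' : Run B (.loop e f p) s' s'' t') :
      Run B (.loop e f p) s s'' (t + t' + 1)
  | loop_false {e f : Expr} {p : Prog} {s : State} (hc : ¬ e.eval s < f.eval s) :
      Run B (.loop e f p) s s 1

/-- A bound for the machine steps per unit of time of `Run`, and for the power of B that the words
of the compiled program need. `Run` bounds only the words that are stored; intermediate values of
expressions may exceed B. -/
def size : Prog → ℕ
  | skip => 1
  | set _ e => e.size + 2
  | put _ e f => e.size + f.size + 1
  | rcopy _ _ => 1
  | radd _ _ _ => 1
  | rget _ _ e => e.size + 1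
  | rput _ e _ => e.size + 1
  | seq p q => p.size + q.size
  | ite e f p q => e.size + f.size + 1 + p.size + q.size
  | rite _ _ p q => 1 + p.size + q.size
  | loop e f p => e.size + f.size + 1 + p.size

end Prog

/-! ### Compilation -/

namespace State

@[simp] theorem setReg_reg (s : State) (x k y : ℕ) :
    (s.setReg x k).reg y = if y = x then k else s.reg y := by
  simp [setReg, Function.update_apply]
@[simp] theorem setReg_rreg (s : State) (x k : ℕ) : (s.setReg x k).rreg = s.rreg := rfl
@[simp] theorem setReg_mem (s : State) (x k : ℕ) : (s.setReg x k).mem = s.mem := rfl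
@[simp] theorem setReg_rmem (s : State) (x k : ℕ) : (s.setReg x k).rmem = s.rmem := rfl
@[simp] theorem setRReg_reg (s : State) (x : ℕ) (k : ℝ) : (s.setRReg x k).reg = s.reg := rfl
@[simp] theorem setRReg_rreg (s : State) (x : ℕ) (k : ℝ) (y : ℕ) :
    (s.setRReg x k).rreg y = if y = x then k else s.rreg y := by
  simp [setRReg, Function.update_apply]
@[simp] theorem setRReg_mem (s : State) (x : ℕ) (k : ℝ) : (s.setRReg x k).mem = s.mem := rfl
@[simp] theorem setRReg_rmem (s : State) (x : ℕ) (k : ℝ) : (s.setRReg x k).rmem = s.rmem := rfl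
@[simp] theorem setMem_reg (s : State) (a i k : ℕ) : (s.setMem a i k).reg = s.reg := rfl
@[simp] theorem setMem_rreg (s : State) (a i k : ℕ) : (s.setMem a i k).rreg = s.rreg := rfl
@[simp] theorem setMem_rmem (s : State) (a i k : ℕ) : (s.setMem a i k).rmem = s.rmem := rfl
@[simp] theorem setMem_mem (s : State) (a i k b j : ℕ) :
    (s.setMem a i k).mem b j = if b = a ∧ j = i then k else s.mem b j := by
  by_cases h : b = a
  · subst h; simp [setMem, Function.update_apply]
  · simp [setMem, h]
@[simp] theorem setMem_mem_of_ne (s : State) {a b : ℕ} (i k : ℕ) (h : b ≠ a) :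
    (s.setMem a i k).mem b = s.mem b := by
  funext j; simp [h]
@[simp] theorem setRMem_reg (s : State) (a i : ℕ) (k : ℝ) : (s.setRMem a i k).reg = s.reg := rfl
@[simp] theorem setRMem_rreg (s : State) (a i : ℕ) (k : ℝ) : (s.setRMem a i k).rreg = s.rreg := rfl
@[simp] theorem setRMem_mem (s : State) (a i : ℕ) (k : ℝ) : (s.setRMem a i k).mem = s.mem := rfl
@[simp] theorem setRMem_rmem (s : State) (a i : ℕ) (k : ℝ) (b j : ℕ) :
    (s.setRMem a i k).rmem b j = if b = a ∧ j = i then k else s.rmem b j := by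
  by_cases h : b = a
  · subst h; simp [setRMem, Function.update_apply]
  · simp [setRMem, h]

/-- The state of the structured language that is represented by a machine state: variable `x` is kept
in register `2 x`; the odd registers are used for the evaluation of expressions. -/
def visible (c : State) : State := { c with reg := fun x => c.reg (2 * x) }

@[simp] theorem visible_reg (c : State) (x : ℕ) : c.visible.reg x = c.reg (2 * x) := rfl
@[simp] theorem visible_rreg (c : State) : c.visible.rreg = c.rreg := rfl
@[simp] theorem visible_mem (c : State) : c.visible.mem = c.mem := rfl
@[simp] theorem visible_rmem (c : State) : c.visible.rmem = c.rmem := rfl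

theorem visible_setReg (c : State) (x k : ℕ) :
    (c.setReg (2 * x) k).visible = c.visible.setReg x k := by
  simp only [visible, setReg, State.mk.injEq, and_true]
  funext y
  by_cases h : y = x <;> simp [h]

theorem visible_setReg_odd (c : State) (j k : ℕ) :
    (c.setReg (2 * j + 1) k).visible = c.visible := by
  simp only [visible, setReg, State.mk.injEq, and_true]
  funext y
  have : 2 * y ≠ 2 * j + 1 := by omega
  simp [this]

/-- All words are less than `B`. -/
def Bounded (B : ℕ) (s : State) : Prop := (∀ x, s.reg x < B) ∧ ∀ a i, s.mem a i < B

end State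

theorem Expr.size_pos (e : Expr) : 0 < e.size := by
  cases e <;> simp [Expr.size]

/-- Multiplication is the worst case. The sum of two numbers below powers that are at least 2 is
below the product of the powers, and the other operations do not exceed their first argument. -/
theorem WordOp.eval_lt {B i j : ℕ} (hB : 2 ≤ B) (hi : 0 < i) (hj : 0 < j) {a b : ℕ}
    (ha : a < B ^ i) (hb : b < B ^ j) (o : WordOp) : o.eval a b < B ^ (i + j) := by
  have h1 : B ^ i ≤ B ^ (i + j) := Nat.pow_le_pow_right (by omega) (by omega)
  have h2 : 2 ≤ B ^ i := hB.trans (Nat.le_self_pow hi.ne' B)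
  have h3 : 2 ≤ B ^ j := hB.trans (Nat.le_self_pow hj.ne' B)
  cases o
  · show a + b < _
    rw [pow_add]; nlinarith
  · exact lt_of_le_of_lt (Nat.sub_le _ _) (by omega)
  · show a * b < _
    rw [pow_add]; exact Nat.mul_lt_mul'' ha hb
  · exact lt_of_le_of_lt (Nat.div_le_self _ _) (by omega)
  · exact lt_of_le_of_lt (Nat.mod_le _ _) (by omega)

theorem Expr.eval_lt {B : ℕ} (hB : 2 ≤ B) {s : State} (hs : s.Bounded B) (e : Expr) :
    e.eval s < B ^ e.size := by
  induction e with
  | lit k =>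
    exact lt_of_lt_of_le (lt_of_lt_of_le (by simp) (Nat.lt_two_pow_self (n := k + 1)).le)
      (Nat.pow_le_pow_left hB _)
  | var x => exact lt_of_lt_of_le (hs.1 x) (Nat.le_self_pow (by simp [size]) B)
  | bin o e f he hf =>
    refine lt_of_lt_of_le (WordOp.eval_lt hB e.size_pos f.size_pos he hf o)
      (Nat.pow_le_pow_right (by omega) ?_)
    simp [size]
  | ld a e => exact lt_of_lt_of_le (hs.2 a _) (Nat.le_self_pow (by simp [size]) B)

/-- Code that evaluates an expression into register `2 d + 1`. -/
def Expr.compile : Expr → ℕ → Cmd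
  | lit k, d => .const (2 * d + 1) k
  | var x, d => .seq (.const (2 * d + 1) 0) (.op .add (2 * d + 1) (2 * x) (2 * d + 1))
  | bin o e f, d =>
    .seq (e.compile d) (.seq (f.compile (d + 1)) (.op o (2 * d + 1) (2 * d + 1) (2 * (d + 1) + 1)))
  | ld a e, d => .seq (e.compile d) (.load (2 * d + 1) a (2 * d + 1))

/-- The odd registers form an evaluation stack. The last clause, that registers below the target are
untouched, is what keeps the value of a first operand intact while the second one is computed one
level higher. -/
theorem Expr.exec_compile {B W : ℕ} (hB : 2 ≤ B) (e : Expr) :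
    ∀ (d : ℕ) (c : State), c.visible.Bounded B → B ^ e.size ≤ W →
      ∃ c' t, Exec W (e.compile d) c c' t ∧ t ≤ e.size ∧ c'.visible = c.visible ∧
        c'.reg (2 * d + 1) = e.eval c.visible ∧ ∀ y < 2 * d + 1, c'.reg y = c.reg y := by
  have hpow : ∀ {i j : ℕ}, i ≤ j → B ^ j ≤ W → B ^ i ≤ W := fun h h' =>
    (Nat.pow_le_pow_right (by omega) h).trans h'
  induction e with
  | lit k =>
    intro d c hc hW
    refine ⟨_, _, .const c (2 * d + 1) k ?_, by simp [size], c.visible_setReg_odd _ _, by simp,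
      fun y hy => ?_⟩
    · exact lt_of_lt_of_le (Expr.eval_lt hB hc (lit k)) hW
    · simp [hy.ne]
  | var x =>
    intro d c hc hW
    have hk : (var x).eval c.visible < W := lt_of_lt_of_le (Expr.eval_lt hB hc (var x)) hW
    have h0 : 0 < W := by omega
    have hne : 2 * x ≠ 2 * d + 1 := by omega
    refine ⟨_, _, .seq (.const c (2 * d + 1) 0 h0) (.op _ .add (2 * d + 1) (2 * x) (2 * d + 1) ?_),
      by simp [size], ?_, ?_, fun y hy => ?_⟩
    · simpa [hne] using hk
    · rw [State.visible_setReg_odd, State.visible_setReg_odd]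
    · simp [hne]
    · simp [hy.ne]
  | bin o e f he hf =>
    intro d c hc hW
    simp only [size] at hW
    obtain ⟨c₁, t₁, x₁, ht₁, hv₁, hr₁, hy₁⟩ := he d c hc (hpow (by omega) hW)
    obtain ⟨c₂, t₂, x₂, ht₂, hv₂, hr₂, hy₂⟩ := hf (d + 1) c₁ (by rwa [hv₁]) (hpow (by omega) hW)
    have e1 : c₂.reg (2 * d + 1) = e.eval c.visible := by rw [hy₂ _ (by omega), hr₁]
    have e2 : c₂.reg (2 * (d + 1) + 1) = f.eval c.visible := by rw [hr₂, hv₁]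
    refine ⟨_, _, .seq x₁ (.seq x₂ (.op _ o (2 * d + 1) (2 * d + 1) (2 * (d + 1) + 1) ?_)),
      by simp [size]; omega, ?_, ?_, fun y hy => ?_⟩
    · rw [e1, e2]
      exact lt_of_lt_of_le (Expr.eval_lt hB hc (bin o e f)) hW
    · rw [State.visible_setReg_odd, hv₂, hv₁]
    · rw [e1, e2]; simp
    · rw [State.setReg_reg, if_neg (by omega), hy₂ _ (by omega), hy₁ _ hy]
  | ld a e he =>
    intro d c hc hW
    simp only [size] at hW
    obtain ⟨c₁, t₁, x₁, ht₁, hv₁, hr₁, hy₁⟩ := he d c hc (hpow (by omega) hW)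
    refine ⟨_, _, .seq x₁ (.load _ (2 * d + 1) a (2 * d + 1)), by simp [size]; omega, ?_, ?_,
      fun y hy => ?_⟩
    · rw [State.visible_setReg_odd, hv₁]
    · have : c₁.mem = c.mem := by simpa using congrArg State.mem hv₁
      simp [hr₁, this]
    · rw [State.setReg_reg, if_neg (by omega), hy₁ _ hy]

/-- Code that evaluates two expressions into registers `1` and `3`. -/
def compile₂ (e f : Expr) : Cmd := .seq (e.compile 0) (f.compile 1)

theorem exec_compile₂ {B W : ℕ} (hB : 2 ≤ B) (e f : Expr) (c : State) (hc : c.visible.Bounded B)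
    (hW : B ^ (e.size + f.size) ≤ W) :
    ∃ c' t, Exec W (compile₂ e f) c c' t ∧ t ≤ e.size + f.size ∧ c'.visible = c.visible ∧
      c'.reg 1 = e.eval c.visible ∧ c'.reg 3 = f.eval c.visible := by
  have hpow : ∀ {i : ℕ}, i ≤ e.size + f.size → B ^ i ≤ W := fun h =>
    (Nat.pow_le_pow_right (by omega) h).trans hW
  obtain ⟨c₁, t₁, x₁, ht₁, hv₁, hr₁, hy₁⟩ := e.exec_compile hB 0 c hc (hpow (by omega))
  obtain ⟨c₂, t₂, x₂, ht₂, hv₂, hr₂, hy₂⟩ := f.exec_compile hB 1 c₁ (by rwa [hv₁]) (hpow (by omega))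
  refine ⟨c₂, _, .seq x₁ x₂, by omega, hv₂.trans hv₁, ?_, ?_⟩
  · rw [hy₂ 1 (by omega)]; exact hr₁
  · rw [← hv₁]; exact hr₂

namespace Prog

def compile : Prog → Cmd
  | skip => .skip
  -- The machine has no command that copies a word register, so the value is moved by adding zero.
  | set x e => .seq (e.compile 0) (.seq (.const 3 0) (.op .add (2 * x) 1 3))
  | put a e f => .seq (compile₂ e f) (.store a 1 3)
  | rcopy r q => .rcopy r q
  | radd r p q => .radd r p q
  | rget r a e => .seq (e.compile 0) (.rload r a 1)
  | rput a e r => .seq (e.compile 0) (.rstore a 1 r)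
  | seq p q => .seq p.compile q.compile
  | ite e f p q => .seq (compile₂ e f) (.ifLt 1 3 p.compile q.compile)
  | rite r r' p q => .ifRLt r r' p.compile q.compile
  -- The machine compares registers only, so the two sides of the test are evaluated before the loop
  -- and again at the end of each pass.
  | loop e f p => .seq (compile₂ e f) (.whileLt 1 3 (.seq p.compile (compile₂ e f)))

theorem size_pos (p : Prog) : 0 < p.size := by
  induction p <;> simp only [size] <;> omega

theorem Run.pos {B : ℕ} {p : Prog} {s s' : State} {t : ℕ} (h : Run B p s s' t) : 0 < t := by
  induction h <;> omega

theorem Run.bounded {B : ℕ} {p : Prog} {s s' : State} {t : ℕ} (h : Run B p s s' t)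
    (hs : s.Bounded B) : s'.Bounded B := by
  induction h with
  | skip | rcopy | radd | rget | rput | loop_false => exact hs
  | set s x e h =>
    refine ⟨fun y => ?_, hs.2⟩
    rw [State.setReg_reg]; split
    · exact h
    · exact hs.1 y
  | put s a e f h =>
    refine ⟨hs.1, fun b j => ?_⟩
    rw [State.setMem_mem]; split
    · exact h
    · exact hs.2 b j
  | seq _ _ h₁ h₂ => exact h₂ (h₁ hs)
  | ite_true _ _ h => exact h hs
  | ite_false _ _ h => exact h hs
  | rite_true _ _ h => exact h hs
  | rite_false _ _ h => exact h hs
  | loop_true _ _ _ h₁ h₂ => exact h₂ (h₁ hs)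

theorem Run.exec_compile {B W : ℕ} (hB : 2 ≤ B) {p : Prog} {s s' : State} {t : ℕ}
    (h : Run B p s s' t) (hs : s.Bounded B) (hW : B ^ p.size ≤ W) :
    ∀ c : State, c.visible = s → ∃ c' t', Exec W p.compile c c' t' ∧ c'.visible = s' ∧
      t' ≤ p.size * t := by
  have hpow : ∀ {i j : ℕ}, i ≤ j → B ^ j ≤ W → B ^ i ≤ W := fun h h' =>
    (Nat.pow_le_pow_right (by omega) h).trans h'
  induction h with
  | skip s => exact fun c hc => ⟨c, _, .skip c, hc, by simp [size]⟩
  | set s x e h =>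
    rintro c rfl
    simp only [size] at hW
    obtain ⟨c₁, t₁, x₁, ht₁, hv₁, hr₁, -⟩ := e.exec_compile hB 0 c hs (hpow (by omega) hW)
    have hk : e.eval c.visible < W := lt_of_lt_of_le (e.eval_lt hB hs) (hpow (by omega) hW)
    have h1 : c₁.reg 1 = e.eval c.visible := hr₁
    refine ⟨_, _, .seq x₁ (.seq (.const _ 3 0 (by omega)) (.op _ .add (2 * x) 1 3 ?_)), ?_,
      by simp [size]; omega⟩
    · simpa [h1] using hk
    · rw [State.visible_setReg, State.visible_setReg_odd _ 1, hv₁]; simp [h1]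
  | put s a e f h =>
    rintro c rfl
    simp only [size] at hW
    obtain ⟨c₁, t₁, x₁, ht₁, hv₁, hr₁, hr₃⟩ := exec_compile₂ hB e f c hs (hpow (by omega) hW)
    refine ⟨_, _, .seq x₁ (.store _ a 1 3), ?_, by simp [size]; omega⟩
    rw [hr₁, hr₃, ← hv₁]; rfl
  | rcopy s r q => rintro c rfl; exact ⟨_, _, .rcopy c r q, rfl, by simp [size]⟩
  | radd s r p q => rintro c rfl; exact ⟨_, _, .radd c r p q, rfl, by simp [size]⟩
  | rget s r a e =>
    rintro c rfl
    simp only [size] at hW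
    obtain ⟨c₁, t₁, x₁, ht₁, hv₁, hr₁, -⟩ := e.exec_compile hB 0 c hs (hpow (by omega) hW)
    have h1 : c₁.reg 1 = e.eval c.visible := hr₁
    refine ⟨_, _, .seq x₁ (.rload _ r a 1), ?_, by simp [size]; omega⟩
    rw [h1, ← hv₁]; rfl
  | rput s a e r =>
    rintro c rfl
    simp only [size] at hW
    obtain ⟨c₁, t₁, x₁, ht₁, hv₁, hr₁, -⟩ := e.exec_compile hB 0 c hs (hpow (by omega) hW)
    have h1 : c₁.reg 1 = e.eval c.visible := hr₁
    refine ⟨_, _, .seq x₁ (.rstore _ a 1 r), ?_, by simp [size]; omega⟩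
    rw [h1, ← hv₁]; rfl
  | @seq p q s s' s'' t t' h h' ih ih' =>
    intro c hc
    simp only [size] at hW
    obtain ⟨c₁, t₁, x₁, hv₁, ht₁⟩ := ih hs (hpow (by omega) hW) c hc
    obtain ⟨c₂, t₂, x₂, hv₂, ht₂⟩ := ih' (h.bounded hs) (hpow (by omega) hW) c₁ hv₁
    refine ⟨c₂, _, .seq x₁ x₂, hv₂, ?_⟩
    simp only [size]; nlinarith
  | @ite_true e f p q s s' t hc h ih =>
    rintro c rfl
    simp only [size] at hW
    obtain ⟨c₁, t₁, x₁, ht₁, hv₁, hr₁, hr₃⟩ := exec_compile₂ hB e f c hs (hpow (by omega) hW)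
    obtain ⟨c₂, t₂, x₂, hv₂, ht₂⟩ := ih hs (hpow (by omega) hW) c₁ hv₁
    refine ⟨c₂, _, .seq x₁ (.ifLt_true (by rwa [hr₁, hr₃]) x₂), hv₂, ?_⟩
    simp only [size]; nlinarith [h.pos]
  | @ite_false e f p q s s' t hc h ih =>
    rintro c rfl
    simp only [size] at hW
    obtain ⟨c₁, t₁, x₁, ht₁, hv₁, hr₁, hr₃⟩ := exec_compile₂ hB e f c hs (hpow (by omega) hW)
    obtain ⟨c₂, t₂, x₂, hv₂, ht₂⟩ := ih hs (hpow (by omega) hW) c₁ hv₁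
    refine ⟨c₂, _, .seq x₁ (.ifLt_false (by rwa [hr₁, hr₃]) x₂), hv₂, ?_⟩
    simp only [size]; nlinarith [h.pos]
  | @rite_true r r' p q s s' t hc h ih =>
    rintro c rfl
    simp only [size] at hW
    obtain ⟨c₂, t₂, x₂, hv₂, ht₂⟩ := ih hs (hpow (by omega) hW) c rfl
    exact ⟨c₂, _, .ifRLt_true hc x₂, hv₂, by simp only [size]; nlinarith⟩
  | @rite_false r r' p q s s' t hc h ih =>
    rintro c rfl
    simp only [size] at hW
    obtain ⟨c₂, t₂, x₂, hv₂, ht₂⟩ := ih hs (hpow (by omega) hW) c rfl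
    exact ⟨c₂, _, .ifRLt_false hc x₂, hv₂, by simp only [size]; nlinarith⟩
  | @loop_true e f p s s' s'' t t' hc h h' ih ih' =>
    rintro c rfl
    have hW' := hW
    simp only [size] at hW
    obtain ⟨c₁, t₁, x₁, ht₁, hv₁, hr₁, hr₃⟩ := exec_compile₂ hB e f c hs (hpow (by omega) hW)
    obtain ⟨c₂, t₂, x₂, hv₂, ht₂⟩ := ih hs (hpow (by omega) hW) c₁ hv₁
    obtain ⟨c₃, t₃, x₃, hv₃, ht₃⟩ := ih' (h.bounded hs) hW' c₂ hv₂
    -- The execution of the remaining loop starts with an evaluation of its test. This prefix is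
    -- split off and becomes the end of the pass just made.
    cases x₃ with
    | @seq _ _ _ c₄ _ t₄ t₅ x₄ x₅ =>
      refine ⟨c₃, _, .seq x₁ (.while_true (by rwa [hr₁, hr₃]) (.seq x₂ x₄) x₅), hv₃, ?_⟩
      simp only [size] at ht₃ ⊢; nlinarith [h.pos]
  | @loop_false e f p s hc =>
    rintro c rfl
    simp only [size] at hW
    obtain ⟨c₁, t₁, x₁, ht₁, hv₁, hr₁, hr₃⟩ := exec_compile₂ hB e f c hs (hpow (by omega) hW)
    exact ⟨c₁, _, .seq x₁ (.while_false (by rwa [hr₁, hr₃])), hv₁, by simp only [size]; omega⟩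

end Prog

end APSP

namespace APSP

namespace Prog

/-! ### Frames -/

/-- `p` may change the word variable `x`. -/
def wr : Prog → ℕ → Bool
  | set y _, x => Nat.beq y x
  | seq p q, x => p.wr x || q.wr x
  | ite _ _ p q, x => p.wr x || q.wr x
  | rite _ _ p q, x => p.wr x || q.wr x
  | loop _ _ p, x => p.wr x
  | _, _ => false

/-- `p` may change the word array `a`. -/
def wm : Prog → ℕ → Bool
  | put b _ _, a => Nat.beq b a
  | seq p q, a => p.wm a || q.wm a
  | ite _ _ p q, a => p.wm a || q.wm a
  | rite _ _ p q, a => p.wm a || q.wm a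
  | loop _ _ p, a => p.wm a
  | _, _ => false

/-- `p` may change the real register `r`. -/
def wrr : Prog → ℕ → Bool
  | rcopy q _, r => Nat.beq q r
  | radd q _ _, r => Nat.beq q r
  | rget q _ _, r => Nat.beq q r
  | seq p q, r => p.wrr r || q.wrr r
  | ite _ _ p q, r => p.wrr r || q.wrr r
  | rite _ _ p q, r => p.wrr r || q.wrr r
  | loop _ _ p, r => p.wrr r
  | _, _ => false

/-- `p` may change the real array `a`. -/
def wrm : Prog → ℕ → Bool
  | rput b _ _, a => Nat.beq b a
  | seq p q, a => p.wrm a || q.wrm a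
  | ite _ _ p q, a => p.wrm a || q.wrm a
  | rite _ _ p q, a => p.wrm a || q.wrm a
  | loop _ _ p, a => p.wrm a
  | _, _ => false

/-- The states `s` and `s'` agree on everything that `p` does not change. -/
structure Frame (p : Prog) (s s' : State) : Prop where
  reg : ∀ x, p.wr x = false → s'.reg x = s.reg x
  mem : ∀ a, p.wm a = false → s'.mem a = s.mem a
  rreg : ∀ r, p.wrr r = false → s'.rreg r = s.rreg r
  rmem : ∀ a, p.wrm a = false → s'.rmem a = s.rmem a

theorem Frame.refl (p : Prog) (s : State) : Frame p s s :=
  ⟨fun _ _ => rfl, fun _ _ => rfl, fun _ _ => rfl, fun _ _ => rfl⟩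

theorem Frame.trans {p : Prog} {s s' s'' : State} (h : Frame p s s') (h' : Frame p s' s'') :
    Frame p s s'' :=
  ⟨fun x hx => (h'.reg x hx).trans (h.reg x hx), fun x hx => (h'.mem x hx).trans (h.mem x hx),
    fun x hx => (h'.rreg x hx).trans (h.rreg x hx), fun x hx => (h'.rmem x hx).trans (h.rmem x hx)⟩

theorem Frame.mono {p q : Prog} {s s' : State} (h : Frame p s s')
    (h1 : ∀ x, q.wr x = false → p.wr x = false) (h2 : ∀ x, q.wm x = false → p.wm x = false)
    (h3 : ∀ x, q.wrr x = false → p.wrr x = false) (h4 : ∀ x, q.wrm x = false → p.wrm x = false) :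
    Frame q s s' :=
  ⟨fun x hx => h.reg x (h1 x hx), fun x hx => h.mem x (h2 x hx),
    fun x hx => h.rreg x (h3 x hx), fun x hx => h.rmem x (h4 x hx)⟩

theorem Frame.seq_left {p q : Prog} {s s' : State} (h : Frame p s s') : Frame (p ;; q) s s' :=
  h.mono (fun x => by simp +contextual [wr]) (fun x => by simp +contextual [wm])
    (fun x => by simp +contextual [wrr]) (fun x => by simp +contextual [wrm])

theorem Frame.seq_right {p q : Prog} {s s' : State} (h : Frame q s s') : Frame (p ;; q) s s' :=
  h.mono (fun x => by simp +contextual [wr]) (fun x => by simp +contextual [wm])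
    (fun x => by simp +contextual [wrr]) (fun x => by simp +contextual [wrm])

theorem Frame.loop {p : Prog} {e f : Expr} {s s' : State} (h : Frame p s s') :
    Frame (.loop e f p) s s' :=
  h.mono (fun x => by simp [wr]) (fun x => by simp [wm])
    (fun x => by simp [wrr]) (fun x => by simp [wrm])

/-- The four write sets are computed by Boolean functions, so for a concrete program and a concrete
register or array the frame condition holds by `rfl`. This is how all that a program leaves alone is
carried along below. -/
theorem Run.frame {B : ℕ} {p : Prog} {s s' : State} {t : ℕ} (h : Run B p s s' t) :
    Frame p s s' := by
  induction h with
  | skip s => exact .refl _ _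
  | set s x e h =>
    refine ⟨fun y hy => ?_, fun _ _ => rfl, fun _ _ => rfl, fun _ _ => rfl⟩
    have : ¬ y = x := by
      rintro rfl
      simp [wr] at hy
    simp [this]
  | put s a e f h =>
    refine ⟨fun _ _ => rfl, fun b hb => ?_, fun _ _ => rfl, fun _ _ => rfl⟩
    have : ¬ b = a := by
      rintro rfl
      simp [wm] at hb
    funext j; simp [this]
  | rcopy s r q =>
    refine ⟨fun _ _ => rfl, fun _ _ => rfl, fun b hb => ?_, fun _ _ => rfl⟩
    have : ¬ b = r := by
      rintro rfl
      simp [wrr] at hb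
    simp [this]
  | radd s r q q' =>
    refine ⟨fun _ _ => rfl, fun _ _ => rfl, fun b hb => ?_, fun _ _ => rfl⟩
    have : ¬ b = r := by
      rintro rfl
      simp [wrr] at hb
    simp [this]
  | rget s r a e =>
    refine ⟨fun _ _ => rfl, fun _ _ => rfl, fun b hb => ?_, fun _ _ => rfl⟩
    have : ¬ b = r := by
      rintro rfl
      simp [wrr] at hb
    simp [this]
  | rput s a e r =>
    refine ⟨fun _ _ => rfl, fun _ _ => rfl, fun _ _ => rfl, fun b hb => ?_⟩
    have : ¬ b = a := by
      rintro rfl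
      simp [wrm] at hb
    funext j; simp [this]
  | seq _ _ h₁ h₂ => exact h₁.seq_left.trans h₂.seq_right
  | ite_true _ _ h | ite_false _ _ h | rite_true _ _ h | rite_false _ _ h =>
    exact h.mono (fun x => by simp +contextual [wr]) (fun x => by simp +contextual [wm])
      (fun x => by simp +contextual [wrr]) (fun x => by simp +contextual [wrm])
  | loop_true _ _ _ h₁ h₂ => exact h₁.loop.trans h₂
  | loop_false => exact .refl _ _

/-! ### Weakest preconditions -/

/-- Started in `s`, the program `p` halts in a state `s'` after `t` steps with `Q s' t`. -/
def wp (B : ℕ) (p : Prog) (Q : State → ℕ → Prop) (s : State) : Prop :=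
  ∃ s' t, Run B p s s' t ∧ Q s' t

variable {B : ℕ} {p q : Prog} {Q Q' : State → ℕ → Prop} {s : State} {e f : Expr}

/-- The frame is supplied along with the postcondition, so a specification has to mention only what
the program changes. -/
theorem wp.mono (h : wp B p Q s) (hQ : ∀ s' t, Q s' t → Frame p s s' → Q' s' t) :
    wp B p Q' s := by
  obtain ⟨s', t, hr, hq⟩ := h
  exact ⟨s', t, hr, hQ s' t hq hr.frame⟩

@[simp] theorem wp_skip : wp B .skip Q s ↔ Q s 1 :=
  ⟨fun ⟨_, _, h, hq⟩ => by cases h; exact hq, fun h => ⟨_, _, .skip s, h⟩⟩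

@[simp] theorem wp_set {x : ℕ} :
    wp B (.set x e) Q s ↔ e.eval s < B ∧ Q (s.setReg x (e.eval s)) 1 :=
  ⟨fun ⟨_, _, h, hq⟩ => by cases h with | set _ _ _ h => exact ⟨h, hq⟩,
    fun h => ⟨_, _, .set s x e h.1, h.2⟩⟩

@[simp] theorem wp_put {a : ℕ} :
    wp B (.put a e f) Q s ↔ f.eval s < B ∧ Q (s.setMem a (e.eval s) (f.eval s)) 1 :=
  ⟨fun ⟨_, _, h, hq⟩ => by cases h with | put _ _ _ _ h => exact ⟨h, hq⟩,
    fun h => ⟨_, _, .put s a e f h.1, h.2⟩⟩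

@[simp] theorem wp_rcopy {r r' : ℕ} :
    wp B (.rcopy r r') Q s ↔ Q (s.setRReg r (s.rreg r')) 1 :=
  ⟨fun ⟨_, _, h, hq⟩ => by cases h; exact hq, fun h => ⟨_, _, .rcopy s r r', h⟩⟩

@[simp] theorem wp_radd {r r' r'' : ℕ} :
    wp B (.radd r r' r'') Q s ↔ Q (s.setRReg r (s.rreg r' + s.rreg r'')) 1 :=
  ⟨fun ⟨_, _, h, hq⟩ => by cases h; exact hq, fun h => ⟨_, _, .radd s r r' r'', h⟩⟩

@[simp] theorem wp_rget {r a : ℕ} :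
    wp B (.rget r a e) Q s ↔ Q (s.setRReg r (s.rmem a (e.eval s))) 1 :=
  ⟨fun ⟨_, _, h, hq⟩ => by cases h; exact hq, fun h => ⟨_, _, .rget s r a e, h⟩⟩

@[simp] theorem wp_rput {r a : ℕ} :
    wp B (.rput a e r) Q s ↔ Q (s.setRMem a (e.eval s) (s.rreg r)) 1 :=
  ⟨fun ⟨_, _, h, hq⟩ => by cases h; exact hq, fun h => ⟨_, _, .rput s a e r, h⟩⟩

@[simp] theorem wp_seq :
    wp B (p ;; q) Q s ↔ wp B p (fun s' t => wp B q (fun s'' t' => Q s'' (t + t')) s') s := by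
  constructor
  · rintro ⟨_, _, h, hq⟩
    cases h with | seq h h' => exact ⟨_, _, h, _, _, h', hq⟩
  · rintro ⟨_, _, h, _, _, h', hq⟩
    exact ⟨_, _, .seq h h', hq⟩

@[simp] theorem wp_ite :
    wp B (.ite e f p q) Q s ↔
      (e.eval s < f.eval s → wp B p (fun s' t => Q s' (t + 1)) s) ∧
        (¬ e.eval s < f.eval s → wp B q (fun s' t => Q s' (t + 1)) s) := by
  constructor
  · rintro ⟨_, _, h, hq⟩
    cases h with
    | ite_true hc h => exact ⟨fun _ => ⟨_, _, h, hq⟩, fun h' => absurd hc h'⟩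
    | ite_false hc h => exact ⟨fun h' => absurd h' hc, fun _ => ⟨_, _, h, hq⟩⟩
  · rintro ⟨h1, h2⟩
    by_cases hc : e.eval s < f.eval s
    · obtain ⟨_, _, h, hq⟩ := h1 hc
      exact ⟨_, _, .ite_true hc h, hq⟩
    · obtain ⟨_, _, h, hq⟩ := h2 hc
      exact ⟨_, _, .ite_false hc h, hq⟩

@[simp] theorem wp_rite {r r' : ℕ} :
    wp B (.rite r r' p q) Q s ↔
      (s.rreg r < s.rreg r' → wp B p (fun s' t => Q s' (t + 1)) s) ∧
        (¬ s.rreg r < s.rreg r' → wp B q (fun s' t => Q s' (t + 1)) s) := by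
  constructor
  · rintro ⟨_, _, h, hq⟩
    cases h with
    | rite_true hc h => exact ⟨fun _ => ⟨_, _, h, hq⟩, fun h' => absurd hc h'⟩
    | rite_false hc h => exact ⟨fun h' => absurd h' hc, fun _ => ⟨_, _, h, hq⟩⟩
  · rintro ⟨h1, h2⟩
    by_cases hc : s.rreg r < s.rreg r'
    · obtain ⟨_, _, h, hq⟩ := h1 hc
      exact ⟨_, _, .rite_true hc h, hq⟩
    · obtain ⟨_, _, h, hq⟩ := h2 hc
      exact ⟨_, _, .rite_false hc h, hq⟩

/-- The rule for loops: the invariant `I` may mention the time that has passed. -/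
theorem wp_loop (I : State → ℕ → Prop) (μ : State → ℕ) (h0 : I s 0)
    (hstep : ∀ s' t, I s' t → Frame p s s' → e.eval s' < f.eval s' →
      wp B p (fun s'' t' => I s'' (t + t' + 1) ∧ μ s'' < μ s') s')
    (hend : ∀ s' t, I s' t → Frame p s s' → ¬ e.eval s' < f.eval s' → Q s' (t + 1)) :
    wp B (.loop e f p) Q s := by
  -- Induction on a bound for the measure; `t` is the time already spent, so the postcondition for
  -- the remaining loop is shifted by it.
  have key : ∀ N s' t, μ s' < N → I s' t → Frame p s s' →
      wp B (.loop e f p) (fun s'' t' => Q s'' (t + t')) s' := by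
    intro N
    induction N with
    | zero => intro s' t h; omega
    | succ N ih =>
      intro s' t hμ hI hF
      by_cases hc : e.eval s' < f.eval s'
      · obtain ⟨s₁, t₁, hr, hI₁, hμ₁⟩ := hstep s' t hI hF hc
        obtain ⟨s₂, t₂, hr₂, hQ⟩ := ih s₁ _ (by omega) hI₁ (hF.trans hr.frame)
        refine ⟨s₂, _, .loop_true hc hr hr₂, ?_⟩
        convert hQ using 1; omega
      · exact ⟨s', _, .loop_false hc, hend s' t hI hF hc⟩
  obtain ⟨s', t, h, hq⟩ := key _ s 0 (Nat.lt_succ_self _) h0 (.refl _ _)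
  exact ⟨s', t, h, by simpa using hq⟩

/-- `for x := 0, …, y - 1 do p` -/
def for_ (x y : ℕ) (p : Prog) : Prog :=
  .set x (.lit 0) ;; .loop (.var x) (.var y) (p ;; .set x (.bin .add (.var x) (.lit 1)))

/-- The invariant is stated for the state in which the counter already has its new value. Each pass
is charged two extra steps, for the test and the increment; the two at the end are the initial
assignment and the failing test. -/
theorem wp_for {x y : ℕ} (I : ℕ → State → ℕ → Prop) (hB : s.reg y < B) (hxy : x ≠ y)
    (hx : p.wr x = false) (hy : p.wr y = false)
    (h0 : I 0 (s.setReg x 0) 0)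
    (hstep : ∀ i < s.reg y, ∀ s' t, I i s' t → s'.reg x = i → Frame (for_ x y p) s s' →
      wp B p (fun s'' t' => I (i + 1) (s''.setReg x (i + 1)) (t + t' + 2)) s')
    (hend : ∀ s' t, I (s.reg y) s' t → Frame (for_ x y p) s s' → Q s' (t + 2)) :
    wp B (for_ x y p) Q s := by
  have hyx : y ≠ x := hxy.symm
  have hwy : (for_ x y p).wr y = false := by
    simpa [for_, wr, hy] using Bool.eq_false_iff.2 fun h => hxy (Nat.eq_of_beq_eq_true h)
  have hF1 : Frame (for_ x y p) s (s.setReg x 0) := by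
    refine ⟨fun z hz => ?_, fun _ _ => rfl, fun _ _ => rfl, fun _ _ => rfl⟩
    have : ¬ z = x := by
      rintro rfl
      simp [for_, wr] at hz
    simp [this]
  have hF2 : ∀ {s' : State}, Frame (p ;; .set x (.bin .add (.var x) (.lit 1))) (s.setReg x 0) s' →
      Frame (for_ x y p) s s' := fun h => hF1.trans h.loop.seq_right
  rw [for_, wp_seq, wp_set]
  refine ⟨by simp; omega, ?_⟩
  refine wp_loop (fun s' t => s'.reg x ≤ s.reg y ∧ I (s'.reg x) s' t)
    (fun s' => s.reg y - s'.reg x) ⟨by simp, by simpa using h0⟩ ?_ ?_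
  · rintro s' t ⟨hle, hI⟩ hF hc
    have hF' := hF2 hF
    have e1 := hF'.reg y hwy
    simp only [Expr.eval, e1] at hc
    rw [wp_seq]
    refine (hstep _ hc s' t hI rfl hF').mono fun s'' t' h hf => ?_
    have e2 := hf.reg x hx
    simp only [wp_set, Expr.eval, WordOp.eval_add, e2, State.setReg_reg, if_true]
    refine ⟨by omega, ⟨hc, ?_⟩, by omega⟩
    convert h using 1; omega
  · rintro s' t ⟨hle, hI⟩ hF hc
    have hF' := hF2 hF
    simp only [Expr.eval, hF'.reg y hwy] at hc
    have : s'.reg x = s.reg y := by omega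
    have := hend s' t (this ▸ hI) hF'
    convert this using 1; omega

/-- The rule for counting loops with a fixed bound for the time of a step. -/
theorem wp_for_const {x y c : ℕ} (I : ℕ → State → Prop) (hB : s.reg y < B) (hxy : x ≠ y)
    (hx : p.wr x = false) (hy : p.wr y = false)
    (h0 : I 0 (s.setReg x 0))
    (hstep : ∀ i < s.reg y, ∀ s', I i s' → s'.reg x = i → Frame (for_ x y p) s s' →
      wp B p (fun s'' t' => I (i + 1) (s''.setReg x (i + 1)) ∧ t' ≤ c) s')
    (hend : ∀ s' t, I (s.reg y) s' → Frame (for_ x y p) s s' → t ≤ (c + 2) * s.reg y + 2 → Q s' t) :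
    wp B (for_ x y p) Q s := by
  refine wp_for (fun i s' t => I i s' ∧ t ≤ (c + 2) * i) hB hxy hx hy ⟨h0, by simp⟩ ?_ ?_
  · rintro i hi s' t ⟨hI, ht⟩ hxi hF
    refine (hstep i hi s' hI hxi hF).mono fun s'' t' h _ => ⟨h.1, ?_⟩
    have := h.2
    rw [Nat.mul_succ]; omega
  · rintro s' t ⟨hI, ht⟩ hF
    exact hend s' _ hI hF (by omega)

end Prog

end APSP

namespace APSP

/-! ### Interruptible subroutines with a fresh memory -/

namespace Cmd

/-- All word registers of the program are less than `r`. -/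
def RegsBelow (r : ℕ) : Cmd → Prop
  | const x _ => x < r
  | op _ x y z => x < r ∧ y < r ∧ z < r
  | load x _ i => x < r ∧ i < r
  | store _ i x => i < r ∧ x < r
  | seq c d => c.RegsBelow r ∧ d.RegsBelow r
  | ifLt x y c d => x < r ∧ y < r ∧ c.RegsBelow r ∧ d.RegsBelow r
  | ifRLt _ _ c d => c.RegsBelow r ∧ d.RegsBelow r
  | whileLt x y c => x < r ∧ y < r ∧ c.RegsBelow r
  | _ => True

theorem RegsBelow.mono {r r' : ℕ} (h : r ≤ r') {c : Cmd} (hc : c.RegsBelow r) :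
    c.RegsBelow r' := by
  induction c <;> simp only [RegsBelow] at * <;> grind

/-- A program text mentions finitely many registers, so the simulated registers can be cleared
before every call by a fixed number of assignments. -/
theorem exists_regsBelow (c : Cmd) : ∃ r, c.RegsBelow r := by
  induction c with
  | const x k => exact ⟨x + 1, Nat.lt_succ_self x⟩
  | op o x y z => exact ⟨x + y + z + 1, by simp only [RegsBelow]; omega⟩
  | load x a i => exact ⟨x + i + 1, by simp only [RegsBelow]; omega⟩
  | store a i x => exact ⟨i + x + 1, by simp only [RegsBelow]; omega⟩
  | seq c d hc hd =>
    obtain ⟨r, hr⟩ := hc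
    obtain ⟨r', hr'⟩ := hd
    exact ⟨r + r', hr.mono (by omega), hr'.mono (by omega)⟩
  | ifLt x y c d hc hd =>
    obtain ⟨r, hr⟩ := hc
    obtain ⟨r', hr'⟩ := hd
    exact ⟨r + r' + x + y + 1, by omega, by omega, hr.mono (by omega), hr'.mono (by omega)⟩
  | ifRLt x y c d hc hd =>
    obtain ⟨r, hr⟩ := hc
    obtain ⟨r', hr'⟩ := hd
    exact ⟨r + r', hr.mono (by omega), hr'.mono (by omega)⟩
  | whileLt x y c hc =>
    obtain ⟨r, hr⟩ := hc
    exact ⟨r + x + y + 1, by omega, by omega, hr.mono (by omega)⟩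
  | _ => exact ⟨0, trivial⟩

end Cmd

open Prog

/-- Do `p` and consume one unit of fuel, if there is any fuel left. -/
def tick (p : Prog) : Prog :=
  .ite (.lit 0) (.var 5) (.set 5 (.bin .sub (.var 5) (.lit 1)) ;; p) .skip

/-- The program `c`, interrupted when the fuel is exhausted.  Array `a` is simulated by the arrays
`60 + 2 a` and `61 + 2 a`; a cell of the former is in use if the same cell of the latter, its time
stamp, is the value of variable `6`, and counts as zero otherwise.  As all real numbers are zero, the
operations on them are left out. -/
def clocked : Cmd → Prog
  | .const x k => tick (.set (60 + x) (.lit k))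
  | .op o x y z => tick (.set (60 + x) (.bin o (.var (60 + y)) (.var (60 + z))))
  | .load x a i => tick (.ite (.ld (61 + 2 * a) (.var (60 + i))) (.var 6)
      (.set (60 + x) (.lit 0)) (.set (60 + x) (.ld (60 + 2 * a) (.var (60 + i)))))
  | .store a i x => tick (.put (61 + 2 * a) (.var (60 + i)) (.var 6) ;;
      .put (60 + 2 * a) (.var (60 + i)) (.var (60 + x)))
  | .seq c d => clocked c ;; clocked d
  | .ifLt x y c d => tick (.ite (.var (60 + x)) (.var (60 + y)) (clocked c) (clocked d))
  | .ifRLt _ _ _ d => tick (clocked d)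
  -- With truncated subtraction, 1 - (1 - fuel) is 1 as long as there is fuel and 0 otherwise; the
  -- factor makes the test fail when the fuel is used up.
  | .whileLt x y c => .loop (.var (60 + x))
      (.bin .mul (.var (60 + y)) (.bin .sub (.lit 1) (.bin .sub (.lit 1) (.var 5))))
      (.set 5 (.bin .sub (.var 5) (.lit 1)) ;; clocked c)
  | _ => tick .skip

/-- The number of steps of `clocked c` per unit of fuel. -/
def clockedCost : Cmd → ℕ
  | .seq c d => clockedCost c + clockedCost d
  | .ifLt _ _ c d => clockedCost c + clockedCost d + 5
  | .ifRLt _ _ _ d => clockedCost d + 5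
  | .whileLt _ _ c => clockedCost c + 5
  | _ => 5

/-- `h` simulates `s`. -/
structure Simulates (r : ℕ) (s h : State) : Prop where
  reg : ∀ x < r, h.reg (60 + x) = s.reg x
  mem : ∀ a i, s.mem a i = if h.mem (61 + 2 * a) i < h.reg 6 then 0 else h.mem (60 + 2 * a) i
  rreg : ∀ x, s.rreg x = 0
  rmem : ∀ a i, s.rmem a i = 0

/-- No time stamp is in the future. -/
def StampsLe (h : State) : Prop := ∀ a i, h.mem (61 + 2 * a) i ≤ h.reg 6

theorem StampsLe.setReg {h : State} (hs : StampsLe h) {x k : ℕ} (hx : x ≠ 6) :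
    StampsLe (h.setReg x k) := fun a i => by simpa [hx.symm] using hs a i

theorem run_tick_zero {B : ℕ} {p : Prog} {h : State} (hf : h.reg 5 = 0) :
    Run B (tick p) h h 2 :=
  .ite_false (by simp [hf]) (.skip h)

theorem run_tick {B : ℕ} {p : Prog} {h h' : State} {t : ℕ} (hf : 0 < h.reg 5) (hB : h.reg 5 < B)
    (hr : Run B p (h.setReg 5 (h.reg 5 - 1)) h' t) : Run B (tick p) h h' (t + 2) := by
  have h1 : Run B (.set 5 (.bin .sub (.var 5) (.lit 1))) h (h.setReg 5 (h.reg 5 - 1)) 1 :=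
    .set h 5 (.bin .sub (.var 5) (.lit 1)) (by simp; omega)
  have e : t + 2 = 1 + t + 1 := by omega
  rw [e]
  exact Run.ite_true (by simpa using hf) (h1.seq hr)

/-- Without fuel every elementary command is skipped and every loop ends at its first test, so
control falls through the text without changing the state. This is what happens to the rest of an
interrupted program. -/
theorem run_clocked_zero {B : ℕ} (c : Cmd) {h : State} (hf : h.reg 5 = 0) :
    ∃ t, Run B (clocked c) h h t ∧ t ≤ clockedCost c := by
  induction c with
  | seq c d hc hd =>
    obtain ⟨t, ht, hle⟩ := hc
    obtain ⟨t', ht', hle'⟩ := hd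
    exact ⟨_, ht.seq ht', by simp [clockedCost]; omega⟩
  | whileLt x y c hc => exact ⟨1, .loop_false (by simp [hf]), by simp [clockedCost]⟩
  | _ => exact ⟨2, run_tick_zero hf, by simp [clockedCost]⟩

theorem Simulates.burn {r : ℕ} {s h : State} (hs : Simulates r s h) (k : ℕ) :
    Simulates r s (h.setReg 5 k) :=
  ⟨fun x hx => by
    have : 60 + x ≠ 5 := by omega
    simpa [this] using hs.reg x hx,
    fun a i => by simpa using hs.mem a i, hs.rreg, hs.rmem⟩

theorem Simulates.setReg {r : ℕ} {s h : State} (hs : Simulates r s h) (x k : ℕ) :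
    Simulates r (s.setReg x k) (h.setReg (60 + x) k) :=
  ⟨fun y hy => by simp [hs.reg y hy],
    fun a i => by
      have : 6 ≠ 60 + x := by omega
      simpa [this] using hs.mem a i, hs.rreg, hs.rmem⟩

/-- What `clocked c` achieves: it is interrupted, or it simulates `c`. -/
def ClockedRun (B r : ℕ) (p : Prog) (K : ℕ) (s' : State) (t : ℕ) (h : State) : Prop :=
  ∃ h' t', Run B p h h' t' ∧ h'.reg 5 ≤ h.reg 5 ∧ t' ≤ K * (h.reg 5 - h'.reg 5 + 1) ∧
    h.reg 5 - h'.reg 5 ≤ t ∧ StampsLe h' ∧ h'.reg 6 = h.reg 6 ∧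
    (0 < h'.reg 5 → Simulates r s' h')

theorem ClockedRun.tick {B r : ℕ} {p : Prog} {K : ℕ} {s' : State} {t : ℕ} {h : State}
    (hf : 0 < h.reg 5) (hB : h.reg 5 < B)
    (hp : ClockedRun B r p K s' t (h.setReg 5 (h.reg 5 - 1))) :
    ClockedRun B r (tick p) (K + 3) s' (t + 1) h := by
  obtain ⟨h', t', hr, h1, h2, h3, h4, h5, h6⟩ := hp
  simp only [State.setReg_reg, if_true] at h1 h2 h3
  refine ⟨h', _, run_tick hf hB hr, by omega, ?_, by omega, h4, by simpa using h5, h6⟩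
  have : h.reg 5 - h'.reg 5 = h.reg 5 - 1 - h'.reg 5 + 1 := by omega
  rw [this]; nlinarith

theorem ClockedRun.mono {B r : ℕ} {p : Prog} {K K' : ℕ} {s' : State} {t t' : ℕ} {h : State}
    (hp : ClockedRun B r p K s' t h) (hK : K ≤ K') (ht : t ≤ t') :
    ClockedRun B r p K' s' t' h := by
  obtain ⟨h', u, hr, h1, h2, h3, h4⟩ := hp
  exact ⟨h', u, hr, h1, h2.trans (Nat.mul_le_mul_right _ hK), h3.trans ht, h4⟩

/-- Induction on the simulated execution. Each unit of fuel pays for a bounded number of steps, and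
one additional unit in the time bound pays for falling through the text after an interruption. Fuel
that remains at the end certifies that the simulation is complete; fuel that runs out exactly at the
end counts as an interruption. -/
theorem Simulates.clockedRun {B W r : ℕ} (hW : W ≤ B) {c : Cmd} {s s' : State} {t : ℕ}
    (hx : Exec W c s s' t) (hc : c.RegsBelow r) :
    ∀ h : State, Simulates r s h → StampsLe h → 0 < h.reg 5 → h.Bounded B →
      ClockedRun B r (clocked c) (clockedCost c) s' t h := by
  have simple : ∀ {p : Prog} {s' h h' : State} {u : ℕ}, 0 < h.reg 5 → h.Bounded B →
      Run B p (h.setReg 5 (h.reg 5 - 1)) h' u → u ≤ 2 → h'.reg 5 = h.reg 5 - 1 →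
      StampsLe h' → h'.reg 6 = h.reg 6 → Simulates r s' h' →
      ClockedRun B r (APSP.tick p) 5 s' 1 h := by
    intro p s' h h' u hf hB hr hu h5 hst h6 hs
    exact ClockedRun.tick (K := 2) (t := 0) hf (hB.1 5)
      ⟨h', u, hr, by simp [h5], by simp [h5]; omega, by simp [h5], hst, by simpa using h6,
        fun _ => hs⟩
  induction hx with
  | skip s =>
    intro h hs hst hf hB
    exact simple hf hB (.skip _) (by omega) (by simp) (hst.setReg (by omega)) (by simp) (hs.burn _)
  | rcopy s r q =>
    intro h hs hst hf hB
    refine simple hf hB (.skip _) (by omega) (by simp) (hst.setReg (by omega)) (by simp) ?_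
    exact ⟨(hs.burn _).reg, (hs.burn _).mem, fun x => by simp [hs.rreg], hs.rmem⟩
  | radd s r q =>
    intro h hs hst hf hB
    refine simple hf hB (.skip _) (by omega) (by simp) (hst.setReg (by omega)) (by simp) ?_
    exact ⟨(hs.burn _).reg, (hs.burn _).mem, fun x => by simp [hs.rreg], hs.rmem⟩
  | rload s r q =>
    intro h hs hst hf hB
    refine simple hf hB (.skip _) (by omega) (by simp) (hst.setReg (by omega)) (by simp) ?_
    exact ⟨(hs.burn _).reg, (hs.burn _).mem, fun x => by simp [hs.rreg, hs.rmem], hs.rmem⟩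
  | rstore s r q =>
    intro h hs hst hf hB
    refine simple hf hB (.skip _) (by omega) (by simp) (hst.setReg (by omega)) (by simp) ?_
    exact ⟨(hs.burn _).reg, (hs.burn _).mem, hs.rreg, fun a i => by simp [hs.rreg, hs.rmem]⟩
  | const s x k hk =>
    intro h hs hst hf hB
    refine simple hf hB (.set _ (60 + x) (.lit k) (lt_of_lt_of_le hk hW)) (by omega) ?_
      ((hst.setReg (by omega)).setReg (by omega)) ?_ ((hs.burn _).setReg x k)
    · have : 5 ≠ 60 + x := by omega
      simp [this]
    · have : 6 ≠ 60 + x := by omega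
      simp [this]
  | op s o x y z hk =>
    intro h hs hst hf hB
    simp only [Cmd.RegsBelow] at hc
    have e : (Expr.bin o (.var (60 + y)) (.var (60 + z))).eval (h.setReg 5 (h.reg 5 - 1)) =
        o.eval (s.reg y) (s.reg z) := by
      have h1 : 60 + y ≠ 5 := by omega
      have h2 : 60 + z ≠ 5 := by omega
      simp [h1, h2, hs.reg y hc.2.1, hs.reg z hc.2.2]
    refine simple hf hB (.set _ (60 + x) (.bin o (.var (60 + y)) (.var (60 + z))) ?_) (by omega) ?_
      ((hst.setReg (by omega)).setReg (by omega)) ?_ ?_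
    · rw [e]; exact lt_of_lt_of_le hk hW
    · have : 5 ≠ 60 + x := by omega
      simp [this]
    · have : 6 ≠ 60 + x := by omega
      simp [this]
    · rw [e]; exact (hs.burn _).setReg x _
  | load s x a i =>
    intro h hs hst hf hB
    simp only [Cmd.RegsBelow] at hc
    have h1 : 60 + i ≠ 5 := by omega
    have h5 : 5 ≠ 60 + x := by omega
    have h6 : 6 ≠ 60 + x := by omega
    by_cases hlt : h.mem (61 + 2 * a) (s.reg i) < h.reg 6
    · have e := hs.mem a (s.reg i)
      rw [if_pos hlt] at e
      rw [e]
      refine simple hf hB (.ite_true ?_ (.set _ (60 + x) (.lit 0) (by have := hB.1 5; simp; omega)))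
        le_rfl (by simp [h5]) ((hst.setReg (by omega)).setReg (by omega)) (by simp [h6])
        ((hs.burn _).setReg x 0)
      simpa [h1, hs.reg i hc.2] using hlt
    · have e := hs.mem a (s.reg i)
      rw [if_neg hlt] at e
      have e' : (Expr.ld (60 + 2 * a) (.var (60 + i))).eval (h.setReg 5 (h.reg 5 - 1)) =
          s.mem a (s.reg i) := by simp [h1, hs.reg i hc.2, e]
      refine simple hf hB (.ite_false ?_ (.set _ (60 + x) (.ld (60 + 2 * a) (.var (60 + i))) ?_))
        le_rfl (by simp [h5]) ((hst.setReg (by omega)).setReg (by omega)) (by simp [h6]) ?_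
      · simpa [h1, hs.reg i hc.2] using hlt
      · rw [e', e]; exact hB.2 _ _
      · rw [e']; exact (hs.burn _).setReg x _
  | store s a i x =>
    intro h hs hst hf hB
    simp only [Cmd.RegsBelow] at hc
    have h1 : 60 + i ≠ 5 := by omega
    have h2 : 60 + x ≠ 5 := by omega
    refine simple hf hB (.seq (.put _ (61 + 2 * a) (.var (60 + i)) (.var 6) ?_)
      (.put _ (60 + 2 * a) (.var (60 + i)) (.var (60 + x)) ?_)) le_rfl (by simp) ?_ (by simp) ?_
    · simpa using hB.1 6
    · simpa [h2] using hB.1 (60 + x)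
    · intro b j
      have : 61 + 2 * b ≠ 60 + 2 * a := by omega
      simp only [State.setMem_mem, this, false_and, if_false, State.setMem_reg]
      split
      · simp
      · simpa using hst b j
    · refine ⟨fun y hy => ?_, fun b j => ?_, hs.rreg, hs.rmem⟩
      · have : 60 + y ≠ 5 := by omega
        simpa [this] using hs.reg y hy
      · have n1 : 61 + 2 * b ≠ 60 + 2 * a := by omega
        have n2 : 60 + 2 * b ≠ 61 + 2 * a := by omega
        have e1 : 61 + 2 * b = 61 + 2 * a ↔ b = a := by omega
        have e2 : 60 + 2 * b = 60 + 2 * a ↔ b = a := by omega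
        simp only [State.setMem_mem, n1, n2, e1, e2, false_and, if_false, State.setMem_reg,
          Expr.eval, State.setReg_reg, h1, h2, hs.reg i hc.1, hs.reg x hc.2, State.setReg_mem]
        by_cases hb : b = a ∧ j = s.reg i
        · simp [hb]
        · simpa [hb] using hs.mem b j
  | @seq c d s s' s'' t t' hx hx' ih ih' =>
    intro h hs hst hf hB
    obtain ⟨h₁, t₁, r₁, p1, p2, p3, p4, p5, p6⟩ := ih hc.1 h hs hst hf hB
    -- If the first part has used up the fuel, the second is only fallen through; the additional
    -- unit in the time bound covers this.
    rcases Nat.eq_zero_or_pos (h₁.reg 5) with h0 | hpos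
    · obtain ⟨t₂, r₂, hle⟩ := run_clocked_zero (B := B) d h0
      refine ⟨h₁, _, r₁.seq r₂, p1, ?_, by omega, p4, p5, by omega⟩
      simp only [clockedCost]; nlinarith
    · obtain ⟨h₂, t₂, r₂, q1, q2, q3, q4, q5, q6⟩ := ih' hc.2 h₁ (p6 hpos) p4 hpos (r₁.bounded hB)
      refine ⟨h₂, _, r₁.seq r₂, by omega, ?_, by omega, q4, q5.trans p5, q6⟩
      have e : h.reg 5 - h₂.reg 5 = (h.reg 5 - h₁.reg 5) + (h₁.reg 5 - h₂.reg 5) := by omega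
      rw [e]; simp only [clockedCost]; nlinarith
  | @ifLt_true x y c d s s' t hxy hx ih =>
    intro h hs hst hf hB
    have hc' := hc
    simp only [Cmd.RegsBelow] at hc
    have h1 : 60 + x ≠ 5 := by omega
    have h2 : 60 + y ≠ 5 := by omega
    refine (ClockedRun.tick (K := clockedCost c + clockedCost d + 2) hf (hB.1 5) ?_).mono le_rfl le_rfl
    rcases Nat.eq_zero_or_pos (h.reg 5 - 1) with h0 | hpos
    · obtain ⟨t₂, r₂, hle⟩ := run_clocked_zero (B := B) c (h := h.setReg 5 (h.reg 5 - 1)) (by simp [h0])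
      refine ⟨_, _, .ite_true ?_ r₂, le_rfl, by simp; omega, by simp, hst.setReg (by omega), rfl,
        by simp [h0]⟩
      simpa [h1, h2, hs.reg x hc.1, hs.reg y hc.2.1] using hxy
    · obtain ⟨h₂, t₂, r₂, q1, q2, q3, q4, q5, q6⟩ := ih hc.2.2.1 _ (hs.burn (h.reg 5 - 1))
        (hst.setReg (by omega)) (by simpa using hpos)
        ⟨fun z => by
          rw [State.setReg_reg]; split
          · have := hB.1 5; omega
          · exact hB.1 z, hB.2⟩
      refine ⟨h₂, _, .ite_true ?_ r₂, q1, by nlinarith, q3, q4, q5, q6⟩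
      simpa [h1, h2, hs.reg x hc.1, hs.reg y hc.2.1] using hxy
  | @ifLt_false x y c d s s' t hxy hx ih =>
    intro h hs hst hf hB
    have hc' := hc
    simp only [Cmd.RegsBelow] at hc
    have h1 : 60 + x ≠ 5 := by omega
    have h2 : 60 + y ≠ 5 := by omega
    refine (ClockedRun.tick (K := clockedCost c + clockedCost d + 2) hf (hB.1 5) ?_).mono le_rfl le_rfl
    rcases Nat.eq_zero_or_pos (h.reg 5 - 1) with h0 | hpos
    · obtain ⟨t₂, r₂, hle⟩ := run_clocked_zero (B := B) d (h := h.setReg 5 (h.reg 5 - 1)) (by simp [h0])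
      refine ⟨_, _, .ite_false ?_ r₂, le_rfl, by simp; omega, by simp, hst.setReg (by omega), rfl,
        by simp [h0]⟩
      simpa [h1, h2, hs.reg x hc.1, hs.reg y hc.2.1] using hxy
    · obtain ⟨h₂, t₂, r₂, q1, q2, q3, q4, q5, q6⟩ := ih hc.2.2.2 _ (hs.burn (h.reg 5 - 1))
        (hst.setReg (by omega)) (by simpa using hpos)
        ⟨fun z => by
          rw [State.setReg_reg]; split
          · have := hB.1 5; omega
          · exact hB.1 z, hB.2⟩
      refine ⟨h₂, _, .ite_false ?_ r₂, q1, by nlinarith, q3, q4, q5, q6⟩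
      simpa [h1, h2, hs.reg x hc.1, hs.reg y hc.2.1] using hxy
  | @ifRLt_true x y c d s s' t hxy hx ih =>
    intro h hs hst hf hB
    -- All simulated real numbers are zero, so this branch is never taken.
    simp [hs.rreg] at hxy
  | @ifRLt_false x y c d s s' t hxy hx ih =>
    intro h hs hst hf hB
    refine (ClockedRun.tick (K := clockedCost d + 2) hf (hB.1 5) ?_).mono le_rfl le_rfl
    rcases Nat.eq_zero_or_pos (h.reg 5 - 1) with h0 | hpos
    · obtain ⟨t₂, r₂, hle⟩ := run_clocked_zero (B := B) d (h := h.setReg 5 (h.reg 5 - 1)) (by simp [h0])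
      exact ⟨_, _, r₂, le_rfl, by simp; omega, by simp, hst.setReg (by omega), rfl, by simp [h0]⟩
    · obtain ⟨h₂, t₂, r₂, q1, q2, q3, q4, q5, q6⟩ := ih hc.2 _ (hs.burn (h.reg 5 - 1))
        (hst.setReg (by omega)) (by simpa using hpos)
        ⟨fun z => by
          rw [State.setReg_reg]; split
          · have := hB.1 5; omega
          · exact hB.1 z, hB.2⟩
      exact ⟨h₂, _, r₂, q1, by nlinarith, q3, q4, q5, q6⟩
  | @while_true x y c s s' s'' t t' hxy hx hx' ih ih' =>
    intro h hs hst hf hB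
    have hc' := hc
    simp only [Cmd.RegsBelow] at hc
    have hcond : (Expr.var (60 + x)).eval h < (Expr.bin .mul (.var (60 + y))
        (.bin .sub (.lit 1) (.bin .sub (.lit 1) (.var 5)))).eval h := by
      have : 1 - (1 - h.reg 5) = 1 := by omega
      simpa [this, hs.reg x hc.1, hs.reg y hc.2.1] using hxy
    have hb : (h.setReg 5 (h.reg 5 - 1)).Bounded B :=
      ⟨fun z => by
        rw [State.setReg_reg]; split
        · have := hB.1 5; omega
        · exact hB.1 z, hB.2⟩
    have r₀ : Run B (.set 5 (.bin .sub (.var 5) (.lit 1))) h (h.setReg 5 (h.reg 5 - 1)) 1 :=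
      .set h 5 (.bin .sub (.var 5) (.lit 1)) (by have := hB.1 5; simp; omega)
    have hexit : ∀ {g : State}, g.reg 5 = 0 →
        Run B (clocked (.whileLt x y c)) g g 1 := fun hg => .loop_false (by simp [hg])
    rcases Nat.eq_zero_or_pos (h.reg 5 - 1) with h0 | hpos
    · obtain ⟨t₂, r₂, hle⟩ := run_clocked_zero (B := B) c (h := h.setReg 5 (h.reg 5 - 1)) (by simp [h0])
      refine ⟨_, _, .loop_true hcond (r₀.seq r₂) (hexit (by simp [h0])), by simp, ?_, by simp; omega,
        hst.setReg (by omega), by simp, by simp [h0]⟩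
      simp only [clockedCost, State.setReg_reg, if_true, h0]; nlinarith
    · obtain ⟨h₂, t₂, r₂, q1, q2, q3, q4, q5, q6⟩ := ih hc.2.2 _ (hs.burn (h.reg 5 - 1))
        (hst.setReg (by omega)) (by simpa using hpos) hb
      simp only [State.setReg_reg, if_true] at q1 q2 q3
      -- If the body has used up the fuel, the loop stops at its next test; otherwise the simulation
      -- of the remaining passes takes over.
      rcases Nat.eq_zero_or_pos (h₂.reg 5) with g0 | gpos
      · refine ⟨_, _, .loop_true hcond (r₀.seq r₂) (hexit g0), by omega, ?_, by omega,
          q4, by simpa using q5, by omega⟩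
        have e : h.reg 5 - h₂.reg 5 = h.reg 5 - 1 - h₂.reg 5 + 1 := by omega
        rw [e]; simp only [clockedCost]; nlinarith
      · obtain ⟨h₃, t₃, r₃, p1, p2, p3, p4, p5, p6⟩ := ih' hc' h₂ (q6 gpos) q4 gpos (r₂.bounded hb)
        refine ⟨h₃, _, .loop_true hcond (r₀.seq r₂) r₃, by omega, ?_, by omega, p4,
          p5.trans (by simpa using q5), p6⟩
        have e : h.reg 5 - h₃.reg 5 = (h.reg 5 - 1 - h₂.reg 5) + (h₂.reg 5 - h₃.reg 5) + 1 := by omega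
        rw [e]; simp only [clockedCost] at p2 ⊢; nlinarith
  | @while_false x y c s hxy =>
    intro h hs hst hf hB
    simp only [Cmd.RegsBelow] at hc
    refine ⟨h, 1, .loop_false ?_, le_rfl, by simp [clockedCost], by simp, hst, rfl, fun _ => hs⟩
    have : 1 - (1 - h.reg 5) = 1 := by omega
    simpa [this, hs.reg x hc.1, hs.reg y hc.2.1] using hxy

end APSP

namespace APSP

namespace Dag

/-! ### Paths -/

variable {n m : ℕ} {G : Dag n m} {w : Fin m → ℝ} {σ : Equiv.Perm (Fin n)} {u v x a b : Fin n}
  {p q : List (Fin n)}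

theorem IsPath.ne_nil (h : G.IsPath u v p) : p ≠ [] := by
  rintro rfl
  simp [IsPath] at h

@[simp] theorem isPath_singleton : G.IsPath u v [a] ↔ a = u ∧ a = v := by
  simp [IsPath]

theorem isPath_snoc (hp : p ≠ []) :
    G.IsPath u v (p ++ [x]) ↔ x = v ∧ ∃ y, G.IsPath u y p ∧ G.Adj y v := by
  obtain ⟨p', y, rfl⟩ := (List.eq_nil_or_concat p).resolve_left hp
  simp only [IsPath, List.concat_eq_append, List.isChain_append, List.head?_append]
  constructor
  · rintro ⟨h1, h2, ⟨h3, h4, h5⟩, -, h6⟩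
    simp at h1 h2 h6
    subst h2
    exact ⟨rfl, y, ⟨by simpa using h1, by simp, h3, h4, h5⟩, h6⟩
  · rintro ⟨rfl, z, ⟨h1, h2, h3, h4, h5⟩, h6⟩
    simp at h1 h2
    subst h2
    exact ⟨by simpa using h1, by simp, ⟨h3, h4, h5⟩, by simp, by simpa using h6⟩

theorem IsPath.snoc (h : G.IsPath u x p) (hxv : G.Adj x v) : G.IsPath u v (p ++ [v]) :=
  (isPath_snoc h.ne_nil).2 ⟨rfl, x, h, hxv⟩

/-- A path is a single vertex or ends with an edge. -/
theorem IsPath.cases (h : G.IsPath u v p) :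
    u = v ∧ p = [v] ∨ ∃ x q, p = q ++ [v] ∧ G.IsPath u x q ∧ G.Adj x v := by
  obtain ⟨q, y, rfl⟩ := (List.eq_nil_or_concat p).resolve_left h.ne_nil
  rw [List.concat_eq_append] at h ⊢
  by_cases hq : q = []
  · subst hq
    simp only [List.nil_append, isPath_singleton] at h
    exact .inl ⟨h.1.symm.trans h.2, by simp [h.2]⟩
  · obtain ⟨rfl, x, hx, hxv⟩ := (isPath_snoc hq).1 h
    exact .inr ⟨x, q, rfl, hx, hxv⟩

theorem isPath_split {p₁ p₂ : List (Fin n)} :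
    G.IsPath u v (p₁ ++ a :: p₂) ↔ G.IsPath u a (p₁ ++ [a]) ∧ G.IsPath a v (a :: p₂) := by
  simp only [IsPath, List.isChain_split (c := a) (l₁ := p₁) (l₂ := p₂), List.head?_append,
    List.getLast?_append]
  simp
  grind

theorem isPath_append {p₁ p₂ : List (Fin n)} (h₁ : G.IsPath u a (p₁ ++ [a]))
    (h₂ : G.IsPath a v (a :: p₂)) : G.IsPath u v (p₁ ++ a :: p₂) := isPath_split.2 ⟨h₁, h₂⟩

/-- A path ends with its last vertex. -/
theorem IsPath.eq_snoc (h : G.IsPath u v p) : ∃ q, p = q ++ [v] := by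
  rcases h.cases with ⟨-, rfl⟩ | ⟨x, q, rfl, -⟩
  · exact ⟨[], rfl⟩
  · exact ⟨q, rfl⟩

/-- A path begins with its first vertex. -/
theorem IsPath.eq_cons (h : G.IsPath u v p) : ∃ q, p = u :: q := by
  cases p with
  | nil => exact absurd rfl h.ne_nil
  | cons a q => exact ⟨q, by have := h.1; simp at this; rw [this]⟩

theorem IsPath.reflTransGen (h : G.IsPath u v p) : Relation.ReflTransGen G.Adj u v := by
  induction p using List.reverseRecOn generalizing v with
  | nil => exact absurd rfl h.ne_nil
  | append_singleton q y ih =>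
    rcases h.cases with ⟨rfl, -⟩ | ⟨x, q', hq, hx, hxv⟩
    · exact .refl
    · obtain rfl : q = q' := (List.append_inj' hq rfl).1
      exact (ih hx).tail hxv

theorem exists_isPath_iff : (∃ p, G.IsPath u v p) ↔ Relation.ReflTransGen G.Adj u v := by
  refine ⟨fun ⟨p, h⟩ => h.reflTransGen, fun h => ?_⟩
  induction h with
  | refl => exact ⟨[u], by simp⟩
  | tail _ hxv ih =>
    obtain ⟨p, hp⟩ := ih
    exact ⟨_, hp.snoc hxv⟩

theorem IsTopological.le_of_reflTransGen (hσ : G.IsTopological σ)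
    (h : Relation.ReflTransGen G.Adj u v) : σ u ≤ σ v := by
  induction h with
  | refl => exact le_rfl
  | tail _ hxv ih => exact ih.trans (hσ _ _ hxv).le

theorem IsTopological.isPath_self (hσ : G.IsTopological σ) (h : G.IsPath u u p) : p = [u] := by
  rcases h.cases with ⟨-, h⟩ | ⟨x, q, -, hx, hxu⟩
  · exact h
  · exact absurd (hσ.le_of_reflTransGen hx.reflTransGen) (hσ _ _ hxu).not_ge

/-! ### Lengths -/

theorem length_split (w : Fin m → ℝ) (p₁ p₂ : List (Fin n)) :
    G.length w (p₁ ++ a :: p₂) = G.length w (p₁ ++ [a]) + G.length w (a :: p₂) := by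
  induction p₁ with
  | nil => simp [length]
  | cons b p₁ ih =>
    cases p₁ with
    | nil => simp [length]
    | cons c p₁ =>
      simp only [List.cons_append, length] at ih ⊢
      rw [ih]; ring

theorem IsPath.length_snoc (h : G.IsPath u x p) (w : Fin m → ℝ) :
    G.length w (p ++ [v]) = G.length w p + G.wt w x v := by
  obtain ⟨q, rfl⟩ := h.eq_snoc
  rw [List.append_assoc, List.singleton_append, length_split]
  simp [length]

theorem IsShortest.right {p₁ p₂ : List (Fin n)} (h : G.IsShortest w u v (p₁ ++ a :: p₂)) :
    G.IsShortest w a v (a :: p₂) := by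
  obtain ⟨h₁, h₂⟩ := isPath_split.1 h.1
  refine ⟨h₂, fun q hq => ?_⟩
  obtain ⟨q', rfl⟩ := hq.eq_cons
  have := h.2 _ (isPath_append h₁ hq)
  rw [length_split, length_split w p₁ q'] at this
  linarith

/-- A shortest path may be replaced by another one in front of a shortest path. -/
theorem IsShortest.replace_left {p₁ q₁ p₂ : List (Fin n)}
    (h : G.IsShortest w u v (p₁ ++ a :: p₂)) (hq : G.IsShortest w a v (a :: q₁)) :
    G.IsShortest w u v (p₁ ++ a :: q₁) := by
  obtain ⟨h₁, h₂⟩ := isPath_split.1 h.1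
  refine ⟨isPath_append h₁ hq.1, fun q hq' => ?_⟩
  have := h.2 q hq'
  have := hq.2 _ h₂
  rw [length_split] at *
  linarith

theorem IsTopological.isShortest_singleton (hσ : G.IsTopological σ) :
    G.IsShortest w u u [u] :=
  ⟨by simp, fun q hq => by rw [hσ.isPath_self hq]⟩

/-! ### Lexicographically first shortest paths -/

theorem LexFirst.isShortest (hσ : G.IsTopological σ) (h : G.LexFirst w σ u v p) :
    G.IsShortest w u v p := by
  cases h with
  | refl => exact hσ.isShortest_singleton
  | snoc hp hs hx => exact hs

/-- The lexicographically first shortest path to `v` is found from those to the tails of the edges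
entering `v`. -/
theorem lexFirst_of_forall_le (hσ : G.IsTopological σ) (huv : u ≠ v) (hp : G.LexFirst w σ u x p)
    (hxv : G.Adj x v)
    (hex : ∀ y q, G.Adj y v → G.IsPath u y q → ∃ q', G.LexFirst w σ u y q')
    (hmin : ∀ y q, G.Adj y v → G.LexFirst w σ u y q →
      G.length w p + G.wt w x v < G.length w q + G.wt w y v ∨
        G.length w p + G.wt w x v = G.length w q + G.wt w y v ∧ σ x ≤ σ y) :
    G.LexFirst w σ u v (p ++ [v]) := by
  have hpp := (hp.isShortest hσ).1
  have hs : G.IsShortest w u v (p ++ [v]) := by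
    refine ⟨hpp.snoc hxv, fun q hq => ?_⟩
    rcases hq.cases with ⟨h, -⟩ | ⟨y, q', rfl, hy, hyv⟩
    · exact absurd h huv
    · obtain ⟨q'', hq''⟩ := hex y q' hyv hy
      rw [hpp.length_snoc, hy.length_snoc]
      have h1 := (hq''.isShortest hσ).2 _ hy
      rcases hmin y q'' hyv hq'' with h | h <;> linarith
  refine .snoc hp hs fun y q hq => ?_
  have e : q ++ [y, v] = (q ++ [y]) ++ [v] := by simp
  rw [e] at hq
  obtain ⟨-, z, hz, hzv⟩ := (isPath_snoc (by simp)).1 hq.1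
  obtain ⟨q', hq'⟩ := hz.eq_snoc
  obtain rfl : y = z := by simpa using (List.append_inj' hq' rfl).2
  obtain ⟨q'', hq''⟩ := hex y _ hzv hz
  rcases hmin y q'' hzv hq'' with h | h
  · have h1 := hq.2 _ (hpp.snoc hxv)
    rw [hpp.length_snoc, hz.length_snoc] at h1
    have h2 := (hq''.isShortest hσ).2 _ hz
    linarith
  · exact h.2

/-- Strong induction on the number of the end vertex, since the tails of its entering edges have
lower numbers. Among the tails that can be reached, one is chosen that minimises first the length of
the path through it and then its number. -/
theorem IsPath.exists_lexFirst (hσ : G.IsTopological σ) (w : Fin m → ℝ) (h : G.IsPath u v q) :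
    ∃ p, G.LexFirst w σ u v p := by
  induction hk : (σ v : ℕ) using Nat.strong_induction_on generalizing v q with
  | _ k ih =>
    subst hk
    by_cases huv : u = v
    · exact ⟨[u], huv ▸ .refl⟩
    have hex : ∀ y q, G.Adj y v → G.IsPath u y q → ∃ q', G.LexFirst w σ u y q' :=
      fun y q hy hq => ih _ (hσ y v hy) hq rfl
    obtain ⟨x₀, q₀, -, hx₀, hx₀v⟩ := h.cases.resolve_left fun h => huv h.1
    choose! f hf using hex
    classical
    let S : Finset (Fin n) := Finset.univ.filter fun y => G.Adj y v ∧ ∃ q, G.IsPath u y q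
    have hS : ∀ {y}, y ∈ S ↔ G.Adj y v ∧ ∃ q, G.IsPath u y q := by simp [S]
    choose! g hg using fun y => (fun hy => (hS.1 hy).2 : y ∈ S → ∃ q, G.IsPath u y q)
    obtain ⟨x, hxS, hx⟩ := S.exists_min_image
      (fun y => toLex (G.length w (f y (g y)) + G.wt w y v, σ y)) ⟨x₀, hS.2 ⟨hx₀v, _, hx₀⟩⟩
    refine ⟨_, lexFirst_of_forall_le hσ huv (hf x _ (hS.1 hxS).1 (hg x hxS)) (hS.1 hxS).1
      (fun y q hy hq => ⟨_, hf y q hy hq⟩) fun y q hy hq => ?_⟩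
    have hyS : y ∈ S := hS.2 ⟨hy, _, (hq.isShortest hσ).1⟩
    have h1 := hx y hyS
    have h2 : G.length w (f y (g y)) = G.length w q :=
      le_antisymm (((hf y _ hy (hg y hyS)).isShortest hσ).2 _ (hq.isShortest hσ).1)
        ((hq.isShortest hσ).2 _ ((hf y _ hy (hg y hyS)).isShortest hσ).1)
    rw [h2, Prod.Lex.le_iff] at h1
    exact h1

/-- Both next to last vertices have the lowest number among the same candidates, so they coincide,
and induction applies to the part before them. -/
theorem LexFirst.unique (hσ : G.IsTopological σ) (hp : G.LexFirst w σ u v p)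
    (hq : G.LexFirst w σ u v q) : p = q := by
  induction hp generalizing q with
  | refl => exact (hσ.isPath_self (hq.isShortest hσ).1).symm
  | @snoc x v p hp hs hx ih =>
    cases hq with
    | refl => exact hσ.isPath_self hs.1
    | @snoc y _ q hq hs' hy =>
      obtain ⟨p', rfl⟩ := (hp.isShortest hσ).1.eq_snoc
      obtain ⟨q', rfl⟩ := (hq.isShortest hσ).1.eq_snoc
      have h1 := hx y q' (by simpa using hs')
      have h2 := hy x p' (by simpa using hs)
      obtain rfl : x = y := σ.injective (le_antisymm h1 h2)
      rw [ih hq]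

/-- An exchange argument: a shortest path for the suffix can be put behind the prefix, which gives a
shortest path for the whole with the same next to last vertex. So a vertex that beats the next to
last one for the suffix would beat it for the whole path. This property lets one search settle all
vertices of a path. -/
theorem LexFirst.right (h : G.LexFirst w σ u v p)
    {p₁ p₂ : List (Fin n)} (hp : p = p₁ ++ a :: p₂) : G.LexFirst w σ a v (a :: p₂) := by
  induction h generalizing p₂ with
  | refl =>
    obtain ⟨rfl, h⟩ : p₁ = [] ∧ u = a ∧ p₂ = [] := by
      cases p₁ with
      | nil => simpa [eq_comm] using hp
      | cons => simp at hp
    rw [← h.1, h.2]; exact .refl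
  | @snoc x v p hp' hs hx ih =>
    rcases List.eq_nil_or_concat p₂ with rfl | ⟨p₃, y, rfl⟩
    · obtain rfl : v = a := by simpa using (List.append_inj' hp rfl).2
      exact .refl
    · rw [List.concat_eq_append, ← List.cons_append, ← List.append_assoc] at hp
      obtain ⟨rfl, h2⟩ := List.append_inj' hp rfl
      obtain rfl : v = y := by simpa using h2
      have hs' : G.IsShortest w u v (p₁ ++ a :: (p₃ ++ [v])) := by simpa using hs
      rw [List.concat_eq_append]
      refine .snoc (ih rfl) hs'.right fun y q hq => ?_
      obtain ⟨q', hq'⟩ := hq.1.eq_cons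
      rw [hq'] at hq
      refine hx y (p₁ ++ q) ?_
      rw [List.append_assoc, hq']
      exact hs'.replace_left hq

/-- If a had a child b in the tree, the suffix property would give a lexicographically first path
that begins with b and a, and b has a lower number than a. In the algorithm the hypothesis says that
no vertex treated earlier has led to a. -/
theorem mem_leaf_of_forall_not_lexFirst (hσ : G.IsTopological σ) (h : G.IsPath a v p)
    (hb : ∀ b q, σ b < σ a → ¬ G.LexFirst w σ b v (b :: a :: q)) : a ∈ G.leaf w σ v := by
  obtain ⟨p', hp'⟩ := h.exists_lexFirst hσ w
  refine ⟨⟨a, p', hp', ?_⟩, fun b ⟨u, q, hq, p₁, p₂, he⟩ => ?_⟩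
  · obtain ⟨r, rfl⟩ := (hp'.isShortest hσ).1.eq_cons
    simp
  · have := hq.right (p₁ := p₁) (p₂ := a :: p₂) (a := b) (by rw [← he]; simp)
    refine hb b p₂ (hσ b a ?_) this
    have := ((this.isShortest hσ).1).2.2
    exact (List.isChain_cons_cons.1 this).1

end Dag

end APSP

namespace APSP

namespace Dag

variable {n m N M : ℕ}

/-! ### Embeddings -/

/-- `f` identifies the weighted graph `G` and its numbering with a part of `H` that no edge enters. -/
structure Embeds (G : Dag n m) (w : Fin m → ℝ) (σ : Equiv.Perm (Fin n)) (H : Dag N M)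
    (w' : Fin M → ℝ) (ρ : Equiv.Perm (Fin N)) (f : Fin n → Fin N) : Prop where
  inj : Function.Injective f
  adj : ∀ a b, H.Adj (f a) (f b) ↔ G.Adj a b
  closed : ∀ x b, H.Adj x (f b) → ∃ a, f a = x
  wt : ∀ a b, H.wt w' (f a) (f b) = G.wt w a b
  le : ∀ a b, ρ (f a) ≤ ρ (f b) ↔ σ a ≤ σ b

namespace Embeds

variable {G : Dag n m} {w : Fin m → ℝ} {σ : Equiv.Perm (Fin n)} {H : Dag N M} {w' : Fin M → ℝ}
  {ρ : Equiv.Perm (Fin N)} {f : Fin n → Fin N} {u v : Fin n} {p : List (Fin n)}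

theorem isPath_map (h : Embeds G w σ H w' ρ f) :
    H.IsPath (f u) (f v) (p.map f) ↔ G.IsPath u v p := by
  simp only [IsPath, List.head?_map, List.getLast?_map, List.isChain_map, h.adj]
  have : ∀ (o : Option (Fin n)) (a : Fin n), o.map f = some (f a) ↔ o = some a := by
    intro o a
    cases o <;> simp [h.inj.eq_iff]
  rw [this, this]

/-- Traced backwards from its end, a path cannot leave the copy, because no edge enters the copy
from outside. So the paths that end in the copy are exactly the images of paths, and lengths and
shortest paths carry over. -/
theorem exists_map (h : Embeds G w σ H w' ρ f) {x : Fin N} {p : List (Fin N)}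
    (hp : H.IsPath x (f v) p) : ∃ u q, f u = x ∧ p = q.map f ∧ G.IsPath u v q := by
  induction p using List.reverseRecOn generalizing v with
  | nil => exact absurd rfl hp.ne_nil
  | append_singleton r z ih =>
    rcases hp.cases with ⟨hx, hr⟩ | ⟨y, q', hq, hy, hyv⟩
    · exact ⟨v, [v], hx.symm, by simpa using hr, by simp⟩
    · obtain ⟨rfl, hz⟩ := List.append_inj' hq rfl
      obtain ⟨y, rfl⟩ := h.closed _ _ hyv
      obtain ⟨u, q, hu, rfl, huq⟩ := ih hy
      exact ⟨u, q ++ [v], hu, by simpa using hz, huq.snoc ((h.adj _ _).1 hyv)⟩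

theorem length_map (h : Embeds G w σ H w' ρ f) (p : List (Fin n)) :
    H.length w' (p.map f) = G.length w p := by
  induction p with
  | nil => rfl
  | cons a p ih =>
    cases p with
    | nil => rfl
    | cons b p =>
      simp only [List.map_cons, length, h.wt] at ih ⊢
      rw [ih]

theorem isShortest_map (h : Embeds G w σ H w' ρ f) :
    H.IsShortest w' (f u) (f v) (p.map f) ↔ G.IsShortest w u v p := by
  simp only [IsShortest, h.isPath_map, h.length_map]
  refine and_congr_right fun _ => ⟨fun hp q hq => ?_, fun hp q hq => ?_⟩
  · rw [← h.length_map q]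
    exact hp _ (h.isPath_map.2 hq)
  · obtain ⟨u', q', hu, rfl, hq'⟩ := h.exists_map hq
    obtain rfl := h.inj hu
    rw [h.length_map]
    exact hp _ hq'

theorem lexFirst_map (h : Embeds G w σ H w' ρ f) (hp : G.LexFirst w σ u v p) :
    H.LexFirst w' ρ (f u) (f v) (p.map f) := by
  induction hp with
  | refl => exact .refl
  | @snoc x v p hp hs hx ih =>
    rw [List.map_append]
    refine .snoc ih (by simpa using h.isShortest_map.2 hs) fun y q hq => ?_
    obtain ⟨u', r, hu, hr, -⟩ := h.exists_map hq.1
    obtain rfl := h.inj hu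
    have hr' := hr
    rw [eq_comm, List.map_eq_append_iff] at hr
    obtain ⟨r₁, r₂, rfl, rfl, h2⟩ := hr
    simp only [List.map_eq_cons_iff, List.map_eq_nil_iff] at h2
    obtain ⟨y', _, rfl, rfl, v', _, rfl, hv', rfl⟩ := h2
    obtain rfl := h.inj hv'
    rw [hr'] at hq
    exact (h.le _ _).2 (hx y' r₁ (h.isShortest_map.1 hq))

theorem exists_lexFirst (h : Embeds G w σ H w' ρ f) (hσ : G.IsTopological σ)
    (hρ : H.IsTopological ρ) {x : Fin N} {p : List (Fin N)} (hp : H.LexFirst w' ρ x (f v) p) :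
    ∃ u q, f u = x ∧ p = q.map f ∧ G.LexFirst w σ u v q := by
  obtain ⟨u, q, rfl, rfl, hq⟩ := h.exists_map (hp.isShortest hρ).1
  obtain ⟨r, hr⟩ := hq.exists_lexFirst hσ w
  exact ⟨u, r, rfl, hp.unique hρ (h.lexFirst_map hr), hr⟩

/-- A child in the small tree is mapped to a child in the large one, so every leaf of the large tree
comes from a leaf. Leaf counts are needed from above only, hence one inclusion is enough. -/
theorem ncard_leaf_le (h : Embeds G w σ H w' ρ f) (hσ : G.IsTopological σ)
    (hρ : H.IsTopological ρ) (v : Fin n) :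
    (H.leaf w' ρ (f v)).ncard ≤ (G.leaf w σ v).ncard := by
  have : H.leaf w' ρ (f v) ⊆ f '' G.leaf w σ v := by
    rintro a' ⟨⟨x, p, hp, ha⟩, hb⟩
    obtain ⟨u, q, rfl, rfl, hq⟩ := h.exists_lexFirst hσ hρ hp
    obtain ⟨a, haq, rfl⟩ := List.mem_map.1 ha
    refine ⟨a, ⟨⟨u, q, hq, haq⟩, fun b ⟨u', q', hq', p₁, p₂, he⟩ => hb (f b) ?_⟩, rfl⟩
    exact ⟨f u', _, h.lexFirst_map hq', p₁.map f, p₂.map f, by rw [← he]; simp⟩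
  exact (Set.ncard_le_ncard this (Set.toFinite _)).trans (Set.ncard_image_le (Set.toFinite _))

end Embeds

/-! ### Reversal -/

variable {G : Dag n m} {w : Fin m → ℝ} {u v : Fin n} {p : List (Fin n)}

@[simp] theorem reverse_adj : G.reverse.Adj u v ↔ G.Adj v u := by
  simp only [Adj, reverse, Prod.swap_eq_iff_eq_swap, Prod.swap_prod_mk]

theorem reverse_wt (a b : Fin n) : G.reverse.wt w a b = G.wt w b a := by
  simp only [wt, reverse, Prod.swap_eq_iff_eq_swap, Prod.swap_prod_mk]

theorem isPath_reverse : G.IsPath u v p.reverse ↔ G.reverse.IsPath v u p := by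
  simp only [IsPath, List.head?_reverse, List.getLast?_reverse, List.isChain_reverse]
  have : (fun a b => G.Adj b a) = G.reverse.Adj := by
    funext a b; simp
  rw [this]; tauto

theorem length_reverse (p : List (Fin n)) : G.length w p.reverse = G.reverse.length w p := by
  induction p with
  | nil => rfl
  | cons a p ih =>
    cases p with
    | nil => rfl
    | cons b p =>
      simp only [List.reverse_cons, List.append_assoc, length, reverse_wt] at ih ⊢
      rw [← ih]
      simp only [List.cons_append, List.nil_append]
      rw [length_split]
      simp [length]; ring

theorem isShortest_reverse : G.IsShortest w u v p.reverse ↔ G.reverse.IsShortest w v u p := by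
  simp only [IsShortest, isPath_reverse, length_reverse]
  refine and_congr_right fun _ => ⟨fun h q hq => ?_, fun h q hq => ?_⟩
  · rw [← length_reverse q]
    exact h _ (isPath_reverse.2 hq)
  · rw [← q.reverse_reverse] at hq ⊢
    rw [length_reverse]
    exact h _ (isPath_reverse.1 hq)

/-! ### The graph together with its reversal -/

section Union

variable (G : Dag n m) (σ τ : Equiv.Perm (Fin n))

/-- The edges of `G` and of the reversed graph, renumbered by `σ` and `τ`. -/
def unionEdge : Fin (m + m) → Fin (n + n) × Fin (n + n) :=
  Fin.addCases (fun e => (Fin.castAdd n (σ (G.edge e).1), Fin.castAdd n (σ (G.edge e).2)))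
    (fun e => (Fin.natAdd n (τ (G.edge e).2), Fin.natAdd n (τ (G.edge e).1)))

@[simp] theorem unionEdge_castAdd (e : Fin m) : G.unionEdge σ τ (Fin.castAdd m e) =
    (Fin.castAdd n (σ (G.edge e).1), Fin.castAdd n (σ (G.edge e).2)) := by
  simp only [unionEdge, Fin.addCases_left]

@[simp] theorem unionEdge_natAdd (e : Fin m) : G.unionEdge σ τ (Fin.natAdd m e) =
    (Fin.natAdd n (τ (G.edge e).2), Fin.natAdd n (τ (G.edge e).1)) := by
  simp only [unionEdge, Fin.addCases_right]

theorem castAdd_ne_natAdd (i j : Fin n) : Fin.castAdd n i ≠ Fin.natAdd n j := fun h => by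
  have := congrArg Fin.val h
  simp at this; omega

/-- The vertices of the union are renamed by their numbers, so the identity is a topological
numbering of the union and comparing numbers means comparing vertices. -/
theorem unionEdge_lt (hσ : G.IsTopological σ) (hτ : G.reverse.IsTopological τ)
    (e : Fin (m + m)) : (G.unionEdge σ τ e).1 < (G.unionEdge σ τ e).2 := by
  induction e using Fin.addCases with
  | left e =>
    rw [unionEdge_castAdd]
    exact hσ _ _ ⟨e, rfl⟩
  | right e =>
    rw [unionEdge_natAdd]
    exact (Fin.natAdd_lt_natAdd_iff n).2 (hτ _ _ (reverse_adj.2 ⟨e, rfl⟩))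

theorem unionEdge_injective : Function.Injective (G.unionEdge σ τ) := by
  intro e e' h
  induction e using Fin.addCases with
  | left e =>
    induction e' using Fin.addCases with
    | left e' =>
      simp only [unionEdge_castAdd, Prod.mk.injEq, Fin.castAdd_inj, σ.injective.eq_iff] at h
      rw [G.edge_injective (Prod.ext h.1 h.2)]
    | right e' => simp [castAdd_ne_natAdd, -Fin.natAdd_eq_addNat] at h
  | right e =>
    induction e' using Fin.addCases with
    | left e' => simp [(castAdd_ne_natAdd _ _).symm, -Fin.natAdd_eq_addNat] at h
    | right e' =>
      simp only [unionEdge_natAdd, Prod.mk.injEq, Fin.natAdd_inj, τ.injective.eq_iff] at h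
      rw [G.edge_injective (Prod.ext h.2 h.1)]

/-- The disjoint union of `G` and its reversal, renumbered in topological order. -/
def union (hσ : G.IsTopological σ) (hτ : G.reverse.IsTopological τ) : Dag (n + n) (m + m) where
  edge := G.unionEdge σ τ
  edge_injective := G.unionEdge_injective σ τ
  acyclic v hv := by
    have : ∀ a b, Relation.TransGen (fun a b => ∃ e, G.unionEdge σ τ e = (a, b)) a b → a < b := by
      intro a b h
      have step : ∀ {a b}, (∃ e, G.unionEdge σ τ e = (a, b)) → a < b := by
        rintro a b ⟨e, he⟩
        have := G.unionEdge_lt σ τ hσ hτ e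
        rwa [he] at this
      induction h with
      | single h => exact step h
      | tail _ h ih => exact ih.trans (step h)
    exact lt_irrefl v (this v v hv)

variable {G σ τ} (hσ : G.IsTopological σ) (hτ : G.reverse.IsTopological τ)

theorem union_lt {a b : Fin (n + n)} (h : (G.union σ τ hσ hτ).Adj a b) : a < b := by
  obtain ⟨e, he⟩ := h
  have := G.unionEdge_lt σ τ hσ hτ e
  rwa [show G.unionEdge σ τ e = (a, b) from he] at this

/-- The identity numbering of the union restricts to σ on this half. Lexicographically first paths,
and with them the trees and their leaves, are therefore those of the given numbering; the other half
does the same for τ and the reversed graph. -/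
theorem embeds_union_left (w : Fin m → ℝ) :
    Embeds G w σ (G.union σ τ hσ hτ) (Fin.append w w) (Equiv.refl _)
      (fun u => Fin.castAdd n (σ u)) where
  inj a b h := σ.injective (Fin.castAdd_inj.1 h)
  adj a b := by
    constructor
    · rintro ⟨e, he⟩
      induction e using Fin.addCases with
      | left e =>
        simp only [union, unionEdge_castAdd, Prod.mk.injEq, Fin.castAdd_inj, σ.injective.eq_iff] at he
        exact ⟨e, Prod.ext he.1 he.2⟩
      | right e => simp [union, (castAdd_ne_natAdd _ _).symm, -Fin.natAdd_eq_addNat] at he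
    · rintro ⟨e, he⟩
      exact ⟨Fin.castAdd m e, by simp [union, he]⟩
  closed x b := by
    rintro ⟨e, he⟩
    induction e using Fin.addCases with
    | left e =>
      simp only [union, unionEdge_castAdd, Prod.mk.injEq] at he
      exact ⟨_, he.1⟩
    | right e => simp [union, (castAdd_ne_natAdd _ _).symm, -Fin.natAdd_eq_addNat] at he
  wt a b := by
    simp only [wt, union, Fin.sum_univ_add, unionEdge_castAdd, unionEdge_natAdd,
      Fin.castAdd_inj, σ.injective.eq_iff, (castAdd_ne_natAdd _ _).symm, false_and, if_false,
      Finset.sum_const_zero, add_zero, Fin.append_left, Prod.ext_iff]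
  le a b := Iff.rfl

theorem embeds_union_right (w : Fin m → ℝ) :
    Embeds G.reverse w τ (G.union σ τ hσ hτ) (Fin.append w w) (Equiv.refl _)
      (fun u => Fin.natAdd n (τ u)) where
  inj a b h := τ.injective ((Fin.natAdd_inj n).1 h)
  adj a b := by
    rw [reverse_adj]
    constructor
    · rintro ⟨e, he⟩
      induction e using Fin.addCases with
      | left e => simp [union, castAdd_ne_natAdd, -Fin.natAdd_eq_addNat] at he
      | right e =>
        simp only [union, unionEdge_natAdd, Prod.mk.injEq, Fin.natAdd_inj, τ.injective.eq_iff] at he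
        exact ⟨e, Prod.ext he.2 he.1⟩
    · rintro ⟨e, he⟩
      exact ⟨Fin.natAdd m e, by simp [union, he, -Fin.natAdd_eq_addNat]⟩
  closed x b := by
    rintro ⟨e, he⟩
    induction e using Fin.addCases with
    | left e => simp [union, castAdd_ne_natAdd, -Fin.natAdd_eq_addNat] at he
    | right e =>
      simp only [union, unionEdge_natAdd, Prod.mk.injEq] at he
      exact ⟨_, he.1⟩
  wt a b := by
    rw [reverse_wt]
    simp only [wt, union, Fin.sum_univ_add, unionEdge_castAdd, unionEdge_natAdd,
      Fin.natAdd_inj, τ.injective.eq_iff, castAdd_ne_natAdd, false_and, if_false,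
      Finset.sum_const_zero, zero_add, Fin.append_right, Prod.ext_iff, and_comm]
  le a b := Fin.natAdd_le_natAdd_iff n

theorem union_indeg_left (v : Fin n) :
    (G.union σ τ hσ hτ).indeg (Fin.castAdd n (σ v)) = G.indeg v := by
  rw [indeg, indeg, Finset.card_filter, Finset.card_filter, Fin.sum_univ_add]
  simp only [union, unionEdge_castAdd, unionEdge_natAdd, Fin.castAdd_inj, σ.injective.eq_iff,
    (castAdd_ne_natAdd _ _).symm, if_false, Finset.sum_const_zero, add_zero]

theorem union_indeg_right (v : Fin n) :
    (G.union σ τ hσ hτ).indeg (Fin.natAdd n (τ v)) = G.outdeg v := by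
  rw [indeg, outdeg, Finset.card_filter, Finset.card_filter, Fin.sum_univ_add]
  simp only [union, unionEdge_castAdd, unionEdge_natAdd, Fin.natAdd_inj, τ.injective.eq_iff,
    castAdd_ne_natAdd, if_false, Finset.sum_const_zero, zero_add]

end Union

end Dag

end APSP

namespace APSP

/-! ### Notation for expressions -/

instance : Add Expr := ⟨.bin .add⟩
instance : Sub Expr := ⟨.bin .sub⟩
instance : Mul Expr := ⟨.bin .mul⟩
instance (k : ℕ) : OfNat Expr k := ⟨.lit k⟩

namespace Expr

@[simp] theorem eval_add (e f : Expr) (s : State) : (e + f).eval s = e.eval s + f.eval s := rfl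
@[simp] theorem eval_sub (e f : Expr) (s : State) : (e - f).eval s = e.eval s - f.eval s := rfl
@[simp] theorem eval_mul (e f : Expr) (s : State) : (e * f).eval s = e.eval s * f.eval s := rfl
@[simp] theorem eval_ofNat (k : ℕ) (s : State) : (OfNat.ofNat k : Expr).eval s = k := rfl

end Expr

open Prog _root_.APSP.Expr

/-- Tables are stored row by row in one array; this says that different entries occupy different
cells. -/
theorem mul_add_inj {S i j i' j' : ℕ} (hj : j < S) (hj' : j' < S) :
    i * S + j = i' * S + j' ↔ i = i' ∧ j = j' := by
  constructor
  · intro h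
    have hS : 0 < S := by omega
    have h1 : (i * S + j) / S = (i' * S + j') / S := by rw [h]
    have h2 : (i * S + j) % S = (i' * S + j') % S := by rw [h]
    rw [mul_comm i, mul_comm i', Nat.mul_add_div hS, Nat.mul_add_div hS, Nat.div_eq_of_lt hj,
      Nat.div_eq_of_lt hj'] at h1
    rw [mul_comm i, mul_comm i', Nat.mul_add_mod, Nat.mul_add_mod, Nat.mod_eq_of_lt hj,
      Nat.mod_eq_of_lt hj'] at h2
    exact ⟨by simpa using h1, h2⟩
  · rintro ⟨rfl, rfl⟩; rfl

/-! ### Arrays for the doubled graph: edge list, inverse numberings, lists of entering edges -/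

namespace Dag

variable {n m N M : ℕ}

/-- The state `s` contains the numbered graph, and all memory that the algorithm uses is clear. -/
structure Start (G : Dag n m) (w : Fin m → ℝ) (σ τ : Equiv.Perm (Fin n)) (s : State) : Prop where
  reg_n : s.reg 0 = n
  reg_m : s.reg 1 = m
  tail : ∀ e : Fin m, s.mem 0 e = (G.edge e).1
  head : ∀ e : Fin m, s.mem 1 e = (G.edge e).2
  wt : ∀ e : Fin m, s.rmem 0 e = w e
  fst : ∀ u : Fin n, s.mem 2 u = σ u
  snd : ∀ u : Fin n, s.mem 3 u = τ u
  mem_zero : ∀ a i, 10 ≤ a → a < 20 ∨ 60 ≤ a → s.mem a i = 0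
  mem_four : ∀ i, s.mem 4 i = 0
  rmem_zero : ∀ a i, 1 ≤ a → s.rmem a i = 0

/-- The state `s` contains the list of edges of the weighted graph `H`. -/
structure Loaded (H : Dag N M) (w : Fin M → ℝ) (s : State) : Prop where
  reg_N : s.reg 2 = N
  reg_M : s.reg 3 = M
  tail : ∀ e : Fin M, s.mem 10 e = (H.edge e).1
  head : ∀ e : Fin M, s.mem 11 e = (H.edge e).2
  wt : ∀ e : Fin M, s.rmem 2 e = w e

theorem Loaded.of_eq {H : Dag N M} {w : Fin M → ℝ} {s s' : State} (h : H.Loaded w s)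
    (h2 : s'.reg 2 = s.reg 2) (h3 : s'.reg 3 = s.reg 3) (h10 : s'.mem 10 = s.mem 10)
    (h11 : s'.mem 11 = s.mem 11) (hw : s'.rmem 2 = s.rmem 2) : H.Loaded w s' :=
  ⟨h2.trans h.reg_N, h3.trans h.reg_M, fun e => by rw [h10, h.tail], fun e => by rw [h11, h.head],
    fun e => by rw [hw, h.wt]⟩

end Dag

/-- Build the edge list of the union of the graph and its reversal. -/
def buildEdges : Prog :=
  set 2 (var 0 + var 0) ;; set 3 (var 1 + var 1) ;;
  for_ 10 1 (
    put 10 (var 10) (ld 2 (ld 0 (var 10))) ;;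
    put 11 (var 10) (ld 2 (ld 1 (var 10))) ;;
    put 10 (var 1 + var 10) (var 0 + ld 3 (ld 1 (var 10))) ;;
    put 11 (var 1 + var 10) (var 0 + ld 3 (ld 0 (var 10))) ;;
    rget 0 0 (var 10) ;;
    rput 2 (var 10) 0 ;;
    rput 2 (var 1 + var 10) 0)

/-- Invert the two numberings. -/
def buildInverse : Prog :=
  for_ 10 0 (put 18 (ld 2 (var 10)) (var 10) ;; put 18 (var 0 + ld 3 (var 10)) (var 10))

/-- Build the linked lists of the edges entering each vertex. -/
def buildLists : Prog :=
  for_ 10 3 (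
    put 13 (var 10) (ld 12 (ld 11 (var 10))) ;;
    put 12 (ld 11 (var 10)) (var 10 + 1))

/-- One more than the last edge before `k` that enters `v`, or `0`. -/
def lastEdge (hd : ℕ → ℕ) (v : ℕ) : ℕ → ℕ
  | 0 => 0
  | k + 1 => if hd k = v then k + 1 else lastEdge hd v k

/-- The linked lists of entering edges. -/
structure Lists (N M : ℕ) (s : State) : Prop where
  first : ∀ v < N, s.mem 12 v = lastEdge (s.mem 11) v M
  next : ∀ e < M, s.mem 13 e = lastEdge (s.mem 11) (s.mem 11 e) e

section

variable {n m B : ℕ} {G : Dag n m} {w : Fin m → ℝ} {σ τ : Equiv.Perm (Fin n)} {s : State}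

theorem wp_buildEdges (hσ : G.IsTopological σ) (hτ : G.reverse.IsTopological τ)
    (hs : G.Start w σ τ s) (hN : n + n < B) (hM : m + m < B) :
    wp B buildEdges (fun s' t => (G.union σ τ hσ hτ).Loaded (Fin.append w w) s' ∧
      t ≤ 20 * m + 10) s := by
  simp only [buildEdges, wp_seq, wp_set, Expr.eval, State.setReg_reg]
  refine ⟨by simpa [hs.reg_n] using hN, by simpa [hs.reg_m] using hM, ?_⟩
  refine wp_for_const (c := 7) (fun i s' => ∀ e : Fin m, (e : ℕ) < i →
      s'.mem 10 e = σ (G.edge e).1 ∧ s'.mem 11 e = σ (G.edge e).2 ∧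
      s'.mem 10 (m + e) = n + τ (G.edge e).2 ∧ s'.mem 11 (m + e) = n + τ (G.edge e).1 ∧
      s'.rmem 2 e = w e ∧ s'.rmem 2 (m + e) = w e) (by simp [hs.reg_m]; omega) (by decide) rfl rfl
    (by simp) ?_ ?_
  · intro i hi s' hI h10 hF
    replace hi : i < m := by simpa [hs.reg_m] using hi
    have h0 : s'.reg 0 = n := by rw [hF.reg 0 rfl]; simp [hs.reg_n]
    have h1 : s'.reg 1 = m := by rw [hF.reg 1 rfl]; simp [hs.reg_m]
    have m0 := hF.mem 0 rfl
    have m1 := hF.mem 1 rfl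
    have m2 := hF.mem 2 rfl
    have m3 := hF.mem 3 rfl
    have r0 := hF.rmem 0 rfl
    simp only [State.setReg_mem, State.setReg_rmem] at m0 m1 m2 m3 r0
    have ht := hs.tail ⟨i, hi⟩
    have hh := hs.head ⟨i, hi⟩
    have hw := hs.wt ⟨i, hi⟩
    simp only at ht hh hw
    simp [h10, h0, h1, m0, m1, m2, m3, r0, ht, hh, hw, hs.fst, hs.snd]
    refine ⟨by omega, by omega, by omega, by omega, fun e he => ?_⟩
    have := e.2
    rcases he.lt_or_eq with h | h
    · obtain ⟨i1, i2, i3, i4, i5, i6⟩ := hI e h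
      simp [i1, i2, i3, i4, i5, i6, show ¬ (e : ℕ) = m + i by omega, show ¬ m + (e : ℕ) = i by omega,
        show ¬ (e : ℕ) = i by omega]
    · obtain rfl : e = ⟨i, hi⟩ := Fin.ext h
      simp [show m ≠ 0 by omega]
  · intro s' t hI hF ht
    simp [hs.reg_m] at hI ht
    refine ⟨⟨?_, ?_, fun e => ?_, fun e => ?_, fun e => ?_⟩, by omega⟩
    · rw [hF.reg 2 rfl]; simp [hs.reg_n]
    · rw [hF.reg 3 rfl]; simp [hs.reg_m]
    all_goals induction e using Fin.addCases with
    | left e =>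
      obtain ⟨i1, i2, i3, i4, i5, i6⟩ := hI e
      simp [Dag.union, i1, i2, i5]
    | right e =>
      obtain ⟨i1, i2, i3, i4, i5, i6⟩ := hI e
      simp [Dag.union, i3, i4, i6, -Fin.natAdd_eq_addNat]

/-- One array holds both inverses. The second is shifted by n, just as the vertices of the reversed
half are, so a vertex of the union is translated back by a single access. -/
theorem wp_buildInverse (hσ : ∀ u : Fin n, s.mem 2 u = σ u) (hτ : ∀ u : Fin n, s.mem 3 u = τ u)
    (hn : s.reg 0 = n) (hN : n < B) :
    wp B buildInverse (fun s' t => (∀ u : Fin n, s'.mem 18 (σ u) = u ∧ s'.mem 18 (n + τ u) = u) ∧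
      t ≤ 4 * n + 10) s := by
  refine wp_for_const (c := 2) (fun i s' => ∀ u : Fin n, (u : ℕ) < i →
    s'.mem 18 (σ u) = u ∧ s'.mem 18 (n + τ u) = u) (by omega) (by decide) rfl rfl (by simp) ?_ ?_
  · intro i hi s' hI h10 hF
    rw [hn] at hi
    have h0 : s'.reg 0 = n := by rw [hF.reg 0 rfl, hn]
    have m2 := hF.mem 2 rfl
    have m3 := hF.mem 3 rfl
    have hσi := hσ ⟨i, hi⟩
    have hτi := hτ ⟨i, hi⟩
    simp only at hσi hτi
    simp [h10, h0, m2, m3, hσi, hτi]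
    refine ⟨by omega, fun u hu => ?_⟩
    have l1 := (σ u).2
    have l2 := (σ ⟨i, hi⟩).2
    rcases hu.lt_or_eq with h | h
    · have hne : u ≠ ⟨i, hi⟩ := fun h' => by simp [h'] at h
      have n1 : (σ u : ℕ) ≠ σ ⟨i, hi⟩ := fun h' => hne (σ.injective (Fin.ext h'))
      have n2 : (τ u : ℕ) ≠ τ ⟨i, hi⟩ := fun h' => hne (τ.injective (Fin.ext h'))
      obtain ⟨i1, i2⟩ := hI u h
      simp [i1, i2, n1, n2, show (σ u : ℕ) ≠ n + τ ⟨i, hi⟩ by omega,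
        show n + (τ u : ℕ) ≠ σ ⟨i, hi⟩ by omega]
    · obtain rfl : u = ⟨i, hi⟩ := Fin.ext h
      simp
  · intro s' t hI hF ht
    rw [hn] at hI ht
    exact ⟨fun u => hI u u.2, by omega⟩

theorem wp_buildLists {N M : ℕ} (h12 : ∀ i, s.mem 12 i = 0) (hM : s.reg 3 = M) (hMB : M < B)
    (hs : s.Bounded B) :
    wp B buildLists (fun s' t => Lists N M s' ∧ t ≤ 4 * M + 10) s := by
  refine wp_for_const (c := 2) (fun i s' => s'.Bounded B ∧
    (∀ v, s'.mem 12 v = lastEdge (s.mem 11) v i) ∧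
    ∀ e < i, s'.mem 13 e = lastEdge (s.mem 11) (s.mem 11 e) e) (by omega) (by decide) rfl rfl ?_ ?_ ?_
  · refine ⟨⟨fun x => ?_, hs.2⟩, by simpa [lastEdge] using h12, by simp⟩
    have := hs.1 x
    rw [State.setReg_reg]; split <;> omega
  · intro i hi s' ⟨hb, hI₁, hI₂⟩ h10 hF
    rw [hM] at hi
    have m11 := hF.mem 11 rfl
    simp only [wp_seq, wp_put, Expr.eval, h10, m11]
    refine ⟨by rw [← m11]; exact hb.2 _ _, by simp [h10]; omega, ⟨⟨fun x => ?_, fun a j => ?_⟩,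
      fun v => ?_, fun e he => ?_⟩, by omega⟩
    · have := hb.1 x
      simp; split <;> omega
    · have h1 := hb.2 a j
      have h2 := hb.2 12 (s.mem 11 i)
      simp [h10]; split_ifs <;> omega
    · simp [h10, hI₁, lastEdge, m11, eq_comm]
    · rcases Nat.lt_succ_iff_lt_or_eq.1 he with h | rfl
      · simp [h10, hI₂ e h, h.ne]
      · simp [hI₁]
  · intro s' t ⟨_, hI₁, hI₂⟩ hF ht
    rw [hM] at hI₁ hI₂ ht
    rw [show 4 * M = (2 + 2) * M by rfl]
    exact ⟨⟨fun v _ => by rw [hI₁, hF.mem 11 rfl], fun e he => by rw [hI₂ e he, hF.mem 11 rfl]⟩,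
      by omega⟩

end

end APSP

namespace APSP

open Prog _root_.APSP.Expr

/-! ### Traversal of the lists of entering edges -/

/-- Do `p` for every edge that enters the vertex `v`; variable `11` is one more than the number of the
edge. -/
def forIn (v : Expr) (p : Prog) : Prog :=
  set 11 (ld 12 v) ;; loop 0 (var 11) (p ;; set 11 (ld 13 (var 11 - 1)))

theorem lastEdge_le (hd : ℕ → ℕ) (v k : ℕ) : lastEdge hd v k ≤ k := by
  induction k with
  | zero => simp [lastEdge]
  | succ k ih => rw [lastEdge]; split <;> omega

/-- A link jumps to the previous edge with the same head: no edge passed over enters the vertex, and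
the edge reached does. -/
theorem lastEdge_spec (hd : ℕ → ℕ) (v k : ℕ) :
    (∀ e, lastEdge hd v k ≤ e → e < k → hd e ≠ v) ∧
      (0 < lastEdge hd v k → hd (lastEdge hd v k - 1) = v) := by
  induction k with
  | zero => simp [lastEdge]
  | succ k ih =>
    rw [lastEdge]
    split_ifs with h
    · exact ⟨fun e h1 h2 => by omega, fun _ => by simpa using h⟩
    · refine ⟨fun e h1 h2 => ?_, ih.2⟩
      rcases (Nat.lt_succ_iff.1 h2).lt_or_eq with h3 | rfl
      · exact ih.1 e h1 h3
      · exact h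

/-- The number of edges `e ≥ k` that enter `v`. -/
def inCount (hd : ℕ → ℕ) (M v k : ℕ) : ℕ := ((Finset.Ico k M).filter (hd · = v)).card

theorem inCount_of_eq {hd : ℕ → ℕ} {M v k : ℕ} (hk : k < M) (h : hd k = v) :
    inCount hd M v k = inCount hd M v (k + 1) + 1 := by
  rw [inCount, inCount, ← Finset.insert_Ico_add_one_left_eq_Ico hk, Finset.filter_insert, if_pos h,
    Finset.card_insert_of_notMem (by simp)]

theorem inCount_of_ne {hd : ℕ → ℕ} {M v k : ℕ} (hk : k < M) (h : hd k ≠ v) :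
    inCount hd M v k = inCount hd M v (k + 1) := by
  rw [inCount, inCount, ← Finset.insert_Ico_add_one_left_eq_Ico hk, Finset.filter_insert, if_neg h]

/-- The rule for the traversal of the edges that enter `v`, in decreasing order: `I k` says that the
edges `e ≥ k` have been dealt with. -/
theorem wp_forIn {B N M v : ℕ} {ev : Expr} {p : Prog} {s : State} {Q : State → ℕ → Prop} (c : ℕ)
    (I : ℕ → State → Prop) (hs : Lists N M s) (hv : v < N) (hev : ev.eval s = v) (hM : M < B)
    (h11 : p.wr 11 = false) (hm : p.wm 13 = false)
    (h0 : ∀ k, I M (s.setReg 11 k))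
    (hskip : ∀ e < M, s.mem 11 e ≠ v → ∀ s', I (e + 1) s' → I e s')
    (hstep : ∀ e < M, s.mem 11 e = v → ∀ s', I (e + 1) s' → s'.reg 11 = e + 1 →
      Frame (forIn ev p) s s' →
      wp B p (fun s'' t => (∀ k, I e (s''.setReg 11 k)) ∧ t ≤ c) s')
    (hend : ∀ s' t, I 0 s' → Frame (forIn ev p) s s' →
      t ≤ (c + 2) * inCount (s.mem 11) M v 0 + 2 → Q s' t) :
    wp B (forIn ev p) Q s := by
  set hd := s.mem 11 with hhd
  -- The links jump over edges that do not enter v. The invariant passes over them by `hskip`, and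
  -- the number of entering edges still counted does not change, so they cost nothing.
  have skips : ∀ {j k : ℕ} {s' : State}, j ≤ k → k ≤ M → (∀ e, j ≤ e → e < k → hd e ≠ v) →
      I k s' → I j s' ∧ inCount hd M v j = inCount hd M v k := by
    intro j k s' hjk hkM h hI
    induction k, hjk using Nat.le_induction with
    | base => exact ⟨hI, rfl⟩
    | succ k hjk ih =>
      have hne := h k hjk (Nat.lt_succ_self k)
      have := ih (by omega) (fun e h1 h2 => h e h1 (by omega)) (hskip k (by omega) hne s' hI)
      exact ⟨this.1, this.2.trans (inCount_of_ne (by omega) hne)⟩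
  have hF0 : ∀ k, Frame (forIn ev p) s (s.setReg 11 k) := by
    intro k
    refine ⟨fun z hz => ?_, fun _ _ => rfl, fun _ _ => rfl, fun _ _ => rfl⟩
    have : ¬ z = 11 := by
      rintro rfl
      simp [forIn, wr] at hz
    simp [this]
  have l0 : s.mem 12 v = lastEdge hd v M := hs.first v hv
  have l1 := lastEdge_le hd v M
  have l2 := lastEdge_spec hd v M
  rw [forIn, wp_seq, wp_set]
  simp only [Expr.eval, hev, l0]
  refine ⟨by omega, ?_⟩
  refine wp_loop (fun s' t => s'.reg 11 ≤ M ∧ I (s'.reg 11) s' ∧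
    (0 < s'.reg 11 → hd (s'.reg 11 - 1) = v) ∧ t ≤ (c + 2) * inCount hd M v (s'.reg 11))
    (fun s' => s'.reg 11) ?_ ?_ ?_
  · simp only [State.setReg_reg, if_true]
    exact ⟨l1, (skips l1 le_rfl l2.1 (h0 _)).1, l2.2, Nat.zero_le _⟩
  · rintro s' t ⟨h1, h2, h3, h4⟩ hF hc
    replace hc : 0 < s'.reg 11 := hc
    have hF' : Frame (forIn ev p) s s' := 
      (hF0 _).trans (show Frame (forIn ev p) _ s' from hF.loop.seq_right)
    obtain ⟨e, he⟩ : ∃ e, s'.reg 11 = e + 1 := ⟨s'.reg 11 - 1, by omega⟩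
    rw [he] at h1 h2 h3 h4
    have hve := h3 (by omega)
    simp only [Nat.add_sub_cancel] at hve
    rw [wp_seq]
    refine (hstep e (by omega) hve s' h2 he hF').mono fun s'' t' ⟨h, ht⟩ hf => ?_
    have e11 : s''.reg 11 = e + 1 := (hf.reg 11 h11).trans he
    have e13 : s''.mem 13 e = lastEdge hd v e := by
      rw [hf.mem 13 hm, hF'.mem 13 (by simp [forIn, wm, hm]), hs.next e (by omega), ← hhd, hve]
    have k1 := lastEdge_le hd v e
    have k2 := lastEdge_spec hd v e
    have k3 := skips k1 (by omega) k2.1 (h (lastEdge hd v e))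
    have hval : (ld 13 (var 11 - 1)).eval s'' = lastEdge hd v e := by simp [e11, e13]
    rw [wp_set, hval]
    simp only [State.setReg_reg, if_true]
    refine ⟨by omega, ⟨by omega, k3.1, k2.2, ?_⟩, by omega⟩
    rw [k3.2, inCount_of_eq (by omega) hve, mul_add]
    omega
  · rintro s' t ⟨h1, h2, h3, h4⟩ hF hc
    have hF' : Frame (forIn ev p) s s' := 
      (hF0 _).trans (show Frame (forIn ev p) _ s' from hF.loop.seq_right)
    have h5 : s'.reg 11 = 0 := by
      have : ¬ 0 < s'.reg 11 := hc
      omega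
    rw [h5] at h2 h4
    exact hend s' _ h2 hF' (by omega)

/-! ### Transitive closure by scanning the edges -/

namespace Dag

variable {N M : ℕ} (H : Dag N M)

/-- The edges, as a relation on natural numbers. -/
def Edge (i j : ℕ) : Prop := ∃ e : Fin M, ((H.edge e).1 : ℕ) = i ∧ ((H.edge e).2 : ℕ) = j

/-- Reachability, as a relation on natural numbers. -/
abbrev Reach (i j : ℕ) : Prop := Relation.ReflTransGen H.Edge i j

variable {H}

theorem edge_iff {u v : Fin N} : H.Edge u v ↔ H.Adj u v := by
  simp only [Edge, Adj, Prod.ext_iff, Fin.ext_iff]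

theorem reach_iff {u v : Fin N} : H.Reach u v ↔ Relation.ReflTransGen H.Adj u v := by
  constructor
  · intro h
    generalize hj : (v : ℕ) = j at h
    induction h generalizing v with
    | refl => rw [Fin.ext hj]
    | tail _ h2 ih =>
      obtain ⟨e, h3, h4⟩ := h2
      subst hj
      exact (ih h3).tail ⟨e, Prod.ext rfl (Fin.ext h4)⟩
  · intro h
    exact h.lift (fun x : Fin N => (x : ℕ)) fun a b hab => edge_iff.2 hab

/-- The edges go from lower to higher numbers. -/
def Ordered (H : Dag N M) : Prop := ∀ u v, H.Adj u v → u < v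

theorem Ordered.lt (hH : H.Ordered) {i j : ℕ} (h : H.Edge i j) : i < j := by
  obtain ⟨e, rfl, rfl⟩ := h
  exact hH _ _ ⟨e, rfl⟩

theorem Ordered.le (hH : H.Ordered) {i j : ℕ} (h : H.Reach i j) : i ≤ j := by
  induction h with
  | refl => exact le_rfl
  | tail _ h ih => exact ih.trans (hH.lt h).le

theorem Ordered.isTopological (hH : H.Ordered) : H.IsTopological (Equiv.refl _) := hH

open Classical in
/-- The word array `14` contains the reachability matrix. -/
def Closed (H : Dag N M) (s : State) : Prop :=
  ∀ i < N, ∀ j < N, s.mem 14 (i * N + j) = if H.Reach i j then 1 else 0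

end Dag

/-- Column `12` of the reachability matrix is added to column `10`. -/
def addColumn : Prog :=
  for_ 13 2 (ite 0 (ld 14 (var 13 * var 2 + var 12)) (put 14 (var 13 * var 2 + var 10) 1) skip)

/-- Compute the reachability matrix from the lists of entering edges. -/
def scanClosure : Prog :=
  for_ 10 2 (
    put 14 (var 10 * var 2 + var 10) 1 ;;
    forIn (var 10) (set 12 (ld 10 (var 11 - 1)) ;; addColumn))

theorem wp_addColumn {B N v x : ℕ} {s : State} (hN : s.reg 2 = N) (hNB : N < B) (h1B : 1 < B)
    (hv : s.reg 10 = v)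
    (hx : s.reg 12 = x) (hvN : v < N) (hxv : x < v) :
    wp B addColumn (fun s' t => (∀ i < N, ∀ j < N, s'.mem 14 (i * N + j) =
      if j = v ∧ 0 < s.mem 14 (i * N + x) then 1 else s.mem 14 (i * N + j)) ∧ t ≤ 4 * N + 2) s := by
  refine wp_for_const (c := 2) (fun k s' => ∀ i < N, ∀ j < N, s'.mem 14 (i * N + j) =
    if i < k ∧ j = v ∧ 0 < s.mem 14 (i * N + x) then 1 else s.mem 14 (i * N + j)) (by omega)
    (by decide) rfl rfl (by simp) ?_ ?_
  · intro k hk s' hI h13 hF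
    rw [hN] at hk
    have h2 : s'.reg 2 = N := by rw [hF.reg 2 rfl, hN]
    have h10 : s'.reg 10 = v := by rw [hF.reg 10 rfl, hv]
    have h12 : s'.reg 12 = x := by rw [hF.reg 12 rfl, hx]
    have e1 := hI k hk x (by omega)
    -- Column x is read while column v is written; they are different because x < v.
    have e2 : s'.mem 14 (k * N + x) = s.mem 14 (k * N + x) := by
      rw [e1, if_neg (by omega)]
    simp [h2, h10, h12, h13, e2]
    refine ⟨fun h => ⟨h1B, fun i hi j hj => ?_⟩, fun h i hi j hj => ?_⟩
    · simp only [mul_add_inj hj hvN]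
      by_cases hc : i = k ∧ j = v
      · simp [hc, h]
      · rw [if_neg hc, hI i hi j hj]
        have : (i < k ∧ j = v ∧ 0 < s.mem 14 (i * N + x)) ↔
          (i ≤ k ∧ j = v ∧ 0 < s.mem 14 (i * N + x)) := by
          constructor
          · rintro ⟨a, b⟩; exact ⟨a.le, b⟩
          · rintro ⟨a, b, c⟩; exact ⟨by omega, b, c⟩
        simp only [this]
    · rw [hI i hi j hj]
      have : (i < k ∧ j = v ∧ 0 < s.mem 14 (i * N + x)) ↔
          (i ≤ k ∧ j = v ∧ 0 < s.mem 14 (i * N + x)) := by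
        constructor
        · rintro ⟨a, b⟩; exact ⟨a.le, b⟩
        · rintro ⟨a, b, c⟩
          refine ⟨lt_of_le_of_ne a ?_, b, c⟩
          rintro rfl; omega
      simp only [this]
  · intro s' t hI hF ht
    rw [hN] at hI ht
    refine ⟨fun i hi j hj => ?_, by omega⟩
    rw [hI i hi j hj]; simp only [hi, true_and]

/-- Each edge has one head, so the scans for all vertices together deal with every edge once. -/
theorem sum_inCount {hd : ℕ → ℕ} {N M : ℕ} (h : ∀ e < M, hd e < N) :
    ∑ v ∈ Finset.range N, inCount hd M v 0 = M := by
  have := Finset.card_eq_sum_card_fiberwise (f := hd) (s := Finset.Ico 0 M) (t := Finset.range N)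
    (fun e he => by simpa using h e (by simpa using he))
  simpa [inCount] using this.symm

-- The columns are completed in topological order. The ancestors of v are v itself and the ancestors
-- of the tails of its entering edges, and the columns of these tails are complete before. Each edge
-- costs one pass through a column, which gives O(NM) in total.
open Classical in
theorem wp_scanClosure {B N M : ℕ} {H : Dag N M} {w : Fin M → ℝ} {s : State} (hH : H.Ordered)
    (hs : H.Loaded w s) (hl : Lists N M s) (h14 : ∀ i, s.mem 14 i = 0) (hNB : N < B) (hMB : M < B)
    (h1B : 1 < B) :
    wp B scanClosure (fun s' t => H.Closed s' ∧ t ≤ (4 * N + 5) * M + 5 * N + 2) s := by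
  have hhd : ∀ e : Fin M, s.mem 11 e = (H.edge e).2 := hs.head
  refine wp_for (fun v s' t => (∀ i < N, ∀ j < N, s'.mem 14 (i * N + j) =
      if j < v ∧ H.Reach i j then 1 else 0) ∧
    t ≤ (4 * N + 5) * (∑ j ∈ Finset.range v, inCount (s.mem 11) M j 0) + 5 * v)
    (by rw [hs.reg_N]; exact hNB) (by decide) rfl rfl (by simp [h14]) ?_ ?_
  · rintro v hv s' t ⟨hI, ht⟩ h10 hF
    rw [hs.reg_N] at hv
    have h2 : s'.reg 2 = N := by rw [hF.reg 2 rfl, hs.reg_N]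
    have m10 := hF.mem 10 rfl
    have m11 := hF.mem 11 rfl
    have m12 := hF.mem 12 rfl
    have m13 := hF.mem 13 rfl
    rw [wp_seq, wp_put]
    refine ⟨h1B, ?_⟩
    simp only [Expr.eval, h10, h2, WordOp.eval_add, WordOp.eval_mul]
    refine wp_forIn (4 * N + 3) (fun k s'' => ∀ i < N, ∀ j < N, s''.mem 14 (i * N + j) =
      if j < v ∧ H.Reach i j ∨ j = v ∧ (i = v ∨ ∃ e : Fin M, k ≤ (e : ℕ) ∧ ((H.edge e).2 : ℕ) = v ∧
        H.Reach i (H.edge e).1) then 1 else 0)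
      ⟨fun v hv => ?_, fun e he => ?_⟩ hv (by simp [h10]) hMB rfl rfl ?_ ?_ ?_ ?_
    · simp [m12, m11, hl.first v hv]
    · simp [m13, m11, hl.next e he]
    · intro k i hi j hj
      have hnone : ∀ e : Fin M, ¬ M ≤ (e : ℕ) := fun e => by have := e.2; omega
      simp only [State.setReg_mem, State.setMem_mem, true_and, mul_add_inj hj hv, hI i hi j hj, hnone,
        false_and, exists_false, or_false]
      by_cases h1 : i = v ∧ j = v
      · simp [h1]
      · have : ¬ (j = v ∧ i = v) := by tauto
        simp [h1, this]
    · intro e he hne s'' h i hi j hj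
      simp only [State.setMem_mem, m11] at hne
      rw [h i hi j hj]
      congr 1
      simp only [eq_iff_iff]
      refine or_congr_right (and_congr_right fun _ => or_congr_right (exists_congr fun e' => ?_))
      refine and_congr_left fun h1 => ⟨fun h => by omega, fun h => ?_⟩
      rcases h.lt_or_eq with h2 | rfl
      · exact h2
      · rw [hhd] at hne
        exact absurd h1.1 (by simpa using hne)
    · intro e he heq s'' h h11 hF'
      simp only [State.setMem_mem, m11] at heq
      have e10 : s''.mem 10 e = (H.edge ⟨e, he⟩).1 := by
        rw [hF'.mem 10 rfl]; simp [m10, hs.tail ⟨e, he⟩]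
      have heq' : ((H.edge ⟨e, he⟩).2 : ℕ) = v := by
        rw [← hhd]; simpa using heq
      have hlt := hH.lt (i := (H.edge ⟨e, he⟩).1) (j := v) ⟨⟨e, he⟩, rfl, heq'⟩
      have hx := (H.edge ⟨e, he⟩).1.2
      simp only [wp_seq, wp_set, Expr.eval_sub, Expr.eval, h11]
      simp only [show e + 1 - 1 = e by omega, e10]
      refine ⟨by omega, ?_⟩
      refine (wp_addColumn (x := (H.edge ⟨e, he⟩).1) (v := v) (N := N) ?_ hNB h1B ?_ (by simp) hv
        hlt).mono ?_
      · have := hF'.reg 2 rfl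
        simpa [h2] using this
      · have := hF'.reg 10 rfl
        simpa [h10] using this
      · rintro s₃ t₃ ⟨g1, g2⟩ -
        refine ⟨fun k i hi j hj => ?_, by omega⟩
        have g1' := g1 i hi j hj
        simp only [State.setReg_mem, h i hi j hj, h i hi _ hx] at g1'
        simp only [State.setReg_mem, g1']
        by_cases hj' : j = v
        · subst hj'
          have key : (∃ e' : Fin M, e ≤ (e' : ℕ) ∧ ((H.edge e').2 : ℕ) = j ∧ H.Reach i (H.edge e').1) ↔
              H.Reach i (H.edge ⟨e, he⟩).1 ∨ ∃ e' : Fin M, e + 1 ≤ (e' : ℕ) ∧ ((H.edge e').2 : ℕ) = j ∧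
                H.Reach i (H.edge e').1 := by
            constructor
            · rintro ⟨e', h1, h2, h3⟩
              rcases h1.lt_or_eq with h4 | h4
              · exact .inr ⟨e', h4, h2, h3⟩
              · obtain rfl : (⟨e, he⟩ : Fin M) = e' := Fin.ext h4
                exact .inl h3
            · rintro (h3 | ⟨e', h1, h2, h3⟩)
              · exact ⟨⟨e, he⟩, le_rfl, heq', h3⟩
              · exact ⟨e', by omega, h2, h3⟩
          simp only [key, hlt, hlt.ne, true_and, false_and, or_false, lt_irrefl, false_or]
          by_cases hr : H.Reach i (H.edge ⟨e, he⟩).1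
          · simp [hr]
          · simp [hr]
        · simp [hj']
    · intro s'' t' h hF' ht'
      have m11' : ((s'.setMem 14 (v * N + v) 1).mem 11) = s.mem 11 := by
        funext i; simp [m11]
      simp only [m11', show 4 * N + 3 + 2 = 4 * N + 5 from rfl] at ht'
      refine ⟨fun i hi j hj => ?_, ?_⟩
      · simp only [State.setReg_mem]
        rw [h i hi j hj]
        congr 1
        simp only [eq_iff_iff]
        constructor
        · rintro (⟨h1, h2⟩ | ⟨rfl, rfl | ⟨e, -, h1, h2⟩⟩)
          · exact ⟨by omega, h2⟩
          · exact ⟨by omega, .refl⟩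
          · exact ⟨by omega, h2.tail ⟨e, rfl, h1⟩⟩
        · rintro ⟨h1, h2⟩
          rcases (Nat.lt_succ_iff.1 h1).lt_or_eq with h3 | rfl
          · exact .inl ⟨h3, h2⟩
          · refine .inr ⟨rfl, ?_⟩
            rcases Relation.ReflTransGen.cases_tail h2 with rfl | ⟨x, hx, e, rfl, h4⟩
            · exact .inl rfl
            · exact .inr ⟨e, Nat.zero_le _, h4, hx⟩
      · rw [Finset.sum_range_succ, mul_add]
        omega
  · rintro s' t ⟨hI, ht⟩ hF
    rw [hs.reg_N] at hI ht
    rw [sum_inCount (fun e he => by rw [hhd ⟨e, he⟩]; exact (H.edge ⟨e, he⟩).2.2)] at ht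
    refine ⟨fun i hi j hj => ?_, by omega⟩
    rw [hI i hi j hj]; simp [hj]

end APSP

namespace APSP

open Prog _root_.APSP.Expr

namespace Prog

theorem wp.mono_bounded {B : ℕ} {p : Prog} {Q Q' : State → ℕ → Prop} {s : State}
    (hs : s.Bounded B) (h : wp B p Q s)
    (hQ : ∀ s' t, Q s' t → Frame p s s' → s'.Bounded B → Q' s' t) : wp B p Q' s := by
  obtain ⟨s', t, hr, hq⟩ := h
  exact ⟨s', t, hr, hQ s' t hq hr.frame (hr.bounded hs)⟩

/-- The rule for two nested counting loops; the argument of the invariant counts the steps. -/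
theorem wp_for₂ {B x y z c : ℕ} {p : Prog} {s : State} {Q : State → ℕ → Prop}
    (I : ℕ → State → Prop) (hB : s.reg z < B) (hxy : x ≠ y) (hxz : x ≠ z) (hyz : y ≠ z)
    (hx : p.wr x = false) (hy : p.wr y = false) (hz : p.wr z = false)
    (hIx : ∀ k s' v, I k s' → I k (s'.setReg x v)) (hIy : ∀ k s' v, I k s' → I k (s'.setReg y v))
    (h0 : I 0 s)
    (hstep : ∀ i < s.reg z, ∀ j < s.reg z, ∀ s', I (i * s.reg z + j) s' → s'.reg x = i →
      s'.reg y = j → Frame (for_ x z (for_ y z p)) s s' →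
      wp B p (fun s'' t => I (i * s.reg z + j + 1) s'' ∧ t ≤ c) s')
    (hend : ∀ s' t, I (s.reg z * s.reg z) s' → Frame (for_ x z (for_ y z p)) s s' →
      t ≤ (c + 2) * s.reg z ^ 2 + 4 * s.reg z + 2 → Q s' t) :
    wp B (for_ x z (for_ y z p)) Q s := by
  have bx : Nat.beq y x = false := Bool.eq_false_iff.2 fun h => hxy (Nat.eq_of_beq_eq_true h).symm
  have bz : Nat.beq y z = false := Bool.eq_false_iff.2 fun h => hyz (Nat.eq_of_beq_eq_true h)
  have bxz : Nat.beq x z = false := Bool.eq_false_iff.2 fun h => hxz (Nat.eq_of_beq_eq_true h)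
  refine wp_for_const (c := (c + 2) * s.reg z + 2) (fun i s' => I (i * s.reg z) s') hB hxz
    (by simp [for_, wr, bx, hx]) (by simp [for_, wr, bz, hz]) ?_ ?_ ?_
  · simpa using hIx _ _ _ h0
  · intro i hi s' hI hxi hF
    have hzz : s'.reg z = s.reg z := hF.reg z (by simp [for_, wr, bz, bxz, hz])
    refine wp_for_const (c := c) (fun j s' => I (i * s.reg z + j) s') (by rw [hzz]; exact hB) hyz hy
      hz (by simpa using hIy _ _ _ hI) ?_ ?_
    · intro j hj s'' hI' hyj hF'
      rw [hzz] at hj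
      refine (hstep i hi j hj s'' hI' ?_ hyj (hF.trans hF'.seq_left.loop.seq_right)).mono
        fun s₃ t h _ => ⟨hIy _ _ _ h.1, h.2⟩
      rw [hF'.reg x (by simp [for_, wr, bx, hx]), hxi]
    · intro s'' t h _ ht
      rw [hzz] at h ht
      refine ⟨hIx _ _ _ ?_, ht⟩
      rwa [Nat.succ_mul]
  · intro s' t h hF ht
    exact hend s' t h hF (ht.trans (by ring_nf; omega))

end Prog

/-! ### Matrix products by a subroutine -/

/-- The program multiplies `n × n` matrices with entries `0` and `1` in at most `τ n` steps. -/
def Multiplies (P : Cmd) (k : ℕ) (τ : ℕ → ℕ) : Prop :=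
  ∀ n : ℕ, 1 ≤ n → ∀ A B : Matrix (Fin n) (Fin n) ℕ, (∀ i j, A i j ≤ 1) → (∀ i j, B i j ≤ 1) →
    ∃ (s : State) (t : ℕ), Exec ((n + 2) ^ k) P (matMulInput A B) s t ∧ t ≤ τ n ∧
      ∀ i j : Fin n, s.mem 2 (i * n + j) = (A * B) i j

/-- The simulated word registers are cleared. -/
def zeroRegs : ℕ → Prog
  | 0 => skip
  | k + 1 => zeroRegs k ;; set (60 + k) 0

/-- The arguments of the subroutine are prepared. -/
def fillInput (ea eb : Expr) : Prog :=
  for_ 14 12 (for_ 15 12 (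
    put 60 (var 14 * var 12 + var 15) ea ;;
    put 61 (var 14 * var 12 + var 15) (var 6) ;;
    put 62 (var 14 * var 12 + var 15) eb ;;
    put 63 (var 14 * var 12 + var 15) (var 6)))

/-- The product of two matrices of size `var 12`, whose entries in row `var 14` and column `var 15`
are given by expressions. -/
def multiply (P : Cmd) (r : ℕ) (ea eb : Expr) : Prog :=
  set 6 (var 6 + 1) ;; fillInput ea eb ;; zeroRegs r ;; set 60 (var 12) ;; clocked P

theorem wr_tick {p : Prog} {x : ℕ} (h : p.wr x = false) (hx : x ≠ 5) : (tick p).wr x = false := by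
  have : Nat.beq 5 x = false := Bool.eq_false_iff.2 fun h => hx (Nat.eq_of_beq_eq_true h).symm
  simp [tick, wr, h, this]

theorem clocked_wr (c : Cmd) {x : ℕ} (h5 : x ≠ 5) (h60 : x < 60) : (clocked c).wr x = false := by
  have hb : ∀ y, Nat.beq (60 + y) x = false := fun y =>
    Bool.eq_false_iff.2 fun h => by have := Nat.eq_of_beq_eq_true h; omega
  have hb5 : Nat.beq 5 x = false := Bool.eq_false_iff.2 fun h => h5 (Nat.eq_of_beq_eq_true h).symm
  induction c with
  | seq c d hc hd => simp [clocked, wr, hc, hd]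
  | whileLt y z c hc => simp [clocked, wr, hc, hb5]
  | ifLt y z c d hc hd => exact wr_tick (by simp [wr, hc, hd]) h5
  | ifRLt y z c d hc hd => exact wr_tick hd h5
  | _ => exact wr_tick (by simp [wr, hb]) h5

theorem clocked_wm (c : Cmd) {a : ℕ} (h60 : a < 60) : (clocked c).wm a = false := by
  have hb : ∀ y, Nat.beq (60 + y) a = false := fun y =>
    Bool.eq_false_iff.2 fun h => by have := Nat.eq_of_beq_eq_true h; omega
  have hb' : ∀ y, Nat.beq (61 + y) a = false := fun y =>
    Bool.eq_false_iff.2 fun h => by have := Nat.eq_of_beq_eq_true h; omega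
  induction c with
  | seq c d hc hd => simp [clocked, wm, hc, hd]
  | whileLt y z c hc => simp [clocked, wm, hc]
  | ifLt y z c d hc hd => simp [clocked, tick, wm, hc, hd]
  | ifRLt y z c d hc hd => simp [clocked, tick, wm, hd]
  | _ => simp [clocked, tick, wm, hb, hb']

theorem clocked_wrm (c : Cmd) (a : ℕ) : (clocked c).wrm a = false := by
  induction c with
  | seq c d hc hd => simp [clocked, wrm, hc, hd]
  | whileLt y z c hc => simp [clocked, wrm, hc]
  | ifLt y z c d hc hd => simp [clocked, tick, wrm, hc, hd]
  | ifRLt y z c d hc hd => simp [clocked, tick, wrm, hd]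
  | _ => simp [clocked, tick, wrm]

theorem zeroRegs_wr (r : ℕ) {x : ℕ} (h60 : x < 60) : (zeroRegs r).wr x = false := by
  have hb : ∀ y, Nat.beq (60 + y) x = false := fun y =>
    Bool.eq_false_iff.2 fun h => by have := Nat.eq_of_beq_eq_true h; omega
  induction r with
  | zero => rfl
  | succ r ih => simp [zeroRegs, wr, ih, hb]

theorem zeroRegs_wm (r a : ℕ) : (zeroRegs r).wm a = false := by
  induction r with
  | zero => rfl
  | succ r ih => simp [zeroRegs, wm, ih]

theorem zeroRegs_wrm (r a : ℕ) : (zeroRegs r).wrm a = false := by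
  induction r with
  | zero => rfl
  | succ r ih => simp [zeroRegs, wrm, ih]

theorem wp_zeroRegs {B : ℕ} (hB : 0 < B) (r : ℕ) (s : State) :
    wp B (zeroRegs r) (fun s' t => (∀ x < r, s'.reg (60 + x) = 0) ∧ t ≤ r + 1) s := by
  induction r with
  | zero => simp [zeroRegs]
  | succ r ih =>
    rw [zeroRegs, wp_seq]
    refine ih.mono fun s' t ⟨h, ht⟩ _ => ?_
    rw [wp_set]
    refine ⟨hB, fun x hx => ?_, by omega⟩
    rcases (Nat.lt_succ_iff.1 hx).lt_or_eq with h1 | rfl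
    · simp [h x h1]
    · simp

/-- Whether an entry of the matrix that the subroutine has computed is positive. -/
def outBit (s : State) (i : ℕ) : ℕ := (1 - (1 - s.mem 64 i)) * (1 - (s.reg 6 - s.mem 65 i))

/-- The two expressions are evaluated in states in which the loop has already changed something.
They must therefore give the right entries in every state that agrees with the initial one on the
low registers and on the arrays that do not belong to the simulation. -/
theorem wp_fillInput {B z : ℕ} {s : State} {ea eb : Expr} (hzB : z < B) (h1B : 1 < B)
    (hz : s.reg 12 = z) (hera : s.reg 6 < B) {a b : ℕ → ℕ → ℕ} (ha1 : ∀ i j, a i j ≤ 1)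
    (hb1 : ∀ i j, b i j ≤ 1)
    (ha : ∀ s' : State, (∀ x < 14, s'.reg x = s.reg x) → (∀ c < 60, s'.mem c = s.mem c) →
      ∀ i < z, ∀ j < z, s'.reg 14 = i → s'.reg 15 = j → ea.eval s' = a i j)
    (hb : ∀ s' : State, (∀ x < 14, s'.reg x = s.reg x) → (∀ c < 60, s'.mem c = s.mem c) →
      ∀ i < z, ∀ j < z, s'.reg 14 = i → s'.reg 15 = j → eb.eval s' = b i j) :
    wp B (fillInput ea eb) (fun s' t => (∀ i, s'.mem 61 i = if i < z * z then s.reg 6 else s.mem 61 i) ∧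
      (∀ i, s'.mem 63 i = if i < z * z then s.reg 6 else s.mem 63 i) ∧
      (∀ i < z * z, s'.mem 60 i = a (i / z) (i % z) ∧ s'.mem 62 i = b (i / z) (i % z)) ∧
      t ≤ 6 * z ^ 2 + 4 * z + 2) s := by
  refine wp_for₂ (c := 4) (fun c s' =>
    (∀ i, s'.mem 61 i = if i < c then s.reg 6 else s.mem 61 i) ∧
    (∀ i, s'.mem 63 i = if i < c then s.reg 6 else s.mem 63 i) ∧
    (∀ i < c, s'.mem 60 i = a (i / z) (i % z) ∧ s'.mem 62 i = b (i / z) (i % z)))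
    (by rw [hz]; exact hzB) (by decide) (by decide) (by decide) rfl rfl rfl
    (fun _ _ _ h => by simpa using h) (fun _ _ _ h => by simpa using h) ?_ ?_ ?_
  · simp
  · rintro i hi j hj s' ⟨h1, h2, h3⟩ h14 h15 hF
    rw [hz] at hi hj h1 h2 h3
    rw [hz]
    have r6 : s'.reg 6 = s.reg 6 := by rw [hF.reg 6 rfl]
    have r12 : s'.reg 12 = z := by rw [hF.reg 12 rfl, hz]
    have hreg : ∀ x < 14, s'.reg x = s.reg x := fun x hx => hF.reg x (by interval_cases x <;> rfl)
    have hmem : ∀ c < 60, s'.mem c = s.mem c := fun c hc => hF.mem c (by interval_cases c <;> rfl)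
    have hav := ha s' hreg hmem i hi j hj h14 h15
    have hbv := hb ((s'.setMem 60 (i * z + j) (a i j)).setMem 61 (i * z + j) (s.reg 6))
      (by simpa using hreg) (fun c hc => by
        rw [State.setMem_mem_of_ne _ _ _ (by omega), State.setMem_mem_of_ne _ _ _ (by omega)]
        exact hmem c hc) i hi j hj (by simpa using h14) (by simpa using h15)
    have hidx : (i * z + j) / z = i ∧ (i * z + j) % z = j := by
      rw [mul_comm]
      exact ⟨by rw [Nat.mul_add_div (by omega), Nat.div_eq_of_lt hj, add_zero],
        by rw [Nat.mul_add_mod, Nat.mod_eq_of_lt hj]⟩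
    have e60 : (var 14 * var 12 + var 15 : Expr).eval s' = i * z + j := by simp [h14, h15, r12]
    simp only [wp_seq, wp_put, Expr.eval, h14, h15, r12, r6, hav,
      hbv, State.setMem_reg, WordOp.eval_add, WordOp.eval_mul]
    have ha1' := ha1 i j
    have hb1' := hb1 i j
    refine ⟨by omega, hera, by omega, hera, ⟨fun l => ?_, fun l => ?_, fun l hl => ?_⟩, by omega⟩
    · have := h1 l
      simp [this]
      split_ifs <;> omega
    · have := h2 l
      simp [this]
      split_ifs <;> omega
    · rcases (Nat.lt_succ_iff.1 hl).lt_or_eq with h | rfl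
      · obtain ⟨h4, h5⟩ := h3 l h
        simp [h4, h5, h.ne]
      · simp [hidx]
  · rintro s' t ⟨h1, h2, h3⟩ - ht
    rw [hz] at h1 h2 h3 ht
    exact ⟨h1, h2, h3, ht⟩

theorem multiply_cost {K r D z t₂ t₃ t : ℕ} (hz : 1 ≤ z) (h₂ : t₂ ≤ 6 * z ^ 2 + 4 * z + 2)
    (h₃ : t₃ ≤ r + 1) (h : t ≤ K * (D + 1)) :
    1 + (t₂ + (t₃ + (1 + t))) ≤ (K + r + 30) * (D + z ^ 2) := by
  have hz2 : 1 ≤ z ^ 2 := Nat.one_le_pow _ _ hz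
  have hz3 : z ≤ z ^ 2 := Nat.le_self_pow (by omega) z
  have h4 : K ≤ K * z ^ 2 := Nat.le_mul_of_pos_right _ hz2
  have h5 : r ≤ r * z ^ 2 := Nat.le_mul_of_pos_right _ hz2
  have e : (K + r + 30) * (D + z ^ 2) =
      K * D + K * z ^ 2 + r * D + r * z ^ 2 + 30 * D + 30 * z ^ 2 := by ring
  rw [e]
  rw [mul_add, mul_one] at h
  omega

/-- Increasing the era, variable 6, makes all earlier time stamps stale, so the entire simulated
memory counts as zero again without being cleared. Only the cells of the arguments are stamped, at a
cost of O(z²). The fuel consumed is bounded by the time of the multiplication program, and the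
product is guaranteed only if fuel is left. -/
theorem wp_multiply {P : Cmd} {k r B z : ℕ} {τ : ℕ → ℕ} {s : State} {ea eb : Expr}
    (hP : Multiplies P k τ) (hr : P.RegsBelow r) (hB : (z + 2) ^ k ≤ B) (hzB : z < B) (h1B : 1 < B)
    (hz : s.reg 12 = z) (hz1 : 1 ≤ z) (hs : s.Bounded B) (hst : StampsLe s)
    (hera : s.reg 6 + 1 < B) {a b : ℕ → ℕ → ℕ} (ha1 : ∀ i j, a i j ≤ 1) (hb1 : ∀ i j, b i j ≤ 1)
    (ha : ∀ s' : State, (∀ x < 14, x ≠ 6 → s'.reg x = s.reg x) → (∀ c < 60, s'.mem c = s.mem c) →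
      ∀ i < z, ∀ j < z, s'.reg 14 = i → s'.reg 15 = j → ea.eval s' = a i j)
    (hb : ∀ s' : State, (∀ x < 14, x ≠ 6 → s'.reg x = s.reg x) → (∀ c < 60, s'.mem c = s.mem c) →
      ∀ i < z, ∀ j < z, s'.reg 14 = i → s'.reg 15 = j → eb.eval s' = b i j) :
    wp B (multiply P r ea eb) (fun s' t => StampsLe s' ∧ s'.reg 6 = s.reg 6 + 1 ∧
      s'.reg 5 ≤ s.reg 5 ∧ s.reg 5 - s'.reg 5 ≤ τ z ∧
      t ≤ (clockedCost P + r + 30) * (s.reg 5 - s'.reg 5 + z ^ 2) ∧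
      (0 < s'.reg 5 → ∀ i < z, ∀ j < z, outBit s' (i * z + j) =
        1 - (1 - ∑ l ∈ Finset.range z, a i l * b l j))) s := by
  rw [multiply, wp_seq, wp_set]
  refine ⟨hera, ?_⟩
  set s₁ := s.setReg 6 ((var 6 + 1).eval s) with hs₁
  have e6 : s₁.reg 6 = s.reg 6 + 1 := by simp [hs₁]
  have e5 : s₁.reg 5 = s.reg 5 := by simp [hs₁]
  have e12 : s₁.reg 12 = z := by simp [hs₁, hz]
  have b1 : s₁.Bounded B := ⟨fun x => by
    by_cases hx : x = 6
    · subst hx; rw [e6]; exact hera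
    · simpa [hs₁, hx] using hs.1 x, hs.2⟩
  rw [wp_seq]
  refine wp.mono_bounded b1 (Q := fun s' t => (∀ i, s'.mem 61 i = if i < z * z then s.reg 6 + 1 else s.mem 61 i) ∧
    (∀ i, s'.mem 63 i = if i < z * z then s.reg 6 + 1 else s.mem 63 i) ∧
    (∀ i < z * z, s'.mem 60 i = a (i / z) (i % z) ∧ s'.mem 62 i = b (i / z) (i % z)) ∧
    t ≤ 6 * z ^ 2 + 4 * z + 2) ?_ ?_
  · refine (wp_fillInput hzB h1B e12 (by rw [e6]; exact hera) ha1 hb1 ?_ ?_).mono fun s' t h _ => ?_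
    · intro s' hr hm
      refine ha s' (fun x hx hx6 => ?_) fun c hc => ?_
      · rw [hr x hx]; simp [hs₁, hx6]
      · rw [hm c hc]; simp [hs₁]
    · intro s' hr hm
      refine hb s' (fun x hx hx6 => ?_) fun c hc => ?_
      · rw [hr x hx]; simp [hs₁, hx6]
      · rw [hm c hc]; simp [hs₁]
    · have em : s₁.mem = s.mem := rfl
      simpa only [e6, em] using h
  · rintro s₂ t₂ ⟨h61, h63, hab, ht₂⟩ hF₂ b2
    rw [wp_seq]
    refine (wp_zeroRegs (by omega) r s₂).mono_bounded b2 fun s₃ t₃ ⟨hz3, ht₃⟩ hF₃ b3 => ?_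
    have r12 : s₃.reg 12 = z := by rw [hF₃.reg 12 (zeroRegs_wr r (by omega)), hF₂.reg 12 rfl, e12]
    have r6 : s₃.reg 6 = s.reg 6 + 1 := by
      rw [hF₃.reg 6 (zeroRegs_wr r (by omega)), hF₂.reg 6 rfl, e6]
    have r5 : s₃.reg 5 = s.reg 5 := by
      rw [hF₃.reg 5 (zeroRegs_wr r (by omega)), hF₂.reg 5 rfl, e5]
    have m3 : s₃.mem = s₂.mem := funext fun c => hF₃.mem c (zeroRegs_wm r c)
    simp only [wp_seq, wp_set, Expr.eval, r12]
    refine ⟨hzB, ?_⟩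
    set h := s₃.setReg 60 z with hh
    have bh : h.Bounded B := ⟨fun x => by
      by_cases hx : x = 60
      · simp [hh, hx, hzB]
      · simpa [hh, hx] using b3.1 x, b3.2⟩
    have q5 : h.reg 5 = s.reg 5 := by simp [hh, r5]
    have q6 : h.reg 6 = s.reg 6 + 1 := by simp [hh, r6]
    have hmo : ∀ c, c ≠ 60 → c ≠ 61 → c ≠ 62 → c ≠ 63 → h.mem c = s.mem c := by
      intro c h0 h1 h2 h3
      have e : ∀ d, c ≠ d → Nat.beq d c = false := fun d hd =>
        Bool.eq_false_iff.2 fun h => hd (Nat.eq_of_beq_eq_true h).symm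
      have : s₂.mem c = s₁.mem c := hF₂.mem c (by
        simp [fillInput, for_, wm, e 60 h0, e 61 h1, e 62 h2, e 63 h3])
      simp [hh, m3, this, hs₁]
    have hstamp : StampsLe h := by
      intro c i
      rw [q6]
      by_cases h0 : c = 0
      · subst h0
        have := hst 0 i
        simp only [hh, State.setReg_mem, m3, mul_zero, add_zero, h61] at this ⊢
        split_ifs <;> omega
      · by_cases h1 : c = 1
        · subst h1
          have := hst 1 i
          simp only [hh, State.setReg_mem, m3, mul_one, Nat.reduceAdd, h63] at this ⊢
          split_ifs <;> omega
        · rw [hmo _ (by omega) (by omega) (by omega) (by omega)]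
          exact (hst c i).trans (Nat.le_succ _)
    rcases Nat.eq_zero_or_pos (h.reg 5) with hf | hf
    · obtain ⟨t, hrun, ht⟩ := run_clocked_zero (B := B) P hf
      have h5 : s.reg 5 = 0 := q5.symm.trans hf
      refine ⟨h, t, hrun, hstamp, q6, q5.le, by simp [q5], ?_, by omega⟩
      refine multiply_cost hz1 ht₂ ht₃ ?_
      rw [q5, Nat.sub_self, zero_add, mul_one]
      exact ht
    · let A : Matrix (Fin z) (Fin z) ℕ := fun i j => a i j
      let B' : Matrix (Fin z) (Fin z) ℕ := fun i j => b i j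
      obtain ⟨s₄, t₄, hx, ht₄, hout⟩ := hP z hz1 A B' (fun i j => ha1 i j) (fun i j => hb1 i j)
      -- The cells outside the two matrices carry stamps from earlier eras, so they count as zero,
      -- as the input format for matrix multiplication requires.
      have hsim : Simulates r (matMulInput A B') h := by
        refine ⟨fun x hx => ?_, fun c i => ?_, fun _ => rfl, fun _ _ => rfl⟩
        · by_cases h0 : x = 0
          · simp [h0, hh, matMulInput]
          · have : 60 + x ≠ 60 := by omega
            simp [h0, hh, matMulInput, hz3 x hx]
        · rw [q6]
          have hdiv : (i / z < z ∧ i % z < z) ↔ i < z * z := by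
            rw [Nat.div_lt_iff_lt_mul (by omega)]
            exact and_iff_left (Nat.mod_lt _ (by omega))
          by_cases h0 : c = 0
          · subst h0
            have h2 := hst 0 i
            simp only [mul_zero, add_zero] at h2
            simp only [matMulInput, hdiv, hh, State.setReg_mem, m3, mul_zero, add_zero, h61]
            by_cases hi : i < z * z
            · simp [hi, A, (hab i hi).1]
            · rw [dif_neg hi, if_neg hi, if_pos (by omega)]
          · by_cases h1 : c = 1
            · subst h1
              have h2 := hst 1 i
              simp only [mul_one, Nat.reduceAdd] at h2
              simp only [matMulInput, hdiv, hh, State.setReg_mem, m3, mul_one, Nat.reduceAdd, h63]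
              by_cases hi : i < z * z
              · simp [hi, B', (hab i hi).2]
              · rw [dif_neg hi, if_neg hi, if_pos (by omega)]
            · have h2 := hst c i
              rw [hmo _ (by omega) (by omega) (by omega) (by omega), if_pos (by omega)]
              simp [matMulInput, h0, h1]
      obtain ⟨h', t', hrun, p1, p2, p3, p4, p5, p6⟩ :=
        hsim.clockedRun hB hx hr h hstamp hf bh
      rw [q5] at p1 p2 p3
      refine ⟨h', t', hrun, p4, p5.trans q6, p1, p3.trans ht₄,
        multiply_cost hz1 ht₂ ht₃ p2, fun hf' i hi j hj => ?_⟩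
      · have h1 := (p6 hf').mem 2 (i * z + j)
        rw [hout ⟨i, hi⟩ ⟨j, hj⟩] at h1
        have hs65 := p4 2 (i * z + j)
        simp only [Nat.reduceMul, Nat.reduceAdd] at h1 hs65
        have h2 : (A * B') ⟨i, hi⟩ ⟨j, hj⟩ = ∑ l ∈ Finset.range z, a i l * b l j := by
          rw [Matrix.mul_apply, Finset.sum_range]
        rw [h2] at h1
        rw [h1, outBit]
        split_ifs with hlt
        · have : 1 - (h'.reg 6 - h'.mem 65 (i * z + j)) = 0 := by omega
          simp [this]
        · have : 1 - (h'.reg 6 - h'.mem 65 (i * z + j)) = 1 := by omega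
          simp [this]

end APSP

namespace APSP

open Prog _root_.APSP.Expr

/-! ### Transitive closure by matrix multiplication -/

/-- Cut off at 1, an integer matrix product becomes a Boolean one. -/
theorem bit_sum_pos {z : ℕ} {f g : ℕ → ℕ} :
    0 < 1 - (1 - ∑ l ∈ Finset.range z, f l * g l) ↔ ∃ l < z, 0 < f l ∧ 0 < g l := by
  have : 0 < 1 - (1 - ∑ l ∈ Finset.range z, f l * g l) ↔
      0 < ∑ l ∈ Finset.range z, f l * g l := by omega
  rw [this, Finset.sum_pos_iff]
  simp [Nat.pos_iff_ne_zero]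

theorem outBit_le (s : State) (i : ℕ) : outBit s i ≤ 1 :=
  (Nat.mul_le_mul (Nat.sub_le _ _) (Nat.sub_le _ _)).trans (by simp)

/-- `outBit` as an expression. -/
def outBitExpr : Expr :=
  (1 - (1 - ld 64 (var 14 * var 12 + var 15))) * (1 - (var 6 - ld 65 (var 14 * var 12 + var 15)))

/-- The reachability in the two halves of the block of size `2 var 12` that begins at `var 13` is
extended to the whole block.  The matrix is in the array `15`, with rows of size `var 4`. -/
def combine (P : Cmd) (r : ℕ) : Prog :=
  multiply P r (1 - (1 - ld 15 ((var 13 + var 14) * var 4 + (var 13 + var 15))))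
    (1 - (1 - ld 15 ((var 13 + var 14) * var 4 + (var 13 + var 12 + var 15)))) ;;
  for_ 14 12 (for_ 15 12 (put 19 (var 14 * var 12 + var 15) outBitExpr)) ;;
  multiply P r (1 - (1 - ld 19 (var 14 * var 12 + var 15)))
    (1 - (1 - ld 15 ((var 13 + var 12 + var 14) * var 4 + (var 13 + var 12 + var 15)))) ;;
  for_ 14 12 (for_ 15 12
    (put 15 ((var 13 + var 14) * var 4 + (var 13 + var 12 + var 15)) outBitExpr))

section

variable {P : Cmd} {k r B z b S : ℕ} {τ : ℕ → ℕ} {s : State}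

theorem wp_saveProduct (_ : 1 < B) (hzB : z < B) (hz : s.reg 12 = z) :
    wp B (for_ 14 12 (for_ 15 12 (put 19 (var 14 * var 12 + var 15) outBitExpr)))
      (fun s' t => (∀ i < z * z, s'.mem 19 i = outBit s i) ∧ t ≤ 3 * z ^ 2 + 4 * z + 2) s := by
  refine wp_for₂ (c := 1) (fun c s' => ∀ i < c, s'.mem 19 i = outBit s i) (by omega) (by decide)
    (by decide) (by decide) rfl rfl rfl (fun _ _ _ h => h) (fun _ _ _ h => h) (by simp) ?_ ?_
  · intro i hi j hj s' hI h14 h15 hF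
    rw [hz] at hi hj hI ⊢
    have h12 : s'.reg 12 = z := by rw [hF.reg 12 rfl, hz]
    have h6 : s'.reg 6 = s.reg 6 := hF.reg 6 rfl
    have e : outBitExpr.eval s' = outBit s (i * z + j) := by
      simp [outBitExpr, outBit, h14, h15, h12, h6, hF.mem 64 rfl, hF.mem 65 rfl]
    have := outBit_le s (i * z + j)
    rw [wp_put, e]
    refine ⟨by omega, fun l hl => ?_, le_rfl⟩
    rcases (Nat.lt_succ_iff.1 hl).lt_or_eq with h | rfl
    · simp [h14, h15, h12, h.ne, hI l h]
    · simp [h14, h15, h12]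
  · intro s' t h _ ht
    rw [hz] at h ht
    exact ⟨h, ht⟩

theorem wp_writeBlock (_ : 1 < B) (hzB : z < B) (hz : s.reg 12 = z) (hb : s.reg 13 = b)
    (hS : s.reg 4 = S) (hbS : b + 2 * z ≤ S) :
    wp B (for_ 14 12 (for_ 15 12
      (put 15 ((var 13 + var 14) * var 4 + (var 13 + var 12 + var 15)) outBitExpr)))
      (fun s' t => (∀ i < z, ∀ j < z, s'.mem 15 ((b + i) * S + (b + z + j)) = outBit s (i * z + j)) ∧
        (∀ i, ∀ j < S, ¬ ((b ≤ i ∧ i < b + z) ∧ b + z ≤ j ∧ j < b + 2 * z) →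
          s'.mem 15 (i * S + j) = s.mem 15 (i * S + j)) ∧
        t ≤ 3 * z ^ 2 + 4 * z + 2) s := by
  refine wp_for₂ (c := 1) (fun c s' =>
      (∀ i < z, ∀ j < z, i * z + j < c →
        s'.mem 15 ((b + i) * S + (b + z + j)) = outBit s (i * z + j)) ∧
      (∀ i, ∀ j < S, ¬ ((b ≤ i ∧ i < b + z) ∧ b + z ≤ j ∧ j < b + 2 * z) →
          s'.mem 15 (i * S + j) = s.mem 15 (i * S + j))) (by omega) (by decide)
    (by decide) (by decide) rfl rfl rfl (fun _ _ _ h => h) (fun _ _ _ h => h) (by simp) ?_ ?_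
  · rintro i hi j hj s' ⟨hI, hI'⟩ h14 h15 hF
    rw [hz] at hi hj hI ⊢
    have h12 : s'.reg 12 = z := by rw [hF.reg 12 rfl, hz]
    have h13 : s'.reg 13 = b := by rw [hF.reg 13 rfl, hb]
    have h4 : s'.reg 4 = S := by rw [hF.reg 4 rfl, hS]
    have h6 : s'.reg 6 = s.reg 6 := hF.reg 6 rfl
    have e : outBitExpr.eval s' = outBit s (i * z + j) := by
      simp [outBitExpr, outBit, h14, h15, h12, h6, hF.mem 64 rfl, hF.mem 65 rfl]
    have := outBit_le s (i * z + j)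
    rw [wp_put, e]
    refine ⟨by omega, ⟨fun i' hi' j' hj' hc => ?_, fun i' j' hj' hn => ?_⟩, le_rfl⟩
    · have e1 : (b + i') * S + (b + z + j') = (b + i) * S + (b + z + j) ↔ i' = i ∧ j' = j := by
        rw [mul_add_inj (by omega) (by omega)]; omega
      simp only [State.setMem_mem, Expr.eval, h14, h15, h12, h13, h4,
        true_and, WordOp.eval_add, WordOp.eval_mul, e1]
      split_ifs with h
      · rw [h.1, h.2]
      · refine hI i' hi' j' hj' ?_
        have h2 : ¬ i' * z + j' = i * z + j := by rwa [mul_add_inj hj' hj]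
        omega
    · have e1 : ¬ i' * S + j' = (b + i) * S + (b + z + j) := by
        rw [mul_add_inj (by omega) (by omega)]; omega
      simp only [State.setMem_mem, Expr.eval, h14, h15, h12, h13, h4,
        true_and, WordOp.eval_add, WordOp.eval_mul, e1, if_false]
      exact hI' i' j' hj' hn
  · rintro s' t ⟨h, h'⟩ _ ht
    rw [hz] at h ht
    exact ⟨fun i hi j hj => h i hi j hj (by nlinarith), h', ht⟩

/-- The number of steps of `multiply` is at most this number times the fuel that is consumed plus the
number of entries. -/
def multiplyCost (P : Cmd) (r : ℕ) : ℕ := clockedCost P + r + 30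

theorem multiply_wr {ea eb : Expr} {x : ℕ} (h5 : x ≠ 5) (h6 : x ≠ 6) (hx : x < 14) :
    (multiply P r ea eb).wr x = false := by
  simp only [multiply, wr, clocked_wr P h5 (by omega : x < 60),
    zeroRegs_wr r (by omega : x < 60)]
  interval_cases x <;> first | rfl | omega

theorem multiply_wm {ea eb : Expr} {x : ℕ} (hx : x < 60) :
    (multiply P r ea eb).wm x = false := by
  simp only [multiply, wm, clocked_wm P (by omega : x < 60), zeroRegs_wm r]
  interval_cases x <;> rfl

theorem multiply_wrm {ea eb : Expr} {x : ℕ} : (multiply P r ea eb).wrm x = false := by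
  simp [multiply, wrm, clocked_wrm P, zeroRegs_wrm r, fillInput, for_]

theorem combine_wr {x : ℕ} (h5 : x ≠ 5) (h6 : x ≠ 6) (hx : x < 14) :
    (combine P r).wr x = false := by
  simp only [combine, wr, multiply_wr h5 h6 hx]
  interval_cases x <;> rfl

theorem combine_wm {x : ℕ} (hx : x < 60) (h19 : x ≠ 19) (h15 : x ≠ 15) :
    (combine P r).wm x = false := by
  simp only [combine, wm, multiply_wm hx]
  interval_cases x <;> first | rfl | omega

theorem combine_wrm {x : ℕ} : (combine P r).wrm x = false := by
  simp [combine, wrm, multiply_wrm, for_]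

/-- Two successive Boolean products form the product of the first diagonal block, the block of edges
between the halves, and the second diagonal block. The first product is saved in the array 19,
because the next call makes the simulated memory stale. Of the matrix, only the block between the
halves is rewritten. -/
theorem wp_combine (hP : Multiplies P k τ) (hr : P.RegsBelow r) (hB : (z + 2) ^ k ≤ B)
    (hzB : z < B) (h1B : 1 < B) (hz : s.reg 12 = z) (hz1 : 1 ≤ z) (hb : s.reg 13 = b)
    (hS : s.reg 4 = S) (hbS : b + 2 * z ≤ S) (hs : s.Bounded B)
    (hst : StampsLe s) (hera : s.reg 6 + 2 < B) :
    wp B (combine P r) (fun s' t => StampsLe s' ∧ s'.reg 6 = s.reg 6 + 2 ∧ s'.reg 5 ≤ s.reg 5 ∧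
      s.reg 5 - s'.reg 5 ≤ 2 * τ z ∧
      t ≤ multiplyCost P r * (s.reg 5 - s'.reg 5 + 3 * z ^ 2) ∧
      (0 < s'.reg 5 →
        (∀ i < z, ∀ j < z, 0 < s'.mem 15 ((b + i) * S + (b + z + j)) ↔
          ∃ p < z, ∃ q < z, 0 < s.mem 15 ((b + i) * S + (b + p)) ∧
            0 < s.mem 15 ((b + p) * S + (b + z + q)) ∧
            0 < s.mem 15 ((b + z + q) * S + (b + z + j))) ∧
        (∀ i, ∀ j < S, ¬ ((b ≤ i ∧ i < b + z) ∧ b + z ≤ j ∧ j < b + 2 * z) →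
          s'.mem 15 (i * S + j) = s.mem 15 (i * S + j)))) s := by
  rw [combine, wp_seq]
  refine (wp_multiply hP hr hB hzB h1B hz hz1 hs hst (by omega)
    (a := fun i j => 1 - (1 - s.mem 15 ((b + i) * S + (b + j))))
    (b := fun i j => 1 - (1 - s.mem 15 ((b + i) * S + (b + z + j))))
    (fun _ _ => Nat.sub_le _ _) (fun _ _ => Nat.sub_le _ _) ?_ ?_).mono_bounded hs ?_
  · intro s' hreg hmem i hi j hj h14 h15
    simp [h14, h15, hreg, hmem, hb, hS]
  · intro s' hreg hmem i hi j hj h14 h15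
    simp [h14, h15, hreg, hmem, hb, hS, hz]
  rintro s₁ t₁ ⟨a1, a2, a3, a4, a5, a6⟩ hF₁ b₁
  have r1 : ∀ x, x ≠ 5 → x ≠ 6 → x < 14 → s₁.reg x = s.reg x := fun x h1 h2 h3 =>
    hF₁.reg x (multiply_wr h1 h2 h3)
  have m1 : s₁.mem 15 = s.mem 15 := hF₁.mem 15 (multiply_wm (by omega))
  rw [wp_seq]
  refine (wp_saveProduct h1B hzB (by rw [r1 12 (by omega) (by omega) (by omega), hz])).mono_bounded b₁ ?_
  rintro s₂ t₂ ⟨c1, c2⟩ hF₂ b₂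
  have r2 : ∀ x, x ≠ 5 → x ≠ 6 → x < 14 → s₂.reg x = s.reg x := fun x h1 h2 h3 => by
    rw [← r1 x h1 h2 h3]
    exact hF₂.reg x (by interval_cases x <;> rfl)
  have m2 : s₂.mem 15 = s.mem 15 := by rw [hF₂.mem 15 rfl, m1]
  have e6 : s₂.reg 6 = s.reg 6 + 1 := by rw [hF₂.reg 6 rfl, a2]
  have e5 : s₂.reg 5 = s₁.reg 5 := hF₂.reg 5 rfl
  have st2 : StampsLe s₂ := fun c i => by
    rw [hF₂.mem (61 + 2 * c) (by
      have : Nat.beq 19 (61 + 2 * c) = false :=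
        Bool.eq_false_iff.2 fun h => by have := Nat.eq_of_beq_eq_true h; omega
      simp [for_, wm, this]), hF₂.reg 6 rfl]
    exact a1 c i
  rw [wp_seq]
  refine (wp_multiply hP hr hB hzB h1B (by rw [r2 12 (by omega) (by omega) (by omega), hz]) hz1 b₂
    st2 (by omega)
    (a := fun i j => 1 - (1 - s₂.mem 19 (i * z + j)))
    (b := fun i j => 1 - (1 - s.mem 15 ((b + z + i) * S + (b + z + j))))
    (fun _ _ => Nat.sub_le _ _) (fun _ _ => Nat.sub_le _ _) ?_ ?_).mono_bounded b₂ ?_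
  · intro s' hreg hmem i hi j hj h14 h15
    simp [h14, h15, hreg, hmem, r2, hz]
  · intro s' hreg hmem i hi j hj h14 h15
    simp [h14, h15, hreg, hmem, r2, m2, hb, hS, hz]
  rintro s₃ t₃ ⟨d1, d2, d3, d4, d5, d6⟩ hF₃ b₃
  have r3 : ∀ x, x ≠ 5 → x ≠ 6 → x < 14 → s₃.reg x = s.reg x := fun x h1 h2 h3 => by
    rw [← r2 x h1 h2 h3]
    exact hF₃.reg x (multiply_wr h1 h2 h3)
  have m3 : s₃.mem 15 = s.mem 15 := by rw [hF₃.mem 15 (multiply_wm (by omega)), m2]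
  refine (wp_writeBlock h1B hzB (by rw [r3 12 (by omega) (by omega) (by omega), hz])
    (by rw [r3 13 (by omega) (by omega) (by omega), hb])
    (by rw [r3 4 (by omega) (by omega) (by omega), hS]) hbS).mono ?_
  rintro s₄ t₄ ⟨f1, f2, f3⟩ hF₄
  have g5 : s₄.reg 5 = s₃.reg 5 := hF₄.reg 5 rfl
  have g6 : s₄.reg 6 = s₃.reg 6 := hF₄.reg 6 rfl
  refine ⟨fun c i => ?_, by omega, by omega, by omega, ?_, fun hf => ⟨fun i hi j hj => ?_, ?_⟩⟩
  · rw [hF₄.mem (61 + 2 * c) (by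
      have : Nat.beq 15 (61 + 2 * c) = false :=
        Bool.eq_false_iff.2 fun h => by have := Nat.eq_of_beq_eq_true h; omega
      simp [for_, wm, this]), hF₄.reg 6 rfl]
    exact d1 c i
  · have hz2 : 1 ≤ z ^ 2 := Nat.one_le_pow _ _ hz1
    have hz3 : z ≤ z ^ 2 := Nat.le_self_pow (by omega) z
    rw [← multiplyCost] at a5 d5
    have hK : 30 * z ^ 2 ≤ multiplyCost P r * z ^ 2 :=
      Nat.mul_le_mul_right _ (by simp [multiplyCost])
    have e : s.reg 5 - s₄.reg 5 = (s.reg 5 - s₁.reg 5) + (s₂.reg 5 - s₃.reg 5) := by omega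
    rw [e]
    rw [mul_add] at a5 d5
    have e2 : multiplyCost P r * (s.reg 5 - s₁.reg 5 + (s₂.reg 5 - s₃.reg 5) + 3 * z ^ 2) =
      multiplyCost P r * (s.reg 5 - s₁.reg 5) + multiplyCost P r * (s₂.reg 5 - s₃.reg 5) +
        3 * (multiplyCost P r * z ^ 2) := by ring
    rw [e2]
    omega
  · have hlt : ∀ {i j}, i < z → j < z → i * z + j < z * z := fun h1 h2 => by nlinarith
    rw [f1 i hi j hj, d6 (by omega) i hi j hj, bit_sum_pos]
    have hq : ∀ q < z, 0 < 1 - (1 - s₂.mem 19 (i * z + q)) ↔ ∃ p < z,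
        0 < s.mem 15 ((b + i) * S + (b + p)) ∧ 0 < s.mem 15 ((b + p) * S + (b + z + q)) := by
      intro q hq
      rw [c1 _ (hlt hi hq), a6 (by omega) i hi q hq]
      have : ∀ x, 0 < 1 - (1 - (1 - (1 - x))) ↔ 0 < 1 - (1 - x) := fun x => by omega
      rw [this, bit_sum_pos]
      refine exists_congr fun p => and_congr_right fun _ => and_congr ?_ ?_ <;> omega
    constructor
    · rintro ⟨q, hqz, h1, h2⟩
      obtain ⟨p, hp, h3, h4⟩ := (hq q hqz).1 h1
      exact ⟨p, hp, q, hqz, h3, h4, by omega⟩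
    · rintro ⟨p, hp, q, hqz, h3, h4, h5⟩
      exact ⟨q, hqz, (hq q hqz).2 ⟨p, hp, h3, h4⟩, by omega⟩
  · intro i j hj hn
    rw [f2 i j hj hn, m3]

end

/-- The blocks of size `z` of the matrix in the array `15` have been closed, and so have those of size
`2 z` that begin before `b`. -/
def Stage {N M : ℕ} (H : Dag N M) (S z b : ℕ) (s : State) : Prop :=
  ∀ i < S, ∀ j < S, 0 < s.mem 15 (i * S + j) ↔
    ((i / z = j / z ∨ (i / (2 * z) = j / (2 * z) ∧ i < b)) ∧ H.Reach i j) ∨ H.Edge i j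

namespace Dag

variable {N M : ℕ} {H : Dag N M}

/-- Numbers increase along a path, so it crosses from below c to c or above exactly once, by one
edge. This is why the two closed halves and the edges between them determine the closure, with no
iteration. -/
theorem Ordered.reach_cut (hH : H.Ordered) {i j c : ℕ} (hi : i < c) (hj : c ≤ j)
    (h : H.Reach i j) : ∃ p q, i ≤ p ∧ p < c ∧ c ≤ q ∧ q ≤ j ∧ H.Reach i p ∧ H.Edge p q ∧
      H.Reach q j := by
  induction h with
  | refl => omega
  | @tail x y h1 h2 ih =>
    by_cases hx : x < c
    · exact ⟨x, y, hH.le h1, hx, hj, le_rfl, h1, h2, .refl⟩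
    · obtain ⟨p, q, g1, g2, g3, g4, g5, g6, g7⟩ := ih (by omega)
      exact ⟨p, q, g1, g2, g3, g4.trans (hH.lt h2).le, g5, g6, g7.tail h2⟩

/-- The rewritten block holds only edges before the step and full reachability after it, by the
decomposition of a path at the boundary between the halves. All other positions keep their values,
and it has to be checked that the stronger claim of the new stage asks nothing more of them. -/
theorem Ordered.stage_step (hH : H.Ordered) {S z c : ℕ} {s s' : State} (hz : 1 ≤ z)
    (hS : 2 * z * c + 2 * z ≤ S) (hs : Stage H S z (2 * z * c) s)
    (h1 : ∀ i < z, ∀ j < z, 0 < s'.mem 15 ((2 * z * c + i) * S + (2 * z * c + z + j)) ↔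
      ∃ p < z, ∃ q < z, 0 < s.mem 15 ((2 * z * c + i) * S + (2 * z * c + p)) ∧
        0 < s.mem 15 ((2 * z * c + p) * S + (2 * z * c + z + q)) ∧
        0 < s.mem 15 ((2 * z * c + z + q) * S + (2 * z * c + z + j)))
    (h2 : ∀ i, ∀ j < S, ¬ ((2 * z * c ≤ i ∧ i < 2 * z * c + z) ∧ 2 * z * c + z ≤ j ∧
      j < 2 * z * c + 2 * z) → s'.mem 15 (i * S + j) = s.mem 15 (i * S + j)) :
    Stage H S z (2 * z * (c + 1)) s' := by
  have hb : 2 * z * (c + 1) = 2 * z * c + 2 * z := by ring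
  rw [hb]
  set b := 2 * z * c with hbdef
  have d1 : ∀ i < z, (b + i) / z = 2 * c := by
    intro i hi
    rw [show b + i = z * (2 * c) + i by rw [hbdef]; ring, Nat.mul_add_div (by omega),
      Nat.div_eq_of_lt hi, add_zero]
  have d2 : ∀ i < z, (b + z + i) / z = 2 * c + 1 := by
    intro i hi
    rw [show b + z + i = z * (2 * c + 1) + i by rw [hbdef]; ring, Nat.mul_add_div (by omega),
      Nat.div_eq_of_lt hi, add_zero]
  have d3 : ∀ i, i / (2 * z) = i / z / 2 := fun i => by rw [mul_comm, Nat.div_div_eq_div_mul]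
  have l1 : ∀ {i}, i < b + 2 * z → ¬ i < b → i / z = 2 * c ∧ i < b + z ∨
      i / z = 2 * c + 1 ∧ b + z ≤ i := by
    intro i h3 h4
    by_cases h5 : i < b + z
    · obtain ⟨k, rfl⟩ := Nat.exists_eq_add_of_le (not_lt.1 h4)
      exact .inl ⟨d1 k (by omega), h5⟩
    · obtain ⟨k, rfl⟩ := Nat.exists_eq_add_of_le (not_lt.1 h5)
      exact .inr ⟨d2 k (by omega), by omega⟩
  have l2 : ∀ {i}, i / z = 2 * c → b ≤ i ∧ i < b + z := by
    intro i h
    have h3 := (Nat.div_eq_iff (by omega)).1 h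
    have : 2 * c * z = b := by rw [hbdef]; ring
    rw [this] at h3
    omega
  have l3 : ∀ {i}, i / z = 2 * c + 1 → b + z ≤ i ∧ i < b + 2 * z := by
    intro i h
    have h3 := (Nat.div_eq_iff (by omega)).1 h
    have : (2 * c + 1) * z = b + z := by rw [hbdef]; ring
    rw [this] at h3
    omega
  intro i hi j hj
  by_cases hblock : (b ≤ i ∧ i < b + z) ∧ b + z ≤ j ∧ j < b + 2 * z
  · obtain ⟨⟨h3, h4⟩, h5, h6⟩ := hblock
    obtain ⟨i', rfl⟩ := Nat.exists_eq_add_of_le h3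
    obtain ⟨j', rfl⟩ := Nat.exists_eq_add_of_le h5
    have hi' : i' < z := by omega
    have hj' : j' < z := by omega
    have heq : (b + i') / (2 * z) = (b + z + j') / (2 * z) := by
      rw [d3, d3, d1 i' hi', d2 j' hj']; omega
    rw [h1 i' hi' j' hj']
    have hR : (((b + i') / z = (b + z + j') / z ∨ (b + i') / (2 * z) = (b + z + j') / (2 * z) ∧
        b + i' < b + 2 * z) ∧ H.Reach (b + i') (b + z + j') ∨ H.Edge (b + i') (b + z + j')) ↔
        H.Reach (b + i') (b + z + j') :=
      ⟨fun h => h.elim (fun h => h.2) (fun h => .single h),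
        fun h => .inl ⟨.inr ⟨heq, by omega⟩, h⟩⟩
    rw [hR]
    have hAA : ∀ p < z, 0 < s.mem 15 ((b + i') * S + (b + p)) ↔ H.Reach (b + i') (b + p) := by
      intro p hp
      rw [hs _ hi _ (by omega), d1 i' hi', d1 p hp]
      exact ⟨fun h => h.elim (fun h => h.2) (fun h => .single h), fun h => .inl ⟨.inl rfl, h⟩⟩
    have hBB : ∀ q < z, 0 < s.mem 15 ((b + z + q) * S + (b + z + j')) ↔
        H.Reach (b + z + q) (b + z + j') := by
      intro q hq
      rw [hs _ (by omega) _ hj, d2 q hq, d2 j' hj']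
      exact ⟨fun h => h.elim (fun h => h.2) (fun h => .single h), fun h => .inl ⟨.inl rfl, h⟩⟩
    have hAB : ∀ p < z, ∀ q < z, 0 < s.mem 15 ((b + p) * S + (b + z + q)) ↔
        H.Edge (b + p) (b + z + q) := by
      intro p hp q hq
      rw [hs _ (by omega) _ (by omega), d1 p hp, d2 q hq]
      have h7 : ¬ b + p < b := by omega
      simp [h7]
    constructor
    · rintro ⟨p, hp, q, hq, g1, g2, g3⟩
      exact (((hAA p hp).1 g1).tail ((hAB p hp q hq).1 g2)).trans ((hBB q hq).1 g3)
    · intro h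
      obtain ⟨p, q, g1, g2, g3, g4, g5, g6, g7⟩ := hH.reach_cut h4 h5 h
      obtain ⟨p', rfl⟩ := Nat.exists_eq_add_of_le (h3.trans g1)
      obtain ⟨q', rfl⟩ := Nat.exists_eq_add_of_le g3
      exact ⟨p', by omega, q', by omega, (hAA p' (by omega)).2 g5,
        (hAB p' (by omega) q' (by omega)).2 g6, (hBB q' (by omega)).2 g7⟩
  · rw [h2 i j hj hblock, hs i hi j hj]
    -- Only reachable pairs can matter here, and for these i ≤ j. This excludes the block below the
    -- diagonal; a pair in the same large block is then in one half or in the rewritten block.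
    refine or_congr_left' fun hE => and_congr_left fun hR => ?_
    have hij := hH.le hR
    constructor
    · rintro (h | ⟨h3, h4⟩)
      · exact .inl h
      · exact .inr ⟨h3, by omega⟩
    · rintro (h | ⟨h3, h4⟩)
      · exact .inl h
      · by_cases h5 : i < b
        · exact .inr ⟨h3, h5⟩
        · left
          rw [d3, d3] at h3
          rcases l1 h4 h5 with ⟨h6, h7⟩ | ⟨h6, h7⟩
          · rw [h6] at h3
            have : j / z = 2 * c ∨ j / z = 2 * c + 1 := by omega
            rcases this with h8 | h8
            · rw [h6, h8]
            · have := l3 h8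
              exact absurd ⟨⟨by omega, h7⟩, this⟩ hblock
          · rw [h6] at h3
            have : j / z = 2 * c ∨ j / z = 2 * c + 1 := by omega
            rcases this with h8 | h8
            · have := l2 h8
              omega
            · rw [h6, h8]

theorem Stage.double {S z : ℕ} {s : State} (hs : Stage H S z S s) : Stage H S (2 * z) 0 s := by
  intro i hi j hj
  rw [hs i hi j hj]
  refine or_congr_left (and_congr_left fun _ => ?_)
  have d3 : ∀ i, i / (2 * z) = i / z / 2 := fun i => by rw [mul_comm, Nat.div_div_eq_div_mul]
  constructor
  · rintro (h | h)
    · exact .inl (by rw [d3, d3, h])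
    · exact .inl h.1
  · rintro (h | h)
    · exact .inr ⟨h, hi⟩
    · omega

end Dag

end APSP

/-! ### Doubling the blocks, and the choice between multiplication and scanning -/

namespace APSP

open Prog _root_.APSP.Expr

/-- All blocks of size `2 var 12` of the matrix of size `var 4` are closed. -/
def closeLevel (P : Cmd) (r : ℕ) : Prog :=
  set 13 0 ;; loop (var 13) (var 4) (combine P r ;; set 13 (var 13 + (var 12 + var 12)))

/-- The matrix of size `var 4` is closed. -/
def closeBlocks (P : Cmd) (r : ℕ) : Prog :=
  set 12 1 ;; loop (var 12) (var 4) (closeLevel P r ;; set 12 (var 12 + var 12))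

/-- The least power of two that is at least `var 2`. -/
def paddedSize : Prog :=
  set 4 1 ;; loop (var 4) (var 2) (set 4 (var 4 + var 4))

/-- The adjacency matrix, padded to the size `var 4`, with a diagonal of ones. -/
def adjacency : Prog :=
  for_ 10 3 (put 15 (ld 10 (var 10) * var 4 + ld 11 (var 10)) 1) ;;
  for_ 10 4 (put 15 (var 10 * var 4 + var 10) 1)

/-- The reachability matrix, by matrix multiplication as long as this is not slower than scanning the
edges. -/
def closure (P : Cmd) (r : ℕ) : Prog :=
  paddedSize ;;
  -- The fuel is of the order of the cost of scanning the edges, so an unsuccessful attempt at most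
  -- multiplies this cost by a constant.
  set 5 (var 2 * var 3 + var 2 * var 2 + 1) ;;
  set 6 0 ;;
  adjacency ;;
  closeBlocks P r ;;
  ite 0 (var 5)
    (for_ 14 2 (for_ 15 2 (put 14 (var 14 * var 2 + var 15)
      (1 - (1 - ld 15 (var 14 * var 4 + var 15))))))
    scanClosure

theorem closeLevel_wr {P : Cmd} {r x : ℕ} (h5 : x ≠ 5) (h6 : x ≠ 6) (hx : x < 13) :
    (closeLevel P r).wr x = false := by
  simp only [closeLevel, wr, combine_wr h5 h6 (by omega : x < 14)]
  interval_cases x <;> rfl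

theorem closeLevel_wm {P : Cmd} {r x : ℕ} (hx : x < 60) (h19 : x ≠ 19) (h15 : x ≠ 15) :
    (closeLevel P r).wm x = false := by
  simp only [closeLevel, wm, combine_wm hx h19 h15, Bool.or_false]

theorem closure_wr {P : Cmd} {r x : ℕ} (hx : x < 4) : (closure P r).wr x = false := by
  simp only [closure, closeBlocks, wr,
    closeLevel_wr (P := P) (r := r) (by omega : x ≠ 5) (by omega : x ≠ 6) (by omega)]
  interval_cases x <;> rfl

theorem closure_wm {P : Cmd} {r x : ℕ} (hx : x < 60) (h19 : x ≠ 19) (h15 : x ≠ 15) (h14 : x ≠ 14) :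
    (closure P r).wm x = false := by
  simp only [closure, closeBlocks, wm, closeLevel_wm (P := P) (r := r) hx h19 h15]
  interval_cases x <;> first | rfl | omega

theorem closure_wrm {P : Cmd} {r x : ℕ} : (closure P r).wrm x = false := by
  simp [closure, closeBlocks, closeLevel, wrm, combine_wrm, for_, paddedSize, adjacency, scanClosure,
    forIn, addColumn]

section

variable {N M : ℕ} {H : Dag N M} {P : Cmd} {k r B z d S L : ℕ} {τ : ℕ → ℕ} {s : State}

/-- There are d pairs of blocks, each handled with two products of size z. The entries touched
number O(z²) per pair, which makes O(z S) for the level. -/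
theorem wp_closeLevel (hH : H.Ordered) (hP : Multiplies P k τ) (hr : P.RegsBelow r)
    (hB : (S + 2) ^ k ≤ B) (hSB : S < B) (hz : s.reg 12 = z) (hz1 : 1 ≤ z)
    (hS : s.reg 4 = S) (hd : S = 2 * z * d) (hd1 : 1 ≤ d) (hs : s.Bounded B)
    (hst : StampsLe s) (hera : s.reg 6 + 2 * d < B) (hstage : 0 < s.reg 5 → Stage H S z 0 s) :
    wp B (closeLevel P r) (fun s' t => StampsLe s' ∧ s'.reg 6 = s.reg 6 + 2 * d ∧
      s'.reg 5 ≤ s.reg 5 ∧ s.reg 5 - s'.reg 5 ≤ 2 * τ z * d ∧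
      t ≤ multiplyCost P r * (s.reg 5 - s'.reg 5 + 2 * z * S) + 2 ∧
      (0 < s'.reg 5 → Stage H S z S s')) s := by
  have hzS : 2 * z ≤ S := by rw [hd]; exact Nat.le_mul_of_pos_right _ hd1
  rw [closeLevel, wp_seq, wp_set]
  refine ⟨by simp; omega, ?_⟩
  refine wp_loop (fun s' t => s'.Bounded B ∧ StampsLe s' ∧ ∃ c ≤ d, s'.reg 13 = 2 * z * c ∧
    s'.reg 6 = s.reg 6 + 2 * c ∧
    s'.reg 5 ≤ s.reg 5 ∧ s.reg 5 - s'.reg 5 ≤ 2 * τ z * c ∧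
    t ≤ multiplyCost P r * (s.reg 5 - s'.reg 5 + 4 * z ^ 2 * c) ∧
    (0 < s'.reg 5 → Stage H S z (2 * z * c) s')) (fun s' => S - s'.reg 13) ?_ ?_ ?_
  · refine ⟨⟨fun x => ?_, hs.2⟩, hst.setReg (by omega), 0, by omega, by simp, by simp, by simp,
      by simp, by simp, fun hf => hstage (by simpa using hf)⟩
    have := hs.1 x
    simp; split <;> omega
  · rintro s' t ⟨b1, st1, c, hc, e13, e6, e5, e5', ht, hstage'⟩ hF hlt
    have hF' : ∀ x, x ≠ 5 → x ≠ 6 → x < 13 → s'.reg x = s.reg x := by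
      intro x h5 h6 hx
      have : s'.reg x = (s.setReg 13 0).reg x := hF.reg x (by
        simp only [wr, combine_wr h5 h6 (by omega : x < 14)]
        interval_cases x <;> rfl)
      rw [this]; simp [show x ≠ 13 by omega]
    have h4 : s'.reg 4 = S := by rw [hF' 4 (by omega) (by omega) (by omega), hS]
    have h12 : s'.reg 12 = z := by rw [hF' 12 (by omega) (by omega) (by omega), hz]
    simp only [Expr.eval, e13, h4] at hlt
    have hcd : c < d := by
      rw [hd] at hlt
      exact lt_of_mul_lt_mul_left hlt (Nat.zero_le _)
    have hle : 2 * z * c + 2 * z ≤ S := by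
      rw [hd]
      calc 2 * z * c + 2 * z = 2 * z * (c + 1) := by ring
        _ ≤ _ := Nat.mul_le_mul_left _ hcd
    rw [wp_seq]
    refine (wp_combine hP hr (le_trans (Nat.pow_le_pow_left (by omega) _) hB) (by omega)
      (by omega) h12 hz1 e13 h4 hle b1 st1 (by omega)).mono_bounded b1 ?_
    rintro s₁ t₁ ⟨a1, a2, a3, a4, a5, a6⟩ hF₁ b₁
    have g13 : s₁.reg 13 = 2 * z * c := by
      rw [hF₁.reg 13 (combine_wr (by omega) (by omega) (by omega)), e13]
    have g12 : s₁.reg 12 = z := by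
      rw [hF₁.reg 12 (combine_wr (by omega) (by omega) (by omega)), h12]
    have hev : (var 13 + (var 12 + var 12) : Expr).eval s₁ = 2 * z * (c + 1) := by
      simp [g13, g12]; ring
    rw [wp_set, hev]
    have hnew : 2 * z * (c + 1) ≤ S := by rw [mul_add, mul_one]; exact hle
    refine ⟨by omega, ⟨⟨fun x => ?_, b₁.2⟩, a1.setReg (by omega), c + 1, hcd, by simp, ?_, ?_, ?_, ?_,
      ?_⟩, ?_⟩
    · have := b₁.1 x
      simp; split <;> omega
    · simp; omega
    · simp; omega
    · simp only [State.setReg_reg, Nat.reduceEqDiff, if_false]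
      rw [mul_add]; omega
    · simp only [State.setReg_reg, Nat.reduceEqDiff, if_false]
      have hz2 : 1 ≤ z ^ 2 := Nat.one_le_pow _ _ hz1
      have hK : 30 * z ^ 2 ≤ multiplyCost P r * z ^ 2 :=
        Nat.mul_le_mul_right _ (by simp [multiplyCost])
      have e : s.reg 5 - s₁.reg 5 = (s.reg 5 - s'.reg 5) + (s'.reg 5 - s₁.reg 5) := by omega
      have e2 : multiplyCost P r * (s.reg 5 - s₁.reg 5 + 4 * z ^ 2 * (c + 1)) =
          multiplyCost P r * (s.reg 5 - s'.reg 5 + 4 * z ^ 2 * c) +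
          multiplyCost P r * (s'.reg 5 - s₁.reg 5 + 3 * z ^ 2) + multiplyCost P r * z ^ 2 := by
        rw [e]; ring
      rw [e2]; omega
    · simp only [State.setReg_reg, Nat.reduceEqDiff, if_false]
      intro hf
      have h6 := hH.stage_step hz1 hle (hstage' (by omega)) (a6 hf).1 (a6 hf).2
      exact h6
    · simp only [State.setReg_reg, if_true, e13]
      rw [mul_add]; omega
  · rintro s' t ⟨b1, st1, c, hc, e13, e6, e5, e5', ht, hstage'⟩ hF hlt
    have h4 : s'.reg 4 = S := by
      have : s'.reg 4 = (s.setReg 13 0).reg 4 := hF.reg 4 (by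
        simp only [wr, combine_wr (by omega : 4 ≠ 5) (by omega : 4 ≠ 6) (by omega : 4 < 14)]
        rfl)
      rw [this]; simp [hS]
    simp only [Expr.eval, e13, h4] at hlt
    obtain rfl : c = d := by
      refine le_antisymm hc ?_
      rw [hd] at hlt
      exact le_of_mul_le_mul_left (not_lt.1 hlt) (by omega)
    refine ⟨st1, e6, e5, e5', ?_, ?_⟩
    · have : 4 * z ^ 2 * c = 2 * z * S := by rw [hd]; ring
      rw [this] at ht
      omega
    · intro hf
      rw [← hd] at hstage'
      exact hstage' hf

/-- The total number of steps that matrix multiplication takes. -/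
def levelSum (τ : ℕ → ℕ) (L l : ℕ) : ℕ := ∑ i ∈ Finset.range l, 2 ^ (L - i) * τ (2 ^ i)

/-- The block size doubles, so the terms z S for handling entries add up to O(S²). The era grows by
at most S on each of L < S levels; the hypothesis on (S + 2)² makes sure that it fits into a word.
-/
theorem wp_closeBlocks (hH : H.Ordered) (hP : Multiplies P k τ) (hr : P.RegsBelow r)
    (hB : (S + 2) ^ k ≤ B) (hSB : (S + 2) ^ 2 ≤ B) (hS : s.reg 4 = S) (hL : S = 2 ^ L)
    (hs : s.Bounded B) (hst : StampsLe s) (hera : s.reg 6 = 0)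
    (hstage : 0 < s.reg 5 → Stage H S 1 0 s) :
    wp B (closeBlocks P r) (fun s' t => s'.reg 5 ≤ s.reg 5 ∧
      s.reg 5 - s'.reg 5 ≤ levelSum τ L L ∧
      t ≤ multiplyCost P r * (s.reg 5 - s'.reg 5 + 3 * S * S) + 2 ∧
      (0 < s'.reg 5 → Stage H S S 0 s')) s := by
  have hS1 : 1 ≤ S := by rw [hL]; exact Nat.one_le_two_pow
  have hLS : L < S := by rw [hL]; exact Nat.lt_two_pow_self
  have hSB' : S * S + 4 * S + 4 ≤ B := by
    have : (S + 2) ^ 2 = S * S + 4 * S + 4 := by ring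
    omega
  rw [closeBlocks, wp_seq, wp_set]
  refine ⟨by simp; omega, ?_⟩
  refine wp_loop (fun s' t => s'.Bounded B ∧ StampsLe s' ∧ ∃ l ≤ L, s'.reg 12 = 2 ^ l ∧
    s'.reg 6 ≤ S * l ∧ s'.reg 5 ≤ s.reg 5 ∧ s.reg 5 - s'.reg 5 ≤ levelSum τ L l ∧
    t ≤ multiplyCost P r * (s.reg 5 - s'.reg 5 + 3 * S * 2 ^ l) ∧
    (0 < s'.reg 5 → Stage H S (2 ^ l) 0 s')) (fun s' => S - s'.reg 12) ?_ ?_ ?_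
  · refine ⟨⟨fun x => ?_, hs.2⟩, hst.setReg (by omega), 0, by omega, by simp, by simp [hera], by simp,
      by simp, by simp, fun hf => hstage (by simpa using hf)⟩
    have := hs.1 x
    simp; split <;> omega
  · rintro s' t ⟨b1, st1, l, hl, e12, e6, e5, e5', ht, hstage'⟩ hF hlt
    have h4 : s'.reg 4 = S := by
      have : s'.reg 4 = (s.setReg 12 1).reg 4 := hF.reg 4 (by
        simp only [wr, closeLevel_wr (by omega : 4 ≠ 5) (by omega : 4 ≠ 6) (by omega : 4 < 13)]
        rfl)
      rw [this]; simp [hS]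
    simp only [Expr.eval, e12, h4] at hlt
    have hlL : l < L := by
      rw [hL] at hlt
      exact (Nat.pow_lt_pow_iff_right (by omega)).1 hlt
    have hd : S = 2 * 2 ^ l * 2 ^ (L - l - 1) := by
      rw [hL, ← pow_succ', ← pow_add]; congr 1; omega
    have h2d : 2 * 2 ^ (L - l - 1) ≤ S := by
      rw [hd]
      have := Nat.one_le_two_pow (n := l)
      nlinarith [Nat.zero_le (2 ^ (L - l - 1))]
    have hl1 : S * l + S ≤ S * S := by
      have : S * (l + 1) ≤ S * S := Nat.mul_le_mul_left _ (by omega)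
      rw [mul_add, mul_one] at this; exact this
    rw [wp_seq]
    refine (wp_closeLevel hH hP hr hB (by omega) e12 Nat.one_le_two_pow h4 hd Nat.one_le_two_pow b1 st1
      (by omega) hstage').mono_bounded b1 ?_
    rintro s₁ t₁ ⟨a1, a2, a3, a4, a5, a6⟩ hF₁ b₁
    have g12 : s₁.reg 12 = 2 ^ l := by
      rw [hF₁.reg 12 (closeLevel_wr (by omega) (by omega) (by omega)), e12]
    have hev : (var 12 + var 12 : Expr).eval s₁ = 2 ^ (l + 1) := by
      simp [g12]; ring
    have h2 : 2 ^ (l + 1) ≤ S := by rw [hL]; exact Nat.pow_le_pow_right (by omega) hlL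
    rw [wp_set, hev]
    refine ⟨by omega, ⟨⟨fun x => ?_, b₁.2⟩, a1.setReg (by omega), l + 1, hlL, by simp, ?_, ?_, ?_, ?_,
      ?_⟩, ?_⟩
    · have := b₁.1 x
      simp; split <;> omega
    · simp only [State.setReg_reg, Nat.reduceEqDiff, if_false]
      rw [mul_add]; omega
    · simp; omega
    · simp only [State.setReg_reg, Nat.reduceEqDiff, if_false]
      have : 2 * τ (2 ^ l) * 2 ^ (L - l - 1) = 2 ^ (L - l) * τ (2 ^ l) := by
        rw [show L - l = L - l - 1 + 1 by omega, pow_succ]; simp only [Nat.add_sub_cancel]; ring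
      rw [this] at a4
      rw [levelSum, Finset.sum_range_succ, ← levelSum]
      omega
    · simp only [State.setReg_reg, Nat.reduceEqDiff, if_false]
      have hK : 30 * (S * 2 ^ l) ≤ multiplyCost P r * (S * 2 ^ l) :=
        Nat.mul_le_mul_right _ (by simp [multiplyCost])
      have h1 : 1 ≤ S * 2 ^ l := Nat.mul_pos hS1 Nat.one_le_two_pow
      have e : s.reg 5 - s₁.reg 5 = (s.reg 5 - s'.reg 5) + (s'.reg 5 - s₁.reg 5) := by omega
      have e2 : multiplyCost P r * (s.reg 5 - s₁.reg 5 + 3 * S * 2 ^ (l + 1)) =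
          multiplyCost P r * (s.reg 5 - s'.reg 5 + 3 * S * 2 ^ l) +
          multiplyCost P r * (s'.reg 5 - s₁.reg 5 + 2 * 2 ^ l * S) +
          multiplyCost P r * (S * 2 ^ l) := by
        rw [e, pow_succ]; ring
      rw [e2]; omega
    · simp only [State.setReg_reg, Nat.reduceEqDiff, if_false]
      intro hf
      have := Dag.Stage.double (a6 hf)
      rw [← pow_succ'] at this
      exact this
    · simp only [State.setReg_reg, if_true, e12]
      have : 2 ^ l < 2 ^ (l + 1) := Nat.pow_lt_pow_right (by omega) (by omega)
      omega
  · rintro s' t ⟨b1, st1, l, hl, e12, e6, e5, e5', ht, hstage'⟩ hF hlt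
    have h4 : s'.reg 4 = S := by
      have : s'.reg 4 = (s.setReg 12 1).reg 4 := hF.reg 4 (by
        simp only [wr, closeLevel_wr (by omega : 4 ≠ 5) (by omega : 4 ≠ 6) (by omega : 4 < 13)]
        rfl)
      rw [this]; simp [hS]
    simp only [Expr.eval, e12, h4] at hlt
    obtain rfl : l = L := by
      refine le_antisymm hl ?_
      by_contra h
      exact hlt (by rw [hL]; exact Nat.pow_lt_pow_right (by omega) (by omega))
    rw [← hL] at ht hstage'
    exact ⟨e5, e5', by omega, hstage'⟩

theorem wp_paddedSize (hN : s.reg 2 = N) (hNB : 2 * N + 1 < B) :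
    -- The summand 1 in the bound 2 N + 1 is there for N = 0, when the padded size is 1.
    wp B paddedSize (fun s' t => ∃ L, s'.reg 4 = 2 ^ L ∧ N ≤ 2 ^ L ∧ 2 ^ L ≤ 2 * N + 1 ∧
      t ≤ 4 * N + 4) s := by
  rw [paddedSize, wp_seq, wp_set]
  refine ⟨by simp; omega, ?_⟩
  refine wp_loop (fun s' t => ∃ l, s'.reg 4 = 2 ^ l ∧ 2 ^ l ≤ 2 * N + 1 ∧ t + 2 ≤ 2 * 2 ^ l)
    (fun s' => N - s'.reg 4) ⟨0, by simp⟩ ?_ ?_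
  · rintro s' t ⟨l, h4, hl, ht⟩ hF hlt
    have h2 : s'.reg 2 = N := by rw [hF.reg 2 rfl]; simp [hN]
    simp only [Expr.eval, h4, h2] at hlt
    have hev : (var 4 + var 4 : Expr).eval s' = 2 ^ (l + 1) := by simp [h4]; ring
    have := Nat.one_le_two_pow (n := l)
    rw [wp_set, hev]
    rw [pow_succ]
    refine ⟨by omega, ⟨l + 1, by simp [pow_succ], by omega, by omega⟩, ?_⟩
    simp [h4]; omega
  · rintro s' t ⟨l, h4, hl, ht⟩ hF hlt
    have h2 : s'.reg 2 = N := by rw [hF.reg 2 rfl]; simp [hN]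
    simp only [Expr.eval, h4, h2] at hlt
    exact ⟨l, h4, by omega, hl, by omega⟩

/-- Reachability is a relation on all natural numbers and reflexive also outside the graph, so the
padding gets a diagonal of ones too. With blocks of size 1 this matrix is a valid first stage. -/
theorem wp_adjacency {w : Fin M → ℝ} (hl : H.Loaded w s) (h15 : ∀ i, s.mem 15 i = 0)
    (hS : s.reg 4 = S) (hNS : N ≤ S) (hSB : S < B) (hMB : M < B) (h1B : 1 < B) :
    wp B adjacency (fun s' t => Stage H S 1 0 s' ∧ t ≤ 3 * M + 3 * S + 4) s := by
  rw [adjacency, wp_seq]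
  refine (wp_for_const (c := 1) (Q := fun s' t => (∀ i, ∀ j < S, 0 < s'.mem 15 (i * S + j) ↔ H.Edge i j) ∧
    t ≤ 3 * M + 2)
    (fun c s' => ∀ i, ∀ j < S, 0 < s'.mem 15 (i * S + j) ↔
      ∃ e : Fin M, (e : ℕ) < c ∧ ((H.edge e).1 : ℕ) = i ∧ ((H.edge e).2 : ℕ) = j)
    (by rw [hl.reg_M]; exact hMB) (by decide) rfl rfl (by simp [h15]) ?_ ?_).mono ?_
  · intro c hc s' hI h10 hF
    rw [hl.reg_M] at hc
    have h4 : s'.reg 4 = S := by rw [hF.reg 4 rfl, hS]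
    have et : s'.mem 10 c = (H.edge ⟨c, hc⟩).1 := by rw [hF.mem 10 rfl]; exact hl.tail ⟨c, hc⟩
    have eh : s'.mem 11 c = (H.edge ⟨c, hc⟩).2 := by rw [hF.mem 11 rfl]; exact hl.head ⟨c, hc⟩
    have hh := (H.edge ⟨c, hc⟩).2.2
    rw [wp_put]
    refine ⟨h1B, fun i j hj => ?_, le_rfl⟩
    have e1 : i * S + j = (H.edge ⟨c, hc⟩).1 * S + (H.edge ⟨c, hc⟩).2 ↔
      i = (H.edge ⟨c, hc⟩).1 ∧ j = (H.edge ⟨c, hc⟩).2 := mul_add_inj hj (by omega)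
    simp only [State.setReg_mem, State.setMem_mem, Expr.eval, h10, h4, et, eh,
      WordOp.eval_add, WordOp.eval_mul, e1, true_and]
    constructor
    · split_ifs with h
      · exact fun _ => ⟨⟨c, hc⟩, Nat.lt_succ_self c, h.1.symm, h.2.symm⟩
      · intro h'
        obtain ⟨e, h1, h2⟩ := (hI i j hj).1 h'
        exact ⟨e, by omega, h2⟩
    · rintro ⟨e, h1, h2, h3⟩
      split_ifs with h
      · exact Nat.one_pos
      · refine (hI i j hj).2 ⟨e, lt_of_le_of_ne (Nat.lt_succ_iff.1 h1) fun h4 => h ?_, h2, h3⟩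
        obtain rfl : e = ⟨c, hc⟩ := Fin.ext h4
        exact ⟨h2.symm, h3.symm⟩
  · intro s' t hI hF ht
    rw [hl.reg_M] at hI ht
    refine ⟨fun i j hj => (hI i j hj).trans (exists_congr fun e => and_iff_right e.2), by omega⟩
  rintro s₁ t₁ ⟨hE, ht₁⟩ hF₁
  have h4 : s₁.reg 4 = S := by rw [hF₁.reg 4 rfl, hS]
  refine wp_for_const (c := 1) (fun c s' => ∀ i, ∀ j < S, 0 < s'.mem 15 (i * S + j) ↔
      (i = j ∧ i < c) ∨ H.Edge i j) (by omega) (by decide) rfl rfl (by simpa using hE) ?_ ?_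
  · intro c hc s' hI h10 hF
    rw [h4] at hc
    have h4' : s'.reg 4 = S := by rw [hF.reg 4 rfl, h4]
    rw [wp_put]
    refine ⟨h1B, fun i j hj => ?_, le_rfl⟩
    have e1 : i * S + j = c * S + c ↔ i = c ∧ j = c := mul_add_inj hj hc
    simp only [State.setReg_mem, State.setMem_mem, Expr.eval, h10, h4',
      WordOp.eval_add, WordOp.eval_mul, e1, true_and]
    split_ifs with h
    · simp [h.1, h.2]
    · rw [hI i j hj]
      refine or_congr_left (and_congr_right fun hij => ?_)
      subst hij
      omega
  · intro s' t hI hF ht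
    rw [h4] at hI ht
    refine ⟨fun i hi j hj => ?_, by omega⟩
    rw [hI i j hj]
    refine or_congr_left ?_
    simp only [Nat.div_one, not_lt_zero, and_false, or_false]
    constructor
    · rintro ⟨rfl, -⟩; exact ⟨rfl, .refl⟩
    · rintro ⟨rfl, -⟩; exact ⟨rfl, hi⟩

/-- The closed padded matrix is copied to the reachability matrix. -/
theorem wp_copyClosure (hst : Stage H S S 0 s) (hNS : N ≤ S) (hN : s.reg 2 = N) (hS : s.reg 4 = S)
    (hNB : N < B) (h1B : 1 < B) :
    wp B (for_ 14 2 (for_ 15 2 (put 14 (var 14 * var 2 + var 15)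
      (1 - (1 - ld 15 (var 14 * var 4 + var 15))))))
      (fun s' t => H.Closed s' ∧ t ≤ 3 * N ^ 2 + 4 * N + 2) s := by
  have hidx : ∀ i, ∀ j < N, (i * N + j) / N = i ∧ (i * N + j) % N = j := by
    intro i j hj
    rw [mul_comm]
    exact ⟨by rw [Nat.mul_add_div (by omega), Nat.div_eq_of_lt hj, add_zero],
      by rw [Nat.mul_add_mod, Nat.mod_eq_of_lt hj]⟩
  refine wp_for₂ (c := 1) (fun c s' => ∀ i < c, s'.mem 14 i =
      1 - (1 - s.mem 15 (i / N * S + i % N)))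
    (by rw [hN]; omega) (by decide) (by decide) (by decide) rfl rfl rfl (fun _ _ _ h => h)
    (fun _ _ _ h => h) (by simp) ?_ ?_
  · intro i hi j hj s' hI g14 g15 hF'
    rw [hN] at hi hj hI ⊢
    have g2 : s'.reg 2 = N := by rw [hF'.reg 2 rfl, hN]
    have g4 : s'.reg 4 = S := by rw [hF'.reg 4 rfl, hS]
    have hev : (1 - (1 - ld 15 (var 14 * var 4 + var 15)) : Expr).eval s' =
        1 - (1 - s.mem 15 (i * S + j)) := by
      simp [g14, g15, g4, hF'.mem 15 rfl]
    rw [wp_put, hev]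
    refine ⟨by omega, fun l hl => ?_, le_rfl⟩
    rcases (Nat.lt_succ_iff.1 hl).lt_or_eq with h | rfl
    · simp [g14, g15, g2, h.ne, hI l h]
    · simp [g14, g15, g2, hidx i j hj]
  · intro s' t h _ ht
    rw [hN] at h ht
    refine ⟨fun i hi j hj => ?_, ht⟩
    have hij : i * N + j < N * N := by
      calc i * N + j < i * N + N := by omega
        _ = (i + 1) * N := by ring
        _ ≤ N * N := Nat.mul_le_mul_right _ hi
    rw [h _ hij, (hidx i j hj).1, (hidx i j hj).2]
    have h1 := hst i (by omega) j (by omega)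
    rw [Nat.div_eq_of_lt (by omega), Nat.div_eq_of_lt (by omega)] at h1
    by_cases hR : H.Reach i j
    · have h2 := h1.2 (.inl ⟨.inl rfl, hR⟩)
      simp only [hR, if_true]; omega
    · have h2 : ¬ 0 < s.mem 15 (i * S + j) := fun h => hR ((h1.1 h).elim (fun h => h.2)
          fun h => .single h)
      simp only [hR, if_false]; omega

/-- The time for the reachability matrix, per unit of the bound. -/
def closureCost (P : Cmd) (r : ℕ) : ℕ := 30 * multiplyCost P r + 100

theorem le_closureCost {D q t : ℕ} (h : t ≤ multiplyCost P r * (D + 24 * q + 6) +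
    50 * (D + q + M) + 50) : t ≤ closureCost P r * (D + q + M + 1) := by
  refine h.trans ?_
  rw [closureCost]
  generalize multiplyCost P r = K
  have h1 : K * (D + 24 * q + 6) ≤ K * (30 * (D + q + M + 1)) := Nat.mul_le_mul_left _ (by omega)
  calc K * (D + 24 * q + 6) + 50 * (D + q + M) + 50
      ≤ K * (30 * (D + q + M + 1)) + 100 * (D + q + M + 1) := by omega
    _ = _ := by ring

theorem Lists.of_eq {s s' : State} (h : Lists N M s) (h11 : s'.mem 11 = s.mem 11)
    (h12 : s'.mem 12 = s.mem 12) (h13 : s'.mem 13 = s.mem 13) : Lists N M s' :=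
  ⟨fun v hv => by rw [h12, h11, h.first v hv], fun e he => by rw [h13, h11, h.next e he]⟩

/-- D is the fuel that the multiplications have consumed. It is bounded both by the supply and by
the total time of the multiplications, and the whole procedure takes O(D + N² + M) steps whichever
way it ends. Thus the smaller of the two methods is paid for, although no running time is known to
the program. -/
theorem wp_closure {w : Fin M → ℝ} (hH : H.Ordered) (hP : Multiplies P k τ) (hr : P.RegsBelow r)
    (hl : H.Loaded w s) (hli : Lists N M s) (h14 : ∀ i, s.mem 14 i = 0) (h15 : ∀ i, s.mem 15 i = 0)
    (h60 : ∀ a i, s.mem (61 + 2 * a) i = 0) (hs : s.Bounded B)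
    (hB : (2 * N + 3) ^ k ≤ B) (hB2 : (2 * N + 3) ^ 2 ≤ B) (hF : N * M + N * N + 1 < B)
    (hMB : M < B) :
    wp B (closure P r) (fun s' t => H.Closed s' ∧ ∃ L D, 2 ^ L ≤ 2 * N + 1 ∧
      D ≤ N * M + N * N + 1 ∧ D ≤ levelSum τ L L ∧
      t ≤ closureCost P r * (D + N ^ 2 + M + 1)) s := by
  have hNB : 2 * N + 1 < B := by nlinarith
  have h1B : 1 < B := by omega
  rw [closure, wp_seq]
  refine (wp_paddedSize hl.reg_N hNB).mono_bounded hs ?_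
  rintro s₁ t₁ ⟨L, h4, hNL, hLN, ht₁⟩ hF₁ b₁
  have l₁ : H.Loaded w s₁ := hl.of_eq (hF₁.reg 2 rfl) (hF₁.reg 3 rfl) (hF₁.mem 10 rfl)
    (hF₁.mem 11 rfl) (hF₁.rmem 2 rfl)
  have hev : (var 2 * var 3 + var 2 * var 2 + 1 : Expr).eval s₁ = N * M + N * N + 1 := by
    simp [l₁.reg_N, l₁.reg_M]
  simp only [wp_seq, wp_set, hev]
  refine ⟨hF, by show 0 < B; omega, ?_⟩
  obtain ⟨s₂, hs₂⟩ : ∃ s₂, s₂ = (s₁.setReg 5 (N * M + N * N + 1)).setReg 6 0 := ⟨_, rfl⟩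
  have hs₂' : (s₁.setReg 5 (N * M + N * N + 1)).setReg 6
    ((0 : Expr).eval (s₁.setReg 5 (N * M + N * N + 1))) = s₂ := hs₂.symm
  rw [hs₂']
  have b₂ : s₂.Bounded B := ⟨fun x => by
    have := b₁.1 x
    simp only [hs₂, State.setReg_reg]
    split_ifs <;> omega, fun a i => by rw [hs₂]; exact b₁.2 a i⟩
  have l₂ : H.Loaded w s₂ := by rw [hs₂]; exact l₁.of_eq rfl rfl rfl rfl rfl
  refine (wp_adjacency l₂ (fun i => by simp [hs₂, hF₁.mem 15 rfl, h15]) (S := 2 ^ L)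
    (by simp [hs₂, h4]) hNL (by omega) hMB h1B).mono_bounded b₂ ?_
  rintro s₃ t₃ ⟨hstage, ht₃⟩ hF₃ b₃
  have hst : StampsLe s₃ := by
    intro a i
    have e15 : Nat.beq 15 (61 + 2 * a) = false :=
      Bool.eq_false_iff.2 fun h => by have := Nat.eq_of_beq_eq_true h; omega
    rw [hF₃.mem (61 + 2 * a) (by simp [adjacency, for_, wm, e15])]
    have : s₁.mem (61 + 2 * a) = s.mem (61 + 2 * a) := hF₁.mem _ (by simp [paddedSize, wm])
    simp [hs₂, this, h60]
  have h5 : s₃.reg 5 = N * M + N * N + 1 := by rw [hF₃.reg 5 rfl]; simp [hs₂]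
  have h6 : s₃.reg 6 = 0 := by rw [hF₃.reg 6 rfl]; simp [hs₂]
  have h4' : s₃.reg 4 = 2 ^ L := by rw [hF₃.reg 4 rfl]; simp [hs₂, h4]
  refine (wp_closeBlocks hH hP hr (le_trans (Nat.pow_le_pow_left (by omega) _) hB)
    (le_trans (Nat.pow_le_pow_left (by omega) _) hB2) h4' rfl b₃ hst h6 fun _ => hstage).mono_bounded
    b₃ ?_
  rintro s₄ t₄ ⟨c1, c2, c3, c4⟩ hF₄ b₄
  have r₄ : ∀ x, x ≠ 5 → x ≠ 6 → x < 12 → s₄.reg x = s₃.reg x := fun x h1 h2 h3 => hF₄.reg x (by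
    simp only [closeBlocks, wr, closeLevel_wr h1 h2 (by omega : x < 13)]
    interval_cases x <;> rfl)
  have m₄ : ∀ x < 60, x ≠ 19 → x ≠ 15 → s₄.mem x = s₃.mem x := fun x h1 h2 h3 => hF₄.mem x (by
    simp only [closeBlocks, wm, closeLevel_wm h1 h2 h3, Bool.or_false])
  have hm : ∀ x < 60, x ≠ 19 → x ≠ 15 → s₄.mem x = s.mem x := by
    intro x h1 h2 h3
    have e15 : Nat.beq 15 x = false :=
      Bool.eq_false_iff.2 fun h => by have := Nat.eq_of_beq_eq_true h; omega
    rw [m₄ x h1 h2 h3, hF₃.mem x (by simp [adjacency, for_, wm, e15]), hs₂]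
    exact hF₁.mem x (by simp [paddedSize, wm])
  have hrm : s₄.rmem 2 = s.rmem 2 := by
    rw [hF₄.rmem 2 (by simp [closeBlocks, closeLevel, wrm, combine_wrm]), hF₃.rmem 2 rfl, hs₂]
    exact hF₁.rmem 2 rfl
  have e2 : s₄.reg 2 = s.reg 2 := by
    rw [r₄ 2 (by omega) (by omega) (by omega), hF₃.reg 2 rfl, hs₂]
    exact hF₁.reg 2 rfl
  have e3 : s₄.reg 3 = s.reg 3 := by
    rw [r₄ 3 (by omega) (by omega) (by omega), hF₃.reg 3 rfl, hs₂]
    exact hF₁.reg 3 rfl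
  have e4 : s₄.reg 4 = 2 ^ L := by rw [r₄ 4 (by omega) (by omega) (by omega), h4']
  have l₄ : H.Loaded w s₄ := hl.of_eq e2 e3 (hm 10 (by omega) (by omega) (by omega))
    (hm 11 (by omega) (by omega) (by omega)) hrm
  have hli₄ : Lists N M s₄ := hli.of_eq (hm 11 (by omega) (by omega) (by omega))
    (hm 12 (by omega) (by omega) (by omega)) (hm 13 (by omega) (by omega) (by omega))
  have h14' : ∀ i, s₄.mem 14 i = 0 := fun i => by rw [hm 14 (by omega) (by omega) (by omega), h14]
  have hS2 : 3 * 2 ^ L * 2 ^ L ≤ 24 * N ^ 2 + 6 := by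
    have : 2 ^ L * 2 ^ L ≤ (2 * N + 1) * (2 * N + 1) := Nat.mul_le_mul hLN hLN
    have h : N ≤ N ^ 2 := Nat.le_self_pow (by omega) N
    nlinarith
  have hN2 : N ≤ N ^ 2 := Nat.le_self_pow (by omega) N
  rw [h5] at c1 c2 c3
  obtain ⟨D, hD⟩ : ∃ D, N * M + N * N + 1 - s₄.reg 5 = D := ⟨_, rfl⟩
  rw [hD] at c2 c3
  have c3' : t₄ ≤ multiplyCost P r * (D + 24 * N ^ 2 + 6) + 2 := by
    refine c3.trans (Nat.add_le_add_right (Nat.mul_le_mul_left _ (by omega)) _)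
  clear c3 hF₁ hF₃ hF₄ b₁ b₂ b₃ b₄ hs₂ hs₂' hst hstage r₄ m₄ hm l₁ l₂ hl hli hB hB2 hS2
  have hDle : D ≤ N * M + N * N + 1 := by omega
  rw [wp_ite]
  constructor
  · intro hf
    have hst4 := c4 hf
    refine (wp_copyClosure hst4 hNL l₄.reg_N e4 (by omega) h1B).mono ?_
    rintro s₅ t₅ ⟨g1, g2⟩ -
    refine ⟨g1, L, D, hLN, hDle, c2, le_closureCost ?_⟩
    omega
  · intro hf
    have hf0 : s₄.reg 5 = 0 := Nat.eq_zero_of_not_pos hf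
    -- The multiplications were interrupted, so D equals the whole supply, and this pays for the
    -- scan.
    have hDF : D = N * M + N * N + 1 := by omega
    refine (wp_scanClosure hH l₄ hli₄ h14' (by omega) hMB h1B).mono ?_
    rintro s₅ t₅ ⟨g1, g2⟩ -
    refine ⟨g1, L, D, hLN, hDle, c2, le_closureCost ?_⟩
    have g3 : t₅ ≤ 4 * (N * M) + 5 * M + 5 * N + 2 := g2.trans (le_of_eq (by ring))
    omega

end

end APSP

/-! ### One column of the tables: search for the last edge, and walk along the path -/

namespace APSP

open Prog _root_.APSP.Expr

/-- Find the next to last vertex, variable `12`, of the lexicographically first shortest path from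
variable `10` to variable `7`, and the weight of its last edge, real register `4`.  Variable `9`
counts the edges considered. -/
def search : Prog :=
  set 12 (var 2) ;;
  forIn (var 7) (
    set 9 (var 9 + 1) ;;
    set 13 (ld 10 (var 11 - 1)) ;;
    ite 0 (ld 14 (var 10 * var 2 + var 13)) (
      rget 1 3 (var 10 * var 2 + var 13) ;;
      rget 2 2 (var 11 - 1) ;;
      radd 1 1 2 ;;
      ite (var 12) (var 2)
        (rite 1 3 (rcopy 3 1 ;; rcopy 4 2 ;; set 12 (var 13))
          (rite 3 1 skip
            (ite (var 13) (var 12) (rcopy 3 1 ;; rcopy 4 2 ;; set 12 (var 13)) skip)))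
        (rcopy 3 1 ;; rcopy 4 2 ;; set 12 (var 13)))
      skip)

/-- Follow this path up to the first vertex with an entry, and make the entries for its vertices. -/
def walk : Prog :=
  set 14 (var 10) ;;
  loop (ld 16 (var 14 * var 2 + var 7)) 1 (
    ite (var 14) (var 12) (set 15 (ld 16 (var 14 * var 2 + var 12) - 1)) (set 15 (var 7)) ;;
    rget 1 3 (var 14 * var 2 + var 12) ;;
    radd 1 1 4 ;;
    rput 3 (var 14 * var 2 + var 7) 1 ;;
    put 16 (var 14 * var 2 + var 7) (var 15 + 1) ;;
    put 17 (var 14 * var 2 + var 7) (var 12) ;;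
    set 14 (var 15))

/-- Make the entries for the ancestors of variable `7`. -/
def column : Prog :=
  -- The root gets a nonzero entry at the start, so that every walk ends there at the latest.
  put 16 (var 7 * var 2 + var 7) (var 7 + 1) ;;
  set 9 0 ;;
  for_ 10 7 (
    ite 0 (ld 14 (var 10 * var 2 + var 7))
      (ite (ld 16 (var 10 * var 2 + var 7)) 1 (search ;; walk) skip)
      skip)

namespace Dag

variable {N M : ℕ} {H : Dag N M} {w : Fin M → ℝ} {s s' : State} {a b u v x : Fin N}

theorem wt_of_edge {e : Fin M} (he : H.edge e = (u, v)) : H.wt w u v = w e := by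
  rw [wt, Finset.sum_eq_single e]
  · rw [if_pos he]
  · intro e' _ hne
    rw [if_neg fun h => hne (H.edge_injective (h.trans he.symm))]
  · simp

theorem reach_iff_exists_isPath : H.Reach u v ↔ ∃ p, H.IsPath u v p :=
  reach_iff.trans exists_isPath_iff.symm

theorem LexFirst.reach (hH : H.Ordered) {p : List (Fin N)}
    (h : H.LexFirst w (Equiv.refl _) u v p) : H.Reach u v :=
  reach_iff_exists_isPath.2 ⟨p, (h.isShortest hH.isTopological).1⟩

/-- The tables contain the length and the second and the next to last vertex of the lexicographically
first shortest path from `a` to `v`. -/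
def Entry (H : Dag N M) (w : Fin M → ℝ) (s : State) (a v : Fin N) : Prop :=
  ∃ p, H.LexFirst w (Equiv.refl _) a v p ∧ s.rmem 3 (a * N + v) = H.length w p ∧
    (a ≠ v → ∃ x y q q', p = a :: x :: q ∧ p = q' ++ [y, v] ∧ s.mem 16 (a * N + v) = x + 1 ∧
      s.mem 17 (a * N + v) = y)

theorem Entry.of_eq (h : H.Entry w s a v) (h3 : s'.rmem 3 (a * N + v) = s.rmem 3 (a * N + v))
    (h16 : s'.mem 16 (a * N + v) = s.mem 16 (a * N + v))
    (h17 : s'.mem 17 (a * N + v) = s.mem 17 (a * N + v)) : H.Entry w s' a v := by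
  rwa [Entry, h3, h16, h17]

/-- The tables are complete for the ancestors of `v`. -/
def Column (H : Dag N M) (w : Fin M → ℝ) (s : State) (v : Fin N) : Prop :=
  ∀ a : Fin N, H.Reach a v → H.Entry w s a v

/-- The tables agree, except for the entries with the descendant `v`. -/
def AgreeOff (N v : ℕ) (s s' : State) : Prop :=
  ∀ i, ∀ j < N, j ≠ v → s'.rmem 3 (i * N + j) = s.rmem 3 (i * N + j) ∧
    s'.mem 16 (i * N + j) = s.mem 16 (i * N + j) ∧ s'.mem 17 (i * N + j) = s.mem 17 (i * N + j)

theorem AgreeOff.refl (N v : ℕ) (s : State) : AgreeOff N v s s := fun _ _ _ _ => ⟨rfl, rfl, rfl⟩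

theorem AgreeOff.trans {N v : ℕ} {s s' s'' : State} (h : AgreeOff N v s s')
    (h' : AgreeOff N v s' s'') : AgreeOff N v s s'' := fun i j hj hv => by
  obtain ⟨a1, a2, a3⟩ := h i j hj hv
  obtain ⟨b1, b2, b3⟩ := h' i j hj hv
  exact ⟨b1.trans a1, b2.trans a2, b3.trans a3⟩

theorem AgreeOff.entry (h : AgreeOff N v s s') (hb : b ≠ v) (he : H.Entry w s a b) :
    H.Entry w s' a b := by
  obtain ⟨h1, h2, h3⟩ := h a b b.2 (fun h => hb (Fin.ext h))
  exact he.of_eq h1 h2 h3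

theorem AgreeOff.column (h : AgreeOff N v s s') (hb : b ≠ v) (he : H.Column w s b) :
    H.Column w s' b := fun a ha => h.entry hb (he a ha)

/-- The vertices that have an entry with the descendant `v`. -/
def marked (N : ℕ) (s : State) (v : ℕ) : Finset (Fin N) :=
  Finset.univ.filter fun a => s.mem 16 (a * N + v) ≠ 0

theorem mem_marked {v : ℕ} : a ∈ marked N s v ↔ s.mem 16 (a * N + v) ≠ 0 := by simp [marked]

/-- The entries with the descendant `v` are correct, and there are entries for the whole path if there
is one for its first vertex. -/
structure Partial (H : Dag N M) (w : Fin M → ℝ) (s : State) (v : Fin N) : Prop where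
  root : v ∈ marked N s v
  entry : ∀ a ∈ marked N s v, H.Entry w s a v
  closed : ∀ a ∈ marked N s v, ∀ p, H.LexFirst w (Equiv.refl _) a v p → ∀ b ∈ p, b ∈ marked N s v

theorem inCount_eq_indeg {hd : ℕ → ℕ} (h : ∀ e : Fin M, hd e = (H.edge e).2) (v : Fin N) :
    inCount hd M v 0 = H.indeg v := by
  rw [inCount, indeg]
  refine (Finset.card_bij (fun (e : Fin M) _ => (e : ℕ)) ?_ ?_ ?_).symm
  · intro e he
    simp only [Finset.mem_filter, Finset.mem_univ, true_and] at he
    simp [h, he]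
  · intro e _ e' _ hee
    exact Fin.ext hee
  · intro e he
    simp only [Finset.mem_filter, Finset.mem_Ico] at he
    refine ⟨⟨e, he.1.2⟩, ?_, rfl⟩
    simp only [Finset.mem_filter, Finset.mem_univ, true_and]
    have := h ⟨e, he.1.2⟩
    exact Fin.ext (this.symm.trans he.2)

end Dag

section

open Dag

variable {N M B : ℕ} {H : Dag N M} {w : Fin M → ℝ} {s : State} {u v x : Fin N}

/-- The best edge entering `v` among those from `k` on. -/
def Best (H : Dag N M) (w : Fin M → ℝ) (u v : Fin N) (k : ℕ) (s : State) : Prop :=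
  (s.reg 12 = N ∧ ∀ e : Fin M, k ≤ e → (H.edge e).2 = v → ¬ H.Reach u (H.edge e).1) ∨
  ∃ x p e, s.reg 12 = (x : Fin N) ∧ k ≤ (e : Fin M) ∧ H.edge e = (x, v) ∧
    H.LexFirst w (Equiv.refl _) u x p ∧ s.rreg 3 = H.length w p + w e ∧ s.rreg 4 = w e ∧
    ∀ (e' : Fin M) y q, k ≤ e' → H.edge e' = (y, v) → H.LexFirst w (Equiv.refl _) u y q →
      s.rreg 3 < H.length w q + w e' ∨ s.rreg 3 = H.length w q + w e' ∧ x ≤ y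

/-- The distances from u to the tails are in their columns, which are complete. Register 12 holds N,
which is no vertex, as long as no candidate has been found. The edges come in the order of the input
rather than of their tails, so ties between lengths are decided by comparing the numbers of the
tails. -/
theorem wp_search (hH : H.Ordered) (hl : H.Loaded w s) (hli : Lists N M s) (hc : H.Closed s)
    (hv : s.reg 7 = v) (hu : s.reg 10 = u) (huv : u ≠ v) (hr : H.Reach u v)
    (hcol : ∀ x, H.Adj x v → H.Column w s x) (hNB : N < B) (hMB : M < B)
    (h9 : s.reg 9 + H.indeg v < B) :
    wp B search (fun s' t => (∃ x p, s'.reg 12 = (x : Fin N) ∧ H.Adj x v ∧ s'.rreg 4 = H.wt w x v ∧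
        H.LexFirst w (Equiv.refl _) u x p ∧ H.LexFirst w (Equiv.refl _) u v (p ++ [v])) ∧
      s'.reg 9 = s.reg 9 + H.indeg v ∧ t ≤ 15 * H.indeg v + 3) s := by
  have hσ := hH.isTopological
  have hcnt := inCount_eq_indeg hl.head v
  have hmono : ∀ k, inCount (s.mem 11) M v k ≤ inCount (s.mem 11) M v 0 := fun k =>
    Finset.card_le_card (Finset.filter_subset_filter _ (Finset.Ico_subset_Ico_left (Nat.zero_le _)))
  rw [search, wp_seq, wp_set]
  refine ⟨by simp [hl.reg_N]; exact hNB, ?_⟩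
  simp only [Expr.eval, hl.reg_N]
  refine wp_forIn 13 (fun k s' => s'.reg 9 = s.reg 9 + inCount (s.mem 11) M v k ∧ Best H w u v k s')
    (s := s.setReg 12 N) (v := v)
    ⟨fun v hv => hli.first v hv, fun e he => hli.next e he⟩ v.2 (by simp [hv]) hMB
    rfl rfl ?_ ?_ ?_ ?_
  · intro k
    refine ⟨by simp [inCount], .inl ⟨by simp, fun e he => ?_⟩⟩
    have := e.2
    omega
  · rintro e he hne s' ⟨h1, h2⟩
    simp only [State.setReg_mem] at hne
    have hne' : ∀ e' : Fin M, (H.edge e').2 = v → e ≤ (e' : ℕ) → e + 1 ≤ (e' : ℕ) := by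
      intro e' h3 h4
      rcases h4.lt_or_eq with h | rfl
      · exact h
      · rw [hl.head, h3] at hne
        exact absurd rfl hne
    refine ⟨by rw [h1, inCount_of_ne he hne], ?_⟩
    rcases h2 with ⟨h3, h4⟩ | ⟨x, p, e₁, g1, g2, g3, g4, g5, g6, g7⟩
    · exact .inl ⟨h3, fun e' h5 h6 => h4 e' (hne' e' h6 h5) h6⟩
    · refine .inr ⟨x, p, e₁, g1, by omega, g3, g4, g5, g6, fun e' y q k1 k2 k3 => ?_⟩
      exact g7 e' y q (hne' e' (by rw [k2]) k1) k2 k3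
  · rintro e he heq s' ⟨h9', hbest⟩ h11 hF
    simp only [State.setReg_mem] at heq
    obtain ⟨y, hy⟩ : ∃ y, H.edge ⟨e, he⟩ = (y, v) := by
      refine ⟨(H.edge ⟨e, he⟩).1, Prod.ext rfl (Fin.ext ?_)⟩
      rw [← hl.head]; exact heq
    have e2 : s'.reg 2 = N := by rw [hF.reg 2 rfl]; simp [hl.reg_N]
    have e10 : s'.reg 10 = u := by rw [hF.reg 10 rfl]; simp [hu]
    have em10 : s'.mem 10 e = y := by
      rw [hF.mem 10 rfl]
      have := hl.tail ⟨e, he⟩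
      rw [hy] at this
      exact this
    have em14 : s'.mem 14 = s.mem 14 := hF.mem 14 rfl
    have er3 : s'.rmem 3 = s.rmem 3 := hF.rmem 3 rfl
    have er2 : s'.rmem 2 e = w ⟨e, he⟩ := by
      rw [hF.rmem 2 rfl]
      exact hl.wt ⟨e, he⟩
    have hin := inCount_of_eq he heq
    have hm := hmono e
    have h9'' : s'.reg 9 + 1 = s.reg 9 + inCount (s.mem 11) M v e := by rw [h9', hin]; omega
    have hsplit : ∀ e' : Fin M, e ≤ (e' : ℕ) → e' = ⟨e, he⟩ ∨ e + 1 ≤ (e' : ℕ) := fun e' h => by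
      rcases h.lt_or_eq with h | h
      · exact .inr h
      · exact .inl (Fin.ext h.symm)
    have hRy := hc u u.2 y y.2
    -- The case in which the present edge becomes the best one; `hkeep` below is the case in which
    -- the old candidate stays.
    have hupd : ∀ (s'' : State) q, H.LexFirst w (Equiv.refl _) u y q → s''.reg 12 = y →
        s''.rreg 3 = H.length w q + w ⟨e, he⟩ → s''.rreg 4 = w ⟨e, he⟩ →
        (∀ (e' : Fin M) z r, e + 1 ≤ (e' : ℕ) → H.edge e' = (z, v) →
          H.LexFirst w (Equiv.refl _) u z r →
          s''.rreg 3 < H.length w r + w e' ∨ s''.rreg 3 = H.length w r + w e' ∧ y ≤ z) →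
        Best H w u v e s'' := by
      intro s'' q k1 k2 k3 k4 k5
      refine .inr ⟨y, q, ⟨e, he⟩, k2, le_rfl, hy, k1, k3, k4, fun e' z r j1 j2 j3 => ?_⟩
      rcases hsplit e' j1 with rfl | j4
      · obtain rfl : y = z := by rw [hy] at j2; exact (Prod.ext_iff.1 j2).1
        rw [k1.unique hσ j3] at k3
        exact .inr ⟨k3, le_rfl⟩
      · exact k5 e' z r j4 j2 j3
    simp only [wp_seq, wp_set, wp_ite, wp_rget, wp_radd, wp_rite, wp_rcopy, wp_skip, Expr.eval_sub,
      Expr.eval, h11, e2, e10, em10, State.setReg_reg,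
      State.setReg_mem, State.setRReg_reg, State.setRReg_rmem, State.setReg_rmem,
      State.setRReg_rreg, State.setReg_rreg, em14, er2, er3, Nat.reduceEqDiff,
      if_true, if_false, Nat.add_sub_cancel]
    have hyB := y.2
    refine ⟨by show s'.reg 9 + 1 < B; omega, by omega, fun hR => ?_, fun hR => ?_⟩
    · have hRch : H.Reach u y := by
        by_contra h
        rw [if_neg h] at hRy
        exact absurd hR (by simp [hRy])
      obtain ⟨p₀, hp₀, hD, -⟩ := hcol y ⟨_, hy⟩ u hRch
      have hD' : s.rmem 3 (WordOp.add.eval (WordOp.mul.eval (u : ℕ) N) y) = H.length w p₀ := hD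
      rw [hD']
      have hlt : s'.reg 12 < N → ∃ x p e₁, s'.reg 12 = (x : Fin N) ∧ e + 1 ≤ (e₁ : Fin M) ∧
          H.edge e₁ = (x, v) ∧ H.LexFirst w (Equiv.refl _) u x p ∧ s'.rreg 3 = H.length w p + w e₁ ∧
          s'.rreg 4 = w e₁ ∧ ∀ (e' : Fin M) y q, e + 1 ≤ e' → H.edge e' = (y, v) →
            H.LexFirst w (Equiv.refl _) u y q →
            s'.rreg 3 < H.length w q + w e' ∨ s'.rreg 3 = H.length w q + w e' ∧ x ≤ y := fun h =>
        hbest.resolve_left fun h' => by omega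
      have hkeep : ∀ s'' : State, s'.reg 12 < N → s''.reg 12 = s'.reg 12 → s''.rreg 3 = s'.rreg 3 →
          s''.rreg 4 = s'.rreg 4 → (s'.rreg 3 < H.length w p₀ + w ⟨e, he⟩ ∨
            s'.rreg 3 = H.length w p₀ + w ⟨e, he⟩ ∧ s'.reg 12 ≤ y) → Best H w u v e s'' := by
        intro s'' h k1 k2 k3 k4
        obtain ⟨x, p, e₁, g1, g2, g3, g4, g5, g6, g7⟩ := hlt h
        refine .inr ⟨x, p, e₁, k1.trans g1, by omega, g3, g4, k2.trans g5, k3.trans g6,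
          fun e' z r j1 j2 j3 => ?_⟩
        rw [k2]
        rcases hsplit e' j1 with rfl | j4
        · obtain rfl : y = z := by rw [hy] at j2; exact (Prod.ext_iff.1 j2).1
          rw [j3.unique hσ hp₀]
          rwa [g1] at k4
        · exact g7 e' z r j4 j2 j3
      -- The cases in order: the new path is shorter; it is longer; it is equally long and its tail
      -- has a lower number; equally long and its tail has no lower number; there was no candidate
      -- before.
      refine ⟨fun h => ⟨fun h1 => ⟨by omega, fun k => ⟨h9'', ?_⟩, by omega⟩,
        fun h1 => ⟨fun h2 => ⟨fun k => ⟨h9'', ?_⟩, by omega⟩,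
          fun h2 => ⟨fun h3 => ⟨by omega, fun k => ⟨h9'', ?_⟩, by omega⟩,
            fun h3 => ⟨fun k => ⟨h9'', ?_⟩, by omega⟩⟩⟩⟩,
        fun h => ⟨by omega, fun k => ⟨h9'', ?_⟩, by omega⟩⟩
      · refine hupd _ p₀ hp₀ (by simp) (by simp) (by simp) fun e' z r j1 j2 j3 => .inl ?_
        obtain ⟨x, p, e₁, g1, g2, g3, g4, g5, g6, g7⟩ := hlt h
        have h4 := g7 e' z r j1 j2 j3
        simp only [State.setReg_rreg, State.setRReg_rreg, Nat.reduceEqDiff, if_true, if_false]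
        rcases h4 with h4 | h4 <;> linarith [h4]
      · exact hkeep _ h (by simp) (by simp) (by simp) (.inl h2)
      · refine hupd _ p₀ hp₀ (by simp) (by simp) (by simp) fun e' z r j1 j2 j3 => ?_
        obtain ⟨x, p, e₁, g1, g2, g3, g4, g5, g6, g7⟩ := hlt h
        have h4 := g7 e' z r j1 j2 j3
        simp only [State.setReg_rreg, State.setRReg_rreg, Nat.reduceEqDiff, if_true, if_false]
        have h5 : s'.rreg 3 = H.length w p₀ + w ⟨e, he⟩ := le_antisymm (not_lt.1 h1) (not_lt.1 h2)
        rw [← h5]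
        refine h4.imp_right fun h4 => ⟨h4.1, le_trans ?_ h4.2⟩
        rw [g1] at h3
        exact le_of_lt h3
      · exact hkeep _ h (by simp) (by simp) (by simp)
          (.inr ⟨le_antisymm (not_lt.1 h1) (not_lt.1 h2), not_lt.1 h3⟩)
      · refine hupd _ p₀ hp₀ (by simp) (by simp) (by simp) fun e' z r j1 j2 j3 => ?_
        rcases hbest with ⟨h3, h4⟩ | ⟨x, p, e₁, g1, g2, g3, g4, g5, g6, g7⟩
        · refine absurd (j3.reach hH) ?_
          have := h4 e' j1 (by rw [j2])
          rwa [j2] at this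
        · have := x.2
          omega
    · have hRch : ¬ H.Reach u y := by
        intro h
        rw [if_pos h] at hRy
        exact hR (by simp [hRy])
      refine ⟨fun k => ⟨h9'', ?_⟩, by omega⟩
      rcases hbest with ⟨h3, h4⟩ | ⟨x, p, e₁, g1, g2, g3, g4, g5, g6, g7⟩
      · refine .inl ⟨by simpa using h3, fun e' j1 j2 => ?_⟩
        rcases hsplit e' j1 with rfl | j4
        · rwa [hy]
        · exact h4 e' j4 j2
      · refine .inr ⟨x, p, e₁, by simpa using g1, by omega, g3, g4, by simpa using g5,
          by simpa using g6, fun e' z r j1 j2 j3 => ?_⟩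
        rcases hsplit e' j1 with rfl | j4
        · obtain rfl : y = z := by rw [hy] at j2; exact (Prod.ext_iff.1 j2).1
          exact absurd (j3.reach hH) hRch
        · simpa using g7 e' z r j4 j2 j3
  · rintro s' t ⟨h1, h2⟩ hF ht
    rw [State.setReg_mem, hcnt] at ht
    refine ⟨?_, by rw [h1, hcnt], by omega⟩
    obtain ⟨q₀, hq₀⟩ := reach_iff_exists_isPath.1 hr
    rcases h2 with ⟨-, h4⟩ | ⟨x, p, e₁, g1, g2, g3, g4, g5, g6, g7⟩
    -- There must be a candidate, because a path from u to v ≠ u has a last edge, whose tail can be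
    -- reached from u.
    · exfalso
      rcases hq₀.cases with ⟨h, -⟩ | ⟨y, q, -, hy, e, he⟩
      · exact huv h
      · refine h4 e (Nat.zero_le _) (by rw [he]) ?_
        rw [he]; exact reach_iff_exists_isPath.2 ⟨q, hy⟩
    · refine ⟨x, p, g1, ⟨e₁, g3⟩, by rw [g6, wt_of_edge g3], g4, ?_⟩
      refine lexFirst_of_forall_le hσ huv g4 ⟨e₁, g3⟩ (fun y q _ hq => hq.exists_lexFirst hσ w) ?_
      rintro y q ⟨e, he⟩ hq
      rw [wt_of_edge g3, wt_of_edge he, ← g5]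
      exact g7 e y q (Nat.zero_le _) he hq

end

end APSP

namespace APSP

open Prog _root_.APSP.Expr Dag

variable {N M B : ℕ} {H : Dag N M} {w : Fin M → ℝ} {s : State} {u v x : Fin N}

/-- One step of `walk`: the next vertex, and the entry for the vertex `a`. -/
theorem entry_snoc (hH : H.Ordered) {p' p₁ p₂ : List (Fin N)} {a : Fin N} (hxv : H.Adj x v)
    (hx : H.LexFirst w (Equiv.refl _) u x p') (hv : H.LexFirst w (Equiv.refl _) u v (p' ++ [v]))
    (hp : p' ++ [v] = p₁ ++ a :: p₂) (ha : a ≠ v) (hcol : H.Column w s x) :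
    ∃ y p₃, p₂ = y :: p₃ ∧ a ≤ x ∧
      (y : ℕ) = (if (a : ℕ) < x then s.mem 16 (a * N + x) - 1 else v) ∧ a < y ∧
      ∀ s' : State, s'.rmem 3 (a * N + v) = s.rmem 3 (a * N + x) + H.wt w x v →
        s'.mem 16 (a * N + v) = y + 1 → s'.mem 17 (a * N + v) = x → H.Entry w s' a v := by
  have hσ := hH.isTopological
  have hav := hv.right hp
  obtain ⟨p₂', rfl⟩ : ∃ p₂', p₂ = p₂' ++ [v] := by
    obtain ⟨q, hq⟩ := (hav.isShortest hσ).1.eq_snoc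
    cases q with
    | nil => exact absurd (by simpa using hq : a = v ∧ _).1 ha
    | cons b q => exact ⟨q, (List.cons.inj hq).2⟩
  have hp' : p' = p₁ ++ a :: p₂' := by
    have : p' ++ [v] = (p₁ ++ a :: p₂') ++ [v] := by rw [hp]; simp
    exact List.append_cancel_right this
  have hax := hx.right hp'
  have hle : a ≤ x := hH.le (hax.reach hH)
  obtain ⟨q, hq, hD, hq'⟩ := hcol a (hax.reach hH)
  obtain rfl := hq.unique hσ hax
  obtain ⟨q', hq''⟩ := (hax.isShortest hσ).1.eq_snoc
  have hlen := (hax.isShortest hσ).1.length_snoc (v := v) w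
  have hentry : ∀ y p₃, p₂' ++ [v] = y :: p₃ → ∀ s' : State,
      s'.rmem 3 (a * N + v) = s.rmem 3 (a * N + x) + H.wt w x v →
        s'.mem 16 (a * N + v) = y + 1 → s'.mem 17 (a * N + v) = x → H.Entry w s' a v := by
    intro y p₃ hy s' h3 h16 h17
    refine ⟨a :: (p₂' ++ [v]), hav, ?_, fun _ => ⟨y, x, p₃, q', by rw [hy], ?_, h16, h17⟩⟩
    · rw [h3, hD, ← List.cons_append, hlen]
    · rw [← List.cons_append, hq'']; simp
  -- For a = x the rest of the path is the single edge to v. Otherwise its second vertex is that of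
  -- the path from a to x, which the column of x contains.
  by_cases h : a = x
  · subst h
    obtain rfl : p₂' = [] := by
      have := hσ.isPath_self (hax.isShortest hσ).1
      simpa using this
    exact ⟨v, [], rfl, le_rfl, by simp, hH _ _ hxv, hentry v [] rfl⟩
  · obtain ⟨y, -, r, -, hr, -, h16, -⟩ := hq' h
    obtain rfl : p₂' = y :: r := (List.cons.inj hr).2
    have hay : a < y := by
      have := ((hax.isShortest hσ).1).2.2
      exact hH _ _ (List.isChain_cons_cons.1 this).1
    refine ⟨y, r ++ [v], rfl, hle, ?_, hay, hentry y _ rfl⟩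
    have hlt : (a : ℕ) < x := lt_of_le_of_ne hle fun h' => h (Fin.ext h')
    rw [if_pos hlt, h16, Nat.add_sub_cancel]

/-- Every pass makes an entry for a vertex that had none, so the time is charged to the growth of
the set of vertices with entries; over a whole column this adds up to O(N). The walk may stop at the
first vertex that has an entry, because then the whole rest of the path has entries; this also shows
that the enlarged set is closed along paths again. -/
theorem wp_walk (hH : H.Ordered) (hN : s.reg 2 = N) (hv : s.reg 7 = v) (hu : s.reg 10 = u)
    (hx : s.reg 12 = x) (hxv : H.Adj x v) (h4 : s.rreg 4 = H.wt w x v) {p : List (Fin N)}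
    (hp : H.LexFirst w (Equiv.refl _) u x p) (hpv : H.LexFirst w (Equiv.refl _) u v (p ++ [v]))
    (hcol : H.Column w s x) (hpart : H.Partial w s v) (hNB : N < B) :
    wp B walk (fun s' t => H.Partial w s' v ∧ AgreeOff N v s s' ∧ marked N s v ⊆ marked N s' v ∧
      u ∈ marked N s' v ∧ t + 10 * (marked N s v).card ≤ 10 * (marked N s' v).card + 2) s := by
  have hσ := hH.isTopological
  have hxltv : x < v := hH _ _ hxv
  have hpp := (hpv.isShortest hσ).1
  have huB := u.2
  rw [walk, wp_seq, wp_set]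
  refine ⟨by simp [hu]; omega, ?_⟩
  simp only [Expr.eval, hu]
  refine wp_loop (fun s' t => AgreeOff N v s s' ∧
    (∃ (a : Fin N) (p₁ p₂ : List (Fin N)), p ++ [v] = p₁ ++ a :: p₂ ∧ s'.reg 14 = a ∧
      ∀ b, b ∈ marked N s' v ↔ b ∈ marked N s v ∨ b ∈ p₁) ∧
    (∀ b ∈ marked N s' v, H.Entry w s' b v) ∧
    t + 10 * (marked N s v).card ≤ 10 * (marked N s' v).card)
    -- Numbers increase along the path, which bounds the walk.
    (fun s' => N - s'.reg 14) ?_ ?_ ?_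
  · obtain ⟨r, hr⟩ := hpp.eq_cons
    exact ⟨AgreeOff.refl _ _ _, ⟨u, [], r, hr, by simp, by simp [mem_marked]⟩,
      fun b hb => (hpart.entry b hb).of_eq rfl rfl rfl, by
      rw [Nat.zero_add]; exact le_rfl⟩
  · rintro s' t ⟨hoff, ⟨a, p₁, p₂, hpa, h14, hmk⟩, hent, ht⟩ hF hlt
    have e2 : s'.reg 2 = N := by rw [hF.reg 2 rfl]; simp [hN]
    have e7 : s'.reg 7 = v := by rw [hF.reg 7 rfl]; simp [hv]
    have e12 : s'.reg 12 = x := by rw [hF.reg 12 rfl]; simp [hx]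
    have er4 : s'.rreg 4 = H.wt w x v := by rw [hF.rreg 4 rfl]; simp [h4]
    have haN : a ∉ marked N s' v := by
      rw [mem_marked, not_not]
      have : s'.mem 16 (s'.reg 14 * s'.reg 2 + s'.reg 7) < 1 := hlt
      rw [h14, e2, e7] at this
      omega
    have hav : a ≠ v := by
      rintro rfl
      exact haN ((hmk a).2 (.inl hpart.root))
    obtain ⟨y, p₃, rfl, hax, hy, hay, hE⟩ := entry_snoc hH hxv hp hpv hpa hav
      (hoff.column hxltv.ne hcol)
    have hyB := y.2
    have hxB := x.2
    have hvB := v.2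
    have key : ∀ s'' : State, s''.reg 14 = y →
        (∀ i, s''.mem 16 i = if i = a * N + v then (y : ℕ) + 1 else s'.mem 16 i) →
        (∀ i, s''.mem 17 i = if i = a * N + v then (x : ℕ) else s'.mem 17 i) →
        (∀ i, s''.rmem 3 i = if i = a * N + v then s'.rmem 3 (a * N + x) + H.wt w x v
          else s'.rmem 3 i) →
        (AgreeOff N v s s'' ∧
          (∃ (a : Fin N) (p₁ p₂ : List (Fin N)), p ++ [v] = p₁ ++ a :: p₂ ∧ s''.reg 14 = a ∧
            ∀ b, b ∈ marked N s'' v ↔ b ∈ marked N s v ∨ b ∈ p₁) ∧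
          (∀ b ∈ marked N s'' v, H.Entry w s'' b v) ∧
          t + 8 + 1 + 10 * (marked N s v).card ≤ 10 * (marked N s'' v).card) ∧
        N - s''.reg 14 < N - s'.reg 14 := by
      intro s'' k14 k16 k17 k3
      have hne : ∀ b : Fin N, b ≠ a → (b : ℕ) * N + v ≠ a * N + v := fun b hb h =>
        hb (Fin.ext ((mul_add_inj hvB hvB).1 h).1)
      have hmk' : marked N s'' v = insert a (marked N s' v) := by
        ext b
        rw [Finset.mem_insert, mem_marked, mem_marked, k16]
        by_cases hb : b = a
        · simp [hb]
        · rw [if_neg (hne b hb)]; simp [hb]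
      refine ⟨⟨hoff.trans fun i j hj hjv => ?_, ⟨y, p₁ ++ [a], p₃, by simp [hpa], k14, fun b => ?_⟩,
        fun b hb => ?_, ?_⟩, ?_⟩
      · have hij : i * N + j ≠ a * N + v := fun h => hjv ((mul_add_inj hj hvB).1 h).2
        rw [k16, k17, k3, if_neg hij, if_neg hij, if_neg hij]
        exact ⟨rfl, rfl, rfl⟩
      · rw [hmk', Finset.mem_insert, hmk, List.mem_append, List.mem_singleton]
        tauto
      · rw [hmk', Finset.mem_insert] at hb
        by_cases hba : b = a
        · subst hba
          exact hE s'' (by rw [k3, if_pos rfl]) (by rw [k16, if_pos rfl]) (by rw [k17, if_pos rfl])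
        · have hij := hne b hba
          exact (hent b (hb.resolve_left hba)).of_eq (by rw [k3, if_neg hij])
            (by rw [k16, if_neg hij]) (by rw [k17, if_neg hij])
      · rw [hmk', Finset.card_insert_of_notMem haN]; omega
      · rw [k14, h14]
        have : (a : ℕ) < y := hay
        omega
    rw [wp_seq]
    have hnext : wp B (.ite (var 14) (var 12) (set 15 (ld 16 (var 14 * var 2 + var 12) - 1))
        (set 15 (var 7))) (fun s'' t => s'' = s'.setReg 15 y ∧ t = 2) s' := by
      rw [wp_ite, wp_set, wp_set]
      have e16 : (ld 16 (var 14 * var 2 + var 12) - 1 : Expr).eval s' =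
        s'.mem 16 (a * N + x) - 1 := by simp [h14, e2, e12]
      have ev : (var 7 : Expr).eval s' = v := e7
      rw [e16, ev]
      simp only [Expr.eval, h14, e12]
      constructor
      · intro h
        rw [if_pos h] at hy
        rw [← hy]
        exact ⟨by omega, rfl, trivial⟩
      · intro h
        rw [if_neg h] at hy
        rw [← hy]
        exact ⟨by omega, rfl, trivial⟩
    refine hnext.mono ?_
    rintro _ _ ⟨rfl, rfl⟩ -
    refine wp.mono (Q := fun s'' t' => s''.reg 14 = y ∧
        (∀ i, s''.mem 16 i = if i = a * N + v then (y : ℕ) + 1 else s'.mem 16 i) ∧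
        (∀ i, s''.mem 17 i = if i = a * N + v then (x : ℕ) else s'.mem 17 i) ∧
        (∀ i, s''.rmem 3 i = if i = a * N + v then s'.rmem 3 (a * N + x) + H.wt w x v
          else s'.rmem 3 i) ∧ t' = 6) ?_ ?_
    · simp [h14, e2, e7, e12, er4]
      omega
    · rintro s'' _ ⟨k1, k2, k3, k4, rfl⟩ -
      exact key s'' k1 k2 k3 k4
  · rintro s' t ⟨hoff, ⟨a, p₁, p₂, hpa, h14, hmk⟩, hent, ht⟩ hF hlt
    have e2 : s'.reg 2 = N := by rw [hF.reg 2 rfl]; simp [hN]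
    have e7 : s'.reg 7 = v := by rw [hF.reg 7 rfl]; simp [hv]
    have haN : a ∈ marked N s' v := by
      rw [mem_marked]
      have : ¬ s'.mem 16 (s'.reg 14 * s'.reg 2 + s'.reg 7) < 1 := hlt
      rw [h14, e2, e7] at this
      omega
    -- A path in an acyclic graph does not return to a vertex, so the entry found at a was not made
    -- by this walk.
    have hnd : a ∉ p₁ := by
      intro ha
      obtain ⟨q₁, q₂, rfl⟩ := List.append_of_mem ha
      have h1 := hpv.right (p₁ := q₁) (a := a) (p₂ := q₂ ++ a :: p₂) (by rw [hpa]; simp)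
      have h2 := (isPath_split (p₁ := a :: q₂) (a := a) (p₂ := p₂)).1 (h1.isShortest hσ).1
      have h3 := hσ.isPath_self h2.1
      simp at h3
    have haS : a ∈ marked N s v := ((hmk a).1 haN).resolve_right hnd
    have hall : ∀ b ∈ p ++ [v], b ∈ marked N s' v := by
      intro b hb
      rw [hpa, List.mem_append] at hb
      rcases hb with hb | hb
      · exact (hmk b).2 (.inr hb)
      · exact (hmk b).2 (.inl (hpart.closed a haS _ (hpv.right hpa) b hb))
    have hsub : marked N s v ⊆ marked N s' v := fun b hb => (hmk b).2 (.inl hb)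
    refine ⟨⟨hsub hpart.root, hent, fun b hb q hq c hc => ?_⟩, hoff, hsub, hall u ?_, by omega⟩
    · rcases (hmk b).1 hb with h | h
      · exact hsub (hpart.closed b h q hq c hc)
      · obtain ⟨q₁, q₂, rfl⟩ := List.append_of_mem h
        have h1 : p ++ [v] = q₁ ++ b :: (q₂ ++ a :: p₂) := by rw [hpa]; simp
        rw [hq.unique hσ (hpv.right h1)] at hc
        refine hall c ?_
        rw [h1]
        exact List.mem_append_right _ hc
    · obtain ⟨r, hr⟩ := hpp.eq_cons
      rw [hr]; simp

/-- L collects the vertices for which a search was made. All of them are leaves of the tree, and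
each search inspects every edge entering v once; so the number of inspections, register 9, is
indeg(v) times the size of L. The other work is O(N). -/
theorem wp_column (hH : H.Ordered) (hl : H.Loaded w s) (hli : Lists N M s) (hc : H.Closed s)
    (hv : s.reg 7 = v) (hcol : ∀ x, H.Adj x v → H.Column w s x) (h16 : ∀ a < N, s.mem 16 (a * N + v) = 0)
    (h3 : s.rmem 3 (v * N + v) = 0) (hNB : N < B) (hMB : M < B) (hIB : H.indeg v * N < B) :
    wp B column (fun s' t => AgreeOff N v s s' ∧ H.Column w s' v ∧
      s'.reg 9 ≤ H.indeg v * (H.leaf w (Equiv.refl _) v).ncard ∧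
      t ≤ 30 * (N + 1 + s'.reg 9)) s := by
  have hσ := hH.isTopological
  have hvB := v.2
  have e2 : s.reg 2 = N := hl.reg_N
  rw [column, wp_seq, wp_put]
  have hidx : (var 7 * var 2 + var 7 : Expr).eval s = v * N + v := by simp [hv, e2]
  have hval : (var 7 + 1 : Expr).eval s = v + 1 := by simp [hv]
  rw [hidx, hval, wp_seq, wp_set]
  refine ⟨by omega, by show 0 < B; omega, ?_⟩
  obtain ⟨s₁, hs₁⟩ : ∃ s₁, s₁ = (s.setMem 16 (v * N + v) (v + 1)).setReg 9
    ((0 : Expr).eval (s.setMem 16 (v * N + v) (v + 1))) := ⟨_, rfl⟩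
  rw [← hs₁]
  have g9 : s₁.reg 9 = 0 := by rw [hs₁]; simp
  have g7 : s₁.reg 7 = v := by rw [hs₁]; simp [hv]
  have gm : ∀ a, a ≠ 16 → s₁.mem a = s.mem a := fun a ha => by
    rw [hs₁]; funext i; simp [ha]
  have gr : s₁.rmem = s.rmem := by rw [hs₁]; rfl
  have gx : ∀ x, x ≠ 9 → s₁.reg x = s.reg x := fun x hx => by rw [hs₁]; simp [hx]
  have g16 : ∀ i, s₁.mem 16 i = if i = v * N + v then (v : ℕ) + 1 else s.mem 16 i := fun i => by
    rw [hs₁]; simp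
  have hmk : marked N s₁ v = {v} := by
    ext a
    rw [mem_marked, g16, Finset.mem_singleton]
    by_cases ha : a = v
    · simp [ha]
    · rw [if_neg (fun h => ha (Fin.ext ((mul_add_inj hvB hvB).1 h).1)), h16 a a.2]
      simp [ha]
  have hoff₁ : AgreeOff N v s s₁ := fun i j hj hjv => by
    rw [gr, gm 17 (by decide), g16, if_neg fun h => hjv ((mul_add_inj hj hvB).1 h).2]
    exact ⟨rfl, rfl, rfl⟩
  have hpart₁ : H.Partial w s₁ v := by
    refine ⟨by simp [hmk], fun a ha => ?_, fun a ha p hp b hb => ?_⟩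
    · rw [hmk, Finset.mem_singleton] at ha
      subst ha
      exact ⟨[a], .refl, by rw [gr, h3]; simp [Dag.length], fun h => absurd rfl h⟩
    · rw [hmk, Finset.mem_singleton] at ha ⊢
      subst ha
      rw [hσ.isPath_self (hp.isShortest hσ).1] at hb
      simpa using hb
  refine wp_for (fun i s' t => H.Partial w s' v ∧ AgreeOff N v s s' ∧
    (∀ a : Fin N, (a : ℕ) < i → H.Reach a v → a ∈ marked N s' v) ∧
    (∃ L : Finset (Fin N), (L : Set (Fin N)) ⊆ H.leaf w (Equiv.refl _) v ∧
      (∀ a ∈ L, (a : ℕ) < i) ∧ L.card ≤ i ∧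
      s'.reg 9 = H.indeg v * L.card) ∧
    t ≤ 15 * s'.reg 9 + 10 * (marked N s' v).card + 15 * i) (by rw [g7]; omega) (by decide) rfl rfl
    ⟨?_, ?_, ?_, ⟨∅, ?_, ?_, ?_, ?_⟩, ?_⟩ ?_ ?_
  · exact ⟨hpart₁.root, fun a ha => (hpart₁.entry a ha).of_eq rfl rfl rfl, hpart₁.closed⟩
  · exact hoff₁
  · intro a ha; omega
  · simp
  · simp
  · simp
  · simp [g9]
  · simp
  · rintro i hi s' t ⟨hpart, hoff, hcov, ⟨L, hL, hLu, hLi, h9⟩, ht⟩ h10 hF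
    rw [g7] at hi
    obtain ⟨u, hu⟩ : ∃ u : Fin N, (u : ℕ) = i := ⟨⟨i, by omega⟩, rfl⟩
    subst hu
    have huv : u ≠ v := fun h => by rw [h] at hi; omega
    have f2 : s'.reg 2 = N := by rw [hF.reg 2 rfl, gx 2 (by decide), e2]
    have f7 : s'.reg 7 = v := by rw [hF.reg 7 rfl, g7]
    have fm : ∀ a < 16, s'.mem a = s.mem a := fun a ha => by
      rw [hF.mem a (by interval_cases a <;> rfl), gm a (by omega)]
    have l' : H.Loaded w s' := hl.of_eq (f2.trans e2.symm)
      (by rw [hF.reg 3 rfl, gx 3 (by decide)]) (fm 10 (by omega)) (fm 11 (by omega))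
      (by rw [hF.rmem 2 rfl, gr])
    have li' : Lists N M s' := hli.of_eq (fm 11 (by omega)) (fm 12 (by omega)) (fm 13 (by omega))
    have c' : H.Closed s' := fun i hi j hj => by rw [fm 14 (by omega)]; exact hc i hi j hj
    have hmem : ∀ (a : Fin N) (s'' : State) (k : ℕ), a ∈ marked N (s''.setReg 10 k) v ↔
      a ∈ marked N s'' v := fun a s'' k => by simp [mem_marked]
    have hmkeq : ∀ (s'' : State) (k : ℕ), marked N (s''.setReg 10 k) v = marked N s'' v :=
      fun s'' k => Finset.ext fun a => hmem a s'' k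
    have hpartR : ∀ (s'' : State) (k : ℕ), H.Partial w s'' v → H.Partial w (s''.setReg 10 k) v :=
      fun s'' k h => ⟨h.root, fun a ha => (h.entry a ha).of_eq rfl rfl rfl, h.closed⟩
    have hskip : (H.Reach u v → u ∈ marked N s' v) → ∀ t' ≤ 3,
        H.Partial w (s'.setReg 10 (u + 1)) v ∧ AgreeOff N v s (s'.setReg 10 (u + 1)) ∧
        (∀ a : Fin N, (a : ℕ) < u + 1 → H.Reach a v → a ∈ marked N (s'.setReg 10 (u + 1)) v) ∧
        (∃ L : Finset (Fin N), (L : Set (Fin N)) ⊆ H.leaf w (Equiv.refl _) v ∧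
          (∀ a ∈ L, (a : ℕ) < u + 1) ∧ L.card ≤ (u : ℕ) + 1 ∧ (s'.setReg 10 (u + 1)).reg 9 = H.indeg v * L.card) ∧
        t + t' + 2 ≤ 15 * (s'.setReg 10 (u + 1)).reg 9 +
          10 * (marked N (s'.setReg 10 (u + 1)) v).card + 15 * (u + 1) := by
      intro h t' ht'
      refine ⟨hpartR _ _ hpart, hoff, fun a ha hav => ?_, ⟨L, hL,
        fun a ha => (hLu a ha).trans (Nat.lt_succ_self _), by omega, h9⟩, ?_⟩
      · rw [hmem]
        rcases (Nat.lt_succ_iff.1 ha).lt_or_eq with h' | h'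
        · exact hcov a h' hav
        · obtain rfl : a = u := Fin.ext h'
          exact h hav
      · rw [hmkeq]
        simp only [State.setReg_reg, Nat.reduceEqDiff, if_false]
        omega
    have i1 : (ld 14 (var 10 * var 2 + var 7) : Expr).eval s' = s'.mem 14 (u * N + v) := by
      simp [h10, f2, f7]
    have i2 : (ld 16 (var 10 * var 2 + var 7) : Expr).eval s' = s'.mem 16 (u * N + v) := by
      simp [h10, f2, f7]
    have hRuv := c' u u.2 v hvB
    rw [wp_ite, wp_ite, i1, i2]
    refine ⟨fun hR => ⟨fun hU => ?_, fun hU => ?_⟩, fun hR => ?_⟩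
    · have hr : H.Reach u v := by
        by_contra h
        rw [if_neg h] at hRuv
        have : 0 < s'.mem 14 (u * N + v) := hR
        omega
      have hUm : u ∉ marked N s' v := by
        rw [mem_marked, not_not]
        have : s'.mem 16 (u * N + v) < 1 := hU
        omega
      -- The heart of the time bound: a child b of u would be an ancestor of v with a lower number,
      -- hence with an entry, and then u, which lies on the path of b, would have an entry as well.
      have huL : u ∉ L ∧ u ∈ H.leaf w (Equiv.refl _) v := by
        constructor
        · exact fun h => lt_irrefl _ (hLu u h)
        · obtain ⟨p, hp⟩ := reach_iff_exists_isPath.1 hr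
          refine mem_leaf_of_forall_not_lexFirst hσ hp fun b q hb hq => hUm ?_
          exact hpart.closed b (hcov b hb (hq.reach hH)) _ hq u (by simp)
      -- The vertices searched so far have numbers below u, so there are fewer than N of them and
      -- the counter fits into a word.
      have hmul : H.indeg v * (L.card + 1) < B :=
        lt_of_le_of_lt (Nat.mul_le_mul_left _ (by omega)) hIB
      rw [mul_add, mul_one] at hmul
      rw [wp_seq]
      refine (wp_search hH l' li' c' f7 h10 huv hr (fun x hx => hoff.column (hH _ _ hx).ne (hcol x hx)) hNB
        hMB (by rw [h9]; exact hmul)).mono ?_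
      rintro s₂ t₂ ⟨⟨x, p, k12, hxv, k4, hp, hpv⟩, k9, ht₂⟩ hF₂
      have hmk₂ : marked N s₂ v = marked N s' v := by
        rw [marked, hF₂.mem 16 rfl]; rfl
      have hpart₂ : H.Partial w s₂ v := by
        refine ⟨by rw [hmk₂]; exact hpart.root, fun a ha => ?_, by rw [hmk₂]; exact hpart.closed⟩
        rw [hmk₂] at ha
        exact (hpart.entry a ha).of_eq (by rw [hF₂.rmem 3 rfl]) (by rw [hF₂.mem 16 rfl])
          (by rw [hF₂.mem 17 rfl])
      have hoff₂ : AgreeOff N v s s₂ := hoff.trans fun i j _ _ => by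
        rw [hF₂.rmem 3 rfl, hF₂.mem 16 rfl, hF₂.mem 17 rfl]
        exact ⟨rfl, rfl, rfl⟩
      have hxv' : x ≠ v := (hH _ _ hxv).ne
      refine (wp_walk hH (by rw [hF₂.reg 2 rfl, f2]) (by rw [hF₂.reg 7 rfl, f7])
        (by rw [hF₂.reg 10 rfl, h10]) k12 hxv k4 hp hpv
        (hoff₂.column hxv' (hcol x hxv)) hpart₂ hNB).mono ?_
      rintro s₃ t₃ ⟨hpart₃, hoff₃, hsub, hu₃, ht₃⟩ hF₃
      rw [hmk₂] at hsub ht₃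
      have j9 : s₃.reg 9 = H.indeg v * L.card + H.indeg v := by rw [hF₃.reg 9 rfl, k9, h9]
      refine ⟨hpartR _ _ hpart₃, hoff₂.trans hoff₃, fun a ha hav => ?_,
        ⟨insert u L, ?_, ?_, ?_, ?_⟩, ?_⟩
      · rw [hmem]
        rcases (Nat.lt_succ_iff.1 ha).lt_or_eq with h' | h'
        · exact hsub (hcov a h' hav)
        · obtain rfl : a = u := Fin.ext h'
          exact hu₃
      · rw [Finset.coe_insert]
        exact Set.insert_subset huL.2 hL
      · intro a ha
        rcases Finset.mem_insert.1 ha with rfl | ha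
        · exact Nat.lt_succ_self _
        · exact (hLu a ha).trans (Nat.lt_succ_self _)
      · rw [Finset.card_insert_of_notMem huL.1]; omega
      · rw [Finset.card_insert_of_notMem huL.1]
        simp only [State.setReg_reg, Nat.reduceEqDiff, if_false]
        rw [j9]; ring
      · rw [hmkeq]
        simp only [State.setReg_reg, Nat.reduceEqDiff, if_false]
        omega
    · rw [wp_skip]
      refine hskip (fun _ => ?_) _ (by omega)
      rw [mem_marked]
      have : ¬ s'.mem 16 (u * N + v) < 1 := hU
      omega
    · rw [wp_skip]
      refine hskip (fun h => ?_) _ (by omega)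
      rw [if_pos h] at hRuv
      exact absurd (show 0 < s'.mem 14 (u * N + v) by omega) hR
  · rintro s' t ⟨hpart, hoff, hcov, ⟨L, hL, hLu, hLi, h9⟩, ht⟩ hF
    rw [g7] at hcov ht
    refine ⟨hoff, fun a ha => ?_, ?_, ?_⟩
    · by_cases hav : a = v
      · subst hav; exact hpart.entry _ hpart.root
      · exact hpart.entry a (hcov a (lt_of_le_of_ne (hH.le ha) fun h => hav (Fin.ext h)) ha)
    · rw [h9]
      refine Nat.mul_le_mul_left _ ?_
      rw [← Set.ncard_coe_finset]
      exact Set.ncard_le_ncard hL (Set.toFinite _)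
    · have : (marked N s' v).card ≤ N := by simpa using Finset.card_le_univ (marked N s' v)
      omega

end APSP

/-! ### All columns: balancing the graph against its reversal -/

namespace APSP

open Prog _root_.APSP.Expr Dag

/-- Complete the tables for one half of the vertices: the two halves are dealt with in turn, so that
the numbers of edges considered for them, variables `18` and `19`, remain balanced. -/
def columns : Prog :=
  set 16 0 ;; set 17 0 ;; set 18 0 ;; set 19 0 ;;
  -- Variables 16 and 17 count the complete columns of the two halves, so the product is positive as
  -- long as neither half is complete.
  loop 0 ((var 0 - var 16) * (var 0 - var 17)) (
    ite (var 18) (var 19)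
      (set 7 (var 16) ;; column ;; set 18 (var 18 + var 9) ;; set 16 (var 16 + 1))
      (set 7 (var 0 + var 17) ;; column ;; set 19 (var 19 + var 9) ;; set 17 (var 17 + 1)))

namespace Dag

variable {N M : ℕ} {H : Dag N M} {w : Fin M → ℝ} {s s' : State}

/-- There are no parallel edges, so the edges that enter a vertex have different tails. -/
theorem indeg_le (H : Dag N M) (v : Fin N) : H.indeg v ≤ N := by
  rw [indeg]
  refine le_trans (Finset.card_le_card_of_injOn (fun e => (H.edge e).1) (t := Finset.univ)
    (fun _ _ => Finset.mem_univ _) ?_) (by simp)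
  intro e he e' he' h
  simp only [Finset.coe_filter, Finset.mem_univ, true_and, Set.mem_ofPred_eq] at he he'
  exact H.edge_injective (Prod.ext h (he.trans he'.symm))

/-- The number of edges considered for the vertex with the number `x` is at most this. -/
noncomputable def workload (H : Dag N M) (w : Fin M → ℝ) (x : ℕ) : ℕ :=
  if h : x < N then H.indeg ⟨x, h⟩ * (H.leaf w (Equiv.refl _) ⟨x, h⟩).ncard else 0

theorem workload_coe (H : Dag N M) (w : Fin M → ℝ) (v : Fin N) :
    H.workload w v = H.indeg v * (H.leaf w (Equiv.refl _) v).ncard := by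
  rw [workload, dif_pos v.2]

theorem workload_le (H : Dag N M) (w : Fin M → ℝ) (x : ℕ) : H.workload w x ≤ N * N := by
  rw [workload]
  split
  · refine Nat.mul_le_mul (H.indeg_le _) ?_
    have := Set.ncard_le_ncard (Set.subset_univ (H.leaf w (Equiv.refl _) ⟨x, by assumption⟩))
      (Set.toFinite _)
    simpa [Set.ncard_univ] using this
  · exact Nat.zero_le _

theorem sum_workload_le (H : Dag N M) (w : Fin M → ℝ) (f : ℕ → ℕ) {k n : ℕ} (hk : k ≤ n) :
    ∑ x ∈ Finset.range k, H.workload w (f x) ≤ n * (N * N) := by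
  refine (Finset.sum_le_card_nsmul _ _ (N * N) fun x _ => H.workload_le w _).trans ?_
  simpa using Nat.mul_le_mul_right (N * N) hk

/-- The tables are complete for the vertices in `T`, and empty for the others. -/
def Tables (H : Dag N M) (w : Fin M → ℝ) (T : ℕ → Prop) (s : State) : Prop :=
  ∀ x : Fin N, (T x → H.Column w s x) ∧
    (¬ T x → (∀ a < N, s.mem 16 (a * N + x) = 0) ∧ s.rmem 3 (x * N + x) = 0)

theorem Tables.insert {T : ℕ → Prop} {v : Fin N} (h : H.Tables w T s) (hoff : AgreeOff N v s s')
    (hv : H.Column w s' v) : H.Tables w (fun x => T x ∨ x = v) s' := by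
  intro x
  by_cases hx : x = v
  · subst hx
    exact ⟨fun _ => hv, fun h => absurd (.inr rfl) h⟩
  · have hx' : (x : ℕ) ≠ v := fun h => hx (Fin.ext h)
    refine ⟨fun hT => hoff.column hx ((h x).1 (hT.resolve_right hx')), fun hT => ?_⟩
    obtain ⟨h1, h2⟩ := (h x).2 fun h => hT (.inl h)
    exact ⟨fun a ha => by rw [(hoff a x x.2 hx').2.1, h1 a ha], by rw [(hoff x x x.2 hx').1, h2]⟩

theorem Tables.congr {T T' : ℕ → Prop} (h : H.Tables w T s) (hT : ∀ x, T x ↔ T' x)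
    (h16 : s'.mem 16 = s.mem 16) (h17 : s'.mem 17 = s.mem 17) (h3 : s'.rmem 3 = s.rmem 3) :
    H.Tables w T' s' := by
  intro x
  rw [← hT, h16, h3]
  exact ⟨fun hx a ha => ((h x).1 hx a ha).of_eq (by rw [h3]) (by rw [h16]) (by rw [h17]), (h x).2⟩

end Dag

section

variable {n M B : ℕ} {H : Dag (n + n) M} {w : Fin M → ℝ} {s : State}

/-- The half with the smaller count so far is advanced, and one column adds at most N² inspections,
so the counts stay within N² of each other, where N = 2n. Each count is bounded by the sum for its
own half. Together these facts bound the total by twice the smaller sum plus O(n²). One complete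
half is all that the output needs. -/
theorem wp_columns (hH : H.Ordered) (hsep : ∀ x v, H.Adj x v → ((x : ℕ) < n ↔ (v : ℕ) < n))
    (hl : H.Loaded w s) (hli : Lists (n + n) M s) (hc : H.Closed s) (hn : s.reg 0 = n)
    (ht : H.Tables w (fun _ => False) s) (hB : (n + 1) * ((n + n) * (n + n)) + 2 * n + 1 < B)
    (hMB : M < B) :
    wp B columns (fun s' t =>
      (s'.reg 16 = n ∧ (∀ x : Fin (n + n), (x : ℕ) < n → H.Column w s' x) ∨
        s'.reg 16 ≠ n ∧ s'.reg 16 ≤ n ∧ (∀ x : Fin (n + n), n ≤ (x : ℕ) → H.Column w s' x)) ∧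
      ∃ c₁ c₂, c₁ ≤ ∑ x ∈ Finset.range n, H.workload w x ∧
        c₂ ≤ ∑ x ∈ Finset.range n, H.workload w (n + x) ∧
        c₁ ≤ c₂ + (n + n) * (n + n) ∧ c₂ ≤ c₁ + (n + n) * (n + n) ∧
        t ≤ 200 * ((n + n) * (n + n) + c₁ + c₂ + 1)) s := by
  have hNN : n ≤ (n + n) * (n + n) := by nlinarith
  rw [add_mul, one_mul] at hB
  simp only [columns, wp_seq, wp_set]
  refine ⟨by show 0 < B; omega, by show 0 < B; omega, by show 0 < B; omega, by show 0 < B; omega, ?_⟩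
  refine wp_loop (fun s' t => ∃ i j c₁ c₂, i ≤ n ∧ j ≤ n ∧ s'.reg 16 = i ∧ s'.reg 17 = j ∧
    s'.reg 18 = c₁ ∧ s'.reg 19 = c₂ ∧ H.Tables w (fun x => x < i ∨ n ≤ x ∧ x < n + j) s' ∧
    c₁ ≤ ∑ x ∈ Finset.range i, H.workload w x ∧
    c₂ ≤ ∑ x ∈ Finset.range j, H.workload w (n + x) ∧
    c₁ ≤ c₂ + (n + n) * (n + n) ∧ c₂ ≤ c₁ + (n + n) * (n + n) ∧
    t ≤ (30 * (n + n + 1) + 10) * (i + j) + 30 * (c₁ + c₂))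
    (fun s' => (n - s'.reg 16) + (n - s'.reg 17)) ?_ ?_ ?_
  · refine ⟨0, 0, 0, 0, by omega, by omega, rfl, rfl, rfl, rfl, ht.congr (fun x => ?_) rfl rfl rfl,
      by simp, by simp, by simp, by simp, by simp⟩
    simp
  · rintro s' t ⟨i, j, c₁, c₂, hi, hj, e16, e17, e18, e19, htab, hc₁, hc₂, hb₁, hb₂, htime⟩ hF hlt
    have e0 : s'.reg 0 = n := by rw [hF.reg 0 rfl]; exact hn
    have hlt' : 0 < (n - i) * (n - j) := by
      have : (0 : ℕ) < (s'.reg 0 - s'.reg 16) * (s'.reg 0 - s'.reg 17) := hlt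
      rwa [e0, e16, e17] at this
    have hin : i < n := by
      have := Nat.pos_of_mul_pos_right hlt'
      omega
    have hjn : j < n := by
      have := Nat.pos_of_mul_pos_left hlt'
      omega
    have e2 : s'.reg 2 = s.reg 2 := hF.reg 2 rfl
    have e3 : s'.reg 3 = s.reg 3 := hF.reg 3 rfl
    have hmem : ∀ a < 16, s'.mem a = s.mem a := fun a ha => by
      rw [hF.mem a (by interval_cases a <;> rfl)]; rfl
    have l' : H.Loaded w s' := hl.of_eq e2 e3 (hmem 10 (by omega)) (hmem 11 (by omega))
      (hF.rmem 2 rfl)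
    have li' : Lists (n + n) M s' := hli.of_eq (hmem 11 (by omega)) (hmem 12 (by omega))
      (hmem 13 (by omega))
    have c' : H.Closed s' := fun i hi j hj => by rw [hmem 14 (by omega)]; exact hc i hi j hj
    have hS₁ := H.sum_workload_le w (fun x => x) (show i ≤ n by omega)
    have hS₂ := H.sum_workload_le w (fun x => n + x) (show j ≤ n by omega)
    have hw₁ := H.workload_le w i
    have hw₂ := H.workload_le w (n + j)
    have hstep : ∀ v : Fin (n + n), ¬ ((v : ℕ) < i ∨ n ≤ (v : ℕ) ∧ (v : ℕ) < n + j) →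
        (∀ x, H.Adj x v → ((x : ℕ) < i ∨ n ≤ (x : ℕ) ∧ (x : ℕ) < n + j)) → ∀ k, k = (v : ℕ) →
        wp B column (fun s'' t => H.Tables w
          (fun x => (x < i ∨ n ≤ x ∧ x < n + j) ∨ x = v) s'' ∧
          s''.reg 9 ≤ H.workload w v ∧ s''.reg 16 = i ∧ s''.reg 17 = j ∧ s''.reg 18 = c₁ ∧
          s''.reg 19 = c₂ ∧ t ≤ 30 * (n + n + 1 + s''.reg 9)) (s'.setReg 7 k) := by
      rintro v hv hpred _ rfl
      obtain ⟨h16, h3⟩ := (htab v).2 hv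
      refine (wp_column hH (l'.of_eq rfl rfl rfl rfl rfl) (li'.of_eq rfl rfl rfl) c'
        (s := s'.setReg 7 v) (v := v) (by simp)
        (fun x hx => fun a ha => ((htab x).1 (hpred x hx) a ha).of_eq rfl rfl rfl) h16 h3 (by omega)
        hMB ?_).mono ?_
      · have := Nat.mul_le_mul_right (n + n) (H.indeg_le v)
        omega
      · rintro s'' t' ⟨hoff, hcol, h9, ht'⟩ hF'
        refine ⟨Tables.insert htab hoff hcol, by rw [workload_coe]; exact h9, ?_, ?_, ?_, ?_, ht'⟩
        · rw [hF'.reg 16 rfl]; exact e16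
        · rw [hF'.reg 17 rfl]; exact e17
        · rw [hF'.reg 18 rfl]; exact e18
        · rw [hF'.reg 19 rfl]; exact e19
    rw [wp_ite]
    have hcond : ((var 18).eval s' < (var 19).eval s') ↔ c₁ < c₂ := by
      simp only [Expr.eval, e18, e19]
    rw [hcond]
    simp only [wp_seq, wp_set]
    refine ⟨fun h => ⟨by simp [e16]; omega, ?_⟩, fun h => ⟨by simp [e0, e17]; omega, ?_⟩⟩
    · refine (hstep ⟨i, by omega⟩ (by simp only; omega) (fun x hx => ?_) _ (by simp [e16])).mono ?_
      · have h1 := hH _ _ hx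
        have h1' : (x : ℕ) < i := h1
        exact .inl h1'
      · rintro s'' t' ⟨g1, g9, g16, g17, g18, g19, gt⟩ -
        simp only at g9
        refine ⟨by simp [g18]; omega, by simp [g16]; omega, ⟨i + 1, j, c₁ + s''.reg 9, c₂, hin, hjn.le,
          by simp [g16], by simpa using g17, by simp [g18], by simpa using g19,
          g1.congr (fun x => by simp only; omega) rfl rfl rfl, ?_, hc₂, by omega, by omega, ?_⟩, ?_⟩
        · rw [Finset.sum_range_succ]; omega
        · have e : (30 * (n + n + 1) + 10) * (i + 1 + j) =
            (30 * (n + n + 1) + 10) * (i + j) + (30 * (n + n + 1) + 10) := by ring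
          omega
        · simp [g16, g17, e16, e17]; omega
    · refine (hstep ⟨n + j, by omega⟩ (by simp only; omega) (fun x hx => ?_) _
        (by simp [e0, e17])).mono ?_
      · have h1' : (x : ℕ) < n + j := hH _ _ hx
        -- No edge leads from the first half into the second, so the columns needed for a vertex of
        -- the second half are those of its own half, and they are complete.
        have h2 := (hsep _ _ hx).1
        simp only at h2
        exact .inr ⟨by omega, h1'⟩
      · rintro s'' t' ⟨g1, g9, g16, g17, g18, g19, gt⟩ -
        simp only at g9
        refine ⟨by simp [g19]; omega, by simp [g17]; omega, ⟨i, j + 1, c₁, c₂ + s''.reg 9, hin.le, hjn,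
          by simpa using g16, by simp [g17], by simpa using g18, by simp [g19],
          g1.congr (fun x => by simp only; omega) rfl rfl rfl, hc₁, ?_, by omega, by omega, ?_⟩, ?_⟩
        · rw [Finset.sum_range_succ]; omega
        · have e : (30 * (n + n + 1) + 10) * (i + (j + 1)) =
            (30 * (n + n + 1) + 10) * (i + j) + (30 * (n + n + 1) + 10) := by ring
          omega
        · simp [g16, g17, e16, e17]; omega
  · rintro s' t ⟨i, j, c₁, c₂, hi, hj, e16, e17, e18, e19, htab, hc₁, hc₂, hb₁, hb₂, htime⟩ hF hlt
    have e0 : s'.reg 0 = n := by rw [hF.reg 0 rfl]; exact hn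
    have hlt' : (n - i) * (n - j) = 0 := by
      have : ¬ (0 : ℕ) < (s'.reg 0 - s'.reg 16) * (s'.reg 0 - s'.reg 17) := hlt
      rw [e0, e16, e17] at this
      omega
    refine ⟨?_, c₁, c₂, hc₁.trans ?_, hc₂.trans ?_, hb₁, hb₂, ?_⟩
    · by_cases h : i = n
      · subst h
        exact .inl ⟨e16, fun x hx => (htab x).1 (.inl hx)⟩
      · have hjn : j = n := by
          rcases Nat.mul_eq_zero.1 hlt' with h' | h' <;> omega
        subst hjn
        exact .inr ⟨by omega, by omega, fun x hx => (htab x).1 (.inr ⟨hx, x.2⟩)⟩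
    · exact Finset.sum_le_sum_of_subset (Finset.range_mono hi)
    · exact Finset.sum_le_sum_of_subset (Finset.range_mono hj)
    · have h1 : (30 * (n + n + 1) + 10) * (i + j) ≤ (30 * (n + n + 1) + 10) * (n + n) :=
        Nat.mul_le_mul_left _ (by omega)
      have h2 : (30 * (n + n + 1) + 10) * (n + n) = 30 * ((n + n) * (n + n)) + 40 * (n + n) := by ring
      omega

end

end APSP

/-! ### Reading the output off the tables -/

namespace APSP

open Prog _root_.APSP.Expr Dag

/-- Write the output; the entries for the pair of the vertices in the variables `10` and `11` are in
the cell `ec` of the tables, and the second vertex of a path is `ex`. -/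
def writePaths (ec ex : Expr) : Prog :=
  for_ 10 0 (for_ 11 0 (
    set 12 ec ;;
    -- One of the two truncated differences is zero and the other is the distance of the numbers, so
    -- the product is positive exactly for reachable pairs of different vertices.
    ite 0 (ld 14 (var 12) * ((var 10 - var 11) + (var 11 - var 10)))
      (rget 1 3 (var 12) ;;
        rput 1 (var 10 * var 0 + var 11) 1 ;;
        put 4 (var 10 * var 0 + var 11) (ex + 1))
      skip))

/-- Write the output, from the half of the tables that is complete. -/
def output : Prog :=
  ite (var 16) (var 0)
    (writePaths ((var 0 + ld 3 (var 11)) * var 2 + (var 0 + ld 3 (var 10))) (ld 18 (ld 17 (var 12))))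
    (writePaths (ld 2 (var 10) * var 2 + ld 2 (var 11)) (ld 18 (ld 16 (var 12) - 1)))

section

variable {n m B : ℕ} {G : Dag n m} {w : Fin m → ℝ} {σ τ : Equiv.Perm (Fin n)} {s : State}

theorem wp_writePaths {ec ex : Expr} {cell next : ℕ → ℕ → ℕ} (hn : s.reg 0 = n) (hnB : n < B)
    (h1 : ∀ i, s.rmem 1 i = 0) (h4 : ∀ i, s.mem 4 i = 0)
    (hec : ∀ s' : State, s'.reg 0 = n → s'.reg 2 = s.reg 2 → (∀ a, a ≠ 4 → s'.mem a = s.mem a) →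
      ∀ u < n, ∀ v < n, s'.reg 10 = u → s'.reg 11 = v → ec.eval s' = cell u v ∧ cell u v < B)
    (hex : ∀ s' : State, (∀ a, a ≠ 4 → s'.mem a = s.mem a) → ∀ u < n, ∀ v < n, u ≠ v →
      0 < s.mem 14 (cell u v) → s'.reg 12 = cell u v → ex.eval s' = next u v ∧ next u v < n) :
    wp B (writePaths ec ex) (fun s' t =>
      (∀ u < n, ∀ v < n, (u ≠ v ∧ 0 < s.mem 14 (cell u v) →
        s'.rmem 1 (u * n + v) = s.rmem 3 (cell u v) ∧ s'.mem 4 (u * n + v) = next u v + 1) ∧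
        (¬ (u ≠ v ∧ 0 < s.mem 14 (cell u v)) →
          s'.rmem 1 (u * n + v) = 0 ∧ s'.mem 4 (u * n + v) = 0)) ∧
      t ≤ 7 * n ^ 2 + 4 * n + 2) s := by
  refine wp_for₂ (c := 5) (fun c s' => ∀ u < n, ∀ v < n,
      (u * n + v < c → (u ≠ v ∧ 0 < s.mem 14 (cell u v) →
        s'.rmem 1 (u * n + v) = s.rmem 3 (cell u v) ∧ s'.mem 4 (u * n + v) = next u v + 1) ∧
        (¬ (u ≠ v ∧ 0 < s.mem 14 (cell u v)) →
          s'.rmem 1 (u * n + v) = 0 ∧ s'.mem 4 (u * n + v) = 0)) ∧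
      (c ≤ u * n + v → s'.rmem 1 (u * n + v) = 0 ∧ s'.mem 4 (u * n + v) = 0))
    (by omega) (by decide) (by decide) (by decide) rfl rfl rfl (fun _ _ _ h => h)
    (fun _ _ _ h => h) ?_ ?_ ?_
  · intro u _ v _
    exact ⟨fun h => absurd h (Nat.not_lt_zero _), fun _ => ⟨h1 _, h4 _⟩⟩
  · intro u hu v hv s' hI g10 g11 hF
    rw [hn] at hu hv hI ⊢
    have g0 : s'.reg 0 = n := by rw [hF.reg 0 rfl, hn]
    have hm : ∀ a, a ≠ 4 → s'.mem a = s.mem a := fun a ha => hF.mem a (by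
      have : Nat.beq 4 a = false := Bool.eq_false_iff.2 fun h => ha (Nat.eq_of_beq_eq_true h).symm
      simp [for_, wm, this])
    obtain ⟨e1, e1B⟩ := hec s' g0 (hF.reg 2 rfl) hm u hu v hv g10 g11
    have er : s'.rmem 3 = s.rmem 3 := hF.rmem 3 rfl
    rw [wp_seq, wp_set, e1]
    have e2 : (ld 14 (var 12) * ((var 10 - var 11) + (var 11 - var 10)) : Expr).eval
        (s'.setReg 12 (cell u v)) = s.mem 14 (cell u v) * ((u - v) + (v - u)) := by
      simp [hm, g10, g11]
    have e3 : (0 : Expr).eval (s'.setReg 12 (cell u v)) = 0 := rfl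
    have hcond : 0 < s.mem 14 (cell u v) * ((u - v) + (v - u)) ↔
        u ≠ v ∧ 0 < s.mem 14 (cell u v) := by
      rw [Nat.pos_iff_ne_zero, mul_ne_zero_iff]
      omega
    have hinj : ∀ u' v', v' < n → (u' * n + v' = u * n + v ↔ u' = u ∧ v' = v) := fun u' v' hv' =>
      mul_add_inj hv' hv
    rw [wp_ite, e2, e3, hcond]
    refine ⟨e1B, fun h => ?_, fun h => ?_⟩
    · obtain ⟨x1, x2⟩ := hex (s'.setReg 12 (cell u v)) hm u hu v hv h.1 h.2 (by simp)
      have x1' : ∀ i c d, (ex + 1 : Expr).eval ((((s'.setReg 12 (cell u v)).setRReg 1 c).setRMem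
          1 i d)) = next u v + 1 := fun i c d => by
        have := (hex (((s'.setReg 12 (cell u v)).setRReg 1 c).setRMem 1 i d) hm u hu v hv h.1 h.2
          (by simp)).1
        rw [Expr.eval_add, this]; rfl
      simp only [wp_seq, wp_rget, wp_rput, wp_put]
      simp only [x1']
      simp [g0, g10, g11, er]
      refine ⟨by omega, fun u' hu' v' hv' => ?_⟩
      by_cases h' : u' = u ∧ v' = v
      · obtain ⟨rfl, rfl⟩ := h'
        have hne := h.1
        have hpos := h.2
        simp [hpos.ne', hne]
      · have h'' : u' * n + v' ≠ u * n + v := fun h'' => h' ((hinj u' v' hv').1 h'')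
        have := hI u' hu' v' hv'
        simp only [h'', if_false]
        refine ⟨fun hlt => ?_, fun hle => this.2 (by omega)⟩
        simpa using this.1 (by omega)
    · rw [wp_skip]
      refine ⟨fun u' hu' v' hv' => ⟨fun hlt => ?_, fun hle => (hI u' hu' v' hv').2 (by omega)⟩, by omega⟩
      rcases (Nat.lt_succ_iff.1 hlt).lt_or_eq with h' | h'
      · exact (hI u' hu' v' hv').1 h'
      · obtain ⟨rfl, rfl⟩ := (hinj u' v' hv').1 h'
        exact ⟨fun h'' => absurd h'' h, fun _ => (hI u' hu' v' hv').2 le_rfl⟩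
  · intro s' t hI hF ht
    rw [hn] at hI ht
    refine ⟨fun u hu v hv => (hI u hu v hv).1 ?_, ht⟩
    calc u * n + v < u * n + n := by omega
      _ = (u + 1) * n := by ring
      _ ≤ n * n := Nat.mul_le_mul_right _ hu

namespace Dag

/-- The output is correct if the tables are complete for a copy of the graph. -/
theorem isOutput_of_embeds_left {N M : ℕ} {H : Dag N M} {w' : Fin M → ℝ} {f : Fin n → Fin N}
    {s s' : State} {next : ℕ → ℕ → ℕ} (hH : H.Ordered)
    (hf : Embeds G w σ H w' (Equiv.refl _) f) (hc : H.Closed s)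
    (hcol : ∀ v, H.Column w' s (f v))
    (hnext : ∀ u v x : Fin n, u ≠ v → s.mem 16 (f u * N + f v) = f x + 1 → next u v = x)
    (hs' : ∀ u v : Fin n, ((u : ℕ) ≠ v ∧ 0 < s.mem 14 (f u * N + f v) →
        s'.rmem 1 (u * n + v) = s.rmem 3 (f u * N + f v) ∧ s'.mem 4 (u * n + v) = next u v + 1) ∧
      (¬ ((u : ℕ) ≠ v ∧ 0 < s.mem 14 (f u * N + f v)) →
        s'.rmem 1 (u * n + v) = 0 ∧ s'.mem 4 (u * n + v) = 0)) : G.IsOutput w s' := by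
  intro u v
  obtain ⟨h1, h2⟩ := hs' u v
  have hR := hc (f u) (f u).2 (f v) (f v).2
  refine ⟨fun h => h2 fun h' => h'.1 (by rw [h]), fun h => (h2 fun h' => ?_).2, fun huv ⟨p, hp⟩ => ?_⟩
  · by_cases hr : H.Reach (f u) (f v)
    · obtain ⟨q, hq⟩ := reach_iff_exists_isPath.1 hr
      obtain ⟨u', q', hu', -, hq'⟩ := hf.exists_map hq
      rw [hf.inj hu'] at hq'
      exact h _ hq'
    · rw [if_neg hr] at hR
      exact absurd h'.2 (by omega)
  · have hr : H.Reach (f u) (f v) := reach_iff_exists_isPath.2 ⟨_, hf.isPath_map.2 hp⟩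
    rw [if_pos hr] at hR
    obtain ⟨k1, k2⟩ := h1 ⟨fun h => huv (Fin.ext h), by omega⟩
    obtain ⟨q, hq, hD, hq'⟩ := hcol v (f u) hr
    obtain ⟨x, y, r, r', hx, -, h16, -⟩ := hq' fun h => huv (hf.inj h)
    obtain ⟨u', q₀, hu', rfl, hq₀⟩ := hf.exists_map (hq.isShortest hH.isTopological).1
    obtain rfl := hf.inj hu'
    obtain ⟨q₁, rfl⟩ := hq₀.eq_cons
    rw [List.map_cons, List.cons.injEq] at hx
    obtain ⟨x', q₂, rfl, rfl, -⟩ := List.map_eq_cons_iff.1 hx.2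
    refine ⟨x', q₂, hf.isShortest_map.1 (hq.isShortest hH.isTopological), ?_, ?_⟩
    · rw [k1, hD, hf.length_map]
    · rw [k2, hnext _ _ x' huv h16]

/-- The output is correct if the tables are complete for a copy of the reversed graph. -/
theorem isOutput_of_embeds_right {N M : ℕ} {H : Dag N M} {w' : Fin M → ℝ} {f : Fin n → Fin N}
    {s s' : State} {next : ℕ → ℕ → ℕ} (hH : H.Ordered)
    (hf : Embeds G.reverse w τ H w' (Equiv.refl _) f) (hc : H.Closed s)
    (hcol : ∀ v, H.Column w' s (f v))
    (hnext : ∀ u v x : Fin n, u ≠ v → s.mem 17 (f v * N + f u) = f x → next u v = x)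
    (hs' : ∀ u v : Fin n, ((u : ℕ) ≠ v ∧ 0 < s.mem 14 (f v * N + f u) →
        s'.rmem 1 (u * n + v) = s.rmem 3 (f v * N + f u) ∧ s'.mem 4 (u * n + v) = next u v + 1) ∧
      (¬ ((u : ℕ) ≠ v ∧ 0 < s.mem 14 (f v * N + f u)) →
        s'.rmem 1 (u * n + v) = 0 ∧ s'.mem 4 (u * n + v) = 0)) : G.IsOutput w s' := by
  intro u v
  obtain ⟨h1, h2⟩ := hs' u v
  have hR := hc (f v) (f v).2 (f u) (f u).2
  refine ⟨fun h => h2 fun h' => h'.1 (by rw [h]), fun h => (h2 fun h' => ?_).2, fun huv ⟨p, hp⟩ => ?_⟩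
  · by_cases hr : H.Reach (f v) (f u)
    · obtain ⟨q, hq⟩ := reach_iff_exists_isPath.1 hr
      obtain ⟨u', q', hu', -, hq'⟩ := hf.exists_map hq
      rw [hf.inj hu'] at hq'
      exact h _ (isPath_reverse.2 hq')
    · rw [if_neg hr] at hR
      exact absurd h'.2 (by omega)
  · have hp' : G.reverse.IsPath v u p.reverse := isPath_reverse.1 (by rwa [List.reverse_reverse])
    have hr : H.Reach (f v) (f u) := reach_iff_exists_isPath.2 ⟨_, hf.isPath_map.2 hp'⟩
    rw [if_pos hr] at hR
    obtain ⟨k1, k2⟩ := h1 ⟨fun h => huv (Fin.ext h), by omega⟩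
    obtain ⟨q, hq, hD, hq'⟩ := hcol u (f v) hr
    obtain ⟨x, y, r, r', -, hx, -, h17⟩ := hq' fun h => huv (hf.inj h).symm
    obtain ⟨v', q₀, hv', rfl, hq₀⟩ := hf.exists_map (hq.isShortest hH.isTopological).1
    obtain rfl := hf.inj hv'
    obtain ⟨q₁, q₂, rfl, rfl, hy⟩ := List.map_eq_append_iff.1 hx
    obtain ⟨y', q₃, rfl, rfl, hz⟩ := List.map_eq_cons_iff.1 hy
    obtain ⟨u', q₄, rfl, hu', hz'⟩ := List.map_eq_cons_iff.1 hz
    obtain rfl := hf.inj hu'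
    obtain rfl := List.map_eq_nil_iff.1 hz'
    have hrev : (q₁ ++ [y', u']).reverse = u' :: y' :: q₁.reverse := by simp
    refine ⟨y', q₁.reverse, ?_, ?_, ?_⟩
    · rw [← hrev]
      exact isShortest_reverse.2 (hf.isShortest_map.1 (hq.isShortest hH.isTopological))
    · rw [k1, hD, hf.length_map, ← hrev, length_reverse]
    · rw [k2, hnext _ _ y' huv h17]

end Dag

/-- From the half for G the second vertex of a path is taken, which array 16 stores increased by
one. In the other half, the path from the copy of v to the copy of u is read backwards, so its next
to last vertex, in array 17, is the required second vertex. Array 18 translates numbers back to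
vertices. -/
theorem wp_output (hσ : G.IsTopological σ) (hτ : G.reverse.IsTopological τ)
    (hc : (G.union σ τ hσ hτ).Closed s) (hn : s.reg 0 = n) (hN : s.reg 2 = n + n)
    (h2 : ∀ u : Fin n, s.mem 2 u = σ u) (h3 : ∀ u : Fin n, s.mem 3 u = τ u)
    (h18 : ∀ u : Fin n, s.mem 18 (σ u) = u ∧ s.mem 18 (n + τ u) = u)
    (h1 : ∀ i, s.rmem 1 i = 0) (h4 : ∀ i, s.mem 4 i = 0) (hB : (n + n) * (n + n) + n < B)
    (hcol : s.reg 16 = n ∧ (∀ x : Fin (n + n), (x : ℕ) < n →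
        (G.union σ τ hσ hτ).Column (Fin.append w w) s x) ∨
      s.reg 16 ≠ n ∧ s.reg 16 ≤ n ∧ (∀ x : Fin (n + n), n ≤ (x : ℕ) →
        (G.union σ τ hσ hτ).Column (Fin.append w w) s x)) :
    wp B output (fun s' t => G.IsOutput w s' ∧ t ≤ 7 * n ^ 2 + 4 * n + 3) s := by
  have hH : (G.union σ τ hσ hτ).Ordered := fun _ _ h => union_lt hσ hτ h
  have hcell : ∀ a b, a < n + n → b < n + n → a * (n + n) + b < B := fun a b ha hb => by
    have : (a + 1) * (n + n) ≤ (n + n) * (n + n) := Nat.mul_le_mul_right _ ha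
    rw [add_mul, one_mul] at this
    omega
  have hex : ∀ {a b : Fin (n + n)}, (a : ℕ) ≠ b → 0 < s.mem 14 (a * (n + n) + b) →
      (G.union σ τ hσ hτ).Column (Fin.append w w) s b →
      (G.union σ τ hσ hτ).Entry (Fin.append w w) s a b := fun {a b} _ h hb => by
    have hR := hc a a.2 b b.2
    refine hb a ?_
    by_contra h'
    rw [if_neg h'] at hR
    omega
  rw [output, wp_ite]
  simp only [Expr.eval, hn]
  refine ⟨fun hlt => ?_, fun hlt => ?_⟩
  · have hcol' := (hcol.resolve_left fun h => by omega).2.2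
    have hf := embeds_union_right hσ hτ w
    refine (wp_writePaths (cell := fun u v => (n + s.mem 3 v) * (n + n) + (n + s.mem 3 u))
      (next := fun u v => s.mem 18 (s.mem 17 ((n + s.mem 3 v) * (n + n) + (n + s.mem 3 u)))) hn
      (by omega) h1 h4 ?_ ?_).mono ?_
    · intro s' k0 k2 km u hu v hv k10 k11
      have e1 := h3 ⟨u, hu⟩
      have e2 := h3 ⟨v, hv⟩
      simp only at e1 e2
      refine ⟨by simp [k0, k2, km, k10, k11, hN], ?_⟩
      rw [e1, e2]
      have := (τ ⟨u, hu⟩).2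
      have := (τ ⟨v, hv⟩).2
      exact hcell _ _ (by omega) (by omega)
    · intro s' km u hu v hv huv hpos k12
      refine ⟨by simp [km, k12], ?_⟩
      have e1 := h3 ⟨u, hu⟩
      have e2 := h3 ⟨v, hv⟩
      simp only at e1 e2
      rw [e1, e2] at hpos ⊢
      have hne : n + (τ ⟨v, hv⟩ : ℕ) ≠ n + τ ⟨u, hu⟩ := fun h => huv
        (congrArg Fin.val (τ.injective (Fin.ext (Nat.add_left_cancel h)))).symm
      obtain ⟨p, hp, -, hp'⟩ := hex (a := Fin.natAdd n (τ ⟨v, hv⟩)) (b := Fin.natAdd n (τ ⟨u, hu⟩))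
        hne hpos (hcol' _ (Nat.le_add_right _ _))
      obtain ⟨x, y, q, q', -, hx, -, h17⟩ := hp' fun h => hne (congrArg Fin.val h)
      -- The path stays in the reversed half, so its next to last vertex is the copy of a vertex and
      -- array 18 has an entry for it.
      have hadj : ∃ a, Fin.natAdd n (τ a) = y := by
        have h := (hp.isShortest hH.isTopological).1
        rw [hx, isPath_split] at h
        obtain ⟨a, -, ha, -⟩ := hf.exists_map h.2
        exact ⟨a, ha⟩
      obtain ⟨a, rfl⟩ := hadj
      have h17' : s.mem 17 ((n + τ ⟨v, hv⟩) * (n + n) + (n + τ ⟨u, hu⟩)) = n + τ a := h17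
      rw [h17', (h18 a).2]
      exact a.2
    · rintro s' t ⟨g1, g2⟩ -
      refine ⟨isOutput_of_embeds_right (s := s)
        (next := fun u v => s.mem 18 (s.mem 17 ((n + s.mem 3 v) * (n + n) + (n + s.mem 3 u)))) hH hf hc
        (fun v => hcol' _ (Nat.le_add_right _ _)) (fun u v x huv h => ?_) (fun u v => ?_), by omega⟩
      · have h' : s.mem 17 ((n + τ v) * (n + n) + (n + τ u)) = n + τ x := h
        rw [h3, h3, h', (h18 x).2]
      · have := g1 u u.2 v v.2
        rw [h3, h3] at this
        rw [h3, h3]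
        exact this
  · have hcol' := (hcol.resolve_right fun h => by omega).2
    have hf := embeds_union_left hσ hτ w
    refine (wp_writePaths (cell := fun u v => s.mem 2 u * (n + n) + s.mem 2 v)
      (next := fun u v => s.mem 18 (s.mem 16 (s.mem 2 u * (n + n) + s.mem 2 v) - 1)) hn (by omega) h1
      h4 ?_ ?_).mono ?_
    · intro s' k0 k2 km u hu v hv k10 k11
      have e1 := h2 ⟨u, hu⟩
      have e2 := h2 ⟨v, hv⟩
      simp only at e1 e2
      refine ⟨by simp [k2, km, k10, k11, hN], ?_⟩
      rw [e1, e2]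
      have := (σ ⟨u, hu⟩).2
      have := (σ ⟨v, hv⟩).2
      exact hcell _ _ (by omega) (by omega)
    · intro s' km u hu v hv huv hpos k12
      refine ⟨by simp [km, k12], ?_⟩
      have e1 := h2 ⟨u, hu⟩
      have e2 := h2 ⟨v, hv⟩
      simp only at e1 e2
      rw [e1, e2] at hpos ⊢
      have hne : (σ ⟨u, hu⟩ : ℕ) ≠ σ ⟨v, hv⟩ := fun h => huv
        (congrArg Fin.val (σ.injective (Fin.ext h)))
      obtain ⟨p, hp, -, hp'⟩ := hex (a := Fin.castAdd n (σ ⟨u, hu⟩)) (b := Fin.castAdd n (σ ⟨v, hv⟩))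
        (by simpa using hne) hpos (hcol' _ (by simp))
      obtain ⟨x, y, q, q', hx, -, h16, -⟩ := hp' fun h => hne (by simpa using congrArg Fin.val h)
      have hadj : ∃ a, Fin.castAdd n (σ a) = x := by
        have h := (hp.isShortest hH.isTopological).1
        rw [hx, show Fin.castAdd n (σ ⟨u, hu⟩) :: x :: q = [Fin.castAdd n (σ ⟨u, hu⟩)] ++ x :: q from rfl,
          isPath_split] at h
        obtain ⟨a, -, ha, -⟩ := hf.exists_map h.2
        exact ⟨a, ha⟩
      obtain ⟨a, rfl⟩ := hadj
      have h16' : s.mem 16 (σ ⟨u, hu⟩ * (n + n) + σ ⟨v, hv⟩) = σ a + 1 := h16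
      rw [h16', Nat.add_sub_cancel, (h18 a).1]
      exact a.2
    · rintro s' t ⟨g1, g2⟩ -
      refine ⟨isOutput_of_embeds_left (s := s)
        (next := fun u v => s.mem 18 (s.mem 16 (s.mem 2 u * (n + n) + s.mem 2 v) - 1)) hH hf hc
        (fun v => hcol' _ (by simp)) (fun u v x huv h => ?_) (fun u v => ?_), by omega⟩
      · have h' : s.mem 16 (σ u * (n + n) + σ v) = σ x + 1 := h
        rw [h2, h2, h', Nat.add_sub_cancel, (h18 x).1]
      · have := g1 u u.2 v v.2
        rw [h2, h2] at this
        rw [h2, h2]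
        exact this

end

end APSP

/-! ### Composition of the phases -/

namespace APSP

open Prog _root_.APSP.Expr Dag

/-- The algorithm for a numbered graph. -/
def solve (P : Cmd) (r : ℕ) : Prog :=
  buildEdges ;; buildInverse ;; buildLists ;; closure P r ;; columns ;; output

namespace Dag

variable {n m : ℕ} {G : Dag n m} {w : Fin m → ℝ} {σ τ : Equiv.Perm (Fin n)}

theorem edge_count_le (G : Dag n m) : m ≤ n * n := by
  simpa using Fintype.card_le_of_injective _ G.edge_injective

theorem sum_workload_left (hσ : G.IsTopological σ) (hτ : G.reverse.IsTopological τ) :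
    ∑ x ∈ Finset.range n, (G.union σ τ hσ hτ).workload (Fin.append w w) x ≤
      ∑ v, G.indeg v * (G.leaf w σ v).ncard := by
  rw [← Fin.sum_univ_eq_sum_range, ← Equiv.sum_comp σ]
  refine Finset.sum_le_sum fun v _ => ?_
  have h := (G.union σ τ hσ hτ).workload_coe (Fin.append w w) (Fin.castAdd n (σ v))
  rw [Fin.val_castAdd] at h
  rw [h, union_indeg_left]
  exact Nat.mul_le_mul_left _ ((embeds_union_left hσ hτ w).ncard_leaf_le hσ
    (fun _ _ h => union_lt hσ hτ h) v)

theorem sum_workload_right (hσ : G.IsTopological σ) (hτ : G.reverse.IsTopological τ) :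
    ∑ x ∈ Finset.range n, (G.union σ τ hσ hτ).workload (Fin.append w w) (n + x) ≤
      ∑ v, G.outdeg v * (G.leafU w τ v).ncard := by
  rw [← Fin.sum_univ_eq_sum_range (fun x => (G.union σ τ hσ hτ).workload (Fin.append w w) (n + x)),
    ← Equiv.sum_comp τ]
  refine Finset.sum_le_sum fun v _ => ?_
  have h := (G.union σ τ hσ hτ).workload_coe (Fin.append w w) (Fin.natAdd n (τ v))
  rw [Fin.val_natAdd] at h
  rw [h, union_indeg_right]
  exact Nat.mul_le_mul_left _ ((embeds_union_right hσ hτ w).ncard_leaf_le hτ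
    (fun _ _ h => union_lt hσ hτ h) v)

theorem union_adj_lt_iff (hσ : G.IsTopological σ) (hτ : G.reverse.IsTopological τ)
    {x v : Fin (n + n)} (h : (G.union σ τ hσ hτ).Adj x v) : (x : ℕ) < n ↔ (v : ℕ) < n := by
  obtain ⟨e, he⟩ := h
  replace he : G.unionEdge σ τ e = (x, v) := he
  induction e using Fin.addCases with
  | left e =>
    rw [unionEdge_castAdd, Prod.mk.injEq] at he
    obtain ⟨rfl, rfl⟩ := he
    simp
  | right e =>
    rw [unionEdge_natAdd, Prod.mk.injEq] at he
    obtain ⟨rfl, rfl⟩ := he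
    simp

end Dag

section

variable {n m B k r : ℕ} {P : Cmd} {T : ℕ → ℕ} {G : Dag n m} {w : Fin m → ℝ}
  {σ τ : Equiv.Perm (Fin n)} {s : State}

/-- The step count is kept in natural numbers and in terms of D, c₁ and c₂, each with all its
bounds. Neither ω nor the minima occur; they enter only when these quantities are compared with the
time bound. -/
theorem wp_solve (hσ : G.IsTopological σ) (hτ : G.reverse.IsTopological τ)
    (hP : Multiplies P k T) (hr : P.RegsBelow r) (hs : G.Start w σ τ s) (hb : s.Bounded B)
    (hBk : (2 * (n + n) + 3) ^ k ≤ B) (hB4 : (4 * n + 4) ^ 4 ≤ B) :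
    wp B (solve P r) (fun s' t => G.IsOutput w s' ∧ ∃ L D c₁ c₂, 2 ^ L ≤ 4 * n + 1 ∧
      D ≤ 4 * (n * m) + 4 * (n * n) + 1 ∧ D ≤ levelSum T L L ∧
      c₁ ≤ ∑ v, G.indeg v * (G.leaf w σ v).ncard ∧
      c₂ ≤ ∑ v, G.outdeg v * (G.leafU w τ v).ncard ∧
      c₁ ≤ c₂ + 4 * (n * n) ∧ c₂ ≤ c₁ + 4 * (n * n) ∧
      t ≤ (2000 + 10 * closureCost P r) * (D + c₁ + c₂ + n * n + m + 1)) s := by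
  have hm := G.edge_count_le
  -- The largest words are the fuel and the counts of inspected edges, which are of order n³ because
  -- m ≤ n²; table indices are of order n².
  have hB5 : 4 * (n * (n * n)) + 4 * (n * n) + 4 * n + 3 < B ∧ 4 * (n * n) + n < B ∧
      (2 * (n + n) + 3) ^ 2 ≤ B := by
    have e : (4 * n + 4) ^ 4 = 256 * (n * n * (n * n)) + 1024 * (n * (n * n)) + 1536 * (n * n) +
      1024 * n + 256 := by ring
    have e2 : (2 * (n + n) + 3) ^ 2 = 16 * (n * n) + 24 * n + 9 := by ring
    rw [e2]
    omega
  obtain ⟨hB1, hB2, hB3⟩ := hB5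
  have hnm : n * m ≤ n * (n * n) := Nat.mul_le_mul_left _ hm
  have enn : (n + n) * (n + n) = 4 * (n * n) := by ring
  have enm : (n + n) * (m + m) = 4 * (n * m) := by ring
  have enn2 : (n + n) ^ 2 = 4 * (n * n) := by ring
  have hnn : n ≤ n * n := Nat.le_mul_self n
  set H := G.union σ τ hσ hτ with hHdef
  have hH : H.Ordered := fun _ _ h => union_lt hσ hτ h
  rw [solve, wp_seq]
  refine (wp_buildEdges hσ hτ hs (by omega) (by omega)).mono_bounded hb ?_
  rintro s₁ t₁ ⟨l₁, ht₁⟩ hF₁ b₁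
  have g0 : s₁.reg 0 = n := by rw [hF₁.reg 0 rfl, hs.reg_n]
  have z₁ : ∀ a i, 12 ≤ a → a < 20 ∨ 60 ≤ a → s₁.mem a i = 0 := fun a i ha ha' => by
    have e1 : Nat.beq 10 a = false := Bool.eq_false_iff.2 fun h => by
      have := Nat.eq_of_beq_eq_true h; omega
    have e2 : Nat.beq 11 a = false := Bool.eq_false_iff.2 fun h => by
      have := Nat.eq_of_beq_eq_true h; omega
    rw [hF₁.mem a (by simp [buildEdges, for_, wm, e1, e2]), hs.mem_zero a i (by omega) ha']
  have p2₁ : ∀ u : Fin n, s₁.mem 2 u = σ u := fun u => by rw [hF₁.mem 2 rfl, hs.fst]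
  have p3₁ : ∀ u : Fin n, s₁.mem 3 u = τ u := fun u => by rw [hF₁.mem 3 rfl, hs.snd]
  rw [wp_seq]
  refine (wp_buildInverse p2₁ p3₁ g0 (by omega)).mono_bounded b₁ ?_
  rintro s₂ t₂ ⟨h18, ht₂⟩ hF₂ b₂
  have l₂ : H.Loaded (Fin.append w w) s₂ := l₁.of_eq (hF₂.reg 2 rfl) (hF₂.reg 3 rfl)
    (hF₂.mem 10 rfl) (hF₂.mem 11 rfl) (hF₂.rmem 2 rfl)
  have z₂ : ∀ a i, 12 ≤ a → a < 18 ∨ a = 19 ∨ 60 ≤ a → s₂.mem a i = 0 := fun a i ha ha' => by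
    have e1 : Nat.beq 18 a = false := Bool.eq_false_iff.2 fun h => by
      have := Nat.eq_of_beq_eq_true h; omega
    rw [hF₂.mem a (by simp [buildInverse, for_, wm, e1]), z₁ a i ha (by omega)]
  rw [wp_seq]
  refine (wp_buildLists (N := n + n) (fun i => z₂ 12 i (by omega) (by omega)) l₂.reg_M (by omega)
    b₂).mono_bounded b₂ ?_
  rintro s₃ t₃ ⟨li₃, ht₃⟩ hF₃ b₃
  have l₃ : H.Loaded (Fin.append w w) s₃ := l₂.of_eq (hF₃.reg 2 rfl) (hF₃.reg 3 rfl)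
    (hF₃.mem 10 rfl) (hF₃.mem 11 rfl) (hF₃.rmem 2 rfl)
  have z₃ : ∀ a i, 14 ≤ a → a < 18 ∨ a = 19 ∨ 60 ≤ a → s₃.mem a i = 0 := fun a i ha ha' => by
    have e1 : Nat.beq 12 a = false := Bool.eq_false_iff.2 fun h => by
      have := Nat.eq_of_beq_eq_true h; omega
    have e2 : Nat.beq 13 a = false := Bool.eq_false_iff.2 fun h => by
      have := Nat.eq_of_beq_eq_true h; omega
    rw [hF₃.mem a (by simp [buildLists, for_, wm, e1, e2]), z₂ a i (by omega) ha']
  rw [wp_seq]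
  refine (wp_closure hH hP hr l₃ li₃ (fun i => z₃ 14 i (by omega) (by omega))
    (fun i => z₃ 15 i (by omega) (by omega)) (fun a i => z₃ _ i (by omega) (by omega)) b₃ hBk hB3
    (by rw [enn, enm]; omega) (by omega)).mono_bounded b₃ ?_
  rintro s₄ t₄ ⟨hc₄, L, D, hL, hD, hDL, ht₄⟩ hF₄ b₄
  have m₄ : ∀ x < 60, x ≠ 19 → x ≠ 15 → x ≠ 14 → s₄.mem x = s₃.mem x := fun x h1 h2 h3 h4 =>
    hF₄.mem x (closure_wm h1 h2 h3 h4)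
  have r₄ : s₄.rmem = s₃.rmem := funext fun a => hF₄.rmem a closure_wrm
  have l₄ : H.Loaded (Fin.append w w) s₄ := l₃.of_eq (hF₄.reg 2 (closure_wr (by omega)))
    (hF₄.reg 3 (closure_wr (by omega))) (m₄ 10 (by omega) (by omega) (by omega) (by omega))
    (m₄ 11 (by omega) (by omega) (by omega) (by omega)) (by rw [r₄])
  have li₄ : Lists (n + n) (m + m) s₄ := li₃.of_eq (m₄ 11 (by omega) (by omega) (by omega) (by omega))
    (m₄ 12 (by omega) (by omega) (by omega) (by omega))
    (m₄ 13 (by omega) (by omega) (by omega) (by omega))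
  have rz : ∀ a i, a = 1 ∨ a = 3 → s₄.rmem a i = 0 := fun a i ha => by
    rw [r₄, hF₃.rmem a rfl, hF₂.rmem a rfl, hF₁.rmem a (by rcases ha with rfl | rfl <;> rfl),
      hs.rmem_zero a i (by omega)]
  have g0₄ : s₄.reg 0 = n := by
    rw [hF₄.reg 0 (closure_wr (by omega)), hF₃.reg 0 rfl, hF₂.reg 0 rfl, g0]
  rw [wp_seq]
  refine (wp_columns hH (fun x v h => union_adj_lt_iff hσ hτ h) l₄ li₄ hc₄ g0₄ (fun x => ?_) ?_
    (by omega)).mono ?_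
  · refine ⟨False.elim, fun _ => ⟨fun a _ => ?_, rz 3 _ (by omega)⟩⟩
    rw [m₄ 16 (by omega) (by omega) (by omega) (by omega), z₃ 16 _ (by omega) (by omega)]
  · rw [enn, add_mul, one_mul]
    have : n * (4 * (n * n)) = 4 * (n * (n * n)) := by ring
    omega
  rintro s₅ t₅ ⟨hcol, c₁, c₂, hc₁, hc₂, hb₁, hb₂, ht₅⟩ hF₅
  have m₅ : ∀ x < 14, s₅.mem x = s₃.mem x := fun x hx => by
    rw [hF₅.mem x (by interval_cases x <;> rfl), m₄ x (by omega) (by omega) (by omega) (by omega)]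
  have hc₅ : H.Closed s₅ := fun i hi j hj => by rw [hF₅.mem 14 rfl]; exact hc₄ i hi j hj
  refine (wp_output hσ hτ hc₅ (by rw [hF₅.reg 0 rfl, g0₄]) (by rw [hF₅.reg 2 rfl, l₄.reg_N])
    (fun u => by rw [m₅ 2 (by omega), hF₃.mem 2 rfl, hF₂.mem 2 rfl, p2₁])
    (fun u => by rw [m₅ 3 (by omega), hF₃.mem 3 rfl, hF₂.mem 3 rfl, p3₁])
    (fun u => by
      rw [hF₅.mem 18 rfl, m₄ 18 (by omega) (by omega) (by omega) (by omega), hF₃.mem 18 rfl]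
      exact h18 u)
    (fun i => by rw [hF₅.rmem 1 rfl, rz 1 i (by omega)])
    (fun i => by
      rw [m₅ 4 (by omega), hF₃.mem 4 rfl, hF₂.mem 4 rfl, hF₁.mem 4 rfl, hs.mem_four])
    (by rw [enn]; omega) hcol).mono ?_
  rintro s₆ t₆ ⟨hout, ht₆⟩ -
  rw [enn] at hb₁ hb₂ ht₅ hD
  rw [enm] at hD
  rw [enn2] at ht₄
  have en : n ^ 2 = n * n := by ring
  rw [en] at ht₆
  refine ⟨hout, L, D, c₁, c₂, by omega, hD, hDL, hc₁.trans (sum_workload_left hσ hτ),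
    hc₂.trans (sum_workload_right hσ hτ), hb₁, hb₂, ?_⟩
  have h1 : closureCost P r * (D + 4 * (n * n) + (m + m) + 1) ≤
      closureCost P r * (10 * (D + c₁ + c₂ + n * n + m + 1)) := Nat.mul_le_mul_left _ (by omega)
  have h2 : (2000 + 10 * closureCost P r) * (D + c₁ + c₂ + n * n + m + 1) =
      2000 * (D + c₁ + c₂ + n * n + m + 1) +
      closureCost P r * (10 * (D + c₁ + c₂ + n * n + m + 1)) := by ring
  rw [h2]
  omega

end

end APSP

namespace APSP

/-! ### The time for matrix multiplication -/

/-- An execution changes at most one cell of an array in a step. -/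
theorem Exec.exists_changed {W : ℕ} {c : Cmd} {s s' : State} {t : ℕ} (h : Exec W c s s' t) (a : ℕ) :
    ∃ S : Finset ℕ, S.card ≤ t ∧ ∀ i ∉ S, s'.mem a i = s.mem a i := by
  induction h with
  | store s b i x =>
    refine ⟨{s.reg i}, by simp, fun j hj => ?_⟩
    have : j ≠ s.reg i := by simpa using hj
    simp [this]
  | seq _ _ h₁ h₂ =>
    obtain ⟨S₁, c₁, e₁⟩ := h₁
    obtain ⟨S₂, c₂, e₂⟩ := h₂
    refine ⟨S₁ ∪ S₂, (Finset.card_union_le _ _).trans (by omega), fun i hi => ?_⟩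
    rw [Finset.mem_union, not_or] at hi
    rw [e₂ i hi.2, e₁ i hi.1]
  | while_true _ _ _ h₁ h₂ =>
    obtain ⟨S₁, c₁, e₁⟩ := h₁
    obtain ⟨S₂, c₂, e₂⟩ := h₂
    refine ⟨S₁ ∪ S₂, (Finset.card_union_le _ _).trans (by omega), fun i hi => ?_⟩
    rw [Finset.mem_union, not_or] at hi
    rw [e₂ i hi.2, e₁ i hi.1]
  | ifLt_true _ _ h | ifLt_false _ _ h | ifRLt_true _ _ h | ifRLt_false _ _ h =>
    obtain ⟨S, c, e⟩ := h
    exact ⟨S, by omega, e⟩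
  | _ => exact ⟨∅, by simp, fun _ _ => rfl⟩

/-- The product of two `n × n` matrices has `n ^ 2` entries, which take as many steps to write. -/
theorem Multiplies.sq_le {P : Cmd} {k : ℕ} {T : ℕ → ℕ} (hP : Multiplies P k T) {n : ℕ} (hn : 1 ≤ n) :
    n * n ≤ T n := by
  -- For the matrices with all entries 1 every entry of the product is n, which is positive, while
  -- the array for the result is zero at the start; so each of its n² cells must have been written.
  obtain ⟨A, hA⟩ : ∃ A : Matrix (Fin n) (Fin n) ℕ, ∀ i j, A i j = 1 := ⟨fun _ _ => 1, fun _ _ => rfl⟩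
  obtain ⟨s, t, hex, ht, hs⟩ := hP n hn A A (by simp [hA]) (by simp [hA])
  obtain ⟨S, hS, hS'⟩ := hex.exists_changed 2
  have hsub : Finset.range (n * n) ⊆ S := by
    intro i hi
    by_contra hiS
    have hi' : i < n * n := Finset.mem_range.1 hi
    have h1 := hS' i hiS
    have h2 := hs ⟨i / n, Nat.div_lt_of_lt_mul hi'⟩ ⟨i % n, Nat.mod_lt _ hn⟩
    rw [Matrix.mul_apply] at h2
    simp only [hA, mul_one, Finset.sum_const, Finset.card_univ, Fintype.card_fin, smul_eq_mul] at h2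
    rw [mul_comm (i / n), Nat.div_add_mod, h1] at h2
    have h3 : (matMulInput A A).mem 2 i = 0 := by
      simp [matMulInput]
    omega
  have := Finset.card_le_card hsub
  rw [Finset.card_range] at this
  omega

/-- Otherwise n^(2-ω) would be bounded by C, although it tends to infinity. -/
theorem two_le_of_sq_le {ω C : ℝ} (h : ∀ n : ℕ, 1 ≤ n → ((n * n : ℕ) : ℝ) ≤ C * (n : ℝ) ^ ω) :
    2 ≤ ω := by
  by_contra hω
  push Not at hω
  have h1 : Filter.Tendsto (fun n : ℕ => (n : ℝ) ^ (2 - ω)) Filter.atTop Filter.atTop :=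
    (tendsto_rpow_atTop (by linarith)).comp tendsto_natCast_atTop_atTop
  obtain ⟨n, hn, hn1⟩ := ((h1.eventually_gt_atTop C).and (Filter.eventually_ge_atTop 1)).exists
  have hn0 : (0 : ℝ) < n := by exact_mod_cast hn1
  have h2 := h n hn1
  have h3 : ((n * n : ℕ) : ℝ) = (n : ℝ) ^ (2 - ω) * (n : ℝ) ^ ω := by
    rw [← Real.rpow_add hn0]
    push_cast
    rw [show 2 - ω + ω = ((2 : ℕ) : ℝ) by push_cast; ring, Real.rpow_natCast, sq]
  rw [h3] at h2
  have h4 := le_of_mul_le_mul_right h2 (Real.rpow_pos_of_pos hn0 ω)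
  linarith

theorem sum_pow_le_pow {q : ℝ} (hq : 2 ≤ q) (L : ℕ) : ∑ i ∈ Finset.range L, q ^ i ≤ q ^ L := by
  induction L with
  | zero => simp
  | succ L ih =>
    rw [Finset.sum_range_succ, pow_succ]
    have : 0 ≤ q ^ L := by positivity
    nlinarith

/-- The term for level i is at most C 2^L q^i with q = 2^(ω-1). Since ω ≥ 2 gives q ≥ 2, the
geometric sum is at most the next power q^L, and no logarithm appears even for ω = 2. -/
theorem levelSum_le {T : ℕ → ℕ} {ω C : ℝ} (hω : 2 ≤ ω) (hC : 0 ≤ C)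
    (hT : ∀ n : ℕ, 1 ≤ n → (T n : ℝ) ≤ C * (n : ℝ) ^ ω) (L : ℕ) :
    (levelSum T L L : ℝ) ≤ C * ((2 ^ L : ℕ) : ℝ) ^ ω := by
  set q : ℝ := 2 ^ (ω - 1) with hq
  have hq2 : 2 ≤ q := by
    calc (2 : ℝ) = 2 ^ (1 : ℝ) := by simp
      _ ≤ _ := Real.rpow_le_rpow_of_exponent_le (by norm_num) (by linarith)
  have hpow : ∀ i : ℕ, ((2 ^ i : ℕ) : ℝ) ^ ω = 2 ^ i * q ^ i := by
    intro i
    rw [← mul_pow, hq]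
    push_cast
    rw [← Real.rpow_natCast, ← Real.rpow_mul (by norm_num), mul_comm, Real.rpow_mul (by norm_num),
      Real.rpow_natCast]
    congr 1
    conv_rhs => rw [← Real.rpow_one_add' (by norm_num) (by linarith)]
    congr 1; ring
  have hterm : ∀ i ∈ Finset.range L, ((2 ^ (L - i) * T (2 ^ i) : ℕ) : ℝ) ≤ C * 2 ^ L * q ^ i := by
    intro i hi
    have hi' := Finset.mem_range.1 hi
    have h1 := hT (2 ^ i) Nat.one_le_two_pow
    rw [hpow] at h1
    have h2 : (2 : ℝ) ^ L = 2 ^ (L - i) * 2 ^ i := by rw [← pow_add]; congr 1; omega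
    push_cast
    calc (2 : ℝ) ^ (L - i) * (T (2 ^ i) : ℝ) ≤ 2 ^ (L - i) * (C * (2 ^ i * q ^ i)) :=
          mul_le_mul_of_nonneg_left h1 (by positivity)
      _ = _ := by rw [h2]; ring
  rw [levelSum, Nat.cast_sum, hpow]
  refine (Finset.sum_le_sum hterm).trans ?_
  rw [← Finset.mul_sum]
  calc C * 2 ^ L * ∑ i ∈ Finset.range L, q ^ i ≤ C * 2 ^ L * q ^ L :=
        mul_le_mul_of_nonneg_left (sum_pow_le_pow hq2 L) (by positivity)
    _ = _ := by ring

/-- The simulation counts whole steps, so the real time bound is replaced by its floor, which a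
natural number of steps respects as well. -/
theorem MatMulInTime.exists_multiplies {ω : ℝ} (h : MatMulInTime ω) :
    ∃ (P : Cmd) (k : ℕ) (T : ℕ → ℕ) (C : ℝ), Multiplies P k T ∧ 0 ≤ C ∧ 2 ≤ ω ∧
      ∀ n : ℕ, 1 ≤ n → (T n : ℝ) ≤ C * (n : ℝ) ^ ω := by
  obtain ⟨P, k, C, h⟩ := h
  have hpos : ∀ n : ℕ, 1 ≤ n → 0 ≤ C * (n : ℝ) ^ ω := by
    intro n hn
    obtain ⟨s, t, -, ht, -⟩ := h n hn 0 0 (by simp) (by simp)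
    exact (Nat.cast_nonneg t).trans ht
  -- For n = 1 the power is 1, and a running time is not negative.
  have hC : 0 ≤ C := by simpa using hpos 1 le_rfl
  have hT : ∀ n : ℕ, 1 ≤ n → ((⌊C * (n : ℝ) ^ ω⌋₊ : ℕ) : ℝ) ≤ C * (n : ℝ) ^ ω :=
    fun n hn => Nat.floor_le (hpos n hn)
  have hP : Multiplies P k fun n => ⌊C * (n : ℝ) ^ ω⌋₊ := by
    intro n hn A B hA hB
    obtain ⟨s, t, hex, ht, hs⟩ := h n hn A B hA hB
    exact ⟨s, t, hex, Nat.le_floor ht, hs⟩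
  refine ⟨P, k, _, C, hP, hC, two_le_of_sq_le (C := C) fun n hn => ?_, hT⟩
  exact (Nat.cast_le.2 (hP.sq_le hn)).trans (hT n hn)

/-! ### The total time -/

namespace Dag

/-- Both D and n² are bounded by a multiple of n^ω and by a multiple of nm + n² log n, hence by a
multiple of the minimum. For n² the first bound comes from the time needed to write a product, the
second from log n ≥ 1/2 for n ≥ 2. All other terms are absorbed by n² or by the second minimum. -/
theorem le_timeBound {T : ℕ → ℕ} {P : Cmd} {k : ℕ} {ω C : ℝ} (hP : Multiplies P k T) (hω : 2 ≤ ω)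
    (hC : 0 ≤ C) (hT : ∀ n : ℕ, 1 ≤ n → (T n : ℝ) ≤ C * (n : ℝ) ^ ω) {n m : ℕ} (G : Dag n m)
    (w : Fin m → ℝ) (σ τ : Equiv.Perm (Fin n)) (hn : 2 ≤ n) {L D c₁ c₂ : ℕ} (hL : 2 ^ L ≤ 4 * n + 1)
    (hD : D ≤ 4 * (n * m) + 4 * (n * n) + 1) (hDL : D ≤ levelSum T L L)
    (hc₁ : c₁ ≤ ∑ v, G.indeg v * (G.leaf w σ v).ncard)
    (hc₂ : c₂ ≤ ∑ v, G.outdeg v * (G.leafU w τ v).ncard)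
    (hb₁ : c₁ ≤ c₂ + 4 * (n * n)) (hb₂ : c₂ ≤ c₁ + 4 * (n * n)) :
    ((D + c₁ + c₂ + n * n + m + 1 : ℕ) : ℝ) ≤ (C * 5 ^ ω + 7 * C + 30) * G.timeBound w ω σ τ := by
  have hm := G.edge_count_le
  have hn0 : (0 : ℝ) ≤ n := Nat.cast_nonneg n
  have hnω : 0 ≤ (n : ℝ) ^ ω := Real.rpow_nonneg hn0 ω
  have h5 : (0 : ℝ) ≤ 5 ^ ω := Real.rpow_nonneg (by norm_num) ω
  have hnn : 1 ≤ n * n := Nat.mul_pos (by omega) (by omega)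
  have hlog : 1 / 2 ≤ Real.log n := by
    have h2 : Real.log 2 ≤ Real.log n := Real.log_le_log (by norm_num) (by exact_mod_cast hn)
    have := Real.log_two_gt_d9
    linarith
  -- the two bounds for `D` and for `n ^ 2`
  have hD₁ : (D : ℝ) ≤ C * 5 ^ ω * (n : ℝ) ^ ω := by
    have h1 := levelSum_le hω hC hT L
    have h2 : (((2 ^ L : ℕ) : ℝ)) ^ ω ≤ (5 * n : ℝ) ^ ω := by
      refine Real.rpow_le_rpow (Nat.cast_nonneg _) ?_ (by linarith)
      have : 2 ^ L ≤ 5 * n := by omega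
      exact_mod_cast this
    rw [Real.mul_rpow (by norm_num) hn0] at h2
    calc (D : ℝ) ≤ levelSum T L L := Nat.cast_le.2 hDL
      _ ≤ C * (5 ^ ω * (n : ℝ) ^ ω) := h1.trans (mul_le_mul_of_nonneg_left h2 hC)
      _ = _ := by ring
  have hsq : ((n * n : ℕ) : ℝ) ≤ C * (n : ℝ) ^ ω :=
    (Nat.cast_le.2 (hP.sq_le (by omega))).trans (hT n (by omega))
  have hsq' : ((n * n : ℕ) : ℝ) ≤ 2 * ((n : ℝ) ^ 2 * Real.log n) := by
    push_cast
    nlinarith [sq_nonneg (n : ℝ)]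
  have hD₂ : (D : ℝ) ≤ 10 * ((n : ℝ) * m + (n : ℝ) ^ 2 * Real.log n) := by
    have h1 : (D : ℝ) ≤ 4 * ((n : ℝ) * m) + 5 * ((n * n : ℕ) : ℝ) := by
      have : D ≤ 4 * (n * m) + 5 * (n * n) := by omega
      calc (D : ℝ) ≤ ((4 * (n * m) + 5 * (n * n) : ℕ) : ℝ) := Nat.cast_le.2 this
        _ = _ := by push_cast; ring
    have h2 : (0 : ℝ) ≤ (n : ℝ) * m := by positivity
    linarith
  have hnm0 : (0 : ℝ) ≤ (n : ℝ) * m := by positivity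
  set X : ℝ := min ((n : ℝ) ^ ω) ((n : ℝ) * m + (n : ℝ) ^ 2 * Real.log n) with hX
  have hX0 : 0 ≤ X := le_min hnω (by nlinarith [sq_nonneg (n : ℝ)])
  have hC5 : 0 ≤ C * 5 ^ ω := mul_nonneg hC h5
  have hDX : (D : ℝ) ≤ (C * 5 ^ ω + 10) * X := by
    rcases min_choice ((n : ℝ) ^ ω) ((n : ℝ) * m + (n : ℝ) ^ 2 * Real.log n) with h | h <;>
      rw [hX, h]
    · linarith
    · rw [h] at hX; rw [hX] at hX0; nlinarith
  have hsqX : ((n * n : ℕ) : ℝ) ≤ (C + 2) * X := by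
    rcases min_choice ((n : ℝ) ^ ω) ((n : ℝ) * m + (n : ℝ) ^ 2 * Real.log n) with h | h <;>
      rw [hX, h]
    · linarith
    · rw [h] at hX; rw [hX] at hX0; nlinarith
  set F : ℝ := ∑ v, (G.indeg v : ℝ) * (G.leaf w σ v).ncard with hF
  set F' : ℝ := ∑ v, (G.outdeg v : ℝ) * (G.leafU w τ v).ncard with hF'
  have hFc : (c₁ : ℝ) ≤ F := by
    rw [hF]; exact_mod_cast hc₁
  have hFc' : (c₂ : ℝ) ≤ F' := by
    rw [hF']; exact_mod_cast hc₂
  have hb₁' : (c₁ : ℝ) ≤ c₂ + 4 * ((n * n : ℕ) : ℝ) := by exact_mod_cast hb₁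
  have hb₂' : (c₂ : ℝ) ≤ c₁ + 4 * ((n * n : ℕ) : ℝ) := by exact_mod_cast hb₂
  -- The balance of the counts pays off: the larger one exceeds the smaller by at most 4 n², and
  -- whichever sum is smaller bounds its own count.
  have hcc : (c₁ : ℝ) + c₂ ≤ 2 * min F F' + 4 * ((n * n : ℕ) : ℝ) := by
    rcases min_choice F F' with h | h <;> rw [h] <;> linarith
  have hmin0 : 0 ≤ min F F' :=
    le_min ((Nat.cast_nonneg _).trans hFc) ((Nat.cast_nonneg _).trans hFc')
  have hm' : (m : ℝ) ≤ ((n * n : ℕ) : ℝ) := Nat.cast_le.2 hm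
  have hone : (1 : ℝ) ≤ ((n * n : ℕ) : ℝ) := by exact_mod_cast hnn
  -- Of the seven n², four come from the imbalance of the counts and one each from n², m and 1.
  have htotal : ((D + c₁ + c₂ + n * n + m + 1 : ℕ) : ℝ) ≤
      D + 2 * min F F' + 7 * ((n * n : ℕ) : ℝ) := by
    rw [Nat.cast_add, Nat.cast_add, Nat.cast_add, Nat.cast_add, Nat.cast_add, Nat.cast_one]
    linarith
  rw [timeBound, ← hX]
  refine htotal.trans ?_
  have e : (C * 5 ^ ω + 7 * C + 30) * (X + min F F') =
      (C * 5 ^ ω + 10) * X + 7 * ((C + 2) * X) + 6 * X + (C * 5 ^ ω + 7 * C + 30) * min F F' := by ring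
  rw [e]
  have h7 : 2 * min F F' ≤ (C * 5 ^ ω + 7 * C + 30) * min F F' :=
    mul_le_mul_of_nonneg_right (by linarith) hmin0
  linarith

end Dag

end APSP

namespace APSP

open Prog _root_.APSP.Expr Dag

/-! ### Topological sorting -/

/-- The adjacency matrix and the numbers of entering edges. -/
def countEdges : Prog :=
  for_ 10 1 (
    put 20 (ld 0 (var 10) * var 0 + ld 1 (var 10)) 1 ;;
    put 21 (ld 1 (var 10)) (ld 21 (ld 1 (var 10)) + 1))

/-- Find a vertex that has no number and no entering edges from vertices without a number. -/
def findSource : Prog :=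
  set 12 0 ;; for_ 11 0 (ite (ld 21 (var 11) + ld 22 (var 11)) 1 (set 12 (var 11)) skip)

/-- Number the vertices, and number them in reverse order. -/
def number : Prog :=
  countEdges ;;
  for_ 10 0 (
    findSource ;;
    put 2 (var 12) (var 10) ;;
    put 3 (var 12) (var 0 - 1 - var 10) ;;
    put 22 (var 12) 1 ;;
    for_ 11 0 (put 21 (var 11) (ld 21 (var 11) - ld 20 (var 12 * var 0 + var 11))))

namespace Dag

variable {n m : ℕ} {G : Dag n m} {S : Finset (Fin n)} {x v : Fin n}

/-- The number of edges that enter `v` from outside `S`. -/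
def indegOff (G : Dag n m) (S : Finset (Fin n)) (v : Fin n) : ℕ :=
  (Finset.univ.filter fun e => (G.edge e).2 = v ∧ (G.edge e).1 ∉ S).card

theorem indegOff_empty (G : Dag n m) (v : Fin n) : G.indegOff ∅ v = G.indeg v := by
  simp [indegOff, indeg]

theorem indegOff_eq_zero_iff : G.indegOff S v = 0 ↔ ∀ u, G.Adj u v → u ∈ S := by
  rw [indegOff, Finset.card_eq_zero, Finset.filter_eq_empty_iff]
  constructor
  · rintro h u ⟨e, he⟩
    by_contra hu
    exact h (Finset.mem_univ e) (by rw [he]; exact ⟨rfl, hu⟩)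
  · rintro h e - ⟨h1, h2⟩
    exact h2 (h _ ⟨e, Prod.ext rfl h1⟩)

-- There are no parallel edges, so numbering x removes at most one entering edge of v.
open Classical in
theorem indegOff_insert (hx : x ∉ S) :
    G.indegOff (insert x S) v = G.indegOff S v - if G.Adj x v then 1 else 0 := by
  split_ifs with h
  · obtain ⟨e₀, he₀⟩ := h
    have : (Finset.univ.filter fun e => (G.edge e).2 = v ∧ (G.edge e).1 ∉ insert x S) =
        (Finset.univ.filter fun e => (G.edge e).2 = v ∧ (G.edge e).1 ∉ S).erase e₀ := by
      ext e
      simp only [Finset.mem_filter, Finset.mem_univ, true_and, Finset.mem_erase, Finset.mem_insert,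
        not_or]
      constructor
      · rintro ⟨h1, h2, h3⟩
        exact ⟨fun h => h2 (by rw [h, he₀]), h1, h3⟩
      · rintro ⟨h1, h2, h3⟩
        refine ⟨h2, fun h => h1 (G.edge_injective ?_), h3⟩
        rw [he₀]; exact Prod.ext h h2
    rw [indegOff, this, Finset.card_erase_of_mem, indegOff]
    simp [he₀, hx]
  · rw [Nat.sub_zero, indegOff, indegOff]
    congr 1
    ext e
    simp only [Finset.mem_filter, Finset.mem_univ, true_and, Finset.mem_insert, not_or]
    refine and_congr_right fun h1 => and_iff_right_of_imp fun _ h2 => h ⟨e, Prod.ext h2 h1⟩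

/-- A vertex without entering edges from outside `S` exists outside `S`. -/
theorem exists_indegOff_eq_zero (G : Dag n m) (hS : S.card < n) : ∃ x ∉ S, G.indegOff S x = 0 := by
  have hne : ((S : Set (Fin n))ᶜ).Nonempty := by
    by_contra h
    rw [Set.not_nonempty_iff_eq_empty, Set.compl_empty_iff, Finset.coe_eq_univ] at h
    rw [h] at hS
    simp at hS
  have hwf : WellFounded (Relation.TransGen G.Adj) := by
    have : IsTrans (Fin n) (Relation.TransGen G.Adj) := ⟨fun _ _ _ => Relation.TransGen.trans⟩
    have : Std.Irrefl (Relation.TransGen G.Adj) := ⟨G.acyclic⟩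
    exact Finite.wellFounded_of_trans_of_irrefl _
  obtain ⟨x, hx, hmin⟩ := hwf.has_min _ hne
  refine ⟨x, hx, indegOff_eq_zero_iff.2 fun u hu => ?_⟩
  by_contra h
  exact hmin u h (.single hu)

/-- The vertices in `S` have been numbered. -/
structure Numbered (G : Dag n m) (S : Finset (Fin n)) (s : State) : Prop where
  flag : ∀ v : Fin n, s.mem 22 v = if v ∈ S then 1 else 0
  count : ∀ v : Fin n, s.mem 21 v = G.indegOff S v
  lt : ∀ v ∈ S, s.mem 2 (v : Fin n) < S.card
  inj : ∀ u ∈ S, ∀ v ∈ S, s.mem 2 (u : Fin n) = s.mem 2 (v : Fin n) → u = v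
  mono : ∀ u v, G.Adj u v → v ∈ S → u ∈ S ∧ s.mem 2 u < s.mem 2 v
  rev : ∀ v ∈ S, s.mem 3 (v : Fin n) = n - 1 - s.mem 2 (v : Fin n)

end Dag

section

variable {n m B : ℕ} {G : Dag n m} {s : State}

open Classical in
theorem wp_countEdges (hn : s.reg 0 = n) (hm : s.reg 1 = m) (ht : ∀ e : Fin m, s.mem 0 e = (G.edge e).1)
    (hh : ∀ e : Fin m, s.mem 1 e = (G.edge e).2) (h20 : ∀ i, s.mem 20 i = 0)
    (h21 : ∀ i, s.mem 21 i = 0) (hmB : m + 1 < B) :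
    wp B countEdges (fun s' t =>
      (∀ u v : Fin n, s'.mem 20 (u * n + v) = if G.Adj u v then 1 else 0) ∧
      (∀ v : Fin n, s'.mem 21 v = G.indeg v) ∧ t ≤ 4 * m + 2) s := by
  refine wp_for_const (c := 2) (fun c s' =>
    (∀ u v : Fin n, s'.mem 20 (u * n + v) = if ∃ e : Fin m, (e : ℕ) < c ∧ G.edge e = (u, v) then 1
      else 0) ∧ ∀ v : ℕ, s'.mem 21 v = inCount (s.mem 1) c v 0) (by omega) (by decide) rfl rfl
    (by simp [h20, h21, inCount]) ?_ ?_
  · rintro c hc s' ⟨hI, hI'⟩ h10 hF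
    rw [hm] at hc
    have g0 : s'.reg 0 = n := by rw [hF.reg 0 rfl, hn]
    have et : s'.mem 0 c = (G.edge ⟨c, hc⟩).1 := by rw [hF.mem 0 rfl]; exact ht ⟨c, hc⟩
    have eh : s'.mem 1 c = (G.edge ⟨c, hc⟩).2 := by rw [hF.mem 1 rfl]; exact hh ⟨c, hc⟩
    have hsucc : ∀ v, inCount (s.mem 1) (c + 1) v 0 =
        inCount (s.mem 1) c v 0 + if v = (G.edge ⟨c, hc⟩).2 then 1 else 0 := by
      intro v
      have eh' : s.mem 1 c = (G.edge ⟨c, hc⟩).2 := hh ⟨c, hc⟩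
      simp only [inCount]
      rw [← Finset.insert_Ico_right_eq_Ico_add_one (Nat.zero_le c), Finset.filter_insert, eh']
      by_cases hv : ((G.edge ⟨c, hc⟩).2 : ℕ) = v
      · rw [if_pos hv, if_pos hv.symm, Finset.card_insert_of_notMem (by simp)]
      · rw [if_neg hv, if_neg fun h => hv h.symm, add_zero]
    have hle : ∀ v, inCount (s.mem 1) c v 0 ≤ c := fun v =>
      (Finset.card_filter_le _ _).trans (by simp)
    have hle' := hle (G.edge ⟨c, hc⟩).2
    rw [wp_seq, wp_put, wp_put]
    simp [h10, g0, et, eh, hI']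
    refine ⟨by omega, by omega, fun u v => ?_, fun v => ?_⟩
    · rw [hI]
      have hind := mul_add_inj (i := u) (i' := (G.edge ⟨c, hc⟩).1) v.2 (G.edge ⟨c, hc⟩).2.2
      by_cases h : G.edge ⟨c, hc⟩ = (u, v)
      · rw [if_pos (by rw [h]), if_pos ⟨⟨c, hc⟩, le_rfl, h⟩]
      · rw [if_neg]
        · congr 1
          simp only [eq_iff_iff]
          refine exists_congr fun e => and_congr_left fun he => ⟨fun h' => h'.le, fun h' => ?_⟩
          refine lt_of_le_of_ne h' fun h'' => h ?_
          rw [← he]; congr 1; exact Fin.ext h''.symm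
        · intro h'
          obtain ⟨h1, h2⟩ := hind.1 h'
          exact h (Prod.ext (Fin.ext h1.symm) (Fin.ext h2.symm))
    · rw [hsucc]
      by_cases hv : v = (G.edge ⟨c, hc⟩).2
      · simp [hv]
      · simp [hv]
  · rintro s' t ⟨hI, hI'⟩ hF ht'
    rw [hm] at hI hI' ht'
    refine ⟨fun u v => ?_, fun v => ?_, ht'⟩
    · rw [hI]
      congr 1
      simp only [eq_iff_iff]
      exact exists_congr fun e => and_iff_right e.2
    · rw [hI', inCount_eq_indeg hh]

theorem wp_findSource {p : ℕ → Prop} (hn : s.reg 0 = n) (hnB : n + 1 < B)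
    (hp : ∀ v < n, p v ↔ s.mem 21 v = 0 ∧ s.mem 22 v = 0) (hex : ∃ v < n, p v) :
    wp B findSource (fun s' t => s'.reg 12 < n ∧ p (s'.reg 12) ∧ t ≤ 4 * n + 3) s := by
  rw [findSource, wp_seq, wp_set]
  refine ⟨by show 0 < B; omega, ?_⟩
  refine wp_for_const (c := 2) (fun c s' => ∀ v < c, p v → s'.reg 12 < n ∧ p (s'.reg 12))
    (by simp [hn]; omega) (by decide) rfl rfl (fun v hv => absurd hv (Nat.not_lt_zero v)) ?_ ?_
  · intro c hc s' hI h11 hF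
    have hc' : c < n := by simpa [hn] using hc
    have e : (ld 21 (var 11) + ld 22 (var 11) : Expr).eval s' = s.mem 21 c + s.mem 22 c := by
      simp [h11, hF.mem 21 rfl, hF.mem 22 rfl]
    have e1 : (1 : Expr).eval s' = 1 := rfl
    rw [wp_ite, e, e1, wp_set, wp_skip]
    refine ⟨fun h => ⟨by simp [h11]; omega, fun v hv hpv => ?_, le_rfl⟩,
      fun h => ⟨fun v hv hpv => ?_, by omega⟩⟩
    · have hpc : p c := (hp c hc').2 (by omega)
      simpa [h11] using ⟨hc', hpc⟩
    · rcases (Nat.lt_succ_iff.1 hv).lt_or_eq with h' | rfl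
      · simpa using hI v h' hpv
      · have := (hp v hc').1 hpv
        omega
  · intro s' t hI hF ht
    obtain ⟨v, hv, hpv⟩ := hex
    have hn' : (s.setReg 12 ((0 : Expr).eval s)).reg 0 = n := by simp [hn]
    rw [hn'] at hI ht
    exact ⟨(hI v hv hpv).1, (hI v hv hpv).2, by omega⟩

end

end APSP

namespace APSP

open Prog _root_.APSP.Expr Dag

section

variable {n m B : ℕ} {G : Dag n m} {s : State}

open Classical in
/-- The vertex `x` gets the next number. -/
theorem Dag.Numbered.insert {S : Finset (Fin n)} {x : Fin n} {s' : State} (h : G.Numbered S s)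
    (hx : x ∉ S) (hx0 : G.indegOff S x = 0)
    (h2 : ∀ v : Fin n, s'.mem 2 v = if v = x then S.card else s.mem 2 v)
    (h3 : ∀ v : Fin n, s'.mem 3 v = if v = x then n - 1 - S.card else s.mem 3 v)
    (h22 : ∀ v : Fin n, s'.mem 22 v = if v = x then 1 else s.mem 22 v)
    (h21 : ∀ v : Fin n, s'.mem 21 v = s.mem 21 v - if G.Adj x v then 1 else 0) :
    G.Numbered (insert x S) s' := by
  have hcard := Finset.card_insert_of_notMem hx
  have hne : ∀ v ∈ S, v ≠ x := fun v hv h => hx (h ▸ hv)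
  refine ⟨fun v => ?_, fun v => ?_, fun v hv => ?_, fun u hu v hv huv => ?_, fun u v huv hv => ?_,
    fun v hv => ?_⟩
  · rw [h22, h.flag]
    by_cases hvx : v = x <;> simp [hvx]
  · rw [h21, h.count, indegOff_insert hx]
  · rw [h2, hcard]
    split_ifs with hvx
    · omega
    · have := h.lt v ((Finset.mem_insert.1 hv).resolve_left hvx)
      omega
  · rw [h2, h2] at huv
    by_cases hux : u = x
    · by_cases hvx : v = x
      · rw [hux, hvx]
      · rw [if_pos hux, if_neg hvx] at huv
        have := h.lt v ((Finset.mem_insert.1 hv).resolve_left hvx)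
        omega
    · have hu' := (Finset.mem_insert.1 hu).resolve_left hux
      by_cases hvx : v = x
      · rw [if_neg hux, if_pos hvx] at huv
        have := h.lt u hu'
        omega
      · rw [if_neg hux, if_neg hvx] at huv
        exact h.inj u hu' v ((Finset.mem_insert.1 hv).resolve_left hvx) huv
  · rw [h2, h2]
    by_cases hvx : v = x
    · subst hvx
      have hu := indegOff_eq_zero_iff.1 hx0 u huv
      rw [if_neg (hne u hu), if_pos rfl]
      exact ⟨Finset.mem_insert_of_mem hu, h.lt u hu⟩
    · obtain ⟨hu, hlt⟩ := h.mono u v huv ((Finset.mem_insert.1 hv).resolve_left hvx)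
      rw [if_neg (hne u hu), if_neg hvx]
      exact ⟨Finset.mem_insert_of_mem hu, hlt⟩
  · rw [h2, h3]
    split_ifs with hvx
    · rfl
    · exact h.rev v ((Finset.mem_insert.1 hv).resolve_left hvx)

/-- Reading a topological numbering backwards gives one for the reversed graph, so one sort provides
both. -/
theorem Dag.Numbered.exists_isTopological (h : G.Numbered Finset.univ s) :
    ∃ σ τ : Equiv.Perm (Fin n), G.IsTopological σ ∧ G.reverse.IsTopological τ ∧
      (∀ u : Fin n, s.mem 2 u = σ u) ∧ ∀ u : Fin n, s.mem 3 u = τ u := by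
  have hlt : ∀ v : Fin n, s.mem 2 v < n := fun v => by simpa using h.lt v (Finset.mem_univ v)
  have hinj : Function.Injective fun v : Fin n => (⟨s.mem 2 v, hlt v⟩ : Fin n) := fun u v huv =>
    h.inj u (Finset.mem_univ u) v (Finset.mem_univ v) (congrArg Fin.val huv)
  let σ : Equiv.Perm (Fin n) := Equiv.ofBijective _ ⟨hinj, Finite.surjective_of_injective hinj⟩
  have hσ : ∀ u : Fin n, ((σ u : Fin n) : ℕ) = s.mem 2 u := fun u => rfl
  refine ⟨σ, σ.trans Fin.revPerm, fun u v huv => ?_, fun u v huv => ?_, fun u => (hσ u).symm,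
    fun u => ?_⟩
  · rw [Fin.lt_def, hσ, hσ]
    exact (h.mono u v huv (Finset.mem_univ v)).2
  · rw [reverse_adj] at huv
    have := (h.mono v u huv (Finset.mem_univ u)).2
    have h1 := hlt u
    rw [Fin.lt_def]
    simp only [Equiv.trans_apply, Fin.revPerm_apply, Fin.val_rev, hσ]
    omega
  · rw [h.rev u (Finset.mem_univ u)]
    simp only [Equiv.trans_apply, Fin.revPerm_apply, Fin.val_rev, hσ]
    omega

-- Quadratic time is within the bound, so it suffices to search all vertices for a source each time
-- and to subtract a whole row of the adjacency matrix from the counts of entering edges.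
open Classical in
theorem wp_number (hn : s.reg 0 = n) (hm : s.reg 1 = m) (ht : ∀ e : Fin m, s.mem 0 e = (G.edge e).1)
    (hh : ∀ e : Fin m, s.mem 1 e = (G.edge e).2) (h0 : ∀ a i, 20 ≤ a → s.mem a i = 0)
    (hnB : n + 1 < B) (hmB : m + 1 < B) :
    wp B number (fun s' t => (∃ σ τ : Equiv.Perm (Fin n), G.IsTopological σ ∧
      G.reverse.IsTopological τ ∧ (∀ u : Fin n, s'.mem 2 u = σ u) ∧ ∀ u : Fin n, s'.mem 3 u = τ u) ∧
      t ≤ 20 * (n * n + m + 1)) s := by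
  rw [number, wp_seq]
  refine (wp_countEdges hn hm ht hh (fun i => h0 20 i le_rfl) (fun i => h0 21 i (by omega)) hmB).mono ?_
  rintro s₁ t₁ ⟨ha, hcnt, ht₁⟩ hF₁
  have g0 : s₁.reg 0 = n := by rw [hF₁.reg 0 rfl, hn]
  have h22 : ∀ i, s₁.mem 22 i = 0 := fun i => by rw [hF₁.mem 22 rfl, h0 22 i (by omega)]
  refine wp_for_const (c := 7 * n + 8) (fun c s' => ∃ S : Finset (Fin n), S.card = c ∧
    G.Numbered S s') (by omega) (by decide) rfl rfl ?_ ?_ ?_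
  · refine ⟨∅, rfl, fun v => by simp [h22], fun v => ?_, by simp, by simp, by simp, by simp⟩
    rw [indegOff_empty]; exact hcnt v
  · rintro c hc s' ⟨S, hS, hN⟩ h10 hF
    rw [g0] at hc
    subst hS
    have g0' : s'.reg 0 = n := by rw [hF.reg 0 rfl, g0]
    have ha' : ∀ u v : Fin n, s'.mem 20 (u * n + v) = if G.Adj u v then 1 else 0 := fun u v => by
      rw [hF.mem 20 rfl, ha]
    rw [wp_seq]
    refine (wp_findSource (p := fun v => s'.mem 21 v = 0 ∧ s'.mem 22 v = 0) g0' hnB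
      (fun _ _ => Iff.rfl) ?_).mono ?_
    · obtain ⟨x, hx, hx0⟩ := G.exists_indegOff_eq_zero hc
      exact ⟨x, x.2, by rw [hN.count, hx0], by rw [hN.flag, if_neg hx]⟩
    rintro s₂ t₂ ⟨hlt, ⟨hp1, hp2⟩, ht₂⟩ hF₂
    obtain ⟨x, hx⟩ : ∃ x : Fin n, s₂.reg 12 = x := ⟨⟨_, hlt⟩, rfl⟩
    rw [hx] at hp1 hp2
    have hxS : x ∉ S := by
      intro h
      rw [hN.flag, if_pos h] at hp2
      omega
    have hx0 : G.indegOff S x = 0 := by rw [← hN.count, hp1]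
    have f0 : s₂.reg 0 = n := by rw [hF₂.reg 0 rfl, g0']
    have f10 : s₂.reg 10 = S.card := by rw [hF₂.reg 10 rfl, h10]
    have fm : s₂.mem = s'.mem := funext fun a => hF₂.mem a rfl
    simp only [wp_seq, wp_put]
    have e1 : (var 10 : Expr).eval s₂ = S.card := f10
    have e2 : (var 12 : Expr).eval s₂ = x := hx
    rw [e1, e2]
    refine ⟨by omega, by simp [f0, f10]; omega, by show 1 < B; omega, ?_⟩
    obtain ⟨s₃, hs₃⟩ : ∃ s₃, s₃ = ((s₂.setMem 2 x S.card).setMem 3 x (n - 1 - S.card)).setMem 22 x 1 :=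
      ⟨_, rfl⟩
    have hs₃' : ((s₂.setMem 2 x S.card).setMem 3 ((var 12 : Expr).eval (s₂.setMem 2 x S.card))
        ((var 0 - 1 - var 10 : Expr).eval (s₂.setMem 2 x S.card))).setMem 22
        ((var 12 : Expr).eval ((s₂.setMem 2 x S.card).setMem 3
          ((var 12 : Expr).eval (s₂.setMem 2 x S.card))
          ((var 0 - 1 - var 10 : Expr).eval (s₂.setMem 2 x S.card))))
        ((1 : Expr).eval ((s₂.setMem 2 x S.card).setMem 3
          ((var 12 : Expr).eval (s₂.setMem 2 x S.card))
          ((var 0 - 1 - var 10 : Expr).eval (s₂.setMem 2 x S.card)))) = s₃ := by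
      rw [hs₃]
      simp [hx, f0, f10]
    rw [hs₃']
    have k0 : s₃.reg 0 = n := by rw [hs₃]; exact f0
    have k21 : ∀ i, s₃.mem 21 i = s'.mem 21 i := fun i => by rw [hs₃]; simp [fm]
    have k20 : ∀ i, s₃.mem 20 i = s'.mem 20 i := fun i => by rw [hs₃]; simp [fm]
    have k12 : s₃.reg 12 = x := by rw [hs₃]; exact hx
    have kle : ∀ i < n, s'.mem 21 i ≤ m := fun i hi => by
      have := hN.count ⟨i, hi⟩
      simp only at this
      rw [this, indegOff]
      exact (Finset.card_filter_le _ _).trans (by simp)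
    refine wp_for_const (c := 1) (fun c s'' => ∀ v : ℕ, s''.mem 21 v =
      s'.mem 21 v - if v < c then s'.mem 20 (x * n + v) else 0) (by omega) (by decide) rfl rfl
      (fun v => by simp [k21]) ?_ ?_
    · intro c hc s₄ hI h11 hF₄
      rw [k0] at hc
      have j0 : s₄.reg 0 = n := by rw [hF₄.reg 0 rfl, k0]
      have j12 : s₄.reg 12 = x := by rw [hF₄.reg 12 rfl, k12]
      have j20 : ∀ i, s₄.mem 20 i = s'.mem 20 i := fun i => by rw [hF₄.mem 20 rfl, k20]
      have ev : (ld 21 (var 11) - ld 20 (var 12 * var 0 + var 11) : Expr).eval s₄ =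
          s'.mem 21 c - s'.mem 20 (x * n + c) := by
        simp [h11, j0, j12, j20, hI]
      have := kle c hc
      rw [wp_put, ev]
      refine ⟨by omega, fun v => ?_, le_rfl⟩
      simp only [State.setReg_mem, State.setMem_mem, true_and, Expr.eval, h11]
      by_cases hvc : v = c
      · simp [hvc]
      · rw [if_neg hvc, hI]
        have : (v < c) = (v < c + 1) := by simp only [eq_iff_iff]; omega
        simp only [this]
    · intro s₄ t₄ hI hF₄ ht₄
      rw [k0] at hI ht₄
      have hmem : ∀ a, a ≠ 21 → s₄.mem a = s₃.mem a := fun a ha => hF₄.mem a (by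
        have : Nat.beq 21 a = false := Bool.eq_false_iff.2 fun h => ha (Nat.eq_of_beq_eq_true h).symm
        simp [for_, wm, this])
      refine ⟨⟨insert x S, Finset.card_insert_of_notMem hxS,
        Numbered.insert (s := s') hN hxS hx0 (fun v => ?_) (fun v => ?_) (fun v => ?_)
          (fun v => ?_)⟩, by omega⟩
      · rw [State.setReg_mem, hmem 2 (by decide), hs₃]
        simp [fm, Fin.ext_iff]
      · rw [State.setReg_mem, hmem 3 (by decide), hs₃]
        simp [fm, Fin.ext_iff]
      · rw [State.setReg_mem, hmem 22 (by decide), hs₃]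
        simp [fm, Fin.ext_iff]
      · rw [State.setReg_mem, hI, if_pos v.2, ha']
  · rintro s' t ⟨S, hS, hN⟩ hF ht₂
    rw [g0] at hS ht₂
    obtain rfl : S = Finset.univ := Finset.eq_univ_of_card S (by simpa using hS)
    refine ⟨hN.exists_isTopological, ?_⟩
    have : (7 * n + 8 + 2) * n ≤ 17 * (n * n) := by
      have := Nat.le_mul_self n
      have e : (7 * n + 8 + 2) * n = 7 * (n * n) + 10 * n := by ring
      omega
    omega

end

/-! ### Runs that do not depend on the real numbers -/

/-- `p` makes no comparisons of real numbers. -/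
def Prog.NoRealTest : Prog → Prop
  | .seq p q => p.NoRealTest ∧ q.NoRealTest
  | .ite _ _ p q => p.NoRealTest ∧ q.NoRealTest
  | .rite _ _ _ _ => False
  | .loop _ _ p => p.NoRealTest
  | _ => True

theorem Expr.eval_congr {s s' : State} (hr : s'.reg = s.reg) (hm : s'.mem = s.mem) (e : Expr) :
    e.eval s' = e.eval s := by
  induction e with
  | lit k => rfl
  | var x => simp [Expr.eval, hr]
  | bin o e f he hf => simp [Expr.eval, he, hf]
  | ld a e he => simp [Expr.eval, he, hm]

/-- Without real tests the control flow and all words are determined by the words at the start. This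
allows the numberings to be fixed before the weights are given. -/
theorem Prog.Run.congr_words {B : ℕ} {p : Prog} {s s' : State} {t : ℕ} (h : Run B p s s' t)
    (hp : p.NoRealTest) : ∀ c : State, c.reg = s.reg → c.mem = s.mem →
      ∃ c', Run B p c c' t ∧ c'.reg = s'.reg ∧ c'.mem = s'.mem := by
  induction h with
  | skip s => exact fun c h1 h2 => ⟨c, .skip c, h1, h2⟩
  | set s x e h =>
    intro c h1 h2
    have he := Expr.eval_congr h1 h2 e
    exact ⟨_, .set c x e (he ▸ h), by rw [he]; simp [State.setReg, h1], h2⟩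
  | put s a e f h =>
    intro c h1 h2
    have he := Expr.eval_congr h1 h2 e
    have hf := Expr.eval_congr h1 h2 f
    exact ⟨_, .put c a e f (hf ▸ h), h1, by rw [he, hf]; simp [State.setMem, h2]⟩
  | rcopy s r q => exact fun c h1 h2 => ⟨_, .rcopy c r q, h1, h2⟩
  | radd s r q q' => exact fun c h1 h2 => ⟨_, .radd c r q q', h1, h2⟩
  | rget s r a e => exact fun c h1 h2 => ⟨_, .rget c r a e, h1, h2⟩
  | rput s a e r => exact fun c h1 h2 => ⟨_, .rput c a e r, h1, h2⟩
  | seq _ _ h₁ h₂ =>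
    intro c h1 h2
    obtain ⟨c₁, r₁, a₁, b₁⟩ := h₁ hp.1 c h1 h2
    obtain ⟨c₂, r₂, a₂, b₂⟩ := h₂ hp.2 c₁ a₁ b₁
    exact ⟨c₂, .seq r₁ r₂, a₂, b₂⟩
  | ite_true hc _ h =>
    intro c h1 h2
    obtain ⟨c', r, a, b⟩ := h hp.1 c h1 h2
    exact ⟨c', .ite_true (by rwa [Expr.eval_congr h1 h2, Expr.eval_congr h1 h2]) r, a, b⟩
  | ite_false hc _ h =>
    intro c h1 h2
    obtain ⟨c', r, a, b⟩ := h hp.2 c h1 h2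
    exact ⟨c', .ite_false (by rwa [Expr.eval_congr h1 h2, Expr.eval_congr h1 h2]) r, a, b⟩
  | rite_true | rite_false => exact hp.elim
  | loop_true hc _ _ h₁ h₂ =>
    intro c h1 h2
    obtain ⟨c₁, r₁, a₁, b₁⟩ := h₁ hp c h1 h2
    obtain ⟨c₂, r₂, a₂, b₂⟩ := h₂ hp c₁ a₁ b₁
    exact ⟨c₂, .loop_true (by rwa [Expr.eval_congr h1 h2, Expr.eval_congr h1 h2]) r₁ r₂, a₂, b₂⟩
  | loop_false hc =>
    exact fun c h1 h2 =>
      ⟨c, .loop_false (by rwa [Expr.eval_congr h1 h2, Expr.eval_congr h1 h2]), h1, h2⟩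

theorem number_noRealTest : number.NoRealTest := by
  simp [number, countEdges, findSource, for_, Prog.NoRealTest]

end APSP

/-! ### From the structured programs to the machine -/

namespace APSP

open Prog _root_.APSP.Expr

/-- Copy the number of edges to where compiled programs expect their variable `1`. -/
def moveInput : Cmd := .seq (.const 3 0) (.op .add 2 1 3)

namespace Dag

variable {n m B : ℕ} {G : Dag n m} {w : Fin m → ℝ} {σ τ : Equiv.Perm (Fin n)}

/-- The state `s` is a solution that has been reached in `t ≤ K * (D + c₁ + c₂ + n * n + m + 1)`
steps, where `D` accounts for the transitive closure and `c₁ + c₂` for the columns. -/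
def SolvedWithin (G : Dag n m) (w : Fin m → ℝ) (σ τ : Equiv.Perm (Fin n)) (T : ℕ → ℕ) (K : ℕ)
    (s : State) (t : ℕ) : Prop :=
  G.IsOutput w s ∧ ∃ L D c₁ c₂, 2 ^ L ≤ 4 * n + 1 ∧
    D ≤ 4 * (n * m) + 4 * (n * n) + 1 ∧ D ≤ levelSum T L L ∧
    c₁ ≤ ∑ v, G.indeg v * (G.leaf w σ v).ncard ∧
    c₂ ≤ ∑ v, G.outdeg v * (G.leafU w τ v).ncard ∧
    c₁ ≤ c₂ + 4 * (n * n) ∧ c₂ ≤ c₁ + 4 * (n * n) ∧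
    t ≤ K * (D + c₁ + c₂ + n * n + m + 1)

theorem SolvedWithin.add {T : ℕ → ℕ} {K K' : ℕ} {s : State} {t t' : ℕ}
    (h : G.SolvedWithin w σ τ T K s t) (ht' : t' ≤ K' * (n * n + m + 1)) :
    G.SolvedWithin w σ τ T (K' + K) s (t' + t) := by
  obtain ⟨ho, L, D, c₁, c₂, h1, h2, h3, h4, h5, h6, h7, ht⟩ := h
  refine ⟨ho, L, D, c₁, c₂, h1, h2, h3, h4, h5, h6, h7, ?_⟩
  have : K' * (n * n + m + 1) ≤ K' * (D + c₁ + c₂ + n * n + m + 1) :=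
    Nat.mul_le_mul_left _ (by omega)
  rw [add_mul]
  omega

theorem input_mem_zero_array (G : Dag n m) (w : Fin m → ℝ) {a : ℕ} (ha : 2 ≤ a) (i : ℕ) :
    (G.input w).mem a i = 0 := by
  simp [input, show a ≠ 0 by omega, show a ≠ 1 by omega]

theorem input_bounded (G : Dag n m) (w : Fin m → ℝ) (hn : n < B) (hm : m < B) :
    (G.input w).Bounded B := by
  refine ⟨fun x => ?_, fun a i => ?_⟩
  · simp only [input]
    split_ifs <;> omega
  · simp only [input]
    split_ifs <;> omega

theorem numberedInput_bounded (G : Dag n m) (w : Fin m → ℝ) (σ τ : Equiv.Perm (Fin n)) (hn : n < B)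
    (hm : m < B) : (G.numberedInput w σ τ).Bounded B := by
  refine ⟨(G.input_bounded w hn hm).1, fun a i => ?_⟩
  simp only [numberedInput]
  split_ifs <;> first | omega | exact lt_trans (Fin.is_lt _) hn | exact (G.input_bounded w hn hm).2 a i

theorem start_numberedInput (G : Dag n m) (w : Fin m → ℝ) (σ τ : Equiv.Perm (Fin n)) :
    G.Start w σ τ (G.numberedInput w σ τ) where
  reg_n := by simp [numberedInput, input]
  reg_m := by simp [numberedInput, input]
  tail e := by simp [numberedInput, input]
  head e := by simp [numberedInput, input]
  wt e := by simp [numberedInput, input]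
  fst u := by simp [numberedInput]
  snd u := by simp [numberedInput]
  mem_zero a i ha _ := by
    simp only [numberedInput, show a ≠ 2 by omega, show a ≠ 3 by omega, if_false]
    exact G.input_mem_zero_array w (by omega) i
  mem_four i := by
    simp only [numberedInput]
    exact G.input_mem_zero_array w (by omega) i
  rmem_zero a i ha := by simp [numberedInput, input, show a ≠ 0 by omega]

/-- A solution by a program yields a solution by a machine program. -/
theorem solvedInTime_of_wp {P : Cmd} {k : ℕ} {T : ℕ → ℕ} {ω C : ℝ} (hP : Multiplies P k T)
    (hω : 2 ≤ ω) (hC : 0 ≤ C) (hT : ∀ n : ℕ, 1 ≤ n → (T n : ℝ) ≤ C * (n : ℝ) ^ ω) {l K : ℕ}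
    {p : Prog} {s : State} (hl : 1 ≤ l) (hb : s.Bounded ((n + 2) ^ l))
    (hreg : s.reg = (G.input w).reg)
    (h : wp ((n + 2) ^ l) p (G.SolvedWithin w σ τ T K) s) :
    G.SolvedInTime w ω σ τ (.seq moveInput p.compile) (l * p.size)
      ((2 + p.size * K : ℕ) * (C * 5 ^ ω + 7 * C + 30)) s := by
  obtain ⟨s', t, hrun, ho, L, D, c₁, c₂, h1, h2, h3, h4, h5, h6, h7, ht⟩ := h
  have hB : 2 ≤ (n + 2) ^ l := le_trans (by omega) (Nat.le_self_pow (by omega) _)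
  have hBW : (n + 2) ^ l ≤ (n + 2) ^ (l * p.size) :=
    Nat.pow_le_pow_right (by omega) (Nat.le_mul_of_pos_right _ p.size_pos)
  obtain ⟨c', t', hex, hv, ht'⟩ := hrun.exec_compile hB hb (W := (n + 2) ^ (l * p.size))
    -- Variable x is kept in register 2 x. Variable 0 is already in place, variable 1 has been moved
    -- to register 2, and the higher even registers of the input are zero, like the corresponding
    -- variables.
    (by rw [pow_mul]) ((s.setReg 3 0).setReg 2 m) (by
      simp only [State.visible, State.setReg, hreg]
      cases s
      simp only at hreg
      subst hreg
      simp only [State.mk.injEq, and_true]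
      funext x
      rcases x with _ | _ | x
      · simp [input]
      · simp [input]
      · simp [input, Function.update, show 2 * (x + 1 + 1) ≠ 2 by omega,
          show 2 * (x + 1 + 1) ≠ 3 by omega])
  have hs1 : s.reg 1 = m := by simp [hreg, input]
  have hmove : Exec ((n + 2) ^ (l * p.size)) moveInput s ((s.setReg 3 0).setReg 2 m) 2 := by
    have h2 := Exec.op (W := (n + 2) ^ (l * p.size)) (s.setReg 3 0) .add 2 1 3 (by
      have := hb.1 1
      simp only [WordOp.eval, State.setReg_reg]
      norm_num
      omega)
    simp only [WordOp.eval, State.setReg_reg] at h2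
    norm_num [hs1] at h2
    exact .seq (.const s 3 0 (by omega)) h2
  refine ⟨c', 2 + t', .seq hmove hex, ?_, fun hn => ?_⟩
  · have e1 : c'.mem = s'.mem := by rw [← hv]; rfl
    have e2 : c'.rmem = s'.rmem := by rw [← hv]; rfl
    simpa only [IsOutput, e1, e2] using ho
  · have hle := le_timeBound hP hω hC hT G w σ τ hn h1 h2 h3 h4 h5 h6 h7
    have htot : 2 + t' ≤ (2 + p.size * K) * (D + c₁ + c₂ + n * n + m + 1) := by
      have h8 : p.size * t ≤ p.size * (K * (D + c₁ + c₂ + n * n + m + 1)) :=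
        Nat.mul_le_mul_left _ ht
      rw [← mul_assoc] at h8
      rw [add_mul]
      omega
    calc ((2 + t' : ℕ) : ℝ)
        ≤ (((2 + p.size * K) * (D + c₁ + c₂ + n * n + m + 1) : ℕ) : ℝ) := by exact_mod_cast htot
      _ = ((2 + p.size * K : ℕ) : ℝ) * ((D + c₁ + c₂ + n * n + m + 1 : ℕ) : ℝ) := Nat.cast_mul _ _
      _ ≤ ((2 + p.size * K : ℕ) : ℝ) * ((C * 5 ^ ω + 7 * C + 30) * G.timeBound w ω σ τ) :=
          mul_le_mul_of_nonneg_left hle (Nat.cast_nonneg _)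
      _ = _ := (mul_assoc _ _ _).symm

/-- The padded matrices have size at most 4 n + 1, and 4 n + 4 is at most the cube of n + 2. The
summand 3 k of the exponent leaves room for the words of the multiplication program, and 12 for a
fourth power. -/
theorem word_bounds (G : Dag n m) (k : ℕ) : (2 * (n + n) + 3) ^ k ≤ (n + 2) ^ (3 * k + 12) ∧
    (4 * n + 4) ^ 4 ≤ (n + 2) ^ (3 * k + 12) ∧ n + 1 < (n + 2) ^ (3 * k + 12) ∧
    m + 1 < (n + 2) ^ (3 * k + 12) := by
  have h3 : 4 * n + 4 ≤ (n + 2) ^ 3 := by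
    have : (n + 2) ^ 3 = n ^ 3 + 6 * n ^ 2 + 12 * n + 8 := by ring
    omega
  have hpow : ∀ {j : ℕ}, j ≤ 3 * k + 12 → (n + 2) ^ j ≤ (n + 2) ^ (3 * k + 12) := fun h =>
    Nat.pow_le_pow_right (by omega) h
  have h12 : n + 1 < n + 2 ∧ m + 1 < (n + 2) ^ 2 := by
    have := G.edge_count_le
    have : (n + 2) ^ 2 = n * n + 4 * n + 4 := by ring
    omega
  refine ⟨?_, ?_, lt_of_lt_of_le h12.1 ?_, lt_of_lt_of_le h12.2 (hpow (by omega))⟩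
  · refine (Nat.pow_le_pow_left (by omega : _ ≤ (n + 2) ^ 3) k).trans ?_
    rw [← pow_mul]
    exact hpow (by omega)
  · refine (Nat.pow_le_pow_left h3 4).trans ?_
    rw [← pow_mul]
    exact hpow (by omega)
  · simpa using hpow (j := 1) (by omega)

/-- The numberings that `number` computes do not depend on the weights. -/
theorem exists_numbering (G : Dag n m) (hnB : n + 1 < B) (hmB : m + 1 < B) :
    ∃ σ τ : Equiv.Perm (Fin n), G.IsTopological σ ∧ G.reverse.IsTopological τ ∧
      ∀ w : Fin m → ℝ, wp B number (fun s t => G.Start w σ τ s ∧ s.Bounded B ∧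
        t ≤ 20 * (n * n + m + 1)) (G.input w) := by
  -- The numberings are taken from the run with all weights zero; the run for any other weights
  -- produces the same words.
  have hnum := wp_number (G := G) (s := G.input 0) (by simp [input]) (by simp [input])
    (by simp [input]) (by simp [input]) (fun a i ha => G.input_mem_zero_array 0 (by omega) i) hnB hmB
  obtain ⟨s, t, hrun, ⟨σ, τ, hσ, hτ, h2, h3⟩, ht⟩ := hnum
  refine ⟨σ, τ, hσ, hτ, fun w => ?_⟩
  obtain ⟨s', hrun', -, hmem⟩ := hrun.congr_words number_noRealTest (G.input w) rfl rfl
  have hF := hrun'.frame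
  have hrm : ∀ a, s'.rmem a = (G.input w).rmem a := fun a => hF.rmem a rfl
  refine ⟨s', t, hrun', ?_, hrun'.bounded (G.input_bounded w (by omega) (by omega)), ht⟩
  refine ⟨?_, ?_, fun e => ?_, fun e => ?_, fun e => ?_, fun u => ?_, fun u => ?_,
    fun a i ha ha' => ?_, fun i => ?_, fun a i ha => ?_⟩
  · rw [hF.reg 0 rfl]; simp [input]
  · rw [hF.reg 1 rfl]; simp [input]
  · rw [hF.mem 0 rfl]; simp [input]
  · rw [hF.mem 1 rfl]; simp [input]
  · rw [hrm]; simp [input]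
  · rw [hmem, h2]
  · rw [hmem, h3]
  · have hbeq : ∀ b, b ≠ a → Nat.beq b a = false := fun b hb => by
      rw [Bool.eq_false_iff]; exact fun h => hb (Nat.eq_of_beq_eq_true h)
    rw [hF.mem a (by
      simp [number, countEdges, findSource, for_, wm, hbeq 2 (by omega), hbeq 3 (by omega),
        hbeq 20 (by omega), hbeq 21 (by omega), hbeq 22 (by omega)])]
    exact G.input_mem_zero_array w (by omega) i
  · rw [hF.mem 4 rfl]
    exact G.input_mem_zero_array w (by omega) i
  · rw [hrm]; simp [input, show a ≠ 0 by omega]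

end Dag

end APSP

theorem theorem3 (ω : ℝ) (hω : APSP.MatMulInTime ω) :
    -- the algorithm computes the two numberings, from the graph alone
    (∃ (P : APSP.Cmd) (k : ℕ) (C : ℝ), ∀ (n m : ℕ) (G : APSP.Dag n m),
      ∃ σ τ : Equiv.Perm (Fin n), G.IsTopological σ ∧ G.reverse.IsTopological τ ∧
        ∀ w : Fin m → ℝ, G.SolvedInTime w ω σ τ P k C (G.input w)) ∧
    -- the numberings are arbitrary, and are supplied
    (∃ (P : APSP.Cmd) (k : ℕ) (C : ℝ), ∀ (n m : ℕ) (G : APSP.Dag n m)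
      (σ τ : Equiv.Perm (Fin n)), G.IsTopological σ → G.reverse.IsTopological τ →
        ∀ w : Fin m → ℝ, G.SolvedInTime w ω σ τ P k C (G.numberedInput w σ τ)) := by
  obtain ⟨P, k, T, C, hP, hC, h2, hT⟩ := hω.exists_multiplies
  obtain ⟨r, hr⟩ := P.exists_regsBelow
  constructor
  · refine ⟨.seq APSP.moveInput (APSP.Prog.seq APSP.number (APSP.solve P r)).compile,
      (3 * k + 12) * (APSP.Prog.seq APSP.number (APSP.solve P r)).size,
      (2 + (APSP.Prog.seq APSP.number (APSP.solve P r)).size *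
        (20 + (2000 + 10 * APSP.closureCost P r)) : ℕ) * (C * 5 ^ ω + 7 * C + 30),
      fun n m G => ?_⟩
    obtain ⟨hk, h4, hn, hm⟩ := G.word_bounds k
    obtain ⟨σ, τ, hσ, hτ, hnum⟩ := G.exists_numbering hn hm
    refine ⟨σ, τ, hσ, hτ, fun w => APSP.Dag.solvedInTime_of_wp hP h2 hC hT (l := 3 * k + 12)
      (K := 20 + (2000 + 10 * APSP.closureCost P r)) (by omega)
      (G.input_bounded w (by omega) (by omega)) rfl ?_⟩
    rw [APSP.Prog.wp_seq]
    refine (hnum w).mono fun s t hs _ => ?_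
    exact (APSP.wp_solve hσ hτ hP hr hs.1 hs.2.1 hk h4).mono fun s' t' hs' _ =>
      APSP.Dag.SolvedWithin.add hs' hs.2.2
  · refine ⟨.seq APSP.moveInput (APSP.solve P r).compile,
      (3 * k + 12) * (APSP.solve P r).size,
      (2 + (APSP.solve P r).size * (2000 + 10 * APSP.closureCost P r) : ℕ) *
        (C * 5 ^ ω + 7 * C + 30), fun n m G σ τ hσ hτ w => ?_⟩
    obtain ⟨hk, h4, hn, hm⟩ := G.word_bounds k
    exact APSP.Dag.solvedInTime_of_wp hP h2 hC hT (l := 3 * k + 12)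
      (K := 2000 + 10 * APSP.closureCost P r) (by omega)
      (G.numberedInput_bounded w σ τ (by omega) (by omega)) rfl
      (APSP.wp_solve hσ hτ hP hr (G.start_numberedInput w σ τ)
        (G.numberedInput_bounded w σ τ (by omega) (by omega)) hk h4)
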